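/- **Setting.** Let $G=(V,E)$ be a finite graph with $V=\{0,\dots,n-1\}$; $d(v)$ is the degree of $v$, and $N(v)$ is the set of neighbors of $v$ together with $v$. A clustering $\mathcal C$ is a partition of $V$, $\mathcal E(\mathcal C)$ is the set of pairs of distinct vertices in a common cluster, $D=E\,\triangle\,\mathcal E(\mathcal C)$ is its violation and $\mathrm{cost}(\mathcal C)=|E\,\triangle\,\mathcal E(\mathcal C)|$; $\mathrm{cost}(\mathrm{OPT})$ is the minimum cost. For a set $F$ of pairs, $d_F(v)$ is the number of pairs of $F$ that contain $v$, and $d_F(S)=\sum_{v\in S}d_F(v)$. Vertices $u,v$ are $\varepsilon$-degree-similar if $\varepsilon d(u)<d(v)<d(u)/\varepsilon$. A cluster $S$ is strong if $|N(v)\triangle S|<\frac16|S|$ for all $v\in S$. A preclustering is a pair $(\mathcal K,E^{\mathrm{adm}})$, where $\mathcal K$ is a clustering each of whose clusters is a singleton or strong and $E^{\mathrm{adm}}\subseteq\binom V2$; the non-singleton clusters of $\mathcal K$ are its atoms. A clustering is accepted by $(\mathcal K,E^{\mathrm{adm}})$ if it separates no two vertices of an atom and joins no two vertices that are neither in a common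 atom nor an admissible pair (an element of $E^{\mathrm{adm}}$). Put $d_{\mathrm{adm}}=d_{E^{\mathrm{adm}}}$ on vertices; for an atom $K$ let $d_{\mathrm{adm}}(K)$ be the number of its admissible neighbors, i.e. of the vertices that are admissible to some vertex of $K$. The model is a word RAM with unit-cost word operations and memory reads and writes, with words of $O(\log n)$ bits (in which the query parameter $t$ fits as well), and with a source of independent uniform samples, drawn once and then readable by index. The input is the cluster representation $(\mathcal C,D)$: an identifier for each cluster, a doubly linked list of the vertices of each cluster accessible from the identifier, the identifier of its cluster for each vertex, and a list of the pairs in $D$; all other memory is zero. **Theorem.** For every $\varepsilon\in(0,0.1)$ there are a deterministic algorithm and query procedures as follows. Given a graph $G$ represented by $(\mathcal C,D)$, the algorithm constructs in $O(|D|+1)$ time a data structure which holds, as a cluster representation (identifiers, linked lists, labels), a clustering $\mathcal K$ with $\mathrm{cost}(\mathcal K)=O(|D|)$, and there are sets $E^-\subseteq E^+\subseteq\binom V2$ such that for every $E^{\mathrm{adm}}$ with $E^-\subseteq E^{\mathrm{adm}}\subseteq E^+$ the pair $(\mathcal K,E^{\mathrm{adm}})$ is a preclustering with the following properties. 1. For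 any $(u,v)\in E^{\mathrm{adm}}$, $\{u\}$ or $\{v\}$ is a cluster of $\mathcal K$. 2. $d_{\mathrm{adm}}(v)=O(1/\varepsilon^2)\,d(v)$ for every vertex $v$. 3. For every atom $K$, every admissible neighbor of $K$ is admissible to all vertices of $K$, and $d_{\mathrm{adm}}(K)\le 3d_{D'}(K)/|K|$, where $D'=E\,\triangle\,\mathcal E(\mathcal K)$. 4. $|E^{\mathrm{adm}}|=O(1/\varepsilon^2)\,\mathrm{cost}(\mathcal K)$. 5. For any $(u,v)\in E^{\mathrm{adm}}$, $u$ and $v$ are $\varepsilon$-degree-similar. 6. There is an accepted clustering $\mathcal A$ with $\mathrm{cost}(\mathcal A)\le\mathrm{cost}(\mathrm{OPT})+4\varepsilon\,\mathrm{cost}(\mathcal K)$ such that for all $A\in\mathcal A$ and $v\in A$, $|A|=1$ or $|A|>\varepsilon d(v)$. 7. Given the identifier of an atom $K$, its admissible neighbors (which are the same for all these $E^{\mathrm{adm}}$) are listed deterministically in $O(d_{\mathrm{adm}}(K)+1)$ time. Moreover, for every integer $t\ge1$ there is a set $E^{\mathrm{adm}}$ with $E^-\subseteq E^{\mathrm{adm}}\subseteq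 E^+$, depending on the random samples, such that: 8. For any two vertices $u,v$, one checks in $O(t)$ time whether $(u,v)\in E^{\mathrm{adm}}$, and the answer is correct with probability at least $1-\exp(-\Omega(t))$. 9. For any $v$ such that $\{v\}$ is a cluster of $\mathcal K$, one lists in $O(t^2d(v)+1)$ time, without repetition, a set of vertices, which is the set of all admissible neighbors of $v$ with probability at least $1-\exp(-\Omega(t))$, provided that $t=\Omega(\log d(v))$. All time bounds are worst-case, and every query leaves the data structure valid for further queries. The constants in the time bounds and in the word size may depend on $\varepsilon$; all other constants are absolute. -/

import Mathlib

open MeasureTheory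
open scoped symmDiff

noncomputable section

namespace CorrClust

/-! ### A randomized word RAM, presented as a small structured language -/

/-- The unit-cost word operations; comparisons return `0` or `1`. -/
inductive Op
  | add | sub | mul | div | mod | lt | eq

def Op.apply : Op → ℕ → ℕ → ℕ
  | .add, a, b => a + b
  | .sub, a, b => a - b
  | .mul, a, b => a * b
  | .div, a, b => a / b
  | .mod, a, b => a % b
  | .lt, a, b => if a < b then 1 else 0
  | .eq, a, b => if a = b then 1 else 0

/-- A machine state: registers and an unbounded array of memory words. -/
structure State where
  reg : ℕ → ℕ
  mem : ℕ → ℕ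

/-- Expressions: constants, registers, word operations, and memory reads. -/
inductive Expr
  | lit (k : ℕ)
  | reg (x : ℕ)
  | bin (o : Op) (e₁ e₂ : Expr)
  | load (e : Expr)

def Expr.val (s : State) : Expr → ℕ
  | .lit k => k
  | .reg x => s.reg x
  | .bin o e₁ e₂ => o.apply (e₁.val s) (e₂.val s)
  | .load e => s.mem (e.val s)

/-- Every value that occurs while the expression is evaluated is a word, i.e. is less than `W`. -/
def Expr.Fits (W : ℕ) (s : State) : Expr → Prop
  | .lit k => k < W
  | .reg x => s.reg x < W
  | .bin o e₁ e₂ => e₁.Fits W s ∧ e₂.Fits W s ∧ o.apply (e₁.val s) (e₂.val s) < W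
  | .load e => e.Fits W s ∧ s.mem (e.val s) < W

/-- The number of elementary operations needed to evaluate the expression. -/
def Expr.cost : Expr → ℕ
  | .lit _ => 1
  | .reg _ => 1
  | .bin _ e₁ e₂ => e₁.cost + e₂.cost + 1
  | .load e => e.cost + 1

/-- Programs. `rand x i m` puts the `i`-th random sample with range `{0, …, m - 1}` in register
`x`. -/
inductive Prog
  | skip
  | assign (x : ℕ) (e : Expr)
  | store (addr e : Expr)
  | rand (x : ℕ) (i m : Expr)
  | seq (p q : Prog)
  | ite (e : Expr) (p q : Prog)
  | loop (e : Expr) (p : Prog)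

/-- The outcomes of the random source: for all `i` and `r`, the `i`-th sample with range
`{0, …, r}`. Samples are drawn once; reading the same sample again returns the same value. -/
abbrev Rnd : Type := (p : ℕ × ℕ) → Fin (p.2 + 1)

/-- All samples are independent and uniformly distributed in their ranges. -/
def rndMeasure : Measure Rnd :=
  Measure.infinitePi fun p : ℕ × ℕ => (PMF.uniformOfFintype (Fin (p.2 + 1))).toMeasure

/-- `Exec W ω p s k s'`: with words `{0, …, W - 1}` and random outcome `ω`, the program `p` started
in state `s` halts in state `s'` after exactly `k` steps. A program that ever produces a value
that is not a word has no execution. -/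
inductive Exec (W : ℕ) (ω : Rnd) : Prog → State → ℕ → State → Prop
  | skip (s : State) : Exec W ω .skip s 1 s
  | assign (s : State) (x : ℕ) (e : Expr) (he : e.Fits W s) :
      Exec W ω (.assign x e) s (e.cost + 1) ⟨Function.update s.reg x (e.val s), s.mem⟩
  | store (s : State) (a e : Expr) (ha : a.Fits W s) (he : e.Fits W s) :
      Exec W ω (.store a e) s (a.cost + e.cost + 1)
        ⟨s.reg, Function.update s.mem (a.val s) (e.val s)⟩
  | rand (s : State) (x : ℕ) (i m : Expr) (hi : i.Fits W s) (hm : m.Fits W s)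
      (hpos : 0 < m.val s) :
      Exec W ω (.rand x i m) s (i.cost + m.cost + 1)
        ⟨Function.update s.reg x (ω (i.val s, m.val s - 1) : ℕ), s.mem⟩
  | seq (p q : Prog) (s s' s'' : State) (k l : ℕ) (hp : Exec W ω p s k s')
      (hq : Exec W ω q s' l s'') : Exec W ω (.seq p q) s (k + l) s''
  | iteTrue (e : Expr) (p q : Prog) (s s' : State) (k : ℕ) (he : e.Fits W s)
      (h : e.val s ≠ 0) (hp : Exec W ω p s k s') : Exec W ω (.ite e p q) s (e.cost + 1 + k) s'
  | iteFalse (e : Expr) (p q : Prog) (s s' : State) (k : ℕ) (he : e.Fits W s)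
      (h : e.val s = 0) (hq : Exec W ω q s k s') : Exec W ω (.ite e p q) s (e.cost + 1 + k) s'
  | loopDone (e : Expr) (p : Prog) (s : State) (he : e.Fits W s) (h : e.val s = 0) :
      Exec W ω (.loop e p) s (e.cost + 1) s
  | loopStep (e : Expr) (p : Prog) (s s' s'' : State) (k l : ℕ) (he : e.Fits W s)
      (h : e.val s ≠ 0) (hp : Exec W ω p s k s') (hl : Exec W ω (.loop e p) s' l s'') :
      Exec W ω (.loop e p) s (e.cost + 1 + k + l) s''

/-- The program halts within `B` steps in a state that satisfies `Q`. -/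
def Runs (W : ℕ) (ω : Rnd) (p : Prog) (s : State) (B : ℕ) (Q : State → Prop) : Prop :=
  ∃ k s', Exec W ω p s k s' ∧ k ≤ B ∧ Q s'

/-- The state in which a program is started: `args` in the first registers, zero in the others. -/
def start (args : List ℕ) (mem : ℕ → ℕ) : State := ⟨fun x => args.getD x 0, mem⟩

/-! ### Correlation clustering -/

variable {n : ℕ}

/-- A clustering of the vertex set `{0, …, n - 1}`. -/
abbrev Clustering (n : ℕ) : Type := Finpartition (Finset.univ : Finset (Fin n))

/-- The pairs of distinct vertices in a common cluster. -/
def clusterGraph (P : Clustering n) : SimpleGraph (Fin n) where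
  Adj u v := u ≠ v ∧ P.part u = P.part v
  symm := ⟨fun _ _ h => ⟨h.1.symm, h.2.symm⟩⟩
  loopless := ⟨fun _ h => h.1 rfl⟩

/-- The violated pairs: the symmetric difference of the edges and the pairs inside clusters. -/
def violation (G : SimpleGraph (Fin n)) (P : Clustering n) : SimpleGraph (Fin n) :=
  G ∆ clusterGraph P

def cost (G : SimpleGraph (Fin n)) (P : Clustering n) : ℕ := (violation G P).edgeSet.ncard

def optCost (G : SimpleGraph (Fin n)) : ℕ := ⨅ P : Clustering n, cost G P

/-- The number of vertices that form a pair with `v`. -/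
def deg (G : SimpleGraph (Fin n)) (v : Fin n) : ℕ := (G.neighborSet v).ncard

/-- The closed neighbourhood. -/
def closedNbhd (G : SimpleGraph (Fin n)) (v : Fin n) : Set (Fin n) := insert v (G.neighborSet v)

def DegreeSimilar (ε : ℝ) (G : SimpleGraph (Fin n)) (u v : Fin n) : Prop :=
  ε * deg G u < deg G v ∧ (deg G v : ℝ) < deg G u / ε

def Agreeing (β : ℝ) (G : SimpleGraph (Fin n)) (S : Finset (Fin n)) : Prop :=
  ∀ v ∈ S, ((closedNbhd G v ∆ (S : Set (Fin n))).ncard : ℝ) < β * S.card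

def StrongCluster (G : SimpleGraph (Fin n)) (S : Finset (Fin n)) : Prop := Agreeing (1 / 6) G S

def StrongClustering (G : SimpleGraph (Fin n)) (K : Clustering n) : Prop :=
  ∀ S ∈ K.parts, S.card = 1 ∨ StrongCluster G S

/-- The atoms are the non-singleton clusters. -/
def IsAtomOf (K : Clustering n) (S : Finset (Fin n)) : Prop := S ∈ K.parts ∧ S.card ≠ 1

def IsSingleton (K : Clustering n) (v : Fin n) : Prop := K.part v = {v}

/-- The vertices that are admissible to some vertex of `S`, for a graph `A` of admissible pairs. -/
def admNbrs (A : SimpleGraph (Fin n)) (S : Finset (Fin n)) : Set (Fin n) :=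
  {u | ∃ v ∈ S, A.Adj u v}

/-- The clustering `P` is accepted by `(K, A)`: it does not separate a pair inside an atom of `K`
and does not join a pair that is neither inside an atom nor admissible. -/
def Accepted (K : Clustering n) (A : SimpleGraph (Fin n)) (P : Clustering n) : Prop :=
  (∀ S, IsAtomOf K S → ∀ u ∈ S, ∀ v ∈ S, P.part u = P.part v) ∧
  ∀ u v, u ≠ v → P.part u = P.part v → (∃ S, IsAtomOf K S ∧ u ∈ S ∧ v ∈ S) ∨ A.Adj u v

/-- `(K, A)` is a preclustering of `G` with the desired structural properties, where `A` is the
graph of admissible pairs and `C` is the constant in the `O(1 / ε²)` bounds. -/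
structure GoodPreclustering (C ε : ℝ) (G : SimpleGraph (Fin n)) (K : Clustering n)
    (A : SimpleGraph (Fin n)) : Prop where
  strong : StrongClustering G K
  singleton : ∀ u v, A.Adj u v → IsSingleton K u ∨ IsSingleton K v
  degree_le : ∀ v, (deg A v : ℝ) ≤ C / ε ^ 2 * deg G v
  atom_uniform : ∀ S, IsAtomOf K S → ∀ u ∈ admNbrs A S, ∀ v ∈ S, A.Adj u v
  atom_degree_le : ∀ S, IsAtomOf K S →
    ((admNbrs A S).ncard : ℝ) ≤ 3 * (∑ v ∈ S, (deg (violation G K) v : ℝ)) / S.card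
  card_le : (A.edgeSet.ncard : ℝ) ≤ C / ε ^ 2 * cost G K
  similar : ∀ u v, A.Adj u v → DegreeSimilar ε G u v
  accepted : ∃ P : Clustering n, Accepted K A P ∧
    (cost G P : ℝ) ≤ optCost G + 4 * ε * cost G K ∧
    ∀ S ∈ P.parts, ∀ v ∈ S, S.card = 1 ∨ ε * deg G v < S.card

/-! ### Cluster representations in memory -/

/-- A pointer to a vertex: `0` is the null pointer and `v + 1` points to the vertex `v`. -/
def ptr : Option (Fin n) → ℕ
  | none => 0
  | some v => v + 1

/-- The memory layout is: `n`, `|D|`, the array of cluster labels (`n` words), the `next` and `prev`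
arrays of the linked lists (`n` words each), the array of list heads, indexed by cluster
identifiers (`2 n` words), and the list of the pairs in `D` (`2 |D|` words). -/
def labelAddr (v : ℕ) : ℕ := 2 + v
def nextAddr (n v : ℕ) : ℕ := 2 + n + v
def prevAddr (n v : ℕ) : ℕ := 2 + 2 * n + v
def headAddr (n c : ℕ) : ℕ := 2 + 3 * n + c
def pairAddr (n i : ℕ) : ℕ := 2 + 5 * n + 2 * i

/-- The memory holds the clustering `P`: clusters have distinct identifiers below `b`, every vertex
is labelled with the identifier of its cluster, and the vertices of every cluster form a doubly
linked list whose head is found from the identifier. -/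
structure StoresClustering (b : ℕ) (P : Clustering n) (mem : ℕ → ℕ) : Prop where
  label_lt : ∀ v : Fin n, mem (labelAddr v) < b
  label_eq : ∀ u v : Fin n, mem (labelAddr u) = mem (labelAddr v) ↔ P.part u = P.part v
  list : ∀ v : Fin n, ∃ L : List (Fin n), L.Nodup ∧ L.toFinset = P.part v ∧
    mem (headAddr n (mem (labelAddr v))) = ptr L[0]? ∧
    ∀ i (hi : i < L.length), mem (nextAddr n L[i]) = ptr L[i + 1]? ∧
      mem (prevAddr n L[i]) = ptr (if i = 0 then none else L[i - 1]?)
  unused : ∀ c < 2 * n, (∀ v : Fin n, mem (labelAddr v) ≠ c) → mem (headAddr n c) = 0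

/-- The memory holds the cluster representation `(P, D)` of the graph `G`, where `D` is given as a
list of its pairs in arbitrary order, and all other words are zero. -/
structure StoresInput (G : SimpleGraph (Fin n)) (P : Clustering n) (mem : ℕ → ℕ) : Prop where
  numVertices : mem 0 = n
  numPairs : mem 1 = cost G P
  clustering : StoresClustering n P mem
  pairs : ∃ L : List (Fin n × Fin n), L.length = cost G P ∧
    (L.map fun p => s(p.1, p.2)).Nodup ∧
    (∀ p, p ∈ L.map (fun p => s(p.1, p.2)) ↔ p ∈ (violation G P).edgeSet) ∧
    ∀ i (hi : i < L.length), mem (pairAddr n i) = L[i].1 ∧ mem (pairAddr n i + 1) = L[i].2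
  zero : ∀ a, pairAddr n (cost G P) ≤ a → mem a = 0

/-- Register `0` holds the truth value of `φ`. -/
def ReturnsBool (φ : Prop) (s : State) : Prop := (φ ∧ s.reg 0 = 1) ∨ (¬φ ∧ s.reg 0 = 0)

/-- The set `T` is listed without repetition: register `0` holds the number of elements, and
register `1` the address of the first one. -/
def ReturnsSet (T : Set (Fin n)) (s : State) : Prop :=
  ∃ L : List (Fin n), L.Nodup ∧ (∀ u, u ∈ L ↔ u ∈ T) ∧ s.reg 0 = L.length ∧
    ∀ i (hi : i < L.length), s.mem (s.reg 1 + i) = L[i]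

end CorrClust

end

open CorrClust

open MeasureTheory
open scoped symmDiff

noncomputable section

/-! Vertices that fit badly into their input cluster are split off as singletons, and what remains
is so clean that a good clustering has to respect it. A vertex is `Loose` if its violations exceed
1/100 of the size of its cluster, or if its whole cluster carries many violations. By `sizedCore`,
what is left of a cluster agrees with the closed neighbourhoods of its vertices up to a fraction
1/49; by the charging in `sum_card_loose_le` and `cost_coreClustering_le`, splitting costs only
O(|D|).

The accepted clustering is an optimum of a penalized problem: maximize edges minus non-edges inside
clusters, minus a multiple of ε times the degree of every loose vertex that is not alone
(`LabelOpt`). All edges at singletons of K are violated, so the penalty totals O(ε cost K), and the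
penalized optimum is nearly optimal (`exists_labelOpt`). Local moves (isolating a vertex, moving a
vertex, splitting off an atom) show that it keeps each atom together (`IsCore.label_eq`), merges no
two atoms (`IsCore.part_eq_of_label_eq`), joins a loose vertex to an atom only if it sees nearly
half of it (`IsCore.atom_bounds`), and joins two loose vertices only if they have many common
neighbours (`IsCore.card_goodCommon_ge`). These necessary conditions define admissibility, and
double counting bounds its degrees (`SizedCore.card_atomAdm_le`, `card_pairAdm_le`). Only common
neighbours with few loose neighbours are counted; this keeps both the degrees and the enumeration
small.

With N = ⌊1/ε⌋, the threshold for common neighbours may lie anywhere between 1/(N+1) and 1/(2N) of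
the degree sum. By Hoeffding, O(t) sampled neighbours tell the two ends apart, and the random graph
`rndAdm` simply follows the test in between (`measure_answer_ne_le`). To list the partners of v, one
samples closed neighbours w of v and tests the loose neighbours of w; a union bound over `reach`
controls the error (`measure_found_ne_le`).

The construction cannot afford to look at all vertices. Instead, every violated ordered pair pays
for 10000 steps along the linked list of the cluster of its first vertex. A cluster with a loose
vertex, or an atom with an admissible neighbour, comes from a cluster of at most 10000 times its
number of violations (`Loose.card_le`, `CoreAdm.card_le`), so it is walked to its end; matrices and
flags need no initialization because memory is zero. Programs are verified with unbounded words, and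
`Ev.exec` transfers them to words of polynomial size, since every word that is kept grows at most by
the running time. -/

namespace CorrClust

/-! ### Programs: verification without overflow, and transfer to bounded words -/

section

/-! ### Programs on unbounded words -/

/-- Big-step semantics of programs without a bound on the size of words. -/
inductive Ev (ω : Rnd) : Prog → State → ℕ → State → Prop
  | skip (s : State) : Ev ω .skip s 1 s
  | assign (s : State) (x : ℕ) (e : Expr) :
      Ev ω (.assign x e) s (e.cost + 1) ⟨Function.update s.reg x (e.val s), s.mem⟩
  | store (s : State) (a e : Expr) :
      Ev ω (.store a e) s (a.cost + e.cost + 1)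
        ⟨s.reg, Function.update s.mem (a.val s) (e.val s)⟩
  | rand (s : State) (x : ℕ) (i m : Expr) (hpos : 0 < m.val s) :
      Ev ω (.rand x i m) s (i.cost + m.cost + 1)
        ⟨Function.update s.reg x (ω (i.val s, m.val s - 1) : ℕ), s.mem⟩
  | seq (p q : Prog) (s s' s'' : State) (k l : ℕ) (hp : Ev ω p s k s')
      (hq : Ev ω q s' l s'') : Ev ω (.seq p q) s (k + l) s''
  | iteTrue (e : Expr) (p q : Prog) (s s' : State) (k : ℕ)
      (h : e.val s ≠ 0) (hp : Ev ω p s k s') : Ev ω (.ite e p q) s (e.cost + 1 + k) s'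
  | iteFalse (e : Expr) (p q : Prog) (s s' : State) (k : ℕ)
      (h : e.val s = 0) (hq : Ev ω q s k s') : Ev ω (.ite e p q) s (e.cost + 1 + k) s'
  | loopDone (e : Expr) (p : Prog) (s : State) (h : e.val s = 0) :
      Ev ω (.loop e p) s (e.cost + 1) s
  | loopStep (e : Expr) (p : Prog) (s s' s'' : State) (k l : ℕ)
      (h : e.val s ≠ 0) (hp : Ev ω p s k s') (hl : Ev ω (.loop e p) s' l s'') :
      Ev ω (.loop e p) s (e.cost + 1 + k + l) s''

/-- All words of the state are at most `V`. -/
def State.Bdd (V : ℕ) (s : State) : Prop := (∀ x, s.reg x ≤ V) ∧ ∀ a, s.mem a ≤ V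

theorem State.Bdd.mono {V V' : ℕ} {s : State} (h : s.Bdd V) (hV : V ≤ V') : s.Bdd V' :=
  ⟨fun x => (h.1 x).trans hV, fun a => (h.2 a).trans hV⟩

/-- The number of leaves of an expression, where a load counts as one more leaf. -/
def Expr.size : Expr → ℕ
  | .lit _ => 1
  | .reg _ => 1
  | .bin _ e₁ e₂ => e₁.size + e₂.size
  | .load e => e.size + 1

/-- All literals are at most `c`. -/
def Expr.LitLe (c : ℕ) : Expr → Prop
  | .lit k => k ≤ c
  | .reg _ => True
  | .bin _ e₁ e₂ => e₁.LitLe c ∧ e₂.LitLe c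
  | .load e => e.LitLe c

/-- Expressions whose value exceeds the largest word of the state at most by their cost. -/
def Expr.Slow : Expr → Prop
  | .lit _ => True
  | .reg _ => True
  | .load _ => True
  | .bin .add e (.lit 1) => e.Slow
  | .bin .sub e _ => e.Slow
  | .bin .mod e _ => e.Slow
  | .bin .div e _ => e.Slow
  | .bin .lt _ _ => True
  | .bin .eq _ _ => True
  | _ => False

theorem Expr.size_pos (e : Expr) : 0 < e.size := by
  induction e <;> simp_all [Expr.size]

/-- Exponents add under multiplication, and V ≥ 2 lets a sum of two powers be absorbed by their
product. So the number of leaves of an expression bounds the degree of its value in the largest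
word. -/
theorem Op.apply_le_pow {V a b x y : ℕ} (hV : 2 ≤ V) (ha : 0 < a) (hb : 0 < b) (o : Op)
    (hx : x ≤ V ^ a) (hy : y ≤ V ^ b) : o.apply x y ≤ V ^ (a + b) := by
  have h1 : 2 ≤ V ^ a := hV.trans (Nat.le_self_pow ha.ne' V)
  have h2 : 2 ≤ V ^ b := hV.trans (Nat.le_self_pow hb.ne' V)
  have h3 : V ^ a ≤ V ^ (a + b) := Nat.pow_le_pow_right (by omega) (by omega)
  have h4 : 1 ≤ V ^ (a + b) := by omega
  cases o <;> simp only [Op.apply]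
  · rw [pow_add]; nlinarith
  · omega
  · rw [pow_add]; exact Nat.mul_le_mul hx hy
  · exact (Nat.div_le_self _ _).trans (hx.trans h3)
  · exact (Nat.mod_le _ _).trans (hx.trans h3)
  · split <;> omega
  · split <;> omega

theorem Expr.val_le_pow {V c : ℕ} {s : State} (hV : 2 ≤ V) (hc : c ≤ V) (hs : s.Bdd V) (e : Expr)
    (hl : e.LitLe c) : e.val s ≤ V ^ e.size := by
  induction e with
  | lit k => simpa [Expr.val, Expr.size] using le_trans hl hc
  | reg x => simpa [Expr.val, Expr.size] using hs.1 x
  | bin o e₁ e₂ h₁ h₂ => exact o.apply_le_pow hV e₁.size_pos e₂.size_pos (h₁ hl.1) (h₂ hl.2)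
  | load e _ => exact (hs.2 _).trans (Nat.le_self_pow (by simp [Expr.size]) V)

theorem Expr.fits_of_bdd {V c W : ℕ} {s : State} (hV : 2 ≤ V) (hc : c ≤ V) (hs : s.Bdd V)
    (e : Expr) (hl : e.LitLe c) (hW : V ^ e.size < W) : e.Fits W s := by
  have hv := e.val_le_pow hV hc hs hl
  have mono : ∀ {a b}, a ≤ b → V ^ a ≤ V ^ b := fun h => Nat.pow_le_pow_right (by omega) h
  induction e with
  | lit k => exact hv.trans_lt hW
  | reg x => exact hv.trans_lt hW
  | bin o e₁ e₂ h₁ h₂ =>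
    exact ⟨h₁ hl.1 ((mono (by simp [Expr.size])).trans_lt hW) (e₁.val_le_pow hV hc hs hl.1),
      h₂ hl.2 ((mono (by simp [Expr.size])).trans_lt hW) (e₂.val_le_pow hV hc hs hl.2),
      hv.trans_lt hW⟩
  | load e h =>
    exact ⟨h hl ((mono (by simp [Expr.size])).trans_lt hW) (e.val_le_pow hV hc hs hl),
      hv.trans_lt hW⟩

/-- The only growing operation in a `Slow` expression is the addition of 1, and each such addition
is paid for by the cost. Kept words therefore grow no faster than time passes; products remain
possible in addresses, tests and other transient values. -/
theorem Expr.val_le_of_slow {V c : ℕ} {s : State} (hV : 1 ≤ V) (hc : c ≤ V) (hs : s.Bdd V)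
    (e : Expr) (hl : e.LitLe c) (he : e.Slow) : e.val s ≤ V + e.cost := by
  induction e with
  | lit k => exact (le_trans hl hc).trans (Nat.le_add_right _ _)
  | reg x => exact (hs.1 x).trans (Nat.le_add_right _ _)
  | load e _ => exact (hs.2 _).trans (Nat.le_add_right _ _)
  | bin o e₁ e₂ h₁ h₂ =>
    cases o with
    | add =>
      cases e₂ with
      | lit k =>
        match k, he with
        | 1, he =>
          have := h₁ hl.1 he
          simp only [Expr.val, Op.apply, Expr.cost]; omega
      | reg x => exact he.elim
      | bin o a b => exact he.elim
      | load a => exact he.elim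
    | sub =>
      have := h₁ hl.1 he
      simp only [Expr.val, Op.apply, Expr.cost]; omega
    | mul => exact he.elim
    | div =>
      have := h₁ hl.1 he
      have h' := Nat.div_le_self (e₁.val s) (e₂.val s)
      simp only [Expr.val, Op.apply, Expr.cost]; omega
    | mod =>
      have := h₁ hl.1 he
      have h' := Nat.mod_le (e₁.val s) (e₂.val s)
      simp only [Expr.val, Op.apply, Expr.cost]; omega
    | lt => simp only [Expr.val, Op.apply]; split <;> omega
    | eq => simp only [Expr.val, Op.apply]; split <;> omega

/-- All expressions are small, and every value that is kept exceeds the previous ones slowly. -/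
def Prog.Tame (c : ℕ) : Prog → Prop
  | .skip => True
  | .assign _ e => e.size ≤ c ∧ e.LitLe c ∧ e.Slow
  | .store a e => (a.size ≤ c ∧ a.LitLe c) ∧ e.size ≤ c ∧ e.LitLe c ∧ e.Slow
  | .rand _ i m => (i.size ≤ c ∧ i.LitLe c) ∧ m.size ≤ c ∧ m.LitLe c ∧ m.Slow
  | .seq p q => p.Tame c ∧ q.Tame c
  | .ite e p q => (e.size ≤ c ∧ e.LitLe c) ∧ p.Tame c ∧ q.Tame c
  | .loop e p => (e.size ≤ c ∧ e.LitLe c) ∧ p.Tame c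

theorem State.Bdd.update_reg {V : ℕ} {s : State} (h : s.Bdd V) {x v : ℕ} (hv : v ≤ V) :
    State.Bdd V ⟨Function.update s.reg x v, s.mem⟩ := by
  refine ⟨fun y => ?_, h.2⟩
  by_cases hy : y = x
  · subst hy; simpa using hv
  · simpa [Function.update_of_ne hy] using h.1 y

theorem State.Bdd.update_mem {V : ℕ} {s : State} (h : s.Bdd V) {x v : ℕ} (hv : v ≤ V) :
    State.Bdd V ⟨s.reg, Function.update s.mem x v⟩ := by
  refine ⟨h.1, fun y => ?_⟩
  by_cases hy : y = x
  · subst hy; simpa using hv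
  · simpa [Function.update_of_ne hy] using h.2 y

/-- A run of a tame program on unbounded words is a run on words that are polynomially larger than
the running time and the words of the initial state. -/
theorem Ev.exec {W c : ℕ} {ω : Rnd} {p : Prog} {s s' : State} {k : ℕ} (h : Ev ω p s k s') :
    ∀ {V : ℕ}, p.Tame c → 2 ≤ V → c ≤ V → s.Bdd V → (V + k) ^ c < W →
      Exec W ω p s k s' ∧ s'.Bdd (V + k) := by
  -- Transient values may be products, so they are bounded by a power of the current word bound. The
  -- assumption on `W` is made for `V + k`, the bound at the end of the run, and hence covers every
  -- moment before.
  have fits : ∀ {V k : ℕ} {s : State} {e : Expr}, 2 ≤ V → c ≤ V → s.Bdd V → e.size ≤ c →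
      e.LitLe c → (V + k) ^ c < W → e.Fits W s := by
    intro V k s e hV hc hs h1 h2 hW
    refine e.fits_of_bdd hV hc hs h2 (lt_of_le_of_lt ?_ hW)
    exact (Nat.pow_le_pow_right (by omega) h1).trans (Nat.pow_le_pow_left (by omega) c)
  have less : ∀ {V k l : ℕ}, l ≤ k → (V + k) ^ c < W → (V + l) ^ c < W := fun h hW =>
    (Nat.pow_le_pow_left (by omega) c).trans_lt hW
  induction h with
  | skip s => intro V _ _ _ hs _; exact ⟨.skip s, hs.mono (by omega)⟩
  | assign s x e =>
    intro V ht hV hc hs hW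
    refine ⟨.assign s x e (fits hV hc hs ht.1 ht.2.1 hW), (hs.mono (by omega)).update_reg ?_⟩
    have := e.val_le_of_slow (by omega) hc hs ht.2.1 ht.2.2
    omega
  | store s a e =>
    intro V ht hV hc hs hW
    refine ⟨.store s a e (fits hV hc hs ht.1.1 ht.1.2 hW) (fits hV hc hs ht.2.1 ht.2.2.1 hW),
      (hs.mono (by omega)).update_mem ?_⟩
    have := e.val_le_of_slow (by omega) hc hs ht.2.2.1 ht.2.2.2
    omega
  | rand s x i m hpos =>
    intro V ht hV hc hs hW
    refine ⟨.rand s x i m (fits hV hc hs ht.1.1 ht.1.2 hW) (fits hV hc hs ht.2.1 ht.2.2.1 hW) hpos,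
      (hs.mono (by omega)).update_reg ?_⟩
    have := m.val_le_of_slow (by omega) hc hs ht.2.2.1 ht.2.2.2
    have h2 := (ω (i.val s, m.val s - 1)).is_lt
    simp only at h2
    omega
  | seq p q s s' s'' k l _ _ ih₁ ih₂ =>
    intro V ht hV hc hs hW
    obtain ⟨h₁, hs₁⟩ := ih₁ ht.1 hV hc hs (less (by omega) hW)
    obtain ⟨h₂, hs₂⟩ := ih₂ ht.2 (by omega) (by omega) hs₁ (by rwa [Nat.add_assoc])
    exact ⟨.seq p q s s' s'' k l h₁ h₂, hs₂.mono (by omega)⟩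
  | iteTrue e p q s s' k hne _ ih =>
    intro V ht hV hc hs hW
    obtain ⟨h₁, hs₁⟩ := ih ht.2.1 hV hc hs (less (by omega) hW)
    exact ⟨.iteTrue e p q s s' k (fits hV hc hs ht.1.1 ht.1.2 hW) hne h₁, hs₁.mono (by omega)⟩
  | iteFalse e p q s s' k hne _ ih =>
    intro V ht hV hc hs hW
    obtain ⟨h₁, hs₁⟩ := ih ht.2.2 hV hc hs (less (by omega) hW)
    exact ⟨.iteFalse e p q s s' k (fits hV hc hs ht.1.1 ht.1.2 hW) hne h₁, hs₁.mono (by omega)⟩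
  | loopDone e p s h0 =>
    intro V ht hV hc hs hW
    exact ⟨.loopDone e p s (fits hV hc hs ht.1.1 ht.1.2 hW) h0, hs.mono (by omega)⟩
  | loopStep e p s s' s'' k l hne _ _ ih₁ ih₂ =>
    intro V ht hV hc hs hW
    obtain ⟨h₁, hs₁⟩ := ih₁ ht.2 hV hc hs (less (by omega) hW)
    obtain ⟨h₂, hs₂⟩ := ih₂ ht (by omega) (by omega) hs₁ (lt_of_le_of_lt
      (Nat.pow_le_pow_left (by omega) c) hW)
    exact ⟨.loopStep e p s s' s'' k l (fits hV hc hs ht.1.1 ht.1.2 hW) hne h₁ h₂,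
      hs₂.mono (by omega)⟩

/-! ### Total correctness with a time bound -/

/-- On unbounded words, the program halts within `B` steps in a state that satisfies `Q`. -/
def Meets (ω : Rnd) (p : Prog) (s : State) (B : ℕ) (Q : State → Prop) : Prop :=
  ∃ k s', Ev ω p s k s' ∧ k ≤ B ∧ Q s'

variable {ω : Rnd} {p q : Prog} {s : State} {B B₁ B₂ : ℕ} {Q R : State → Prop}

theorem Meets.mono (h : Meets ω p s B₁ Q) (hB : B₁ ≤ B₂) (hQ : ∀ s, Q s → R s) :
    Meets ω p s B₂ R := by
  obtain ⟨k, s', h, hk, hq⟩ := h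
  exact ⟨k, s', h, hk.trans hB, hQ _ hq⟩

theorem Meets.seq (h : Meets ω p s B₁ R) (h' : ∀ s', R s' → Meets ω q s' B₂ Q) :
    Meets ω (.seq p q) s (B₁ + B₂) Q := by
  obtain ⟨k, s', h, hk, hq⟩ := h
  obtain ⟨l, s'', h2, hl, hq2⟩ := h' s' hq
  exact ⟨k + l, s'', .seq _ _ _ _ _ _ _ h h2, by omega, hq2⟩

theorem Meets.ite {e : Expr} (h₁ : e.val s ≠ 0 → Meets ω p s B Q)
    (h₂ : e.val s = 0 → Meets ω q s B Q) : Meets ω (.ite e p q) s (e.cost + 1 + B) Q := by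
  by_cases h : e.val s = 0
  · obtain ⟨k, s', h3, hk, hq⟩ := h₂ h
    exact ⟨_, s', .iteFalse _ _ _ _ _ _ h h3, by omega, hq⟩
  · obtain ⟨k, s', h3, hk, hq⟩ := h₁ h
    exact ⟨_, s', .iteTrue _ _ _ _ _ _ h h3, by omega, hq⟩

theorem Meets.rand {x : ℕ} {i m : Expr} (hm : 0 < m.val s)
    (hQ : Q ⟨Function.update s.reg x (ω (i.val s, m.val s - 1) : ℕ), s.mem⟩) :
    Meets ω (.rand x i m) s (i.cost + m.cost + 1) Q :=
  ⟨_, _, .rand s x i m hm, le_rfl, hQ⟩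

/-- Programs without loops and random samples. -/
def Prog.Straight : Prog → Prop
  | .skip => True
  | .assign _ _ => True
  | .store _ _ => True
  | .rand _ _ _ => False
  | .seq p q => p.Straight ∧ q.Straight
  | .ite _ p q => p.Straight ∧ q.Straight
  | .loop _ _ => False

/-- The final state of a program without loops and random samples. -/
def Prog.eval : Prog → State → State
  | .skip, s => s
  | .assign x e, s => ⟨Function.update s.reg x (e.val s), s.mem⟩
  | .store a e, s => ⟨s.reg, Function.update s.mem (a.val s) (e.val s)⟩
  | .rand _ _ _, s => s
  | .seq p q, s => q.eval (p.eval s)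
  | .ite e p q, s => if e.val s = 0 then q.eval s else p.eval s
  | .loop _ _, s => s

/-- A bound for the running time of a program without loops. -/
def Prog.time : Prog → ℕ
  | .skip => 1
  | .assign _ e => e.cost + 1
  | .store a e => a.cost + e.cost + 1
  | .rand _ i m => i.cost + m.cost + 1
  | .seq p q => p.time + q.time
  | .ite e p q => e.cost + 1 + (p.time + q.time)
  | .loop _ _ => 0

theorem Prog.Straight.meets_eval (h : p.Straight) (s : State) :
    Meets ω p s p.time (fun s' => s' = p.eval s) := by
  induction p generalizing s with
  | skip => exact ⟨_, _, .skip s, le_rfl, rfl⟩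
  | assign x e => exact ⟨_, _, .assign s x e, le_rfl, rfl⟩
  | store a e => exact ⟨_, _, .store s a e, le_rfl, rfl⟩
  | rand x i m => exact h.elim
  | seq p q hp hq =>
    refine (hp h.1 s).seq fun s' hs' => ?_
    subst hs'
    exact hq h.2 _
  | ite e p q hp hq =>
    refine Meets.ite (fun h0 => (hp h.1 s).mono (by omega) ?_)
      (fun h0 => (hq h.2 s).mono (by omega) ?_)
    · rintro _ rfl; simp [Prog.eval, h0]
    · rintro _ rfl; simp [Prog.eval, h0]
  | loop e p _ => exact h.elim

theorem Prog.Straight.meets (h : p.Straight) (hQ : Q (p.eval s)) : Meets ω p s p.time Q :=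
  (h.meets_eval s).mono le_rfl (by rintro _ rfl; exact hQ)

/-- `for x := 0, …, e - 1 do p`. -/
def forLoop (x : ℕ) (e : Expr) (p : Prog) : Prog :=
  .seq (.assign x (.lit 0))
    (.loop (.bin .lt (.reg x) e) (.seq p (.assign x (.bin .add (.reg x) (.lit 1)))))

/-- The bound `e` is evaluated anew in each round, so `hm` demands that the invariant fixes its
value. After the body, the invariant is required of the state in which the counter has already been
increased. -/
theorem Meets.forLoop {x m : ℕ} {e : Expr} (Inv : ℕ → State → Prop) (c : ℕ → ℕ)
    (h0 : Inv 0 ⟨Function.update s.reg x 0, s.mem⟩)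
    (hm : ∀ k ≤ m, ∀ s, Inv k s → s.reg x = k → e.val s = m)
    (hstep : ∀ k < m, ∀ s, Inv k s → s.reg x = k → Meets ω p s (c k) fun s' =>
      s'.reg x = k ∧ Inv (k + 1) ⟨Function.update s'.reg x (k + 1), s'.mem⟩) :
    Meets ω (forLoop x e p) s (∑ k ∈ Finset.range m, (c k + e.cost + 10) + e.cost + 10)
      (fun s' => s'.reg x = m ∧ Inv m s') := by
  -- Induction on the number `j` of remaining rounds, because the semantics unfolds a loop from the
  -- front.
  have key : ∀ j ≤ m, ∀ s, Inv (m - j) s → s.reg x = m - j →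
      Meets ω (.loop (.bin .lt (.reg x) e) (.seq p (.assign x (.bin .add (.reg x) (.lit 1))))) s
        (∑ k ∈ Finset.Ico (m - j) m, (c k + e.cost + 10) + e.cost + 4)
        (fun s' => s'.reg x = m ∧ Inv m s') := by
    intro j
    induction j with
    | zero =>
      intro _ s hI hx
      refine ⟨_, s, .loopDone _ _ _ ?_, ?_, hx, hI⟩
      · simp [Expr.val, Op.apply, hm _ le_rfl s hI hx, hx]
      · simp [Expr.cost]; omega
    | succ j ih =>
      intro hj s hI hx
      obtain ⟨k, s', hev, hk, hx', hI'⟩ := hstep (m - (j + 1)) (by omega) s hI hx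
      have e1 : m - (j + 1) + 1 = m - j := by omega
      rw [e1] at hI'
      obtain ⟨l, s'', hev2, hl, hQ⟩ := ih (by omega) _ hI' (by simp)
      refine ⟨_, s'', .loopStep _ _ _ _ _ _ l ?_ (.seq _ _ _ _ _ _ _ hev (.assign _ _ _)) ?_,
        ?_, hQ⟩
      · have := hm _ (by omega) s hI hx
        simp only [Expr.val, Op.apply, this, hx]
        rw [if_pos (by omega)]; simp
      · simpa [Expr.val, Op.apply, hx', e1] using hev2
      · rw [Finset.sum_eq_sum_Ico_succ_bot (by omega : m - (j + 1) < m), e1]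
        simp only [Expr.cost]
        omega
  obtain ⟨k, s', hev, hk, hQ⟩ := key m le_rfl ⟨Function.update s.reg x 0, s.mem⟩
    (by simpa using h0) (by simp)
  refine ⟨_, s', .seq _ _ _ _ _ _ _ (.assign _ _ _) hev, ?_, hQ⟩
  simp only [Nat.sub_self, ← Finset.range_eq_Ico] at hk
  simp only [Expr.cost]
  omega

/-- The bridge to the machine: everything later is proved for `Meets`, and only here does the word
size enter. -/
theorem Meets.runs {W c V : ℕ} (h : Meets ω p s B Q) (ht : p.Tame c) (hV : 2 ≤ V) (hc : c ≤ V)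
    (hs : s.Bdd V) (hW : (V + B) ^ c < W) : Runs W ω p s B fun s' => Q s' ∧ s'.Bdd (V + B) := by
  obtain ⟨k, s', hev, hk, hQ⟩ := h
  obtain ⟨h1, h2⟩ := hev.exec ht hV hc hs ((Nat.pow_le_pow_left (by omega) c).trans_lt hW)
  exact ⟨k, s', h1, hk, hQ, h2.mono (by omega)⟩

/-! ### Fields in memory -/

/-- The first address behind the input. -/
def memBase (m : ℕ → ℕ) : ℕ := 2 + (5 * m 0 + 2 * m 1)

def fldAddr (m : ℕ → ℕ) (r i : ℕ) : ℕ := memBase m + (32 * i + r)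

/-- The memory behind the input is divided into 32 interleaved arrays. -/
def fld (m : ℕ → ℕ) (r i : ℕ) : ℕ := m (fldAddr m r i)

def setFld (m : ℕ → ℕ) (r i x : ℕ) : ℕ → ℕ := Function.update m (fldAddr m r i) x

theorem setFld_zero (m : ℕ → ℕ) (r i x : ℕ) : setFld m r i x 0 = m 0 :=
  Function.update_of_ne (by simp [fldAddr, memBase]; omega) _ _

theorem setFld_one (m : ℕ → ℕ) (r i x : ℕ) : setFld m r i x 1 = m 1 :=
  Function.update_of_ne (by simp [fldAddr, memBase]; omega) _ _

theorem memBase_setFld (m : ℕ → ℕ) (r i x : ℕ) : memBase (setFld m r i x) = memBase m := by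
  simp [memBase, setFld_zero, setFld_one]

theorem setFld_of_lt {m : ℕ → ℕ} {a : ℕ} (h : a < memBase m) (r i x : ℕ) :
    setFld m r i x a = m a :=
  Function.update_of_ne (by simp [fldAddr]; omega) _ _

/-- Array and index are recovered from the address as remainder and quotient modulo 32. All arrays
lie behind words 0 and 1, on which the base address depends, so writing never moves the arrays. -/
theorem fld_setFld {m : ℕ → ℕ} {r r' i i' x : ℕ} (hr : r < 32) (hr' : r' < 32) :
    fld (setFld m r i x) r' i' = if r' = r ∧ i' = i then x else fld m r' i' := by
  unfold fld
  have : fldAddr (setFld m r i x) r' i' = fldAddr m r' i' := by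
    simp [fldAddr, memBase_setFld]
  rw [this, setFld, Function.update_apply]
  congr 1
  simp only [fldAddr, eq_iff_iff]
  omega

/-- Outside the arrays in `rs`, the memory is unchanged. -/
structure Frame (rs : List ℕ) (m m' : ℕ → ℕ) : Prop where
  low : ∀ a < memBase m, m' a = m a
  fld : ∀ r < 32, r ∉ rs → ∀ i, fld m' r i = fld m r i

theorem Frame.refl (rs : List ℕ) (m : ℕ → ℕ) : Frame rs m m := ⟨fun _ _ => rfl, fun _ _ _ _ => rfl⟩

theorem Frame.zero {rs : List ℕ} {m m' : ℕ → ℕ} (h : Frame rs m m') : m' 0 = m 0 :=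
  h.low 0 (by simp [memBase])

theorem Frame.one {rs : List ℕ} {m m' : ℕ → ℕ} (h : Frame rs m m') : m' 1 = m 1 :=
  h.low 1 (by simp [memBase]; omega)

theorem Frame.memBase {rs : List ℕ} {m m' : ℕ → ℕ} (h : Frame rs m m') :
    memBase m' = memBase m := by
  simp [CorrClust.memBase, h.zero, h.one]

theorem Frame.trans {rs rs' : List ℕ} {m m' m'' : ℕ → ℕ} (h : Frame rs m m')
    (h' : Frame rs' m' m'') (hs : rs' ⊆ rs) : Frame rs m m'' :=
  ⟨fun a ha => (h'.low a (by rwa [h.memBase])).trans (h.low a ha),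
    fun r hr hn i => (h'.fld r hr (fun h => hn (hs h)) i).trans (h.fld r hr hn i)⟩

theorem Frame.set {rs : List ℕ} {m m' : ℕ → ℕ} (h : Frame rs m m') {r : ℕ} (hr : r < 32)
    (hm : r ∈ rs) (i x : ℕ) : Frame rs m (setFld m' r i x) := by
  refine ⟨fun a ha => ?_, fun r' hr' hn j => ?_⟩
  · rw [setFld_of_lt (by rwa [h.memBase]), h.low a ha]
  · rw [fld_setFld hr hr', if_neg (fun h' : r' = r ∧ j = i => hn (h'.1 ▸ hm)), h.fld r' hr' hn j]

/-! ### Notation for programs -/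

abbrev Expr.numV : Expr := .load (.lit 0)
abbrev Expr.numP : Expr := .load (.lit 1)

def Expr.fldAddr (r : ℕ) (i : Expr) : Expr :=
  .bin .add (.bin .add (.lit 2) (.bin .add (.bin .mul (.lit 5) .numV) (.bin .mul (.lit 2) .numP)))
    (.bin .add (.bin .mul (.lit 32) i) (.lit r))

/-- The entry `i` of the array `r`. -/
def Expr.fld (r : ℕ) (i : Expr) : Expr := .load (.fldAddr r i)

/-- The position of the `j`-th entry of row `v` of a matrix. -/
def Expr.idx (v j : Expr) : Expr := .bin .add (.bin .mul j .numV) v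

def Prog.setFld (r : ℕ) (i e : Expr) : Prog := .store (.fldAddr r i) e

theorem Expr.val_fld (s : State) (r : ℕ) (i : Expr) :
    (Expr.fld r i).val s = CorrClust.fld s.mem r (i.val s) := rfl

theorem Expr.val_idx (s : State) (v j : Expr) :
    (Expr.idx v j).val s = j.val s * s.mem 0 + v.val s := rfl

theorem Prog.eval_setFld (s : State) (r : ℕ) (i e : Expr) :
    (Prog.setFld r i e).eval s = ⟨s.reg, CorrClust.setFld s.mem r (i.val s) (e.val s)⟩ := rfl

theorem idx_inj {n v w i j : ℕ} (hv : v < n) (hw : w < n) :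
    i * n + v = j * n + w ↔ i = j ∧ v = w := by
  constructor
  · intro h
    have h1 : v = w := by
      have := congrArg (· % n) h
      simpa [Nat.mod_eq_of_lt hv, Nat.mod_eq_of_lt hw] using this
    subst h1
    have h2 : i * n = j * n := by omega
    exact ⟨Nat.eq_of_mul_eq_mul_right (by omega) h2, rfl⟩
  · rintro ⟨rfl, rfl⟩; rfl

end

/-! ### Values of labellings, and what local moves say about a penalized optimum -/

section

variable {n : ℕ}

/-! ### The value of a labelling -/

section Value
open Classical

/-- `1` for edges, `-1` for pairs of distinct non-adjacent vertices. -/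
def esign (G : SimpleGraph (Fin n)) (u v : Fin n) : ℝ :=
  if u = v then 0 else if G.Adj u v then 1 else -1

theorem esign_comm (G : SimpleGraph (Fin n)) (u v : Fin n) : esign G u v = esign G v u := by
  simp [esign, eq_comm, G.adj_comm]

theorem esign_self (G : SimpleGraph (Fin n)) (u : Fin n) : esign G u u = 0 := by simp [esign]

/-- The indicator of a proposition. -/
def ind (p : Prop) : ℝ := if p then 1 else 0

theorem ind_pos {p : Prop} (h : p) : ind p = 1 := if_pos h
theorem ind_neg {p : Prop} (h : ¬ p) : ind p = 0 := if_neg h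
theorem ind_nonneg (p : Prop) : 0 ≤ ind p := by unfold ind; split <;> simp
theorem ind_le_one (p : Prop) : ind p ≤ 1 := by unfold ind; split <;> simp

theorem sum_ind {ι : Type*} [Fintype ι] {p : ι → Prop} (A : Finset ι) (h : ∀ i, i ∈ A ↔ p i) :
    ∑ i, ind (p i) = (A.card : ℝ) := by
  simp only [ind, Finset.sum_boole, ← h, Finset.filter_univ_mem]

@[simp] theorem ind_true : ind True = 1 := ind_pos trivial
@[simp] theorem ind_false : ind False = 0 := ind_neg id

/-- The sum of the signs of the pairs with a common label. -/
def labelVal {α : Type*} (G : SimpleGraph (Fin n)) (f : Fin n → α) : ℝ :=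
  ∑ u, ∑ v, ind (f u = f v) * esign G u v

/-- Only pairs containing `v` change, and each is counted in both orders, whence the factor 2. The
label `none` is carried by no other vertex, so one formula covers both joining another class and
becoming isolated. -/
theorem labelVal_update {α : Type*} (G : SimpleGraph (Fin n)) (f : Fin n → α) (v : Fin n)
    (x : Option α) :
    labelVal G (Function.update (fun w => some (f w)) v x) = labelVal G f +
      2 * ∑ w, (ind (some (f w) = x) - ind (f w = f v)) *
        esign G v w := by
  set a : Fin n → ℝ := fun w =>
    (ind (some (f w) = x) - ind (f w = f v)) * esign G v w with ha
  have hav : a v = 0 := by simp [ha, esign_self]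
  have h : ∀ u w, ind (Function.update (fun w => some (f w)) v x u =
      Function.update (fun w => some (f w)) v x w) * esign G u w =
      ind (f u = f w) * esign G u w + ((if u = v then a w else 0) +
        (if w = v then a u else 0)) := by
    intro u w
    by_cases hu : u = v
    · subst hu
      by_cases hw : w = u
      · subst hw; simp [hav]
      · rw [Function.update_self, Function.update_of_ne hw]
        simp only [hw, if_true, if_false, ha, eq_comm (a := x), eq_comm (a := f u)]
        ring
    · by_cases hw : w = v
      · subst hw
        rw [Function.update_self, Function.update_of_ne hu]
        simp only [hu, if_true, if_false, ha, esign_comm G w u]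
        ring
      · simp [hu, hw]
  unfold labelVal
  simp only [h, Finset.sum_add_distrib]
  have e1 : ∑ u, ∑ w, (if u = v then a w else 0) = ∑ w, a w := by
    rw [Finset.sum_comm]; simp
  have e2 : ∑ u, ∑ w, (if w = v then a u else 0) = ∑ w, a w := by simp
  rw [e1, e2]; ring

/-- Pairs inside `S` with different labels are gained, and the sum over `u ∈ S` meets them in both
orders. Pairs of a class that are cut by the boundary of `S` are lost; they are met from one end
only, whence the factor 2. -/
theorem labelVal_split {α : Type*} (G : SimpleGraph (Fin n)) (f : Fin n → α)
    (S : Finset (Fin n)) :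
    labelVal G (fun w => if w ∈ S then none else some (f w)) = labelVal G f +
      ∑ u ∈ S, ∑ w, (if w ∈ S then (1 - ind (f u = f w)) * esign G u w
        else -2 * (ind (f u = f w) * esign G u w)) := by
  set b : Fin n → Fin n → ℝ := fun u w => if u ∈ S then (if w ∈ S then 0 else
    ind (f u = f w) * esign G u w) else 0 with hb
  set a : Fin n → Fin n → ℝ := fun u w => if u ∈ S then (if w ∈ S then
    (1 - ind (f u = f w)) * esign G u w else 0) else 0 with ha
  have h : ∀ u w, ind ((if u ∈ S then none else some (f u)) =
      (if w ∈ S then none else some (f w))) * esign G u w =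
      ind (f u = f w) * esign G u w + (a u w - b u w - b w u) := by
    intro u w
    by_cases hu : u ∈ S <;> by_cases hw : w ∈ S <;> simp only [hu, hw, ha, hb, if_true, if_false,
      reduceCtorEq, Option.some.injEq, ind_true, ind_false]
    · ring
    · ring
    · rw [esign_comm G w u, eq_comm (a := f w)]; ring
    · ring
  have e : ∑ u ∈ S, ∑ w, (if w ∈ S then (1 - ind (f u = f w)) * esign G u w
        else -2 * (ind (f u = f w) * esign G u w)) =
      ∑ u, ∑ w, (a u w - 2 * b u w) := by
    rw [← Finset.sum_filter_add_sum_filter_not Finset.univ (· ∈ S) (fun u => ∑ w, (a u w - 2 * b u w))]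
    have : ∑ u ∈ Finset.univ.filter (¬ · ∈ S), ∑ w, (a u w - 2 * b u w) = 0 := by
      refine Finset.sum_eq_zero fun u hu => Finset.sum_eq_zero fun w _ => ?_
      simp only [Finset.mem_filter, Finset.mem_univ, true_and] at hu
      simp [ha, hb, hu]
    rw [this, add_zero]
    refine Finset.sum_congr (by ext; simp) fun u hu => Finset.sum_congr rfl fun w _ => ?_
    have hu : u ∈ S := by simpa using hu
    by_cases hw : w ∈ S <;> simp [ha, hb, hu, hw]
  unfold labelVal
  simp only [h, Finset.sum_add_distrib, e, Finset.sum_sub_distrib, ← Finset.mul_sum]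
  rw [Finset.sum_comm (f := fun u w => b w u)]
  ring

/-- The total degree of the vertices in `T` that share their label. -/
def labelPen {α : Type*} (G : SimpleGraph (Fin n)) (T : Fin n → Prop) (f : Fin n → α) : ℝ :=
  ∑ v, ind (T v ∧ ∃ w, w ≠ v ∧ f w = f v) * deg G v

theorem labelPen_mono {α β : Type*} (G : SimpleGraph (Fin n)) (T : Fin n → Prop) (f : Fin n → α)
    (g : Fin n → β) (h : ∀ v, T v → (∃ w, w ≠ v ∧ g w = g v) → ∃ w, w ≠ v ∧ f w = f v) :
    labelPen G T g ≤ labelPen G T f := by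
  refine Finset.sum_le_sum fun v _ => ?_
  by_cases hg : T v ∧ ∃ w, w ≠ v ∧ g w = g v
  · rw [ind_pos hg, ind_pos ⟨hg.1, h v hg.1 hg.2⟩]
  · rw [ind_neg hg, zero_mul]; exact mul_nonneg (ind_nonneg _) (by positivity)

/-- `f` maximizes the value minus a multiple of the penalty. -/
def LabelOpt {α : Type*} (G : SimpleGraph (Fin n)) (T : Fin n → Prop) (ε : ℝ) (f : Fin n → α) :
    Prop :=
  ∀ g : Fin n → Option α,
    labelVal G g - 4 * ε * labelPen G T g ≤ labelVal G f - 4 * ε * labelPen G T f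

variable {G : SimpleGraph (Fin n)} {T : Fin n → Prop} {ε : ℝ} {α : Type*} {f : Fin n → α}

/-- Isolating `v` refunds its penalty of 4ε times its degree and creates none elsewhere. At an
optimum the signs from `v` to its class must outweigh this refund; they count twice in the value,
which leaves 2ε. -/
theorem LabelOpt.sum_esign_ge (h : LabelOpt G T ε f) (hε : 0 < ε) {v : Fin n} (hv : T v)
    (hw : ∃ w, w ≠ v ∧ f w = f v) :
    2 * ε * deg G v ≤ ∑ w, ind (f w = f v) * esign G v w := by
  have h1 := h (Function.update (fun w => some (f w)) v none)
  rw [labelVal_update] at h1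
  -- The term of `v` disappears, and a vertex that shares its label after the move also shared it
  -- before.
  have h2 : labelPen G T (Function.update (fun w => some (f w)) v none) + deg G v
      ≤ labelPen G T f := by
    have h0 : ¬ (T v ∧ ∃ w, w ≠ v ∧ Function.update (fun w => some (f w)) v none w =
        Function.update (fun w => some (f w)) v none v) := by
      rintro ⟨-, w, hwv, he⟩
      simp [Function.update_of_ne hwv] at he
    have e1 := Finset.add_sum_erase Finset.univ (fun u => ind (T u ∧ ∃ w, w ≠ u ∧
      Function.update (fun w => some (f w)) v none w =
        Function.update (fun w => some (f w)) v none u) * (deg G u : ℝ))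
      (Finset.mem_univ v)
    have e2 := Finset.add_sum_erase Finset.univ
      (fun u => ind (T u ∧ ∃ w, w ≠ u ∧ f w = f u) * (deg G u : ℝ)) (Finset.mem_univ v)
    simp only [ind_neg h0, zero_mul, one_mul, ind_pos (show T v ∧ ∃ w, w ≠ v ∧ f w = f v from ⟨hv, hw⟩)] at e1 e2
    unfold labelPen
    rw [← e1, ← e2, zero_add, add_comm]
    · refine add_le_add le_rfl (Finset.sum_le_sum fun u hu => ?_)
      have huv : u ≠ v := Finset.ne_of_mem_erase hu
      by_cases hg : T u ∧ ∃ w, w ≠ u ∧ Function.update (fun w => some (f w)) v none w =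
          Function.update (fun w => some (f w)) v none u
      · rw [ind_pos hg, ind_pos]
        obtain ⟨hT, w, hwu, he⟩ := hg
        refine ⟨hT, w, hwu, ?_⟩
        rw [Function.update_of_ne huv] at he
        by_cases hwv : w = v
        · subst hwv; simp at he
        · simpa [Function.update_of_ne hwv] using he
      · rw [ind_neg hg, zero_mul]; exact mul_nonneg (ind_nonneg _) (by positivity)
  simp only [reduceCtorEq, ind_false, zero_sub, neg_mul, Finset.sum_neg_distrib] at h1
  nlinarith

/-- Moving `v` into the class of `a` costs no penalty: `v` itself is never penalized, and a vertex
of `T` in that class already has the companion `a`, which is not in `T`. -/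
theorem LabelOpt.sum_esign_le (h : LabelOpt G T ε f) (hε : 0 < ε) {v a : Fin n} (hv : ¬ T v)
    (ha : ¬ T a) :
    ∑ w, ind (f w = f a) * esign G v w ≤
      ∑ w, ind (f w = f v) * esign G v w := by
  have h1 := h (Function.update (fun w => some (f w)) v (some (f a)))
  rw [labelVal_update] at h1
  have h2 : labelPen G T (Function.update (fun w => some (f w)) v (some (f a)))
      ≤ labelPen G T f := by
    refine labelPen_mono G T _ _ fun u hu => ?_
    rintro ⟨w, hwu, he⟩
    have huv : u ≠ v := fun h => hv (h ▸ hu)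
    rw [Function.update_of_ne huv] at he
    by_cases hwv : w = v
    · subst hwv
      simp only [Function.update_self, Option.some.injEq] at he
      exact ⟨a, fun h => ha (h ▸ hu), he⟩
    · exact ⟨w, hwu, by simpa [Function.update_of_ne hwv] using he⟩
  simp only [Option.some.injEq, sub_mul, Finset.sum_sub_distrib] at h1
  nlinarith

/-- Making `S` a cluster of its own can only take companions away from vertices of `T`. The penalty
does not increase, so the value must not increase either. -/
theorem LabelOpt.split_le (h : LabelOpt G T ε f) (hε : 0 < ε) {S : Finset (Fin n)}
    (hS : ∀ v ∈ S, ¬ T v) :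
    ∑ u ∈ S, ∑ w, (if w ∈ S then (1 - ind (f u = f w)) * esign G u w
        else -2 * (ind (f u = f w) * esign G u w)) ≤ 0 := by
  have h1 := h (fun w => if w ∈ S then none else some (f w))
  rw [labelVal_split] at h1
  have h2 : labelPen G T (fun w => if w ∈ S then none else some (f w)) ≤ labelPen G T f := by
    refine labelPen_mono G T _ _ fun u hu => ?_
    rintro ⟨w, hwu, he⟩
    have huS : u ∉ S := fun h => hS u h hu
    refine ⟨w, hwu, ?_⟩
    by_cases hw : w ∈ S
    · simp [hw, huS] at he
    · simpa [hw, huS] using he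
  nlinarith

/-! ### Closed neighbourhoods -/

/-- The closed neighbourhood as a finite set. -/
def nbhd (G : SimpleGraph (Fin n)) (v : Fin n) : Finset (Fin n) :=
  Finset.univ.filter fun w => w = v ∨ G.Adj v w

theorem mem_nbhd {v w : Fin n} : w ∈ nbhd G v ↔ w = v ∨ G.Adj v w := by simp [nbhd]

theorem mem_nbhd_comm {v w : Fin n} : w ∈ nbhd G v ↔ v ∈ nbhd G w := by
  simp [mem_nbhd, eq_comm, G.adj_comm]

theorem coe_nbhd (v : Fin n) : (nbhd G v : Set (Fin n)) = closedNbhd G v := by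
  ext w; simp [mem_nbhd, closedNbhd]

theorem deg_eq_card_filter (G : SimpleGraph (Fin n)) (v : Fin n) :
    deg G v = (Finset.univ.filter fun w => G.Adj v w).card := by
  rw [deg, ← Set.ncard_coe_finset]; congr 1; ext; simp

theorem card_nbhd (G : SimpleGraph (Fin n)) (v : Fin n) : (nbhd G v).card = deg G v + 1 := by
  have : nbhd G v = insert v (Finset.univ.filter fun w => G.Adj v w) := by
    ext; simp [mem_nbhd]
  rw [this, Finset.card_insert_of_notMem (by simp), deg_eq_card_filter]

/-- Signs are `1` inside and `-1` outside a set that agrees with the neighbourhood. -/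
theorem esign_ge_of_mem {S : Finset (Fin n)} {v w : Fin n} (hvw : w ≠ v) (hw : w ∈ S) :
    1 - 2 * ind (w ∈ nbhd G v ∆ S) ≤ esign G v w := by
  by_cases h : G.Adj v w <;> simp [esign, mem_nbhd, Finset.mem_symmDiff, h, hw, hvw, hvw.symm]
  norm_num

theorem esign_le_of_notMem {S : Finset (Fin n)} {v w : Fin n} (hv : v ∈ S) (hw : w ∉ S) :
    esign G v w ≤ -1 + 2 * ind (w ∈ nbhd G v ∆ S) := by
  have hvw : w ≠ v := fun h => hw (h ▸ hv)
  by_cases h : G.Adj v w <;> simp [esign, mem_nbhd, Finset.mem_symmDiff, h, hw, hvw, hvw.symm]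
  norm_num

end Value

end

/-! ### An optimal labelling compared with clusters that agree with neighbourhoods -/

section

variable {n : ℕ}

/-! ### Optimal labellings and agreeing clusters -/

section Core
open Classical

/-- The clusters of `K` are the singletons of the vertices in `T` and sets that agree with the
neighbourhoods of their vertices. -/
structure IsCore (G : SimpleGraph (Fin n)) (K : Clustering n) (T : Fin n → Prop) : Prop where
  single : ∀ v, T v → K.part v = {v}
  agree : ∀ v, ¬ T v → 49 * (nbhd G v ∆ K.part v).card ≤ (K.part v).card

variable {G : SimpleGraph (Fin n)} {K : Clustering n} {T : Fin n → Prop} {ε : ℝ} {α : Type*}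
  {f : Fin n → α}

theorem part_eq_of_mem {K : Clustering n} {v w : Fin n} (h : w ∈ K.part v) :
    K.part w = K.part v := K.part_eq_of_mem (K.part_mem.2 (Finset.mem_univ v)) h

theorem mem_part_self (K : Clustering n) (v : Fin n) : v ∈ K.part v :=
  K.mem_part (Finset.mem_univ v)

theorem part_eq_iff {K : Clustering n} {v w : Fin n} : K.part w = K.part v ↔ w ∈ K.part v :=
  ⟨fun h => h ▸ mem_part_self K w, part_eq_of_mem⟩

theorem IsCore.notMem (h : IsCore G K T) {v w : Fin n} (hv : ¬ T v) (hw : w ∈ K.part v) :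
    ¬ T w := by
  intro hT
  have h1 := h.single w hT
  rw [part_eq_of_mem hw] at h1
  have : v ∈ K.part v := mem_part_self K v
  rw [h1, Finset.mem_singleton] at this
  exact hv (this ▸ hT)

theorem IsCore.agree_of_mem (h : IsCore G K T) {v w : Fin n} (hv : ¬ T v) (hw : w ∈ K.part v) :
    49 * (nbhd G w ∆ K.part v).card ≤ (K.part v).card := by
  have := h.agree w (h.notMem hv hw)
  rwa [part_eq_of_mem hw] at this

/-- Compare with splitting off the whole cluster. If all signs were 1 inside it and -1 across its
boundary, every internal pair with different labels would be gained, and every outside companion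
gained twice. Each exceptional sign spoils this by at most 4, and every vertex of the cluster has at
most 1/49 of the cluster size of them. -/
theorem IsCore.sum_le (h : IsCore G K T) (hf : LabelOpt G T ε f) (hε : 0 < ε) {v : Fin n}
    (hv : ¬ T v) :
    ∑ u ∈ K.part v, 49 * (((K.part v).filter fun w => f w ≠ f u).card +
      2 * (Finset.univ.filter fun w => w ∉ K.part v ∧ f w = f u).card) ≤
      ∑ _u ∈ K.part v, 4 * (K.part v).card := by
  set S := K.part v with hS
  have h1 := hf.split_le hε (S := S) (fun w hw => h.notMem hv hw)
  have h2 : ∀ u ∈ S, (((S.filter fun w => f w ≠ f u).card : ℝ) +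
      2 * (Finset.univ.filter fun w => w ∉ S ∧ f w = f u).card) - 4 * (nbhd G u ∆ S).card ≤
      ∑ w, (if w ∈ S then (1 - ind (f u = f w)) * esign G u w
        else -2 * (ind (f u = f w) * esign G u w)) := by
    intro u hu
    have e1 := sum_ind (p := fun w => w ∈ S ∧ f w ≠ f u) (S.filter fun w => f w ≠ f u) (by simp)
    have e2 := sum_ind (p := fun w => w ∉ S ∧ f w = f u)
      (Finset.univ.filter fun w => w ∉ S ∧ f w = f u) (by simp)
    have e3 := sum_ind (p := fun w => w ∈ nbhd G u ∆ S) (nbhd G u ∆ S) (by simp)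
    rw [← e1, ← e2, ← e3, Finset.mul_sum, Finset.mul_sum, ← Finset.sum_add_distrib,
      ← Finset.sum_sub_distrib]
    refine Finset.sum_le_sum fun w _ => ?_
    have hi := ind_nonneg (w ∈ nbhd G u ∆ S)
    by_cases hw : w ∈ S
    · by_cases he : f w = f u
      · simp [hw, he]; linarith
      · have hwu : w ≠ u := fun h => he (h ▸ rfl)
        have := esign_ge_of_mem (G := G) hwu hw
        simp only [hw, he, ne_comm.1 he, ind_true, ind_false, if_true, not_true, and_self,
          not_false_iff, ne_eq]
        linarith
    · by_cases he : f w = f u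
      · have := esign_le_of_notMem (G := G) hu hw
        simp only [hw, he, ind_true, ind_false, if_false, false_and, and_self, not_false_iff]
        linarith
      · simp [hw, he, eq_comm (a := f u)]; linarith
  have h3 : ∀ u ∈ S, (49 : ℝ) * (nbhd G u ∆ S).card ≤ S.card := fun u hu => by
    exact_mod_cast h.agree_of_mem hv hu
  have h4 := (Finset.sum_le_sum h2).trans h1
  have h5 : (∑ u ∈ S, 49 * (((S.filter fun w => f w ≠ f u).card : ℝ) +
      2 * (Finset.univ.filter fun w => w ∉ S ∧ f w = f u).card)) ≤ ∑ _u ∈ S, 4 * (S.card : ℝ) := by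
    have h6 := Finset.sum_le_sum h3
    rw [Finset.sum_sub_distrib] at h4
    rw [← Finset.mul_sum] at h4 h6 ⊢
    rw [← Finset.mul_sum]
    linarith
  exact_mod_cast h5

/-- By averaging, the class of some `a` contains almost all of the cluster and few outsiders. A
vertex of the cluster with another label would gain by joining the class of `a`, contrary to
optimality. -/
theorem IsCore.label_eq (h : IsCore G K T) (hf : LabelOpt G T ε f) (hε : 0 < ε) {v w : Fin n}
    (hv : ¬ T v) (hw : w ∈ K.part v) : f w = f v := by
  obtain ⟨a, ha, hle⟩ := Finset.exists_le_of_sum_le ⟨v, mem_part_self K v⟩ (h.sum_le hf hε hv)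
  suffices H : ∀ w ∈ K.part v, f w = f a by rw [H w hw, H v (mem_part_self K v)]
  clear hw w
  intro w hw
  by_contra hne
  set S := K.part v with hS
  have hδ := h.agree_of_mem hv hw
  rw [← hS] at hδ
  have h1 := hf.sum_esign_le hε (h.notMem hv hw) (h.notMem hv ha)
  have lo : ∑ x, (ind (x ∈ S ∧ f x = f a) - ind (x ∉ S ∧ f x = f a) -
      2 * ind (x ∈ nbhd G w ∆ S)) ≤ ∑ x, ind (f x = f a) * esign G w x := by
    refine Finset.sum_le_sum fun x _ => ?_
    have hi := ind_nonneg (x ∈ nbhd G w ∆ S)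
    by_cases he : f x = f a
    · by_cases hx : x ∈ S
      · have hwx : x ≠ w := fun h => hne (h ▸ he)
        have := esign_ge_of_mem (G := G) hwx hx
        simp [he, hx]; linarith
      · have : -1 ≤ esign G w x := by unfold esign; split_ifs <;> norm_num
        simp [he, hx]; linarith
    · simp [he]; linarith
  have hi : ∑ x, ind (f x = f w) * esign G w x ≤
      ∑ x, (ind (x ∈ nbhd G w ∆ S) + ind (x ∈ S ∧ f x ≠ f a)) := by
    refine Finset.sum_le_sum fun x _ => ?_
    have hi := ind_nonneg (x ∈ nbhd G w ∆ S)
    have hi' := ind_nonneg (x ∈ S ∧ f x ≠ f a)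
    by_cases he : f x = f w
    · by_cases hx : x ∈ S
      · have : esign G w x ≤ 1 := by unfold esign; split_ifs <;> norm_num
        simp [he, hx, hne]; linarith
      · have := esign_le_of_notMem (G := G) hw hx
        have h1 := ind_le_one (x ∈ nbhd G w ∆ S)
        simp [he, hx]; linarith
    · simp only [he, ind_false, zero_mul]; linarith
  have h2 := lo.trans (h1.trans hi)
  simp only [Finset.sum_sub_distrib, Finset.sum_add_distrib, ← Finset.mul_sum] at h2
  rw [sum_ind (S.filter fun x => f x = f a) (by simp),
    sum_ind (Finset.univ.filter fun x => x ∉ S ∧ f x = f a) (by simp),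
    sum_ind (nbhd G w ∆ S) (by simp), sum_ind (S.filter fun x => f x ≠ f a) (by simp)] at h2
  have h3 : (S.filter fun x => f x = f a).card + (S.filter fun x => f x ≠ f a).card = S.card :=
    Finset.card_filter_add_card_filter_not _
  have hpos : 0 < S.card := Finset.card_pos.2 ⟨w, hw⟩
  have h4 : ((S.filter fun x => f x = f a).card : ℝ) ≤
    (Finset.univ.filter fun x => x ∉ S ∧ f x = f a).card + 3 * (nbhd G w ∆ S).card +
      (S.filter fun x => f x ≠ f a).card := by linarith
  have h5 : (S.filter fun x => f x = f a).card ≤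
    (Finset.univ.filter fun x => x ∉ S ∧ f x = f a).card + 3 * (nbhd G w ∆ S).card +
      (S.filter fun x => f x ≠ f a).card := by exact_mod_cast h4
  -- In units of |S|/49: the left side is at least 45. On the right, the outsiders and the vertices
  -- of `S` with another label account for at most 4, and three times the neighbourhood difference
  -- for at most 3.
  omega

/-- Once the whole cluster has one label, only the outsiders remain in `sum_le`, with the same
number for each vertex of the cluster. -/
theorem IsCore.card_diff_le (h : IsCore G K T) (hf : LabelOpt G T ε f) (hε : 0 < ε) {v : Fin n}
    (hv : ¬ T v) :
    49 * (Finset.univ.filter fun w => w ∉ K.part v ∧ f w = f v).card ≤ 2 * (K.part v).card := by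
  have h1 := h.sum_le hf hε hv
  have h2 : ∀ u ∈ K.part v, 49 * (((K.part v).filter fun w => f w ≠ f u).card +
      2 * (Finset.univ.filter fun w => w ∉ K.part v ∧ f w = f u).card) =
      98 * (Finset.univ.filter fun w => w ∉ K.part v ∧ f w = f v).card := by
    intro u hu
    have e : (K.part v).filter (fun w => f w ≠ f u) = ∅ := by
      refine Finset.filter_eq_empty_iff.2 fun w hw => ?_
      simp [h.label_eq hf hε hv hw, h.label_eq hf hε hv hu]
    rw [e, h.label_eq hf hε hv hu, Finset.card_empty]; ring
  rw [Finset.sum_congr rfl h2, Finset.sum_const, Finset.sum_const, smul_eq_mul, smul_eq_mul] at h1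
  have hpos : 0 < (K.part v).card := Finset.card_pos.2 ⟨v, mem_part_self K v⟩
  have := Nat.le_of_mul_le_mul_left h1 hpos
  omega

/-- Two different clusters in one class would each belong to the few outsiders of the other, so each
would be much smaller than the other. -/
theorem IsCore.part_eq_of_label_eq (h : IsCore G K T) (hf : LabelOpt G T ε f) (hε : 0 < ε)
    {v w : Fin n} (hv : ¬ T v) (hw : ¬ T w) (he : f w = f v) : K.part w = K.part v := by
  by_contra hne
  have sub : ∀ {v w : Fin n}, ¬ T v → ¬ T w → f w = f v → K.part w ≠ K.part v →
      49 * (K.part w).card ≤ 2 * (K.part v).card := by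
    intro v w hv hw he hne
    refine le_trans (Nat.mul_le_mul_left 49 (Finset.card_le_card fun x hx => ?_))
      (h.card_diff_le hf hε hv)
    simp only [Finset.mem_filter, Finset.mem_univ, true_and]
    refine ⟨fun hx' => hne ?_, (h.label_eq hf hε hw hx).trans he⟩
    rw [← part_eq_of_mem hx, part_eq_of_mem hx']
  have h1 := sub hv hw he hne
  have h2 := sub hw hv he.symm (Ne.symm hne)
  have hpos : 0 < (K.part v).card := Finset.card_pos.2 ⟨v, mem_part_self K v⟩
  omega

/-- The term `w = v` has sign 0, but `v` belongs to its own closed neighbourhood and class; the last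
-1 compensates for this. -/
theorem sum_ind_esign (v : Fin n) :
    ∑ w, ind (f w = f v) * esign G v w =
      2 * ((nbhd G v).filter fun w => f w = f v).card -
        (Finset.univ.filter fun w => f w = f v).card - 1 := by
  have h : ∀ w, ind (f w = f v) * esign G v w =
      2 * ind (w ∈ nbhd G v ∧ f w = f v) - ind (f w = f v) - (if w = v then 1 else 0) := by
    intro w
    by_cases hw : w = v
    · subst hw; simp [esign, mem_nbhd]; norm_num
    · by_cases he : f w = f v
      · by_cases ha : G.Adj v w <;> simp [esign, mem_nbhd, hw, he, ha, Ne.symm hw] ; norm_num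
      · simp [he, hw]
  rw [Finset.sum_congr rfl fun w _ => h w]
  simp only [Finset.sum_sub_distrib, ← Finset.mul_sum]
  rw [sum_ind ((nbhd G v).filter fun w => f w = f v) (by simp),
    sum_ind (Finset.univ.filter fun w => f w = f v) (by simp)]
  simp

theorem LabelOpt.card_nbhd_ge (hf : LabelOpt G T ε f) (hε : 0 < ε) {v : Fin n} (hv : T v)
    (hw : ∃ w, w ≠ v ∧ f w = f v) :
    (Finset.univ.filter fun w => f w = f v).card + 1 + 2 * ε * deg G v ≤
      2 * (((nbhd G v).filter fun w => f w = f v).card : ℝ) := by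
  have := hf.sum_esign_ge hε hv hw
  rw [sum_ind_esign] at this
  linarith

/-- Bounding the neighbours within the class once by the whole class and once by the whole
neighbourhood confines the size of the class to between about 2ε and about 2 times the degree. -/
theorem LabelOpt.deg_le (hf : LabelOpt G T ε f) (hε : 0 < ε) {v : Fin n} (hv : T v)
    (hw : ∃ w, w ≠ v ∧ f w = f v) :
    2 * ε * deg G v + 1 ≤ (Finset.univ.filter fun w => f w = f v).card ∧
    ((Finset.univ.filter fun w => f w = f v).card : ℝ) + 2 * ε * deg G v ≤ 2 * deg G v + 1 ∧
    0 < deg G v := by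
  have h1 := hf.card_nbhd_ge hε hv hw
  have h2 : (((nbhd G v).filter fun w => f w = f v).card : ℝ) ≤
      (Finset.univ.filter fun w => f w = f v).card := by
    exact_mod_cast Finset.card_le_card (Finset.filter_subset_filter _ (Finset.subset_univ _))
  have h3 : (((nbhd G v).filter fun w => f w = f v).card : ℝ) ≤ deg G v + 1 := by
    rw [← Nat.cast_add_one, ← card_nbhd]
    exact_mod_cast Finset.card_le_card (Finset.filter_subset _ _)
  have h4 : 1 < (Finset.univ.filter fun w => f w = f v).card := by
    obtain ⟨w, hwv, he⟩ := hw
    exact Finset.one_lt_card.2 ⟨w, by simpa, v, by simp, hwv⟩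
  refine ⟨by linarith, by linarith, ?_⟩
  by_contra h0
  have h5 : (deg G v : ℝ) = 0 := by exact_mod_cast Nat.eq_zero_of_not_pos h0
  have h6 : (1 : ℝ) < (Finset.univ.filter fun w => f w = f v).card := by exact_mod_cast h4
  rw [h5] at h1 h3
  linarith

/-- The number of closed neighbours in `T`. -/
def tcard (G : SimpleGraph (Fin n)) (T : Fin n → Prop) (w : Fin n) : ℕ := ((nbhd G w).filter T).card

theorem tcard_le (w : Fin n) : tcard G T w ≤ (nbhd G w).card :=
  Finset.card_le_card (Finset.filter_subset _ _)

/-- The common closed neighbours with few neighbours in `T`. -/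
def goodCommon (G : SimpleGraph (Fin n)) (T : Fin n → Prop) (N : ℕ) (u v : Fin n) :
    Finset (Fin n) :=
  (nbhd G u).filter fun w => w ∈ nbhd G v ∧ tcard G T w ≤ N * deg G u ∧ tcard G T w ≤ N * deg G v

/-- The two vertices see the same class: `u` bounds its size from below and `v` from above. The
quotient of the two factors is (1 - ε)/ε = 1/ε - 1. -/
theorem LabelOpt.deg_lt (hf : LabelOpt G T ε f) (hε : 0 < ε) {N : ℕ} (hN : 1 / ε - 1 < N)
    {u v : Fin n} (hu : T u) (hv : T v) (huv : u ≠ v) (he : f u = f v) :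
    deg G u < N * deg G v := by
  have h1 := (hf.deg_le hε hu ⟨v, huv.symm, he.symm⟩).1
  obtain ⟨-, h2, h3⟩ := hf.deg_le hε hv ⟨u, huv, he⟩
  rw [he] at h1
  have h4 : ε * deg G u ≤ (1 - ε) * deg G v := by linarith
  have h5 : (deg G u : ℝ) ≤ (1 / ε - 1) * deg G v := by
    have : (1 / ε - 1) * deg G v = ((1 - ε) * deg G v) / ε := by field_simp
    rw [this, le_div_iff₀ hε]; linarith
  have h6 : (deg G u : ℝ) < N * deg G v :=
    h5.trans_lt (mul_lt_mul_of_pos_right hN (by exact_mod_cast h3))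
  exact_mod_cast h6

/-- Every class mate of `v` has a neighbourhood of size O(N deg v): those in `T` by `deg_lt`, the
others because their cluster lies inside the class and agrees with their neighbourhood. Hence the
restriction to vertices with few neighbours in `T` discards no common neighbour within the class. -/
theorem IsCore.tcard_le_of_label_eq (h : IsCore G K T) (hf : LabelOpt G T ε f) (hε : 0 < ε)
    {N : ℕ} (hN : 1 / ε - 1 < N) (hN' : 4 ≤ N) {v w : Fin n} (hv : T v)
    (hx : ∃ x, x ≠ v ∧ f x = f v) (he : f w = f v) : tcard G T w ≤ N * deg G v := by
  obtain ⟨-, h2, h3⟩ := hf.deg_le hε hv hx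
  have h4 := tcard_le (G := G) (T := T) w
  by_cases hwv : w = v
  · subst hwv
    rw [card_nbhd] at h4
    nlinarith
  by_cases hw : T w
  · have := hf.deg_lt hε hN hw hv hwv he
    rw [card_nbhd] at h4
    omega
  · have h5 := h.agree w hw
    have h6 : (K.part w).card ≤ (Finset.univ.filter fun x => f x = f v).card :=
      Finset.card_le_card fun x hx => by simp [h.label_eq hf hε hw hx, he]
    have h7 : (nbhd G w).card ≤ (K.part w).card + (nbhd G w ∆ K.part w).card := by
      refine le_trans (Finset.card_le_card (t := K.part w ∪ (nbhd G w ∆ K.part w)) fun x hx => ?_)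
        (Finset.card_union_le _ _)
      by_cases hxK : x ∈ K.part w <;> simp [Finset.mem_symmDiff, hx, hxK]
    have h8 : (Finset.univ.filter fun x => f x = f v).card ≤ 2 * deg G v + 1 := by
      have : (0 : ℝ) ≤ 2 * ε * deg G v := by positivity
      have : ((Finset.univ.filter fun x => f x = f v).card : ℝ) ≤ 2 * deg G v + 1 := by linarith
      exact_mod_cast this
    have : 4 * deg G v ≤ N * deg G v := Nat.mul_le_mul_right _ hN'
    omega

/-- Each of the two neighbourhoods covers more than half of the common class. By inclusion-exclusion
they overlap at least in half the sum of the two surpluses, that is, in half of 1 + 2ε deg u and 1 +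
2ε deg v together. -/
theorem IsCore.card_goodCommon_ge (h : IsCore G K T) (hf : LabelOpt G T ε f) (hε : 0 < ε)
    {N : ℕ} (hN : 1 / ε - 1 < N) (hN' : 4 ≤ N) {u v : Fin n} (hu : T u) (hv : T v) (huv : u ≠ v)
    (he : f u = f v) : ε * (deg G u + deg G v) + 1 ≤ (goodCommon G T N u v).card := by
  have h1 := hf.card_nbhd_ge hε hu ⟨v, huv.symm, he.symm⟩
  have h2 := hf.card_nbhd_ge hε hv ⟨u, huv, he⟩
  rw [he] at h1
  set O := Finset.univ.filter fun w => f w = f v with hO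
  set A := (nbhd G u).filter fun w => f w = f v with hA
  set B := (nbhd G v).filter fun w => f w = f v with hB
  have h3 : (A ∪ B).card ≤ O.card := Finset.card_le_card fun x hx => by
    simp only [hA, hB, hO, Finset.mem_union, Finset.mem_filter, Finset.mem_univ, true_and] at hx ⊢
    tauto
  have h4 := Finset.card_union_add_card_inter A B
  have h5 : (A ∩ B).card ≤ (goodCommon G T N u v).card := Finset.card_le_card fun x hx => by
    simp only [hA, hB, Finset.mem_inter, Finset.mem_filter] at hx
    simp only [goodCommon, Finset.mem_filter]
    exact ⟨hx.1.1, hx.2.1,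
      h.tcard_le_of_label_eq hf hε hN hN' hu ⟨v, huv.symm, he.symm⟩ (hx.1.2.trans he.symm),
      h.tcard_le_of_label_eq hf hε hN hN' hv ⟨u, huv, he⟩ hx.1.2⟩
  have h6 : (A.card : ℝ) + B.card ≤ O.card + (goodCommon G T N u v).card := by
    have : A.card + B.card ≤ O.card + (goodCommon G T N u v).card := by omega
    exact_mod_cast this
  linarith

/-- The class consists of the cluster of `v` and at most 2/49 as many outsiders (`card_diff_le`),
and the closed neighbourhood of `u` covers more than half of the class. So `u` sees at least (1 -
2/49)/2 = 47/98 of the cluster. -/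
theorem IsCore.atom_bounds (h : IsCore G K T) (hf : LabelOpt G T ε f) (hε : 0 < ε) {u v : Fin n}
    (hu : T u) (hv : ¬ T v) (he : f u = f v) :
    47 * (K.part v).card ≤ 98 * ((K.part v).filter fun w => G.Adj u w).card ∧
    98 * (ε * deg G u) ≤ 51 * (K.part v).card := by
  have huv : u ≠ v := fun h => hv (h ▸ hu)
  have h1 := hf.card_nbhd_ge hε hu ⟨v, huv.symm, he.symm⟩
  have h2 := (hf.deg_le hε hu ⟨v, huv.symm, he.symm⟩).1
  rw [he] at h1 h2
  have h3 := h.card_diff_le hf hε hv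
  set O := Finset.univ.filter fun w => f w = f v with hO
  set Y := Finset.univ.filter fun w => w ∉ K.part v ∧ f w = f v with hY
  have h4 : O.card = (K.part v).card + Y.card := by
    rw [← Finset.card_union_of_disjoint]
    · congr 1; ext x
      simp only [hO, hY, Finset.mem_filter, Finset.mem_univ, true_and, Finset.mem_union]
      constructor
      · intro hx; by_cases hxK : x ∈ K.part v <;> simp [hx, hxK]
      · rintro (hx | hx)
        · exact h.label_eq hf hε hv hx
        · exact hx.2
    · refine Finset.disjoint_left.2 fun x hx hx' => ?_
      simp only [hY, Finset.mem_filter, Finset.mem_univ, true_and] at hx'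
      exact hx'.1 hx
  have h5 : ((nbhd G u).filter fun w => f w = f v).card ≤
      ((K.part v).filter fun w => G.Adj u w).card + Y.card := by
    refine le_trans (Finset.card_le_card fun x hx => ?_) (Finset.card_union_le _ _)
    simp only [Finset.mem_filter, mem_nbhd] at hx
    simp only [hY, Finset.mem_filter, Finset.mem_univ, true_and, Finset.mem_union]
    by_cases hxK : x ∈ K.part v
    · have hxu : x ≠ u := fun h' => h.notMem hv hxK (h' ▸ hu)
      exact Or.inl ⟨hxK, hx.1.resolve_left hxu⟩
    · exact Or.inr ⟨hxK, hx.2⟩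
  have h4' : (O.card : ℝ) = (K.part v).card + Y.card := by exact_mod_cast h4
  have h5' : (((nbhd G u).filter fun w => f w = f v).card : ℝ) ≤
      ((K.part v).filter fun w => G.Adj u w).card + Y.card := by exact_mod_cast h5
  have h3' : (49 : ℝ) * Y.card ≤ 2 * (K.part v).card := by exact_mod_cast h3
  have hd : (0 : ℝ) ≤ 2 * ε * deg G u := by positivity
  constructor
  · have : (47 : ℝ) * (K.part v).card ≤ 98 * ((K.part v).filter fun w => G.Adj u w).card := by
      linarith
    exact_mod_cast this
  · linarith

end Core

end

/-! ### Near-optimality of the penalized optimum; admissible pairs and how many there are -/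

section

variable {n : ℕ}

/-! ### Clusterings given by labels, and their cost -/

section Label
open Classical

/-- The clustering whose clusters are the sets of vertices with a common label. -/
def ofLabel {α : Type*} (f : Fin n → α) : Clustering n := Finpartition.ofSetoid (Setoid.ker f)

theorem mem_part_ofLabel {α : Type*} {f : Fin n → α} {v w : Fin n} :
    w ∈ (ofLabel f).part v ↔ f w = f v := by
  unfold ofLabel
  rw [Finpartition.mem_part_ofSetoid_iff_rel, Setoid.ker_def, eq_comm]

theorem part_ofLabel_eq_iff {α : Type*} {f : Fin n → α} {v w : Fin n} :
    (ofLabel f).part w = (ofLabel f).part v ↔ f w = f v :=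
  part_eq_iff.trans mem_part_ofLabel

theorem sum_deg (H : SimpleGraph (Fin n)) : ∑ v, deg H v = 2 * H.edgeSet.ncard := by
  have h := H.sum_degrees_eq_twice_card_edges
  rw [← SimpleGraph.coe_edgeFinset, Set.ncard_coe_finset, ← h]
  refine Finset.sum_congr rfl fun v _ => ?_
  rw [deg_eq_card_filter, SimpleGraph.degree]
  congr 1; ext; simp

theorem cast_deg (H : SimpleGraph (Fin n)) (v : Fin n) : (deg H v : ℝ) = ∑ w, ind (H.Adj v w) := by
  rw [deg_eq_card_filter, ← sum_ind (p := fun w => H.Adj v w) _ (by simp)]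

theorem violation_adj {G : SimpleGraph (Fin n)} {P : Clustering n} {v w : Fin n} :
    (violation G P).Adj v w ↔ v ≠ w ∧ (G.Adj v w ↔ P.part v ≠ P.part w) := by
  simp only [violation, symmDiff_def, SimpleGraph.sup_adj, SimpleGraph.sdiff_adj, clusterGraph]
  have := fun h : G.Adj v w => h.ne
  tauto

/-- A pair inside a cluster contributes its sign to the value: an edge saves the cost 1 that it
would have across clusters, a non-edge adds a cost of 1. Thus maximizing `labelVal` is minimizing
the cost, with a factor 2 for the two orders. -/
theorem two_mul_cost (G : SimpleGraph (Fin n)) (P : Clustering n) :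
    2 * (cost G P : ℝ) = (∑ v, (deg G v : ℝ)) - labelVal G P.part := by
  have h1 : 2 * (cost G P : ℝ) = ∑ v, (deg (violation G P) v : ℝ) := by
    have := sum_deg (violation G P)
    rw [cost]; exact_mod_cast this.symm
  rw [h1, labelVal, ← Finset.sum_sub_distrib]
  refine Finset.sum_congr rfl fun u _ => ?_
  rw [cast_deg, cast_deg, ← Finset.sum_sub_distrib]
  refine Finset.sum_congr rfl fun w _ => ?_
  by_cases hw : u = w
  · subst hw; simp [esign]
  · by_cases ha : G.Adj u w <;> by_cases hp : P.part u = P.part w <;>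
      simp [esign, violation_adj, hw, ha, hp]

theorem labelVal_congr {α β : Type*} {G : SimpleGraph (Fin n)} {f : Fin n → α} {g : Fin n → β}
    (h : ∀ u v, f u = f v ↔ g u = g v) : labelVal G f = labelVal G g := by
  simp [labelVal, h]

theorem labelPen_congr {α β : Type*} {G : SimpleGraph (Fin n)} {T : Fin n → Prop}
    {f : Fin n → α} {g : Fin n → β} (h : ∀ u v, f u = f v ↔ g u = g v) :
    labelPen G T f = labelPen G T g := by
  simp [labelPen, h]

theorem labelPen_le {α : Type*} {G : SimpleGraph (Fin n)} {T : Fin n → Prop} {f : Fin n → α} :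
    labelPen G T f ≤ ∑ v ∈ Finset.univ.filter T, (deg G v : ℝ) := by
  rw [Finset.sum_filter]
  refine Finset.sum_le_sum fun v _ => ?_
  by_cases h : T v
  · rw [if_pos h]; exact mul_le_of_le_one_left (by positivity) (ind_le_one _)
  · simp [h]

theorem labelPen_nonneg {α : Type*} {G : SimpleGraph (Fin n)} {T : Fin n → Prop} {f : Fin n → α} :
    0 ≤ labelPen G T f :=
  Finset.sum_nonneg fun v _ => mul_nonneg (ind_nonneg _) (by positivity)

/-- The penalty of any clustering lies between 0 and 4ε times the total degree of `T`. So the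
penalized optimum loses at most this much value, which is half as much in cost. -/
theorem exists_labelOpt (G : SimpleGraph (Fin n)) (T : Fin n → Prop) {ε : ℝ} (hε : 0 < ε) :
    ∃ Q : Clustering n, LabelOpt G T ε Q.part ∧
      (cost G Q : ℝ) ≤ optCost G + 2 * ε * ∑ v ∈ Finset.univ.filter T, (deg G v : ℝ) := by
  have : Nonempty (Clustering n) := ⟨ofLabel id⟩
  have : Finite (Clustering n) := Finite.of_injective (fun P : Clustering n => P.parts)
    fun _ _ h => Finpartition.ext h
  obtain ⟨Q, hQ⟩ := Finite.exists_min (fun Q : Clustering n =>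
    4 * ε * labelPen G T Q.part - labelVal G Q.part)
  refine ⟨Q, fun g => ?_, ?_⟩
  · have h := hQ (ofLabel g)
    rw [labelPen_congr (g := g) fun u v => part_ofLabel_eq_iff,
      labelVal_congr (g := g) fun u v => part_ofLabel_eq_iff] at h
    linarith
  · obtain ⟨R, hR⟩ : ∃ R : Clustering n, cost G R = optCost G :=
      Nat.sInf_mem (Set.range_nonempty (fun P : Clustering n => cost G P))
    have h := hQ R
    have h1 := two_mul_cost G Q
    have h2 := two_mul_cost G R
    have h3 := labelPen_le (G := G) (T := T) (f := R.part)
    have h4 := labelPen_nonneg (G := G) (T := T) (f := Q.part)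
    rw [hR] at h2
    nlinarith

end Label

/-! ### Admissible pairs -/

section Adm
open Classical

/-- A core together with sizes `x` that are almost the sizes of the clusters. -/
structure SizedCore (G : SimpleGraph (Fin n)) (K : Clustering n) (T : Fin n → Prop)
    (x : Fin n → ℕ) : Prop extends IsCore G K T where
  card_le : ∀ v, ¬ T v → (K.part v).card ≤ x v
  le_card : ∀ v, ¬ T v → 99 * x v ≤ 100 * (K.part v).card
  size_eq : ∀ v, ¬ T v → ∀ w ∈ K.part v, x w = x v

/-- The vertex `u` is admissible to the atom that contains `v`. -/
def AtomAdm (G : SimpleGraph (Fin n)) (K : Clustering n) (T : Fin n → Prop) (x : Fin n → ℕ)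
    (N : ℕ) (u v : Fin n) : Prop :=
  T u ∧ ¬ T v ∧ 2 * x v ≤ 5 * ((K.part v).filter fun w => G.Adj u w).card ∧
    5 * deg G u ≤ 3 * N * x v

/-- The necessary conditions for a pair of vertices in `T` to be admissible. -/
def PairSim (G : SimpleGraph (Fin n)) (T : Fin n → Prop) (N : ℕ) (u v : Fin n) : Prop :=
  u ≠ v ∧ T u ∧ T v ∧ deg G u < N * deg G v ∧ deg G v < N * deg G u

/-- The number 1/k is the threshold for the common neighbourhood relative to the degree sum. Joining
two vertices of `T` in the optimum implies the condition for k = N + 1; the condition for k = 2N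
still gives bounded degrees; randomness acts in between. -/
def PairAdm (G : SimpleGraph (Fin n)) (T : Fin n → Prop) (N k : ℕ) (u v : Fin n) : Prop :=
  PairSim G T N u v ∧ deg G u + deg G v ≤ k * (goodCommon G T N u v).card

variable {G : SimpleGraph (Fin n)} {K : Clustering n} {T : Fin n → Prop} {x : Fin n → ℕ} {N k : ℕ}

theorem goodCommon_comm (u v : Fin n) : goodCommon G T N u v = goodCommon G T N v u := by
  ext w; simp only [goodCommon, Finset.mem_filter]; tauto

theorem PairSim.symm {u v : Fin n} (h : PairSim G T N u v) : PairSim G T N v u :=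
  ⟨h.1.symm, h.2.2.1, h.2.1, h.2.2.2.2, h.2.2.2.1⟩

theorem PairAdm.symm {u v : Fin n} (h : PairAdm G T N k u v) : PairAdm G T N k v u :=
  ⟨h.1.symm, by rw [goodCommon_comm, add_comm]; exact h.2⟩

/-- The graph of admissible pairs with threshold `1 / k`. -/
def admGraph (G : SimpleGraph (Fin n)) (K : Clustering n) (T : Fin n → Prop) (x : Fin n → ℕ)
    (N k : ℕ) : SimpleGraph (Fin n) where
  Adj u v := PairAdm G T N k u v ∨ AtomAdm G K T x N u v ∨ AtomAdm G K T x N v u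
  symm := ⟨fun _ _ h => h.elim (fun h => Or.inl h.symm) fun h => Or.inr h.symm⟩
  loopless := ⟨fun _ h => h.elim (fun h => h.1.1 rfl) fun h => h.elim (fun h => h.2.1 h.1)
    fun h => h.2.1 h.1⟩

theorem admGraph_mono {k k' : ℕ} (h : k ≤ k') : admGraph G K T x N k ≤ admGraph G K T x N k' :=
  fun _ _ hA => hA.imp (fun hA => ⟨hA.1, hA.2.trans (Nat.mul_le_mul_right _ h)⟩) id

theorem SizedCore.size_pos (h : SizedCore G K T x) {v : Fin n} (hv : ¬ T v) : 0 < x v :=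
  lt_of_lt_of_le (Finset.card_pos.2 ⟨v, mem_part_self K v⟩) (h.card_le v hv)

theorem SizedCore.atomAdm_congr (h : SizedCore G K T x) {u v w : Fin n} (hv : ¬ T v)
    (hw : w ∈ K.part v) : AtomAdm G K T x N u w ↔ AtomAdm G K T x N u v := by
  unfold AtomAdm
  rw [part_eq_of_mem hw, h.size_eq v hv w hw]
  simp [hv, h.notMem hv hw]

/-- The vertices admissible to the atom of `v`. -/
def atomNbrs (G : SimpleGraph (Fin n)) (K : Clustering n) (T : Fin n → Prop) (x : Fin n → ℕ)
    (N : ℕ) (v : Fin n) : Finset (Fin n) := Finset.univ.filter fun u => AtomAdm G K T x N u v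

/-- Double counting of the edges between the cluster and its admissible vertices, each of which sees
at least 2/5 of the cluster. -/
theorem SizedCore.card_atomNbrs_mul_le (h : SizedCore G K T x) {v : Fin n} (hv : ¬ T v) :
    2 * ((atomNbrs G K T x N v).card * (K.part v).card) ≤
      5 * ∑ w ∈ K.part v, ((atomNbrs G K T x N v).filter fun u => G.Adj u w).card := by
  have e : ∑ w ∈ K.part v, ((atomNbrs G K T x N v).filter fun u => G.Adj u w).card =
      ∑ u ∈ atomNbrs G K T x N v, ((K.part v).filter fun w => G.Adj u w).card := by
    simp only [Finset.card_filter]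
    exact Finset.sum_comm
  rw [e, Finset.mul_sum, ← mul_assoc, mul_comm 2, mul_assoc, ← smul_eq_mul]
  refine Finset.card_nsmul_le_sum _ _ _ fun u hu => ?_
  have hu : AtomAdm G K T x N u v := by simpa [atomNbrs] using hu
  have := h.card_le v hv
  have := hu.2.2.1
  omega

/-- Edges to admissible vertices leave the cluster, so each vertex of the cluster has at most 1/49
of the cluster size of them. In particular, an atom with an admissible vertex has at least 20
vertices, and a cluster of one vertex has no admissible vertex. -/
theorem SizedCore.sum_atomNbrs_le (h : SizedCore G K T x) {v : Fin n} (hv : ¬ T v) :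
    98 * (atomNbrs G K T x N v).card ≤ 5 * (K.part v).card := by
  have h1 := h.card_atomNbrs_mul_le (N := N) hv
  have h2 : ∑ w ∈ K.part v, 49 * ((atomNbrs G K T x N v).filter fun u => G.Adj u w).card ≤
      ∑ _w ∈ K.part v, (K.part v).card := by
    refine Finset.sum_le_sum fun w hw => le_trans (Nat.mul_le_mul_left 49 (Finset.card_le_card ?_))
      (h.agree_of_mem hv hw)
    intro u hu
    simp only [Finset.mem_filter, atomNbrs, Finset.mem_univ, true_and] at hu
    rw [Finset.mem_symmDiff, mem_nbhd]
    exact Or.inl ⟨Or.inr hu.2.symm, fun hu' => h.notMem hv hu' hu.1.1⟩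
  rw [← Finset.mul_sum, Finset.sum_const, smul_eq_mul] at h2
  have hpos : 0 < (K.part v).card := Finset.card_pos.2 ⟨v, mem_part_self K v⟩
  refine Nat.le_of_mul_le_mul_right (c := (K.part v).card) ?_ hpos
  nlinarith

theorem SizedCore.deg_bounds (h : SizedCore G K T x) {u v : Fin n} (hu : AtomAdm G K T x N u v) :
    9 * x v ≤ 10 * deg G v ∧ 10 * deg G v ≤ 11 * x v ∧ 2 * x v ≤ 5 * deg G u := by
  have hv := hu.2.1
  have h1 := h.sum_atomNbrs_le (N := N) hv
  -- Together with `h1` this gives at least 20 vertices in the cluster, enough to absorb the 1 by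
  -- which degree and closed neighbourhood differ.
  have h0 : 0 < (atomNbrs G K T x N v).card := Finset.card_pos.2 ⟨u, by simpa [atomNbrs] using hu⟩
  have h2 := h.agree v hv
  have h3 : (nbhd G v).card ≤ (K.part v).card + (nbhd G v ∆ K.part v).card := by
    refine le_trans (Finset.card_le_card (t := K.part v ∪ (nbhd G v ∆ K.part v)) fun x hx => ?_)
      (Finset.card_union_le _ _)
    by_cases hxK : x ∈ K.part v <;> simp [Finset.mem_symmDiff, hx, hxK]
  have h4 : (K.part v).card ≤ (nbhd G v).card + (nbhd G v ∆ K.part v).card := by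
    refine le_trans (Finset.card_le_card (t := nbhd G v ∪ (nbhd G v ∆ K.part v)) fun x hx => ?_)
      (Finset.card_union_le _ _)
    by_cases hxK : x ∈ nbhd G v <;> simp [Finset.mem_symmDiff, hx, hxK]
  rw [card_nbhd] at h3 h4
  have h5 := h.card_le v hv
  have h6 := h.le_card v hv
  have h7 : ((K.part v).filter fun w => G.Adj u w).card ≤ deg G u := by
    rw [deg_eq_card_filter]
    exact Finset.card_le_card (Finset.filter_subset_filter _ (Finset.subset_univ _))
  have h8 := hu.2.2.1
  omega

theorem SizedCore.card_atomNbrs_le (h : SizedCore G K T x) {v : Fin n} (hv : ¬ T v) :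
    (atomNbrs G K T x N v).card ≤ deg G v := by
  rcases Finset.eq_empty_or_nonempty (atomNbrs G K T x N v) with h0 | ⟨u, hu⟩
  · simp [h0]
  · have := h.deg_bounds (N := N) (u := u) (v := v) (by simpa [atomNbrs] using hu)
    have h1 := h.sum_atomNbrs_le (N := N) hv
    have := h.card_le v hv
    omega

/-- A charging argument: every neighbour `w` of `u` distributes 5 evenly over the cluster of `w`. A
vertex of an atom to which `u` is admissible receives at least 2, since `u` sees 2/5 of that atom.
-/
theorem SizedCore.card_atomAdm_le (h : SizedCore G K T x) (u : Fin n) :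
    2 * (Finset.univ.filter fun v => AtomAdm G K T x N u v).card ≤ 5 * deg G u := by
  set S := Finset.univ.filter fun v => AtomAdm G K T x N u v with hS
  have h1 : ∀ v ∈ S, (2 : ℝ) ≤ ∑ w ∈ Finset.univ.filter fun w => G.Adj u w,
      5 * (ind (w ∈ K.part v) / (K.part w).card) := by
    intro v hv
    have hv : AtomAdm G K T x N u v := by simpa [hS] using hv
    have hpos : 0 < (K.part v).card := Finset.card_pos.2 ⟨v, mem_part_self K v⟩
    have h2 : ∑ w ∈ Finset.univ.filter fun w => G.Adj u w,
      5 * (ind (w ∈ K.part v) / (K.part w).card) =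
        5 * (((K.part v).filter fun w => G.Adj u w).card / (K.part v).card) := by
      rw [← Finset.mul_sum, ← sum_ind (p := fun w => w ∈ K.part v ∧ G.Adj u w) _ (by simp),
        Finset.sum_div, Finset.sum_filter]
      congr 1
      refine Finset.sum_congr rfl fun w _ => ?_
      by_cases hw : w ∈ K.part v <;> by_cases ha : G.Adj u w <;> simp [hw, ha]
      rw [part_eq_of_mem hw]
    rw [h2, ← mul_div_assoc, le_div_iff₀ (by exact_mod_cast hpos)]
    have := h.card_le v hv.2.1
    have := hv.2.2.1
    have : 2 * (K.part v).card ≤ 5 * ((K.part v).filter fun w => G.Adj u w).card := by omega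
    exact_mod_cast this
  have h2 := Finset.sum_le_sum h1
  rw [Finset.sum_const, Finset.sum_comm] at h2
  have h3 : ∀ w ∈ Finset.univ.filter fun w => G.Adj u w,
      ∑ v ∈ S, 5 * (ind (w ∈ K.part v) / ((K.part w).card : ℝ)) ≤ 5 := by
    intro w _
    rw [← Finset.mul_sum, ← Finset.sum_div]
    have hpos : 0 < (K.part w).card := Finset.card_pos.2 ⟨w, mem_part_self K w⟩
    have : ∑ v ∈ S, ind (w ∈ K.part v) ≤ (K.part w).card := by
      rw [← sum_ind (p := fun v => w ∈ K.part v) (K.part w)]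
      · exact Finset.sum_le_univ_sum_of_nonneg fun v => ind_nonneg _
      · intro v; rw [← part_eq_iff, ← part_eq_iff, eq_comm]
    have := (div_le_one (by exact_mod_cast hpos : (0 : ℝ) < (K.part w).card)).2 this
    linarith
  have h4 := h2.trans (Finset.sum_le_sum h3)
  rw [Finset.sum_const, ← deg_eq_card_filter, nsmul_eq_mul, nsmul_eq_mul] at h4
  have : S.card * 2 ≤ deg G u * 5 := by exact_mod_cast h4
  omega

/-- The vertices of `T` with a path of length two to `v` through a vertex with few neighbours in
`T`. -/
def reach (G : SimpleGraph (Fin n)) (T : Fin n → Prop) (N : ℕ) (v : Fin n) : Finset (Fin n) :=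
  ((nbhd G v).filter fun w => tcard G T w ≤ N * deg G v).biUnion fun w => (nbhd G w).filter T

theorem card_reach_le (v : Fin n) :
    (reach G T N v).card ≤ (deg G v + 1) * (N * deg G v) := by
  refine Finset.card_biUnion_le.trans ?_
  rw [← card_nbhd]
  refine le_trans (Finset.sum_le_card_nsmul _ _ (N * deg G v) fun w hw => ?_)
    (Nat.mul_le_mul_right _ (Finset.card_le_card (Finset.filter_subset _ _)))
  exact (Finset.mem_filter.1 hw).2

/-- A good common neighbour would be the middle of a path that defines `reach`. Errors at `v` thus
only concern vertices in `reach`, which is a small set by `card_reach_le`. -/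
theorem goodCommon_eq_empty {u v : Fin n} (hu : T u) (h : u ∉ reach G T N v) :
    goodCommon G T N v u = ∅ := by
  refine Finset.filter_eq_empty_iff.2 fun w hw hw' => h ?_
  simp only [reach, Finset.mem_biUnion, Finset.mem_filter]
  exact ⟨w, ⟨hw, hw'.2.1⟩, mem_nbhd_comm.1 hw'.1, hu⟩

/-- Count pairs of an admissible `u` and a good common neighbour `w`. Each `u` takes part in at
least deg v / k of them, and each of the at most deg v + 1 vertices `w` in at most N deg v, because
`w` has few neighbours in `T`. -/
theorem card_pairAdm_le (v : Fin n) :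
    (Finset.univ.filter fun u => PairAdm G T N k u v).card ≤ 2 * k * N * deg G v := by
  set S := Finset.univ.filter fun u => PairAdm G T N k u v with hS
  rcases Finset.eq_empty_or_nonempty S with h0 | ⟨u₀, hu₀⟩
  · simp [h0]
  have hd : 0 < deg G v := by
    have h1 : PairAdm G T N k u₀ v := by simpa [hS] using hu₀
    rcases Nat.eq_zero_or_pos (deg G v) with h0 | h0
    · have := h1.1.2.2.2.1; simp [h0] at this
    · exact h0
  have h1 : S.card * deg G v ≤ ∑ u ∈ S, k * (goodCommon G T N v u).card := by
    rw [← smul_eq_mul]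
    refine Finset.card_nsmul_le_sum _ _ _ fun u hu => ?_
    have hu : PairAdm G T N k u v := by simpa [hS] using hu
    have := hu.2
    rw [goodCommon_comm] at this
    omega
  have h2 : ∑ u ∈ S, (goodCommon G T N v u).card ≤ (deg G v + 1) * (N * deg G v) := by
    have : ∀ u ∈ S, (goodCommon G T N v u).card ≤
        ∑ w ∈ (nbhd G v).filter (fun w => tcard G T w ≤ N * deg G v),
          if u ∈ (nbhd G w).filter T then 1 else 0 := by
      intro u hu
      have hu : PairAdm G T N k u v := by simpa [hS] using hu
      rw [← Finset.card_filter]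
      refine Finset.card_le_card fun w hw => ?_
      simp only [goodCommon, Finset.mem_filter] at hw ⊢
      exact ⟨⟨hw.1, hw.2.2.1⟩, mem_nbhd_comm.1 hw.2.1, hu.1.2.1⟩
    refine (Finset.sum_le_sum this).trans ?_
    rw [Finset.sum_comm, ← card_nbhd]
    refine le_trans (Finset.sum_le_card_nsmul _ _ (N * deg G v) fun w hw => ?_)
      (Nat.mul_le_mul_right _ (Finset.card_le_card (Finset.filter_subset _ _)))
    refine le_trans ?_ (Finset.mem_filter.1 hw).2
    rw [← Finset.card_filter]
    exact Finset.card_le_card fun u hu => (Finset.mem_filter.1 hu).2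
  rw [← Finset.mul_sum] at h1
  refine Nat.le_of_mul_le_mul_right (c := deg G v) (h1.trans ?_) hd
  refine (Nat.mul_le_mul_left k h2).trans ?_
  have : deg G v + 1 ≤ 2 * deg G v := by omega
  calc k * ((deg G v + 1) * (N * deg G v)) ≤ k * ((2 * deg G v) * (N * deg G v)) := by gcongr
    _ = _ := by ring

end Adm

end

/-! ### Verification of the preclustering properties, and the core of the input clustering -/

section

variable {n : ℕ}

/-! ### The structural properties of the preclustering -/

section Good
open Classical

variable {G : SimpleGraph (Fin n)} {K : Clustering n} {T : Fin n → Prop} {x : Fin n → ℕ} {N : ℕ}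
  {A : SimpleGraph (Fin n)} {ε : ℝ}

theorem IsAtomOf.exists_part {S : Finset (Fin n)} (hS : IsAtomOf K S) (h : IsCore G K T) :
    ∃ v ∈ S, S = K.part v ∧ ¬ T v := by
  obtain ⟨v, hv⟩ := K.nonempty_of_mem_parts hS.1
  have e : K.part v = S := K.part_eq_of_mem hS.1 hv
  refine ⟨v, hv, e.symm, fun hT => hS.2 ?_⟩
  rw [← e, h.single v hT]; simp

theorem mem_admGraph_neighbor {k : ℕ} {u v : Fin n} (hv : T v)
    (h : (admGraph G K T x N k).Adj v u) : PairAdm G T N k u v ∨ AtomAdm G K T x N v u := by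
  rcases h with h | h | h
  · exact Or.inl h.symm
  · exact Or.inr h
  · exact absurd hv h.2.1

theorem admGraph_neighbor_of_not {k : ℕ} {u v : Fin n} (hv : ¬ T v)
    (h : (admGraph G K T x N k).Adj u v) : AtomAdm G K T x N u v := by
  rcases h with h | h | h
  · exact absurd h.1.2.2.1 hv
  · exact h
  · exact absurd h.1 hv

theorem deg_mono {H H' : SimpleGraph (Fin n)} (h : H ≤ H') (v : Fin n) : deg H v ≤ deg H' v :=
  Set.ncard_le_ncard (fun _ hw => h hw) (Set.toFinite _)

/-- At a vertex of `T`, pairs contribute 2 · 2N · N = 4N² and atoms 5/2 times the degree. Any other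
vertex is only admissible to the vertices admissible to its atom. -/
theorem SizedCore.deg_admGraph_le (h : SizedCore G K T x) (hN : 10 ≤ N) (v : Fin n) :
    deg (admGraph G K T x N (2 * N)) v ≤ 5 * N ^ 2 * deg G v := by
  rw [deg_eq_card_filter]
  by_cases hv : T v
  · have h1 := card_pairAdm_le (G := G) (T := T) (N := N) (k := 2 * N) v
    have h2 := h.card_atomAdm_le (N := N) v
    have h3 : (Finset.univ.filter fun w => (admGraph G K T x N (2 * N)).Adj v w).card ≤ _ :=
      le_trans (Finset.card_le_card (t := (Finset.univ.filter fun u => PairAdm G T N (2 * N) u v) ∪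
        Finset.univ.filter fun u => AtomAdm G K T x N v u) fun u hu => by
          simp only [Finset.mem_filter, Finset.mem_univ, true_and, Finset.mem_union] at hu ⊢
          exact mem_admGraph_neighbor hv hu) (Finset.card_union_le _ _)
    have h4 : 3 * deg G v ≤ N ^ 2 * deg G v := Nat.mul_le_mul_right _ (by nlinarith)
    have h5 : 2 * (2 * N) * N * deg G v = 4 * (N ^ 2 * deg G v) := by ring
    have h6 : 5 * N ^ 2 * deg G v = 5 * (N ^ 2 * deg G v) := by ring
    omega
  · have h1 := h.card_atomNbrs_le (N := N) hv
    have h3 : (Finset.univ.filter fun w => (admGraph G K T x N (2 * N)).Adj v w).card ≤ _ :=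
      Finset.card_le_card (t := atomNbrs G K T x N v) fun u hu => by
          simp only [Finset.mem_filter, Finset.mem_univ, true_and, atomNbrs] at hu ⊢
          exact admGraph_neighbor_of_not hv hu.symm
    have : 1 * deg G v ≤ (5 * N ^ 2) * deg G v := Nat.mul_le_mul_right _ (by nlinarith)
    omega

/-- All edges at a vertex whose cluster is a singleton are violated. -/
theorem IsCore.sum_deg_le (h : IsCore G K T) :
    ∑ v ∈ Finset.univ.filter T, deg G v ≤ 2 * cost G K := by
  rw [cost, ← sum_deg]
  refine le_trans (Finset.sum_le_sum fun v hv => ?_)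
    (Finset.sum_le_univ_sum_of_nonneg fun v => Nat.zero_le _)
  have hv : T v := by simpa using hv
  refine Set.ncard_le_ncard (fun w hw => ?_) (Set.toFinite _)
  have hw : G.Adj v w := hw
  show (violation G K).Adj v w
  refine violation_adj.2 ⟨hw.ne, iff_of_true hw fun he => hw.ne ?_⟩
  have h1 := part_eq_iff.1 he.symm
  rw [h.single v hv, Finset.mem_singleton] at h1
  exact h1.symm

/-- The condition for atoms does not involve the threshold k, so all graphs between the two bounds
agree around atoms. -/
theorem SizedCore.admNbrs_eq (h : SizedCore G K T x) {k k' : ℕ} (hA : admGraph G K T x N k ≤ A)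
    (hA' : A ≤ admGraph G K T x N k') {v : Fin n} (hv : ¬ T v) :
    admNbrs A (K.part v) = atomNbrs G K T x N v := by
  ext u
  simp only [admNbrs, atomNbrs, Finset.coe_filter, Finset.mem_univ, true_and, Set.mem_ofPred_eq]
  constructor
  · rintro ⟨w, hw, ha⟩
    exact (h.atomAdm_congr hv hw).1 (admGraph_neighbor_of_not (h.notMem hv hw) (hA' ha))
  · exact fun hu => ⟨v, mem_part_self K v, hA (Or.inr (Or.inl hu))⟩

theorem SizedCore.similar (h : SizedCore G K T x) (hε : 0 < ε) (hε' : ε < 1 / 10) (hN : N ≤ 1 / ε)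
    {u v : Fin n} (hA : (admGraph G K T x N (2 * N)).Adj u v) : DegreeSimilar ε G u v := by
  have lt_of : ∀ {a b : ℕ}, a < N * b → ε * (a : ℝ) < b ∧ (a : ℝ) < b / ε := by
    intro a b hab
    have h1 : (a : ℝ) < N * b := by exact_mod_cast hab
    have h2 : (N : ℝ) * b ≤ 1 / ε * b := mul_le_mul_of_nonneg_right hN (by positivity)
    have h3 : (a : ℝ) < b / ε := by
      have : (1 : ℝ) / ε * b = b / ε := by ring
      linarith
    exact ⟨by rw [lt_div_iff₀ hε] at h3; linarith, h3⟩
  have atom : ∀ {u v : Fin n}, AtomAdm G K T x N u v →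
      (ε * (deg G u : ℝ) < deg G v ∧ (deg G u : ℝ) < deg G v / ε) ∧
      (ε * (deg G v : ℝ) < deg G u ∧ (deg G v : ℝ) < deg G u / ε) := by
    intro u v hu
    obtain ⟨h1, h2, h3⟩ := h.deg_bounds hu
    have h4 := hu.2.2.2
    have h5 := h.size_pos hu.2.1
    have hN0 : 0 < N := by
      rcases Nat.eq_zero_or_pos N with h0 | h0
      · subst h0; omega
      · exact h0
    -- From 5 deg u ≤ 3N x and 9x ≤ 10 deg v one gets deg u ≤ (2/3) N deg v.
    have h6 : deg G u < N * deg G v := by nlinarith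
    refine ⟨lt_of h6, ?_⟩
    have h1' : (10 : ℝ) * deg G v ≤ 11 * x v := by exact_mod_cast h2
    have h3' : (2 : ℝ) * x v ≤ 5 * deg G u := by exact_mod_cast h3
    have h5' : (0 : ℝ) < x v := by exact_mod_cast h5
    have h7 : ε * (deg G v : ℝ) < deg G u := by
      have : ε * (deg G v : ℝ) ≤ 1 / 10 * deg G v :=
        mul_le_mul_of_nonneg_right hε'.le (by positivity)
      linarith
    exact ⟨h7, by rw [lt_div_iff₀ hε]; linarith⟩
  rcases hA with hA | hA | hA
  · exact ⟨(lt_of hA.1.2.2.2.1).1, (lt_of hA.1.2.2.2.2).2⟩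
  · exact ⟨(atom hA).1.1, (atom hA).2.2⟩
  · exact ⟨(atom hA).2.1, (atom hA).1.2⟩

/-- The witness is the penalized optimum: each pair that it joins lies in a common atom or satisfies
the admissibility conditions with the stricter threshold 1/(N+1) ≤ ε. -/
theorem SizedCore.accepted (h : SizedCore G K T x) (hε : 0 < ε) (hN : N ≤ 1 / ε)
    (hN' : 1 / ε - 1 < N) (hN10 : 10 ≤ N) (hA : admGraph G K T x N (N + 1) ≤ A) :
    ∃ Q : Clustering n, Accepted K A Q ∧
      (cost G Q : ℝ) ≤ optCost G + 4 * ε * cost G K ∧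
      ∀ S ∈ Q.parts, ∀ v ∈ S, S.card = 1 ∨ ε * deg G v < S.card := by
  have hεN : ε * N ≤ 1 := by
    have := mul_le_mul_of_nonneg_left hN hε.le
    rwa [mul_one_div_cancel hε.ne'] at this
  have hεN' : 1 ≤ ε * (N + 1) := by
    have : 1 / ε ≤ (N : ℝ) + 1 := by linarith
    rw [div_le_iff₀ hε] at this
    linarith
  obtain ⟨Q, hQ, hc⟩ := exists_labelOpt G T hε
  refine ⟨Q, ⟨fun S hS u hu v hv => ?_, fun u v huv he => ?_⟩, ?_, fun S hS v hv => ?_⟩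
  · obtain ⟨a, -, rfl, ha⟩ := hS.exists_part h.toIsCore
    rw [h.label_eq hQ hε ha hu, h.label_eq hQ hε ha hv]
  · have atom : ∀ {u v : Fin n}, T u → ¬ T v → Q.part u = Q.part v → AtomAdm G K T x N u v := by
      intro u v hu hv he
      obtain ⟨h1, h2⟩ := h.atom_bounds hQ hε hu hv he
      have h3 := h.le_card v hv
      have h4 := h.card_le v hv
      -- The cluster has at least 99/100 of the size x, and 47/98 · 99/100 > 2/5.
      refine ⟨hu, hv, by omega, ?_⟩
      have h5 : (98 : ℝ) * deg G u ≤ 51 * (K.part v).card * (N + 1) := by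
        have := mul_le_mul_of_nonneg_right h2 (by positivity : (0 : ℝ) ≤ N + 1)
        have h6 : (deg G u : ℝ) ≤ (ε * (N + 1)) * deg G u :=
          le_mul_of_one_le_left (by positivity) hεN'
        nlinarith
      have h6 : 98 * deg G u ≤ 51 * (K.part v).card * (N + 1) := by exact_mod_cast h5
      have h7 : 51 * (K.part v).card * (N + 1) ≤ 51 * x v * (N + 1) := by gcongr
      -- For N ≥ 10 one has N + 1 ≤ 11N/10, and 51/98 · 11/10 < 3/5.
      have h8 : x v * 10 ≤ x v * N := Nat.mul_le_mul_left _ hN10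
      have h9 : 51 * x v * (N + 1) = 51 * (x v * N) + 51 * x v := by ring
      have h10 : 3 * N * x v = 3 * (x v * N) := by ring
      omega
    by_cases hu : T u <;> by_cases hv : T v
    · refine Or.inr (hA (Or.inl ⟨⟨huv, hu, hv, hQ.deg_lt hε hN' hu hv huv he,
        hQ.deg_lt hε hN' hv hu huv.symm he.symm⟩, ?_⟩))
      have h1 := h.card_goodCommon_ge hQ hε hN' (by omega) hu hv huv he
      have h2 : ((deg G u : ℝ) + deg G v) ≤ (N + 1) * (goodCommon G T N u v).card := by
        have h3 := mul_le_mul_of_nonneg_left h1 (by positivity : (0 : ℝ) ≤ N + 1)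
        have h4 : ((deg G u : ℝ) + deg G v) ≤ (ε * (N + 1)) * (deg G u + deg G v) :=
          le_mul_of_one_le_left (by positivity) hεN'
        have : (0 : ℝ) ≤ N := by positivity
        nlinarith
      exact_mod_cast h2
    · exact Or.inr (hA (Or.inr (Or.inl (atom hu hv he))))
    · exact Or.inr (hA (Or.inr (Or.inr (atom hv hu he.symm))))
    · have e := h.part_eq_of_label_eq hQ hε hv hu he
      refine Or.inl ⟨K.part v, ⟨K.part_mem.2 (Finset.mem_univ v), fun h1 => huv ?_⟩,
        part_eq_iff.1 e, mem_part_self K v⟩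
      exact Finset.card_le_one.1 h1.le _ (part_eq_iff.1 e) _ (mem_part_self K v)
  -- The excess over the optimum is 2ε times the total degree of `T`, and that degree is at most
  -- twice the cost of `K`.
  · have h1 : (∑ v ∈ Finset.univ.filter T, (deg G v : ℝ)) ≤ 2 * cost G K := by
      exact_mod_cast h.sum_deg_le
    nlinarith
  · have e : Q.part v = S := Q.part_eq_of_mem hS hv
    have e2 : S = Finset.univ.filter fun w => Q.part w = Q.part v := by
      ext w; rw [Finset.mem_filter, part_eq_iff, e]; simp
    by_cases h1 : S.card = 1
    · exact Or.inl h1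
    right
    by_cases hT : T v
    · have h2 : ∃ w, w ≠ v ∧ Q.part w = Q.part v := by
        by_contra hcon
        push Not at hcon
        refine h1 (Finset.card_eq_one.2 ⟨v, ?_⟩)
        ext w
        rw [Finset.mem_singleton]
        refine ⟨fun hw => by_contra fun hne => hcon w hne ?_, fun hw => hw ▸ hv⟩
        rw [part_eq_iff, e]; exact hw
      have h3 := (hQ.deg_le hε hT h2).1
      have h4 : 2 * ε * deg G v + 1 ≤ S.card := by rw [e2]; convert h3
      have : (0 : ℝ) ≤ ε * deg G v := by positivity
      linarith
    -- Outside `T`, the cluster contains the part of `v` in `K`, which is almost as large as the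
    -- closed neighbourhood; this gives deg v < 2|S|, and ε ≤ 1/10 leaves ample room.
    · have h2 : (K.part v).card ≤ S.card := Finset.card_le_card fun w hw => by
        rw [← e, ← part_eq_iff]; exact h.label_eq hQ hε hT hw
      have h3 := h.agree v hT
      have h4 : (nbhd G v).card ≤ (K.part v).card + (nbhd G v ∆ K.part v).card := by
        refine le_trans (Finset.card_le_card (t := K.part v ∪ (nbhd G v ∆ K.part v))
          fun x hx => ?_) (Finset.card_union_le _ _)
        by_cases hxK : x ∈ K.part v <;> simp [Finset.mem_symmDiff, hx, hxK]
      rw [card_nbhd] at h4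
      have h5 : deg G v < 2 * S.card := by omega
      have h6 : (deg G v : ℝ) < 2 * S.card := by exact_mod_cast h5
      have h7 : ε ≤ 1 / 10 := by
        have : (10 : ℝ) ≤ N := by exact_mod_cast hN10
        nlinarith
      nlinarith

theorem SizedCore.good (h : SizedCore G K T x) {C : ℝ} (hC : 10 ≤ C) (hε : 0 < ε)
    (hε' : ε < 1 / 10) (hN : N ≤ 1 / ε) (hN' : 1 / ε - 1 < N) (hN10 : 10 ≤ N)
    (hA : admGraph G K T x N (N + 1) ≤ A) (hA' : A ≤ admGraph G K T x N (2 * N)) :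
    GoodPreclustering C ε G K A := by
  have hN2 : (N : ℝ) ^ 2 ≤ 1 / ε ^ 2 := by
    rw [← one_div_pow]; exact pow_le_pow_left₀ (by positivity) hN 2
  have hdeg : ∀ v, (deg A v : ℝ) ≤ 5 * (1 / ε ^ 2) * deg G v := by
    intro v
    have h1 : (deg A v : ℝ) ≤ 5 * (N : ℝ) ^ 2 * deg G v := by
      exact_mod_cast (deg_mono hA' v).trans (h.deg_admGraph_le hN10 v)
    refine h1.trans (mul_le_mul_of_nonneg_right ?_ (by positivity))
    linarith
  have hC' : 10 * (1 / ε ^ 2) ≤ C / ε ^ 2 := by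
    rw [mul_one_div]; gcongr
  have hp : 0 ≤ 1 / ε ^ 2 := by positivity
  refine ⟨fun S hS => ?_, fun u v ha => ?_, fun v => ?_, fun S hS u hu v hv => ?_, fun S hS => ?_,
    ?_, fun u v ha => h.similar hε hε' hN (hA' ha), h.accepted hε hN hN' hN10 hA⟩
  · by_cases h1 : S.card = 1
    · exact Or.inl h1
    right
    obtain ⟨a, -, rfl, ha⟩ := IsAtomOf.exists_part ⟨hS, h1⟩ h.toIsCore
    intro v hv
    have h2 := h.agree_of_mem ha hv
    have hpos : 0 < (K.part a).card := Finset.card_pos.2 ⟨v, hv⟩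
    have e : closedNbhd G v ∆ (K.part a : Set (Fin n)) =
        ((nbhd G v ∆ K.part a : Finset (Fin n)) : Set (Fin n)) := by
      rw [Finset.coe_symmDiff, coe_nbhd]
    rw [e, Set.ncard_coe_finset]
    have h2' : (49 : ℝ) * (nbhd G v ∆ K.part a).card ≤ (K.part a).card := by exact_mod_cast h2
    have hpos' : (0 : ℝ) < (K.part a).card := by exact_mod_cast hpos
    linarith
  · rcases hA' ha with ha | ha | ha
    · exact Or.inl (h.single u ha.1.2.1)
    · exact Or.inl (h.single u ha.1)
    · exact Or.inr (h.single v ha.1)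
  · refine (hdeg v).trans (mul_le_mul_of_nonneg_right ?_ (by positivity))
    linarith
  · obtain ⟨a, -, rfl, ha⟩ := hS.exists_part h.toIsCore
    rw [h.admNbrs_eq hA hA' ha] at hu
    have hu : AtomAdm G K T x N u a := by simpa [atomNbrs] using hu
    exact hA (Or.inr (Or.inl ((h.atomAdm_congr ha hv).2 hu)))
  · obtain ⟨a, -, rfl, ha⟩ := hS.exists_part h.toIsCore
    rw [h.admNbrs_eq hA hA' ha, Set.ncard_coe_finset]
    have h1 := h.card_atomNbrs_mul_le (N := N) ha
    have h2 : ∑ w ∈ K.part a, ((atomNbrs G K T x N a).filter fun u => G.Adj u w).card ≤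
        ∑ w ∈ K.part a, deg (violation G K) w := by
      refine Finset.sum_le_sum fun w hw => ?_
      rw [deg_eq_card_filter]
      refine Finset.card_le_card fun u hu => ?_
      simp only [Finset.mem_filter, atomNbrs, Finset.mem_univ, true_and] at hu ⊢
      refine violation_adj.2 ⟨hu.2.ne.symm, iff_of_true hu.2.symm fun he => ?_⟩
      refine h.notMem ha (w := u) ?_ hu.1.1
      rw [← part_eq_iff, ← he, part_eq_of_mem hw]
    have hpos : 0 < (K.part a).card := Finset.card_pos.2 ⟨a, mem_part_self K a⟩
    rw [le_div_iff₀ (by exact_mod_cast hpos)]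
    have h3 : (atomNbrs G K T x N a).card * (K.part a).card ≤
        3 * ∑ w ∈ K.part a, deg (violation G K) w := by omega
    exact_mod_cast h3
  · have h1 : 2 * (A.edgeSet.ncard : ℝ) = ∑ u, ∑ v, ind (A.Adj u v) := by
      have := sum_deg A
      simp only [← cast_deg]
      exact_mod_cast this.symm
    -- Each admissible pair is charged to an endpoint in `T`. The degrees in `T` sum to at most
    -- twice the cost of `K`, which is why few pairs are admissible even though degrees are only
    -- bounded relative to those in `G`.
    have h2 : ∑ u, ∑ v, ind (A.Adj u v) ≤
        ∑ u, ∑ v, (ind (T u) * ind (A.Adj u v) + ind (T v) * ind (A.Adj v u)) := by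
      refine Finset.sum_le_sum fun u _ => Finset.sum_le_sum fun v _ => ?_
      by_cases ha : A.Adj u v
      · have : T u ∨ T v := by
          rcases hA' ha with ha | ha | ha
          · exact Or.inl ha.1.2.1
          · exact Or.inl ha.1
          · exact Or.inr ha.1
        rcases this with ht | ht
        · simp only [ha, ht, ha.symm, ind_true, mul_one]
          have := ind_nonneg (T v); linarith
        · simp only [ha, ht, ha.symm, ind_true, mul_one]
          have := ind_nonneg (T u); linarith
      · rw [ind_neg ha]
        have := mul_nonneg (ind_nonneg (T u)) (ind_nonneg (A.Adj u v))
        have := mul_nonneg (ind_nonneg (T v)) (ind_nonneg (A.Adj v u))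
        rw [ind_neg ha] at *
        linarith
    simp only [Finset.sum_add_distrib] at h2
    rw [Finset.sum_comm (f := fun u v => ind (T v) * ind (A.Adj v u))] at h2
    simp only [← Finset.mul_sum, ← cast_deg] at h1 h2
    have h3 : ∑ u, ind (T u) * (deg A u : ℝ) ≤
        ∑ v ∈ Finset.univ.filter T, 5 * (1 / ε ^ 2) * (deg G v : ℝ) := by
      rw [Finset.sum_filter]
      refine Finset.sum_le_sum fun v _ => ?_
      by_cases ht : T v
      · simpa [ht] using hdeg v
      · simp [ht]
    rw [← Finset.mul_sum] at h3
    have h4 : (∑ v ∈ Finset.univ.filter T, (deg G v : ℝ)) ≤ 2 * cost G K := by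
      exact_mod_cast h.sum_deg_le
    have h5 : (A.edgeSet.ncard : ℝ) ≤ 10 * (1 / ε ^ 2) * cost G K := by nlinarith
    exact h5.trans (mul_le_mul_of_nonneg_right hC' (by positivity))

end Good

/-! ### The core of a clustering -/

section Split
open Classical

variable (G : SimpleGraph (Fin n)) (P : Clustering n)

/-- The total number of violations at the vertices of the cluster of `v`. -/
def mass (v : Fin n) : ℕ := ∑ w ∈ P.part v, deg (violation G P) w

/-- The vertices that are split off: those with many violations compared to the size of their
cluster, and those of clusters with many violations. -/
def Loose (v : Fin n) : Prop :=
  (P.part v).card < 100 * deg (violation G P) v ∨ (P.part v).card ^ 2 < 10000 * mass G P v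

def coreLabel (v : Fin n) : Fin n ⊕ Finset (Fin n) :=
  if Loose G P v then Sum.inl v else Sum.inr (P.part v)

def coreClustering : Clustering n := ofLabel (coreLabel G P)

variable {G P}

theorem mass_congr {v w : Fin n} (h : P.part w = P.part v) : mass G P w = mass G P v := by
  rw [mass, mass, h]

theorem mem_coreClustering {v w : Fin n} : w ∈ (coreClustering G P).part v ↔
    w = v ∨ ¬ Loose G P w ∧ ¬ Loose G P v ∧ P.part w = P.part v := by
  rw [coreClustering, mem_part_ofLabel]
  by_cases hv : Loose G P v <;> by_cases hw : Loose G P w <;> simp [coreLabel, hv, hw]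
  · rintro rfl; exact hw hv
  · rintro rfl; exact hv hw
  · rintro rfl; rfl

theorem nbhd_symmDiff_part (v : Fin n) :
    (nbhd G v ∆ P.part v).card = deg (violation G P) v := by
  rw [deg_eq_card_filter]
  congr 1; ext w
  simp only [Finset.mem_symmDiff, mem_nbhd, Finset.mem_filter, Finset.mem_univ, true_and,
    violation_adj]
  have h1 : w ∈ P.part v ↔ P.part v = P.part w := by rw [← part_eq_iff, eq_comm]
  by_cases hw : w = v
  · subst hw; simp
  · rw [h1]
    have := Ne.symm hw
    tauto

/-- The second condition of `Loose` depends only on the cluster, so it fails in the whole cluster of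
`v`. Every loose vertex there has more than |P|/100 violations, and all violations sum to at most
|P|²/10000. -/
theorem card_filter_loose_le {v : Fin n} (hv : ¬ Loose G P v) :
    100 * ((P.part v).filter (Loose G P)).card ≤ (P.part v).card := by
  have h1 : ((P.part v).filter (Loose G P)).card * (P.part v).card ≤ 100 * mass G P v := by
    rw [mass, Finset.mul_sum, ← smul_eq_mul]
    refine le_trans (Finset.card_nsmul_le_sum _ (fun w => 100 * deg (violation G P) w) _
      fun w hw => ?_) (Finset.sum_le_sum_of_subset (Finset.filter_subset _ _))
    obtain ⟨hw, hl⟩ := Finset.mem_filter.1 hw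
    have e := part_eq_of_mem hw
    rcases hl with hl | hl
    · rw [e] at hl; exact hl.le
    · rw [mass_congr e, e] at hl
      exact absurd (Or.inr hl) hv
  have h2 : 10000 * mass G P v ≤ (P.part v).card ^ 2 := by
    by_contra hcon; exact hv (Or.inr (by omega))
  have hpos : 0 < (P.part v).card := Finset.card_pos.2 ⟨v, mem_part_self P v⟩
  refine Nat.le_of_mul_le_mul_right (c := (P.part v).card) ?_ hpos
  nlinarith

theorem part_coreClustering {v : Fin n} (hv : ¬ Loose G P v) :
    (coreClustering G P).part v = (P.part v).filter fun w => ¬ Loose G P w := by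
  ext w
  rw [mem_coreClustering, Finset.mem_filter, part_eq_iff]
  constructor
  · rintro (rfl | h)
    · exact ⟨mem_part_self P w, hv⟩
    · exact ⟨h.2.2, h.1⟩
  · exact fun h => Or.inr ⟨h.2, hv, h.1⟩

/-- The sizes are those of the input clusters, of which at most 1/100 is removed. The neighbourhood
difference is at most 1/100 by violations and 1/100 by removed vertices, and 2/100 compared with the
remaining 99/100 is less than 1/49. -/
theorem sizedCore (G : SimpleGraph (Fin n)) (P : Clustering n) :
    SizedCore G (coreClustering G P) (Loose G P) fun v => (P.part v).card := by
  have split : ∀ v, ((P.part v).filter (Loose G P)).card +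
      ((P.part v).filter fun w => ¬ Loose G P w).card = (P.part v).card :=
    fun v => Finset.card_filter_add_card_filter_not _
  refine ⟨⟨fun v hv => ?_, fun v hv => ?_⟩, fun v hv => ?_, fun v hv => ?_, fun v hv w hw => ?_⟩
  · ext w; rw [mem_coreClustering]; simp [hv]
  · rw [part_coreClustering hv]
    have h1 := card_filter_loose_le hv
    have h2 : 100 * deg (violation G P) v ≤ (P.part v).card := by
      by_contra hcon; exact hv (Or.inl (by omega))
    have h3 : (nbhd G v ∆ ((P.part v).filter fun w => ¬ Loose G P w)).card ≤
        deg (violation G P) v + ((P.part v).filter (Loose G P)).card := by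
      rw [← nbhd_symmDiff_part]
      refine le_trans (Finset.card_le_card fun w hw => ?_) (Finset.card_union_le _ _)
      simp only [Finset.mem_symmDiff, Finset.mem_filter, Finset.mem_union] at hw ⊢
      by_cases a : w ∈ nbhd G v <;> by_cases b : w ∈ P.part v <;> by_cases c : Loose G P w <;>
        simp [a, b, c] at hw ⊢
    have := split v
    omega
  · rw [part_coreClustering hv]
    exact Finset.card_le_card (Finset.filter_subset _ _)
  · rw [part_coreClustering hv]
    have h1 := card_filter_loose_le hv
    have := split v
    omega
  · rcases mem_coreClustering.1 hw with rfl | h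
    · rfl
    · simp only [h.2.2]

/-- Every vertex w passes on its violations in equal shares to the members of its cluster, so after
exchanging the sums each w counts exactly its violations. -/
theorem sum_mass_div (G : SimpleGraph (Fin n)) (P : Clustering n) :
    ∑ v, (mass G P v : ℝ) / (P.part v).card = 2 * cost G P := by
  have h1 : ∀ v, (mass G P v : ℝ) / (P.part v).card =
      ∑ w, ind (w ∈ P.part v) * deg (violation G P) w / (P.part w).card := by
    intro v
    rw [mass, Nat.cast_sum, Finset.sum_div, ← Finset.sum_filter_add_sum_filter_not Finset.univ
      (· ∈ P.part v) (fun w => ind (w ∈ P.part v) * (deg (violation G P) w : ℝ) / (P.part w).card)]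
    rw [Finset.sum_eq_zero (s := Finset.univ.filter (¬ · ∈ P.part v)), add_zero]
    · refine Finset.sum_congr (by ext; simp) fun w hw => ?_
      have hw : w ∈ P.part v := by simpa using hw
      rw [ind_pos hw, part_eq_of_mem hw, one_mul]
    · intro w hw
      have hw : w ∉ P.part v := by simpa using hw
      simp [hw]
  have h2 : 2 * (cost G P : ℝ) = ∑ v, (deg (violation G P) v : ℝ) := by
    have := sum_deg (violation G P)
    rw [cost]; exact_mod_cast this.symm
  rw [Finset.sum_congr rfl fun v _ => h1 v, Finset.sum_comm, h2]
  refine Finset.sum_congr rfl fun w _ => ?_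
  rw [← Finset.sum_div, ← Finset.sum_mul, sum_ind (P.part w)
    (fun v => by rw [← part_eq_iff, ← part_eq_iff, eq_comm])]
  have hpos : 0 < (P.part w).card := Finset.card_pos.2 ⟨w, mem_part_self P w⟩
  field_simp

/-- The total size of the clusters of loose vertices is linear in the number of violations. -/
theorem sum_card_loose_le (G : SimpleGraph (Fin n)) (P : Clustering n) :
    ∑ v ∈ Finset.univ.filter (Loose G P), (P.part v).card ≤ 20200 * cost G P := by
  -- Either reason for being loose pays for the cluster size by one of the two terms. Over all
  -- vertices both the violations and the averages mass/|P| sum to 2 cost, whence 2 · (100 + 10000)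
  -- = 20200.
  have h1 : ∀ v ∈ Finset.univ.filter (Loose G P), ((P.part v).card : ℝ) ≤
      100 * deg (violation G P) v + 10000 * (mass G P v / (P.part v).card) := by
    intro v hv
    have hv : Loose G P v := by simpa using hv
    have hpos : 0 < (P.part v).card := Finset.card_pos.2 ⟨v, mem_part_self P v⟩
    have hpos' : (0 : ℝ) < (P.part v).card := by exact_mod_cast hpos
    rcases hv with hv | hv
    · have : ((P.part v).card : ℝ) < 100 * deg (violation G P) v := by exact_mod_cast hv
      have : (0 : ℝ) ≤ mass G P v / (P.part v).card := by positivity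
      linarith
    · have h2 : ((P.part v).card : ℝ) ^ 2 < 10000 * mass G P v := by exact_mod_cast hv
      have h3 : ((P.part v).card : ℝ) ≤ 10000 * (mass G P v / (P.part v).card) := by
        rw [← mul_div_assoc, le_div_iff₀ hpos']; nlinarith
      have : (0 : ℝ) ≤ deg (violation G P) v := by positivity
      linarith
  have h2 : ∑ v ∈ Finset.univ.filter (Loose G P), ((P.part v).card : ℝ) ≤
      ∑ v, (100 * (deg (violation G P) v : ℝ) + 10000 * (mass G P v / (P.part v).card)) :=
    (Finset.sum_le_sum h1).trans (Finset.sum_le_univ_sum_of_nonneg fun v => by positivity)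
  rw [Finset.sum_add_distrib, ← Finset.mul_sum, ← Finset.mul_sum, sum_mass_div] at h2
  have h3 : 2 * (cost G P : ℝ) = ∑ v, (deg (violation G P) v : ℝ) := by
    have := sum_deg (violation G P)
    rw [cost]; exact_mod_cast this.symm
  have h4 : ∑ v ∈ Finset.univ.filter (Loose G P), ((P.part v).card : ℝ) ≤ 20200 * cost G P := by
    linarith
  exact_mod_cast h4

/-- The new violations are pairs inside an input cluster with a loose endpoint, and these are
counted by `sum_card_loose_le`. -/
theorem cost_coreClustering_le (G : SimpleGraph (Fin n)) (P : Clustering n) :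
    cost G (coreClustering G P) ≤ 20201 * cost G P := by
  have h1 : ∑ u, ∑ v, ind ((violation G (coreClustering G P)).Adj u v) ≤
      ∑ u, ∑ v, (ind ((violation G P).Adj u v) + (ind (Loose G P u) * ind (v ∈ P.part u) +
        ind (Loose G P v) * ind (u ∈ P.part v))) := by
    refine Finset.sum_le_sum fun u _ => Finset.sum_le_sum fun v _ => ?_
    have n1 := mul_nonneg (ind_nonneg (Loose G P u)) (ind_nonneg (v ∈ P.part u))
    have n2 := mul_nonneg (ind_nonneg (Loose G P v)) (ind_nonneg (u ∈ P.part v))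
    have n3 := ind_nonneg ((violation G P).Adj u v)
    by_cases h : (violation G (coreClustering G P)).Adj u v
    · rw [ind_pos h]
      by_cases hp : P.part u = P.part v
      · have m1 : v ∈ P.part u := part_eq_iff.1 hp.symm
        have m2 : u ∈ P.part v := part_eq_iff.1 hp
        by_cases hu : Loose G P u
        · rw [ind_pos hu, ind_pos m1] at *; linarith
        by_cases hv : Loose G P v
        · rw [ind_pos hv, ind_pos m2] at *; linarith
        have : (violation G P).Adj u v := by
          rw [violation_adj] at h ⊢
          simp only [ne_eq, part_eq_iff (K := coreClustering G P), mem_coreClustering] at h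
          have := h.1
          tauto
        rw [ind_pos this]; linarith
      · have : (violation G P).Adj u v := by
          rw [violation_adj] at h ⊢
          simp only [ne_eq, part_eq_iff (K := coreClustering G P), mem_coreClustering] at h
          have := h.1
          tauto
        rw [ind_pos this]; linarith
    · rw [ind_neg h]; linarith
  simp only [Finset.sum_add_distrib] at h1
  rw [Finset.sum_comm (f := fun u v => ind (Loose G P v) * ind (u ∈ P.part v))] at h1
  simp only [← Finset.mul_sum, ← cast_deg] at h1
  have h2 : ∑ u, ind (Loose G P u) * ∑ v, ind (v ∈ P.part u) =
      ∑ v ∈ Finset.univ.filter (Loose G P), ((P.part v).card : ℝ) := by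
    rw [Finset.sum_filter]
    refine Finset.sum_congr rfl fun u _ => ?_
    rw [sum_ind (P.part u) (by simp)]
    by_cases hu : Loose G P u <;> simp [hu]
  have h3 : ∑ v ∈ Finset.univ.filter (Loose G P), ((P.part v).card : ℝ) ≤ 20200 * cost G P := by
    exact_mod_cast sum_card_loose_le G P
  have h4 : ∀ P : Clustering n, 2 * (cost G P : ℝ) = ∑ v, (deg (violation G P) v : ℝ) := by
    intro P
    have := sum_deg (violation G P)
    rw [cost]; exact_mod_cast this.symm
  rw [h2, ← h4, ← h4] at h1
  have h5 : (cost G (coreClustering G P) : ℝ) ≤ 20201 * cost G P := by linarith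
  exact_mod_cast h5

end Split

end

/-! ### Randomness: Hoeffding bounds, and the error of the two randomized queries -/

section

variable {n : ℕ}

/-! ### Concentration of the random samples -/

section Random
open ProbabilityTheory

instance : IsProbabilityMeasure rndMeasure := by unfold rndMeasure; infer_instance

/-- Samples with a fixed range are distinct coordinates of the product measure. -/
theorem iIndepFun_samples (d : ℕ) :
    iIndepFun (fun (i : ℕ) (ω : Rnd) => ω (i, d)) rndMeasure := by
  have h := iIndepFun_infinitePi (P := fun p : ℕ × ℕ =>
    (PMF.uniformOfFintype (Fin (p.2 + 1))).toMeasure) (X := fun p ω => ω) (by fun_prop)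
  exact h.precomp (g := fun i : ℕ => (i, d)) fun _ _ h => (Prod.ext_iff.1 h).1

theorem integral_sample (d i : ℕ) (F : Fin (d + 1) → ℝ) :
    ∫ ω, F (ω (i, d)) ∂rndMeasure = (∑ a, F a) / (d + 1) := by
  have h := measurePreserving_eval_infinitePi (fun p : ℕ × ℕ =>
    (PMF.uniformOfFintype (Fin (p.2 + 1))).toMeasure) (i, d)
  have h2 := integral_map (μ := rndMeasure) (φ := fun ω : Rnd => ω (i, d)) (f := F)
    (measurable_pi_apply _).aemeasurable (by fun_prop)
  rw [← h2]
  have h3 : Measure.map (fun ω : Rnd => ω (i, d)) rndMeasure =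
    (PMF.uniformOfFintype (Fin (d + 1))).toMeasure := h.map_eq
  rw [h3, PMF.integral_eq_sum]
  have h4 : ((d : ENNReal) + 1).toReal = d + 1 := by
    rw [ENNReal.toReal_add (by simp) (by simp)]; simp
  simp [PMF.uniformOfFintype_apply, div_eq_inv_mul, ← Finset.mul_sum, h4]

/-- Hoeffding: a centred variable with values in an interval of length 1 is sub-Gaussian with
parameter 1/4, and the parameters of independent samples add. -/
theorem samples_tail (d m : ℕ) (F : Fin (d + 1) → ℝ) {a : ℝ} (hF : ∀ x, F x ∈ Set.Icc a (a + 1))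
    {δ : ℝ} (hδ : 0 ≤ δ) :
    rndMeasure {ω | δ * m ≤ ∑ i ∈ Finset.range m, (F (ω (i, d)) - (∑ x, F x) / (d + 1))} ≤
      ENNReal.ofReal (Real.exp (-(2 * δ ^ 2 * m))) := by
  have hX : ∀ i, HasSubgaussianMGF (fun ω : Rnd => F (ω (i, d)) - (∑ x, F x) / (d + 1))
      ((‖(a + 1) - a‖₊ / 2) ^ 2) rndMeasure := by
    intro i
    have hm : Measurable (fun ω : Rnd => F (ω (i, d))) :=
      (measurable_of_finite F).comp
        (measurable_pi_apply (X := fun p : ℕ × ℕ => Fin (p.2 + 1)) (i, d))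
    have := hasSubgaussianMGF_of_mem_Icc (μ := rndMeasure) (X := fun ω : Rnd => F (ω (i, d)))
      (a := a) (b := a + 1)
      hm.aemeasurable (Filter.Eventually.of_forall fun ω => hF _)
    rwa [integral_sample] at this
  have hind : iIndepFun (fun (i : ℕ) (ω : Rnd) => F (ω (i, d)) - (∑ x, F x) / (d + 1))
      rndMeasure :=
    (iIndepFun_samples d).comp (fun _ x => F x - (∑ x, F x) / (d + 1)) fun _ => by fun_prop
  have h := HasSubgaussianMGF.measure_sum_range_ge_le_of_iIndepFun hind (n := m)
    (fun i _ => hX i) (ε := δ * m) (by positivity)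
  rw [← ofReal_measureReal]
  refine ENNReal.ofReal_le_ofReal (h.trans (Real.exp_le_exp.2 ?_))
  rcases Nat.eq_zero_or_pos m with rfl | hm
  · simp
  · have : (0 : ℝ) < m := by exact_mod_cast hm
    simp only [add_sub_cancel_left, nnnorm_one]
    push_cast
    refine le_of_eq ?_
    field_simp

/-- The number of samples among the first `m` with range `{0, …, d}` that lie in `S`. -/
def hits (d m : ℕ) (S : Fin (d + 1) → Prop) (ω : Rnd) : ℕ :=
  open Classical in ((Finset.range m).filter fun i => S (ω (i, d))).card

open Classical in
theorem cast_hits (d m : ℕ) (S : Fin (d + 1) → Prop) (ω : Rnd) :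
    (hits d m S ω : ℝ) = ∑ i ∈ Finset.range m, ind (S (ω (i, d))) := by
  simp [hits, ind]

-- The lower tail is the upper tail of the negated indicators, whose values lie in [-1, 0].
open Classical in
theorem hits_lower (d m : ℕ) (S : Fin (d + 1) → Prop) {δ : ℝ} (hδ : 0 ≤ δ) :
    rndMeasure {ω | (hits d m S ω : ℝ) ≤
      (((Finset.univ.filter S).card : ℝ) / (d + 1) - δ) * m} ≤
      ENNReal.ofReal (Real.exp (-(2 * δ ^ 2 * m))) := by
  refine le_trans (measure_mono fun ω hω => ?_) (samples_tail d m (fun x => -ind (S x)) (a := -1)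
    (fun x => ⟨by have := ind_le_one (S x); linarith, by have := ind_nonneg (S x); linarith⟩) hδ)
  simp only [Set.mem_ofPred_eq, Finset.sum_sub_distrib, Finset.sum_neg_distrib, ← cast_hits,
    Finset.sum_const, Finset.card_range, nsmul_eq_mul] at hω ⊢
  rw [sum_ind (Finset.univ.filter S) (by simp)]
  have : -((Finset.univ.filter S).card : ℝ) / ((d : ℝ) + 1) =
    -(((Finset.univ.filter S).card : ℝ) / (d + 1)) := by ring
  rw [this]
  linarith

open Classical in
theorem hits_upper (d m : ℕ) (S : Fin (d + 1) → Prop) {δ : ℝ} (hδ : 0 ≤ δ) :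
    rndMeasure {ω | (((Finset.univ.filter S).card : ℝ) / (d + 1) + δ) * m ≤ (hits d m S ω : ℝ)} ≤
      ENNReal.ofReal (Real.exp (-(2 * δ ^ 2 * m))) := by
  refine le_trans (measure_mono fun ω hω => ?_) (samples_tail d m (fun x => ind (S x)) (a := 0)
    (fun x => ⟨ind_nonneg _, by have := ind_le_one (S x); linarith⟩) hδ)
  simp only [Set.mem_ofPred_eq, Finset.sum_sub_distrib, ← cast_hits,
    Finset.sum_const, Finset.card_range, nsmul_eq_mul] at hω ⊢
  rw [sum_ind (Finset.univ.filter S) (by simp)]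
  linarith

end Random

end

section

variable {n : ℕ}

/-! ### Sampling common neighbours -/

section Sampling
open Classical

variable (G : SimpleGraph (Fin n)) (K : Clustering n) (T : Fin n → Prop) (x : Fin n → ℕ) (N : ℕ)
  (L : Fin n → List (Fin n)) (m : ℕ)

/-- The sample `i` from the list `L a` lies in `S`. -/
def SampleIn (a : Fin n) (S : Finset (Fin n)) (i : Fin (deg G a + 1)) : Prop :=
  ∃ w ∈ S, (L a)[(i : ℕ)]? = some w

/-- The number of samples from `L a` that are good common neighbours of `a` and `b`. -/
def commonHits (a b : Fin n) (ω : Rnd) : ℕ :=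
  hits (deg G a) m (SampleIn G L a (goodCommon G T N a b)) ω

/-- The common neighbourhood is estimated by the fraction of hits times deg a + 1 and compared with
2/(3N) of the degree sum. This threshold lies strictly between 1/(2N) and 1/(N+1) for N > 2. -/
def SampleTest (a b : Fin n) (ω : Rnd) : Prop :=
  2 * (deg G a + deg G b) * m ≤ 3 * N * (commonHits G T N L m a b ω * (deg G a + 1))

/-- The test for a pair of vertices in `T`. -/
def PairTest (u v : Fin n) (ω : Rnd) : Prop :=
  PairSim G T N u v ∧ SampleTest G T N L m (min u v) (max u v) ω

/-- The random graph of admissible pairs. -/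
def rndAdm (ω : Rnd) : SimpleGraph (Fin n) where
  Adj u v := (admGraph G K T x N (N + 1)).Adj u v ∨
    (admGraph G K T x N (2 * N)).Adj u v ∧ PairTest G T N L m u v ω
  symm := ⟨fun u v h => h.imp (fun h => h.symm) fun h =>
    ⟨h.1.symm, h.2.1.symm, by rw [min_comm, max_comm]; exact h.2.2⟩⟩
  loopless := ⟨fun _ h => h.elim (fun h => h.ne rfl) fun h => h.1.ne rfl⟩

/-- The answer of the test for an arbitrary pair. -/
def Answer (u v : Fin n) (ω : Rnd) : Prop :=
  PairTest G T N L m u v ω ∨ AtomAdm G K T x N u v ∨ AtomAdm G K T x N v u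

/-- The neighbours of `v` that are found. -/
def Found (v : Fin n) (ω : Rnd) (u : Fin n) : Prop :=
  AtomAdm G K T x N v u ∨ PairTest G T N L m u v ω ∧ ∃ i < m, ∃ w,
    (L v)[(ω (i, deg G v) : ℕ)]? = some w ∧ tcard G T w ≤ N * deg G v ∧ u ∈ nbhd G w

variable {G K T x N L m}

/-- The list of every vertex of `T` is its closed neighbourhood. -/
def ListsNbhd (G : SimpleGraph (Fin n)) (T : Fin n → Prop) (L : Fin n → List (Fin n)) : Prop :=
  ∀ v, T v → (L v).Nodup ∧ ∀ w, w ∈ L v ↔ w ∈ nbhd G v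

theorem ListsNbhd.length_eq (hL : ListsNbhd G T L) {v : Fin n} (hv : T v) :
    (L v).length = deg G v + 1 := by
  rw [← card_nbhd, ← List.toFinset_card_of_nodup (hL v hv).1]
  congr 1; ext w; simp [(hL v hv).2 w]

theorem ListsNbhd.card_sampleIn (hL : ListsNbhd G T L) {a : Fin n} (ha : T a)
    {S : Finset (Fin n)} (hS : S ⊆ nbhd G a) :
    (Finset.univ.filter (SampleIn G L a S)).card = S.card := by
  have hlen := hL.length_eq ha
  have hlt : ∀ i : Fin (deg G a + 1), (i : ℕ) < (L a).length := fun i => by rw [hlen]; exact i.2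
  refine Finset.card_bij (fun i _ => (L a)[(i : ℕ)]'(hlt i)) ?_ ?_ ?_
  · intro i hi
    obtain ⟨w, hw, he⟩ : SampleIn G L a S i := by simpa using hi
    rw [List.getElem?_eq_getElem (hlt i), Option.some.injEq] at he
    rwa [he]
  · intro i _ j _ hij
    exact Fin.ext ((hL a ha).1.getElem_inj_iff.1 hij)
  · intro w hw
    obtain ⟨i, hi, he⟩ := List.getElem_of_mem (((hL a ha).2 w).2 (hS hw))
    refine ⟨⟨i, by rw [← hlen]; exact hi⟩, ?_, he⟩
    simp only [Finset.mem_filter, Finset.mem_univ, true_and]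
    exact ⟨w, hw, by simp [List.getElem?_eq_getElem hi, he]⟩

theorem goodCommon_subset (u v : Fin n) : goodCommon G T N u v ⊆ nbhd G u :=
  Finset.filter_subset _ _

/-- Hits measure common neighbours relative to deg a + 1, thresholds are relative to the degree sum.
This ratio, called `r` below, turns a gap between thresholds into an absolute gap between hit
fractions. -/
theorem half_le {a b : ℕ} (ha : 0 < a) : (1 : ℝ) / 2 ≤ (a + b) / (a + 1) := by
  have : (1 : ℝ) ≤ a := by exact_mod_cast ha
  rw [le_div_iff₀ (by positivity)]
  have : (0 : ℝ) ≤ b := by positivity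
  linarith

theorem exp_gap (hN : 0 < N) :
    Real.exp (-(2 * (1 / (12 * (N : ℝ))) ^ 2 * m)) = Real.exp (-(m / (72 * (N : ℝ) ^ 2))) := by
  congr 2; field_simp; ring

/-- The expected fraction of hits is at least r/(N+1), while the test demands 2r/(3N). The
difference is at least 1/(12N), which is the deviation in Hoeffding's bound. -/
theorem measure_not_sampleTest_le (hL : ListsNbhd G T L) (hN : 10 ≤ N) {a b : Fin n} (ha : T a)
    (hd : 0 < deg G a) (h : deg G a + deg G b ≤ (N + 1) * (goodCommon G T N a b).card) :
    rndMeasure {ω | ¬ SampleTest G T N L m a b ω} ≤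
      ENNReal.ofReal (Real.exp (-(m / (72 * (N : ℝ) ^ 2)))) := by
  have hN0 : (10 : ℝ) ≤ N := by exact_mod_cast hN
  rw [← exp_gap (by omega)]
  refine le_trans (measure_mono fun ω hω => ?_) (hits_lower (deg G a) m
    (SampleIn G L a (goodCommon G T N a b)) (by positivity))
  simp only [Set.mem_ofPred_eq, SampleTest, not_le] at hω ⊢
  rw [hL.card_sampleIn ha (goodCommon_subset a b)]
  have h1 : (3 : ℝ) * N * (commonHits G T N L m a b ω * (deg G a + 1)) <
      2 * (deg G a + deg G b) * m := by exact_mod_cast hω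
  have h2 : ((deg G a : ℝ) + deg G b) ≤ (N + 1) * (goodCommon G T N a b).card := by
    exact_mod_cast h
  have h3 := half_le (b := deg G b) hd
  set r : ℝ := ((deg G a : ℝ) + deg G b) / (deg G a + 1) with hr
  have hd' : (0 : ℝ) < (deg G a : ℝ) + 1 := by positivity
  have h4 : (commonHits G T N L m a b ω : ℝ) ≤ 2 / (3 * N) * r * m := by
    rw [hr, show 2 / (3 * (N : ℝ)) * (((deg G a : ℝ) + deg G b) / (deg G a + 1)) * m =
      (2 * (deg G a + deg G b) * m) / (3 * N * (deg G a + 1)) by field_simp,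
      le_div_iff₀ (by positivity)]
    linarith
  have h5 : r / (N + 1) ≤ (goodCommon G T N a b).card / ((deg G a : ℝ) + 1) := by
    rw [hr, div_div, mul_comm, ← div_div, div_le_div_iff_of_pos_right hd',
      div_le_iff₀ (by positivity)]
    linarith
  have h6 : 2 / (3 * (N : ℝ)) * r ≤ r / (N + 1) - 1 / (12 * N) := by
    have e : r / (N + 1) - 2 / (3 * (N : ℝ)) * r = r * ((N - 2) / (3 * N * (N + 1))) := by
      field_simp; ring
    -- This amounts to N + 1 ≤ 2(N - 2), which holds for N ≥ 5.
    have e2 : (1 : ℝ) / (6 * N) ≤ (N - 2) / (3 * N * (N + 1)) := by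
      rw [div_le_div_iff₀ (by positivity) (by positivity)]; nlinarith
    have e3 : (1 : ℝ) / (12 * N) = 1 / 2 * (1 / (6 * N)) := by field_simp; norm_num
    have e4 : (1 : ℝ) / 2 * (1 / (6 * N)) ≤ r * ((N - 2) / (3 * N * (N + 1))) :=
      mul_le_mul h3 e2 (by positivity) (by linarith)
    linarith
  refine h4.trans (mul_le_mul_of_nonneg_right ?_ (by positivity))
  linarith

/-- The other side of the gap: the expected fraction is at most r/(2N), and 2/3 - 1/2 = 1/6 together
with r ≥ 1/2 gives the same deviation 1/(12N). -/
theorem measure_sampleTest_le (hL : ListsNbhd G T L) (hN : 10 ≤ N) {a b : Fin n} (ha : T a)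
    (hd : 0 < deg G a) (h : 2 * N * (goodCommon G T N a b).card < deg G a + deg G b) :
    rndMeasure {ω | SampleTest G T N L m a b ω} ≤
      ENNReal.ofReal (Real.exp (-(m / (72 * (N : ℝ) ^ 2)))) := by
  have hN0 : (10 : ℝ) ≤ N := by exact_mod_cast hN
  rw [← exp_gap (by omega)]
  refine le_trans (measure_mono fun ω hω => ?_) (hits_upper (deg G a) m
    (SampleIn G L a (goodCommon G T N a b)) (by positivity))
  simp only [Set.mem_ofPred_eq, SampleTest] at hω ⊢
  rw [hL.card_sampleIn ha (goodCommon_subset a b)]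
  have h1 : 2 * ((deg G a : ℝ) + deg G b) * m ≤
      3 * N * (commonHits G T N L m a b ω * (deg G a + 1)) := by exact_mod_cast hω
  have h2 : 2 * (N : ℝ) * (goodCommon G T N a b).card ≤ ((deg G a : ℝ) + deg G b) := by
    exact_mod_cast h.le
  have h3 := half_le (b := deg G b) hd
  set r : ℝ := ((deg G a : ℝ) + deg G b) / (deg G a + 1) with hr
  have hd' : (0 : ℝ) < (deg G a : ℝ) + 1 := by positivity
  have h4 : 2 / (3 * N) * r * m ≤ (commonHits G T N L m a b ω : ℝ) := by
    rw [hr, show 2 / (3 * (N : ℝ)) * (((deg G a : ℝ) + deg G b) / (deg G a + 1)) * m =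
      (2 * (deg G a + deg G b) * m) / (3 * N * (deg G a + 1)) by field_simp,
      div_le_iff₀ (by positivity)]
    linarith
  have h5 : (goodCommon G T N a b).card / ((deg G a : ℝ) + 1) ≤ r / (2 * N) := by
    rw [hr, div_div, mul_comm, ← div_div, div_le_div_iff_of_pos_right hd',
      le_div_iff₀ (by positivity)]
    linarith
  have h6 : r / (2 * N) + 1 / (12 * N) ≤ 2 / (3 * (N : ℝ)) * r := by
    have e : 2 / (3 * (N : ℝ)) * r - r / (2 * N) = r * (1 / (6 * N)) := by field_simp; norm_num
    have e3 : (1 : ℝ) / (12 * N) = 1 / 2 * (1 / (6 * N)) := by field_simp; norm_num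
    have e4 : (1 : ℝ) / 2 * (1 / (6 * N)) ≤ r * (1 / (6 * N)) :=
      mul_le_mul_of_nonneg_right h3 (by positivity)
    linarith
  refine le_trans (mul_le_mul_of_nonneg_right ?_ (by positivity)) h4
  linarith

/-- Even with the weaker threshold, the good common neighbours are at least 1/(4N) of the closed
neighbourhood, so having no hit at all is a deviation of more than 1/(12N). -/
theorem measure_no_hit_le (hL : ListsNbhd G T L) (hN : 10 ≤ N) {a b : Fin n} (ha : T a)
    (hd : 0 < deg G a) (h : deg G a + deg G b ≤ 2 * N * (goodCommon G T N a b).card) :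
    rndMeasure {ω | commonHits G T N L m a b ω = 0} ≤
      ENNReal.ofReal (Real.exp (-(m / (72 * (N : ℝ) ^ 2)))) := by
  have hN0 : (10 : ℝ) ≤ N := by exact_mod_cast hN
  rw [← exp_gap (by omega)]
  refine le_trans (measure_mono fun ω hω => ?_) (hits_lower (deg G a) m
    (SampleIn G L a (goodCommon G T N a b)) (by positivity))
  have hω : commonHits G T N L m a b ω = 0 := hω
  simp only [Set.mem_ofPred_eq]
  rw [hL.card_sampleIn ha (goodCommon_subset a b)]
  unfold commonHits at hω
  rw [hω, Nat.cast_zero]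
  refine mul_nonneg ?_ (by positivity)
  have h2 : ((deg G a : ℝ) + deg G b) ≤ 2 * N * (goodCommon G T N a b).card := by
    exact_mod_cast h
  have h3 := half_le (b := deg G b) hd
  have hd' : (0 : ℝ) < (deg G a : ℝ) + 1 := by positivity
  have h5 : ((deg G a : ℝ) + deg G b) / (deg G a + 1) / (2 * N) ≤
      (goodCommon G T N a b).card / ((deg G a : ℝ) + 1) := by
    rw [div_div, mul_comm, ← div_div, div_le_div_iff_of_pos_right hd',
      div_le_iff₀ (by positivity)]
    linarith
  have h6 : (1 : ℝ) / 2 / (2 * N) ≤ ((deg G a : ℝ) + deg G b) / (deg G a + 1) / (2 * N) := by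
    gcongr
  have h7 : (1 : ℝ) / (12 * N) ≤ 1 / 2 / (2 * N) := by
    rw [div_div, div_le_div_iff₀ (by positivity) (by positivity)]; linarith
  linarith

theorem le_rndAdm (ω : Rnd) : admGraph G K T x N (N + 1) ≤ rndAdm G K T x N L m ω :=
  fun _ _ h => Or.inl h

theorem rndAdm_le (hN : 1 ≤ N) (ω : Rnd) : rndAdm G K T x N L m ω ≤ admGraph G K T x N (2 * N) :=
  fun _ _ h => h.elim (fun h => admGraph_mono (by omega) h) fun h => h.1

theorem PairSim.deg_pos {u v : Fin n} (h : PairSim G T N u v) : 0 < deg G u ∧ 0 < deg G v := by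
  have h1 := h.2.2.2.1
  have h2 := h.2.2.2.2
  constructor <;> by_contra h0 <;> simp only [not_lt, Nat.le_zero] at h0 <;> simp [h0] at h1 h2

/-- Between the thresholds the random graph is defined by the test, so no error is possible there.
Beyond them, an error means that the test is on the wrong side of the gap. Taking the samples always
from the list of the smaller vertex makes the test independent of the order of the pair. -/
theorem measure_answer_ne_le (hL : ListsNbhd G T L) (hN : 10 ≤ N) (u v : Fin n) :
    rndMeasure {ω | ¬ ((rndAdm G K T x N L m ω).Adj u v ↔ Answer G K T x N L m u v ω)} ≤
      ENNReal.ofReal (Real.exp (-(m / (72 * (N : ℝ) ^ 2)))) := by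
  by_cases hat : AtomAdm G K T x N u v ∨ AtomAdm G K T x N v u
  · refine le_trans (le_of_eq ?_) (zero_le)
    convert measure_empty (μ := rndMeasure)
    refine Set.eq_empty_of_forall_notMem fun ω hω => hω ?_
    exact iff_of_true (Or.inl (Or.inr hat)) (Or.inr hat)
  by_cases hs : PairSim G T N u v
  swap
  · refine le_trans (le_of_eq ?_) (zero_le)
    convert measure_empty (μ := rndMeasure)
    refine Set.eq_empty_of_forall_notMem fun ω hω => hω ?_
    refine iff_of_false ?_ ?_
    · rintro ((h | h) | h)
      · exact hs h.1
      · exact hat h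
      · exact hs h.2.1
    · rintro (h | h)
      · exact hs h.1
      · exact hat h
  have hadm : ∀ k, (admGraph G K T x N k).Adj u v ↔
      deg G u + deg G v ≤ k * (goodCommon G T N u v).card := fun k =>
    ⟨fun h => h.elim (fun h => h.2) fun h => absurd h hat, fun h => Or.inl ⟨hs, h⟩⟩
  have hsum : deg G (min u v) + deg G (max u v) = deg G u + deg G v ∧
      goodCommon G T N (min u v) (max u v) = goodCommon G T N u v ∧ T (min u v) ∧
      0 < deg G (min u v) := by
    rcases le_total u v with h | h
    · simp only [min_eq_left h, max_eq_right h]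
      exact ⟨trivial, trivial, hs.2.1, hs.deg_pos.1⟩
    · simp only [min_eq_right h, max_eq_left h]
      exact ⟨add_comm _ _, goodCommon_comm _ _, hs.2.2.1, hs.deg_pos.2⟩
  have hans : ∀ ω, Answer G K T x N L m u v ω ↔ SampleTest G T N L m (min u v) (max u v) ω :=
    fun ω => ⟨fun h => h.elim (fun h => h.2) fun h => absurd h hat, fun h => Or.inl ⟨hs, h⟩⟩
  by_cases hlo : deg G u + deg G v ≤ (N + 1) * (goodCommon G T N u v).card
  · refine le_trans (measure_mono fun ω hω => ?_) (measure_not_sampleTest_le (m := m) hL hN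
      hsum.2.2.1 hsum.2.2.2 (by rw [hsum.1, hsum.2.1]; exact hlo))
    intro ht
    exact hω (iff_of_true (Or.inl ((hadm _).2 hlo)) ((hans ω).2 ht))
  by_cases hhi : deg G u + deg G v ≤ 2 * N * (goodCommon G T N u v).card
  · refine le_trans (le_of_eq ?_) (zero_le)
    convert measure_empty (μ := rndMeasure)
    refine Set.eq_empty_of_forall_notMem fun ω hω => hω ?_
    rw [hans]
    constructor
    · rintro (h | h)
      · exact absurd ((hadm _).1 h) hlo
      · exact h.2.2
    · exact fun h => Or.inr ⟨(hadm _).2 hhi, hs, h⟩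
  · refine le_trans (measure_mono fun ω hω => ?_) (measure_sampleTest_le (m := m) hL hN
      hsum.2.2.1 hsum.2.2.2 (by rw [hsum.1, hsum.2.1]; omega))
    by_contra ht
    refine hω (iff_of_false ?_ fun h => ht ((hans ω).1 h))
    rintro (h | h)
    · exact hlo ((hadm _).1 h)
    · exact hhi ((hadm _).1 h.1)

theorem hits_ne_zero {d : ℕ} {S : Fin (d + 1) → Prop} {ω : Rnd} (h : hits d m S ω ≠ 0) :
    ∃ i < m, S (ω (i, d)) := by
  obtain ⟨i, hi⟩ := Finset.card_pos.1 (Nat.pos_of_ne_zero h)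
  simp only [Finset.mem_filter, Finset.mem_range] at hi
  exact ⟨i, hi⟩

/-- Vertices of admissible atoms are always found, and other vertices outside `reach` are neither
found nor adjacent. For `u` in `reach` a failure needs an error of the test or a sample of `v`
without any good common neighbour with `u`, which explains the factor 2. -/
theorem measure_found_ne_le (hL : ListsNbhd G T L) (hN : 10 ≤ N) {v : Fin n} (hv : T v) :
    rndMeasure {ω | ¬ ∀ u, Found G K T x N L m v ω u ↔ (rndAdm G K T x N L m ω).Adj v u} ≤
      (reach G T N v).card * (2 * ENNReal.ofReal (Real.exp (-(m / (72 * (N : ℝ) ^ 2))))) := by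
  set e := ENNReal.ofReal (Real.exp (-(m / (72 * (N : ℝ) ^ 2)))) with he
  have hsub : {ω | ¬ ∀ u, Found G K T x N L m v ω u ↔ (rndAdm G K T x N L m ω).Adj v u} ⊆
      ⋃ u ∈ reach G T N v,
        ({ω | ¬ ((rndAdm G K T x N L m ω).Adj u v ↔ Answer G K T x N L m u v ω)} ∪
        {ω | PairAdm G T N (2 * N) v u ∧ commonHits G T N L m v u ω = 0}) := by
    intro ω hω
    obtain ⟨u, hu⟩ : ∃ u, ¬ (Found G K T x N L m v ω u ↔ (rndAdm G K T x N L m ω).Adj v u) := by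
      by_contra hcon; push Not at hcon; exact hω hcon
    by_contra hnot
    simp only [Set.mem_iUnion, Set.mem_union, Set.mem_ofPred_eq, not_exists, not_or, not_not,
      not_and] at hnot
    by_cases hat : AtomAdm G K T x N v u
    · exact hu (iff_of_true (Or.inl hat) (Or.inl (Or.inr (Or.inl hat))))
    have hat' : ¬ AtomAdm G K T x N u v := fun h => h.2.1 hv
    by_cases hr : u ∈ reach G T N v
    · obtain ⟨h1, h2⟩ := hnot u hr
      have hA : Answer G K T x N L m u v ω ↔ PairTest G T N L m u v ω :=
        ⟨fun h => h.elim id fun h => absurd h (by tauto), Or.inl⟩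
      rw [hA, SimpleGraph.adj_comm] at h1
      refine hu ⟨fun hf => h1.2 (hf.resolve_left hat).1, fun ha => Or.inr ⟨h1.1 ha, ?_⟩⟩
      have hadm : PairAdm G T N (2 * N) v u :=
        (rndAdm_le (by omega) ω ha).resolve_right (by tauto)
      obtain ⟨i, hi, w, hw, hw'⟩ := hits_ne_zero (h2 hadm)
      simp only [goodCommon, Finset.mem_filter] at hw
      exact ⟨i, hi, w, hw', hw.2.2.1, mem_nbhd_comm.1 hw.2.1⟩
    · refine hu (iff_of_false ?_ ?_)
      · rintro (h | ⟨h, i, hi, w, hw, hw1, hw2⟩)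
        · exact hat h
        · refine hr ?_
          simp only [reach, Finset.mem_biUnion, Finset.mem_filter]
          exact ⟨w, ⟨((hL v hv).2 w).1 (List.mem_of_getElem? hw), hw1⟩, hw2, h.1.2.1⟩
      · intro ha
        have hadm : PairAdm G T N (2 * N) v u :=
          (rndAdm_le (by omega) ω ha).resolve_right (by tauto)
        have h1 := hadm.2
        rw [goodCommon_eq_empty hadm.1.2.2.1 hr] at h1
        have := hadm.1.deg_pos
        simp at h1
        omega
  refine (measure_mono hsub).trans ((measure_biUnion_finset_le _ _).trans ?_)
  rw [← nsmul_eq_mul]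
  refine Finset.sum_le_card_nsmul _ _ _ fun u _ => (measure_union_le _ _).trans ?_
  rw [two_mul e]
  refine add_le_add (measure_answer_ne_le hL hN u v) ?_
  by_cases hadm : PairAdm G T N (2 * N) v u
  · refine (measure_mono fun ω hω => hω.2).trans
      (measure_no_hit_le hL hN hv hadm.1.deg_pos.1 hadm.2)
  · refine le_trans (le_of_eq ?_) (zero_le)
    convert measure_empty (μ := rndMeasure)
    exact Set.eq_empty_of_forall_notMem fun ω hω => hadm hω.1

/-- The number of samples per unit of the query parameter. -/
def sampleRate (N : ℕ) : ℕ := 72 * N ^ 2 * (4 * N + 10)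

theorem exp_sampleRate (hN : 10 ≤ N) (t : ℕ) :
    Real.exp (-((sampleRate N * t : ℕ) / (72 * (N : ℝ) ^ 2))) =
      Real.exp (-((4 * N + 10) * t)) := by
  have : (0 : ℝ) < N := by exact_mod_cast (by omega : 0 < N)
  congr 2
  rw [sampleRate]; push_cast; field_simp

theorem answer_error_le (hN : 10 ≤ N) (t : ℕ) :
    Real.exp (-((sampleRate N * t : ℕ) / (72 * (N : ℝ) ^ 2))) ≤ Real.exp (-(1 * t)) := by
  rw [exp_sampleRate hN]
  refine Real.exp_le_exp.2 ?_
  have : (0 : ℝ) ≤ N := by positivity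
  have : (0 : ℝ) ≤ t := by positivity
  nlinarith

/-- By log deg ≤ t the set `reach` has at most 2N e^{2t} elements. With the factor 2 for the kinds
of failure, the constant 4N is at most e^{4Nt}, and the exponent (4N + 10)t provided by `sampleRate`
beats all of this. -/
theorem found_error_le (hN : 10 ≤ N) {t : ℕ} (ht : 1 ≤ t) {v : Fin n}
    (hlog : Real.log (deg G v) ≤ t) :
    ((reach G T N v).card : ENNReal) * (2 * ENNReal.ofReal
      (Real.exp (-((sampleRate N * t : ℕ) / (72 * (N : ℝ) ^ 2))))) ≤
      ENNReal.ofReal (Real.exp (-(1 * t))) := by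
  have hc := card_reach_le (G := G) (T := T) (N := N) v
  rcases Nat.eq_zero_or_pos (deg G v) with h0 | h0
  · simp only [h0, mul_zero, Nat.le_zero] at hc
    simp [hc]
  have e : ((reach G T N v).card : ENNReal) * (2 * ENNReal.ofReal
      (Real.exp (-((sampleRate N * t : ℕ) / (72 * (N : ℝ) ^ 2))))) = ENNReal.ofReal
      ((reach G T N v).card * (2 * Real.exp (-((sampleRate N * t : ℕ) / (72 * (N : ℝ) ^ 2))))) := by
    rw [ENNReal.ofReal_mul (by positivity), ENNReal.ofReal_mul (by positivity)]
    simp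
  rw [e, exp_sampleRate hN]
  refine ENNReal.ofReal_le_ofReal ?_
  have hd : (0 : ℝ) < deg G v := by exact_mod_cast h0
  have h1 : (deg G v : ℝ) ≤ Real.exp t := (Real.log_le_iff_le_exp hd).1 hlog
  have h2 : ((reach G T N v).card : ℝ) ≤ (2 * Real.exp t) * (N * Real.exp t) := by
    have h3 : ((reach G T N v).card : ℝ) ≤ (deg G v + 1) * (N * deg G v) := by exact_mod_cast hc
    have h4 : (deg G v : ℝ) + 1 ≤ 2 * Real.exp t := by
      have : (1 : ℝ) ≤ deg G v := by exact_mod_cast h0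
      linarith
    refine h3.trans (mul_le_mul h4 ?_ (by positivity) (by positivity))
    exact mul_le_mul_of_nonneg_left h1 (by positivity)
  -- Here t ≥ 1 is needed: a factor depending on N must be absorbed so that the constant in the
  -- exponent remains absolute.
  have h5 : 4 * (N : ℝ) ≤ Real.exp (4 * N * t) := by
    have h6 := Real.add_one_le_exp (4 * (N : ℝ) * t)
    have : (1 : ℝ) ≤ t := by exact_mod_cast ht
    have : (0 : ℝ) ≤ N := by positivity
    nlinarith
  calc ((reach G T N v).card : ℝ) * (2 * Real.exp (-((4 * N + 10) * t)))
      ≤ ((2 * Real.exp t) * (N * Real.exp t)) * (2 * Real.exp (-((4 * N + 10) * t))) := by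
        gcongr
    _ = (4 * N) * (Real.exp t * Real.exp t * Real.exp (-((4 * N + 10) * t))) := by ring
    _ ≤ Real.exp (4 * N * t) * (Real.exp t * Real.exp t * Real.exp (-((4 * N + 10) * t))) := by
        gcongr
    _ = Real.exp (4 * N * t + (t + t + -((4 * N + 10) * t))) := by
        rw [Real.exp_add, Real.exp_add, Real.exp_add]
    _ ≤ Real.exp (-(1 * t)) := by
        refine Real.exp_le_exp.2 ?_
        have : (0 : ℝ) ≤ t := by positivity
        nlinarith

end Sampling

end

/-! ### Lists in memory, loops over them, and the input -/

section

variable {n : ℕ}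

/-! ### Loops over lists -/

/-- The register `x` is not assigned. -/
def Prog.Keeps (x : ℕ) : Prog → Prop
  | .skip => True
  | .assign y _ => x ≠ y
  | .store _ _ => True
  | .rand y _ _ => x ≠ y
  | .seq p q => p.Keeps x ∧ q.Keeps x
  | .ite _ p q => p.Keeps x ∧ q.Keeps x
  | .loop _ p => p.Keeps x

theorem Prog.Keeps.eval_reg {x : ℕ} {p : Prog} (h : p.Keeps x) (s : State) :
    (p.eval s).reg x = s.reg x := by
  induction p generalizing s with
  | skip => rfl
  | assign y e => exact Function.update_of_ne h _ _
  | store a e => rfl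
  | rand y i m => rfl
  | seq p q hp hq => exact (hq h.2 _).trans (hp h.1 s)
  | ite e p q hp hq =>
    simp only [Prog.eval]
    split
    · exact hq h.2 s
    · exact hp h.1 s
  | loop e p _ => rfl

/-- The invariant speaks of the prefix treated so far and, by `hx`, does not depend on the counter
register, so it survives the increments. The time of a round may depend on the element. -/
theorem Meets.forList {α : Type*} {ω : Rnd} {s : State} {x : ℕ} {e : Expr} {p : Prog} (L : List α)
    (c : α → ℕ) (Inv : List α → State → Prop)
    (hx : ∀ pre s r, Inv pre s → Inv pre ⟨Function.update s.reg x r, s.mem⟩)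
    (h0 : Inv [] s) (hm : ∀ pre s, Inv pre s → e.val s = L.length)
    (hstep : ∀ pre a post, L = pre ++ a :: post → ∀ s, Inv pre s → s.reg x = pre.length →
      Meets ω p s (c a) fun s' => s'.reg x = s.reg x ∧ Inv (pre ++ [a]) s') :
    Meets ω (CorrClust.forLoop x e p) s ((L.map fun a => c a + e.cost + 20).sum + (e.cost + 20))
      fun s' => Inv L s' := by
  refine (Meets.forLoop (m := L.length) (fun k s => Inv (L.take k) s)
    (fun k => (L[k]?.map c).getD 0) ?_ ?_ ?_).mono ?_ ?_
  · simpa using hx _ _ _ h0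
  · intro k _ s hI _; exact hm _ s hI
  · intro k hk s hI hr
    have hL : L = L.take k ++ L[k] :: L.drop (k + 1) := by simp
    have hlen : (L.take k).length = k := by simp; omega
    have := hstep _ _ _ hL s hI (by rw [hlen, hr])
    rw [List.getElem?_eq_getElem hk]
    refine this.mono le_rfl fun s' h => ⟨h.1.trans hr, ?_⟩
    rw [List.take_succ_eq_append_getElem hk]
    exact hx _ _ _ h.2
  · have : ∀ L : List α, ∑ k ∈ Finset.range L.length, ((L[k]?.map c).getD 0 + e.cost + 10) ≤
        (L.map fun a => c a + e.cost + 20).sum := by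
      intro L
      induction L with
      | nil => simp
      | cons a L ih =>
        rw [List.length_cons, Finset.sum_range_succ', List.map_cons, List.sum_cons]
        simp only [List.getElem?_cons_succ, List.getElem?_cons_zero, Option.map_some,
          Option.getD_some]
        omega
    have := this L
    omega
  · intro s h; simpa using h.2

theorem Meets.forListStraight {α : Type*} {ω : Rnd} {s : State} {x : ℕ} {e : Expr} {p : Prog}
    (L : List α) (Inv : List α → (ℕ → ℕ) → Prop) (hb : p.Straight) (hk : p.Keeps x)
    (h0 : Inv [] s.mem) (hm : ∀ pre s, Inv pre s.mem → e.val s = L.length)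
    (hstep : ∀ pre a post, L = pre ++ a :: post → ∀ s, Inv pre s.mem → s.reg x = pre.length →
      Inv (pre ++ [a]) (p.eval s).mem) :
    Meets ω (CorrClust.forLoop x e p) s ((p.time + e.cost + 20) * (L.length + 1))
      fun s' => Inv L s'.mem := by
  refine (Meets.forList L (fun _ => p.time) (fun pre s => Inv pre s.mem) (fun _ _ _ h => h) h0 hm
    ?_).mono ?_ (fun _ h => h)
  · intro pre a post hL s hI hr
    exact hb.meets ⟨hk.eval_reg s, hstep pre a post hL s hI hr⟩
  · simp only [List.map_const', List.sum_replicate, smul_eq_mul]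
    nlinarith [Nat.zero_le p.time]

/-! ### Lists in memory -/

@[simp] theorem fld_setFld_ne {m : ℕ → ℕ} {r r' i i' x : ℕ} (hr : r < 32) (hr' : r' < 32)
    (h : r' ≠ r) : fld (setFld m r i x) r' i' = fld m r' i' := by
  rw [fld_setFld hr hr', if_neg (fun h' => h h'.1)]

@[simp] theorem fld_setFld_same {m : ℕ → ℕ} {r i i' x : ℕ} (hr : r < 32) :
    fld (setFld m r i x) r i' = if i' = i then x else fld m r i' := by
  rw [fld_setFld hr hr]; simp

attribute [simp] setFld_zero setFld_one memBase_setFld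

/-- Append `x` to row `v` of the array `r` with row lengths in `c`. -/
def pushRow (m : ℕ → ℕ) (r c v x : ℕ) : ℕ → ℕ :=
  setFld (setFld m r (fld m c v * m 0 + v) x) c v (fld m c v + 1)

@[simp] theorem fld_pushRow_ne {m : ℕ → ℕ} {r c r' v x i : ℕ} (hr : r < 32) (hc : c < 32)
    (hr' : r' < 32) (h : r' ≠ r) (h' : r' ≠ c) : fld (pushRow m r c v x) r' i = fld m r' i := by
  simp [pushRow, *]

@[simp] theorem pushRow_zero (m : ℕ → ℕ) (r c v x : ℕ) : pushRow m r c v x 0 = m 0 := by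
  simp [pushRow]

theorem Frame.push {rs : List ℕ} {m m' : ℕ → ℕ} (h : Frame rs m m') {r c : ℕ} (hr : r < 32)
    (hc : c < 32) (hm : r ∈ rs) (hm' : c ∈ rs) (v x : ℕ) : Frame rs m (pushRow m' r c v x) :=
  (h.set hr hm _ _).set hc hm' _ _

/-- The array `r` holds the lists `L v` in its rows, and the array `c` holds their lengths. -/
def Rows (m : ℕ → ℕ) (r c : ℕ) (L : Fin n → List (Fin n)) : Prop :=
  ∀ v : Fin n, fld m c v = (L v).length ∧
    ∀ j (hj : j < (L v).length), fld m r (j * n + v) = (L v)[j]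

theorem Rows.congr {m m' : ℕ → ℕ} {r c : ℕ} {L : Fin n → List (Fin n)} (h : Rows m r c L)
    (h1 : ∀ i, fld m' r i = fld m r i) (h2 : ∀ i, fld m' c i = fld m c i) : Rows m' r c L := by
  intro v; simpa only [h1, h2] using h v

theorem Rows.push {m : ℕ → ℕ} {r c : ℕ} {L : Fin n → List (Fin n)} (h : Rows m r c L)
    (hr : r < 32) (hc : c < 32) (hrc : r ≠ c) (h0 : m 0 = n) (v x : Fin n) :
    Rows (pushRow m r c v x) r c (Function.update L v (L v ++ [x])) := by
  intro w
  have hw := h w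
  rw [pushRow, (h v).1]
  by_cases e : w = v
  · subst e
    refine ⟨by simp [hc], fun j hj => ?_⟩
    simp only [Function.update_self, List.length_append, List.length_singleton] at hj
    simp only [Function.update_self, fld_setFld_ne hc hr hrc, fld_setFld_same hr, h0,
      idx_inj w.2 w.2, and_true]
    split
    · rename_i hj'; subst hj'; simp
    · rw [List.getElem_append_left (by omega)]; exact hw.2 j (by omega)
  · have e' : (w : ℕ) ≠ v := fun h => e (Fin.ext h)
    refine ⟨?_, fun j hj => ?_⟩
    · simp [fld_setFld_ne, hr, hc, hrc.symm, e, e', hw.1]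
    · simp only [Function.update_of_ne e] at hj ⊢
      simp only [fld_setFld_ne hc hr hrc, fld_setFld_same hr, h0,
        idx_inj w.2 v.2, e', and_false, if_false]
      exact hw.2 j hj

/-- Append `x` to the list in the array `r` whose length is stored in the array `c`. -/
def pushVec (m : ℕ → ℕ) (r c x : ℕ) : ℕ → ℕ :=
  setFld (setFld m r (fld m c 0) x) c 0 (fld m c 0 + 1)

@[simp] theorem fld_pushVec_ne {m : ℕ → ℕ} {r c r' x i : ℕ} (hr : r < 32) (hc : c < 32)
    (hr' : r' < 32) (h : r' ≠ r) (h' : r' ≠ c) : fld (pushVec m r c x) r' i = fld m r' i := by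
  simp [pushVec, *]

theorem Frame.pushVec {rs : List ℕ} {m m' : ℕ → ℕ} (h : Frame rs m m') {r c : ℕ} (hr : r < 32)
    (hc : c < 32) (hm : r ∈ rs) (hm' : c ∈ rs) (x : ℕ) : Frame rs m (pushVec m' r c x) :=
  (h.set hr hm _ _).set hc hm' _ _

/-- The array `r` holds the list `L`, and the array `c` holds its length. -/
def Vec (m : ℕ → ℕ) (r c : ℕ) (L : List (Fin n)) : Prop :=
  fld m c 0 = L.length ∧ ∀ j (hj : j < L.length), fld m r j = L[j]

theorem Vec.congr {m m' : ℕ → ℕ} {r c : ℕ} {L : List (Fin n)} (h : Vec m r c L)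
    (h1 : ∀ i, fld m' r i = fld m r i) (h2 : ∀ i, fld m' c i = fld m c i) : Vec m' r c L := by
  exact ⟨(h2 0).trans h.1, fun j hj => (h1 j).trans (h.2 j hj)⟩

theorem Vec.push {m : ℕ → ℕ} {r c : ℕ} {L : List (Fin n)} (h : Vec m r c L)
    (hr : r < 32) (hc : c < 32) (hrc : r ≠ c) (x : Fin n) :
    Vec (pushVec m r c x) r c (L ++ [x]) := by
  rw [pushVec, h.1]
  refine ⟨by simp [hc], fun j hj => ?_⟩
  simp only [List.length_append, List.length_singleton] at hj
  simp only [fld_setFld_ne hc hr hrc, fld_setFld_same hr]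
  split
  · rename_i hj'; subst hj'; simp
  · rw [List.getElem_append_left (by omega)]; exact h.2 j (by omega)

/-- Append register `y` to the row of the array `r` given by register `x`. -/
def Prog.push (r c x y : ℕ) : Prog :=
  .seq (.setFld r (.idx (.reg x) (.fld c (.reg x))) (.reg y))
    (.setFld c (.reg x) (.bin .add (.fld c (.reg x)) (.lit 1)))

theorem Prog.eval_push {s : State} {r c x y : ℕ} (hr : r < 32) (hc : c < 32) (hrc : c ≠ r) :
    (Prog.push r c x y).eval s = ⟨s.reg, pushRow s.mem r c (s.reg x) (s.reg y)⟩ := by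
  simp [Prog.push, Prog.eval, Prog.eval_setFld, Expr.val_fld, Expr.val_idx, Expr.val, Op.apply,
    pushRow, hr, hc, hrc]

/-- Append register `x` to the list in the array `r`. -/
def Prog.pushVec (r c x : ℕ) : Prog :=
  .seq (.setFld r (.fld c (.lit 0)) (.reg x))
    (.setFld c (.lit 0) (.bin .add (.fld c (.lit 0)) (.lit 1)))

theorem Prog.eval_pushVec {s : State} {r c x : ℕ} (hr : r < 32) (hc : c < 32) (hrc : c ≠ r) :
    (Prog.pushVec r c x).eval s = ⟨s.reg, CorrClust.pushVec s.mem r c (s.reg x)⟩ := by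
  simp [Prog.pushVec, Prog.eval, Prog.eval_setFld, Expr.val_fld, Expr.val, Op.apply,
    CorrClust.pushVec, hr, hc, hrc]

theorem Frame.vec {rs : List ℕ} {m m' : ℕ → ℕ} (h : Frame rs m m') {r c : ℕ}
    {L : List (Fin n)} (hL : Vec m r c L) (hr : r < 32) (hc : c < 32) (hm : r ∉ rs)
    (hm' : c ∉ rs) : Vec m' r c L :=
  hL.congr (h.fld r hr hm) (h.fld c hc hm')

/-! ### The input -/

section Input

/-- The first vertex of the `i`-th violated ordered pair. -/
def incFst (n : ℕ) (m : ℕ → ℕ) (i : ℕ) : ℕ := m (2 + 5 * n + i)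

/-- The second vertex of the `i`-th violated ordered pair. -/
def incSnd (n : ℕ) (m : ℕ → ℕ) (i : ℕ) : ℕ := m (2 + 5 * n + (i + 1 - 2 * (i % 2)))

variable {G : SimpleGraph (Fin n)} {P : Clustering n} {m₀ : ℕ → ℕ}

theorem StoresInput.memBase (h : StoresInput G P m₀) :
    memBase m₀ = 2 + (5 * n + 2 * cost G P) := by
  rw [CorrClust.memBase, h.numVertices, h.numPairs]

theorem StoresInput.fld_eq_zero (h : StoresInput G P m₀) (r i : ℕ) : fld m₀ r i = 0 := by
  refine h.zero _ ?_
  rw [fldAddr, h.memBase, pairAddr]; omega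

/-- The list of violated ordered pairs. -/
theorem StoresInput.exists_inc (h : StoresInput G P m₀) :
    (∀ i < 2 * cost G P, ∃ u v : Fin n, incFst n m₀ i = u ∧ incSnd n m₀ i = v ∧
      (violation G P).Adj u v) ∧
    (∀ u v : Fin n, (violation G P).Adj u v → ∃ i < 2 * cost G P,
      incFst n m₀ i = u ∧ incSnd n m₀ i = v) ∧
    (∀ i < 2 * cost G P, ∀ j < 2 * cost G P, incFst n m₀ i = incFst n m₀ j →
      incSnd n m₀ i = incSnd n m₀ j → i = j) := by
  obtain ⟨L, hlen, hnd, hmem, hL⟩ := h.pairs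
  -- The pair with index i occupies words 2i and 2i + 1. Since `incSnd` reads the partner of a word,
  -- the even position gives the pair in one order and the odd position in the other.
  have hget : ∀ i (hi : i < L.length), incFst n m₀ (2 * i) = L[i].1 ∧ incSnd n m₀ (2 * i) = L[i].2 ∧
      incFst n m₀ (2 * i + 1) = L[i].2 ∧ incSnd n m₀ (2 * i + 1) = L[i].1 := by
    intro i hi
    obtain ⟨h1, h2⟩ := hL i hi
    simp only [pairAddr] at h1 h2
    refine ⟨h1, ?_, h2, ?_⟩
    · rw [incSnd, show 2 + 5 * n + (2 * i + 1 - 2 * (2 * i % 2)) = 2 + 5 * n + 2 * i + 1 by omega]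
      exact h2
    · rw [incSnd, show 2 + 5 * n + (2 * i + 1 + 1 - 2 * ((2 * i + 1) % 2)) = 2 + 5 * n + 2 * i by
        omega]
      exact h1
  have hadj : ∀ i (hi : i < L.length), (violation G P).Adj L[i].1 L[i].2 := fun i hi => by
    have := (hmem s(L[i].1, L[i].2)).1 (List.mem_map.2 ⟨L[i], List.getElem_mem _, rfl⟩)
    rwa [SimpleGraph.mem_edgeSet] at this
  have hcase : ∀ i < 2 * cost G P, ∃ j, ∃ hj : j < L.length, i / 2 = j ∧
      ((i = 2 * j ∧ incFst n m₀ i = L[j].1 ∧ incSnd n m₀ i = L[j].2) ∨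
      (i = 2 * j + 1 ∧ incFst n m₀ i = L[j].2 ∧ incSnd n m₀ i = L[j].1)) := by
    intro i hi
    refine ⟨i / 2, by omega, rfl, ?_⟩
    rcases Nat.even_or_odd' i with ⟨j, rfl | rfl⟩
    · have e : 2 * j / 2 = j := by omega
      have := hget j (by omega)
      left; simp only [e]; exact ⟨trivial, this.1, this.2.1⟩
    · have e : (2 * j + 1) / 2 = j := by omega
      have := hget j (by omega)
      right; simp only [e]; exact ⟨trivial, this.2.2.1, this.2.2.2⟩
  refine ⟨fun i hi => ?_, fun u v huv => ?_, fun i hi j hj h1 h2 => ?_⟩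
  · obtain ⟨j, hj, -, h1 | h1⟩ := hcase i hi
    · exact ⟨_, _, h1.2.1, h1.2.2, hadj j hj⟩
    · exact ⟨_, _, h1.2.1, h1.2.2, (hadj j hj).symm⟩
  · have := (hmem s(u, v)).2 huv
    obtain ⟨p, hp, he⟩ := List.mem_map.1 this
    obtain ⟨j, hj, rfl⟩ := List.getElem_of_mem hp
    have hg := hget j hj
    rcases Sym2.eq_iff.1 he with ⟨h1, h2⟩ | ⟨h1, h2⟩
    · exact ⟨2 * j, by omega, by rw [hg.1, h1], by rw [hg.2.1, h2]⟩
    · exact ⟨2 * j + 1, by omega, by rw [hg.2.2.1, h2], by rw [hg.2.2.2, h1]⟩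
  · obtain ⟨a, ha, hia, hi'⟩ := hcase i hi
    obtain ⟨b, hb, hjb, hj'⟩ := hcase j hj
    have hsym : s(L[a].1, L[a].2) = s(L[b].1, L[b].2) := by
      rw [Sym2.eq_iff]
      simp only [Fin.ext_iff]
      rcases hi' with hi' | hi' <;> rcases hj' with hj' | hj' <;> omega
    have hab : a = b := by
      have := hnd.getElem_inj_iff (i := a) (hi := by simpa using ha) (j := b)
        (hj := by simpa using hb)
      simp only [List.getElem_map] at this
      exact this.1 hsym
    subst hab
    have hne : (L[a].1 : ℕ) ≠ L[a].2 := fun h => (hadj a ha).ne (Fin.ext h)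
    rcases hi' with hi' | hi' <;> rcases hj' with hj' | hj' <;> omega

/-- The memory holds the labels and the cluster lists, and the list `D` of violated ordered
pairs. -/
structure Input (lab : Fin n → Fin n) (M : Fin n → List (Fin n)) (D : List (Fin n × Fin n))
    (m : ℕ → ℕ) : Prop where
  zero : m 0 = n
  one : 2 * m 1 = D.length
  lab : ∀ v : Fin n, m (2 + v) = lab v
  head : ∀ l : Fin n, m (2 + 3 * n + l) = ptr (M l)[0]?
  next : ∀ l i (hi : i < (M l).length), m (2 + n + (M l)[i]) = ptr (M l)[i + 1]?
  prev : ∀ l i (hi : i < (M l).length),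
    m (2 + 2 * n + (M l)[i]) = ptr (if i = 0 then none else (M l)[i - 1]?)
  unused : ∀ l : Fin n, m (2 + 3 * n + (n + l)) = 0
  fst : ∀ i (hi : i < D.length), incFst n m i = D[i].1
  snd : ∀ i (hi : i < D.length), incSnd n m i = D[i].2

/-- The lists `M` and `D` describe the clustering `P` and its violation. -/
structure InputSpec (G : SimpleGraph (Fin n)) (P : Clustering n) (lab : Fin n → Fin n)
    (M : Fin n → List (Fin n)) (D : List (Fin n × Fin n)) : Prop where
  lab_eq : ∀ u v, lab u = lab v ↔ P.part u = P.part v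
  nodup : ∀ l, (M l).Nodup
  mem : ∀ l x, x ∈ M l ↔ lab x = l
  nodup_viol : D.Nodup
  mem_viol : ∀ u v, (u, v) ∈ D ↔ (violation G P).Adj u v

theorem StoresInput.exists_input (h : StoresInput G P m₀) :
    ∃ lab M D, Input (n := n) lab M D m₀ ∧ InputSpec G P lab M D := by
  classical
  obtain ⟨h1, h2, h3⟩ := h.exists_inc
  choose u v hu hv hadj using h1
  set D : List (Fin n × Fin n) :=
    List.ofFn (fun i : Fin (2 * cost G P) => (u i i.2, v i i.2)) with hD
  have hlen : D.length = 2 * cost G P := by simp [hD]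
  set lab : Fin n → Fin n := fun v => ⟨m₀ (2 + v), h.clustering.label_lt v⟩ with hlab
  have hleq : ∀ u v, lab u = lab v ↔ P.part u = P.part v := fun u v => by
    rw [← h.clustering.label_eq u v]; exact Fin.ext_iff
  have hlist : ∀ l : Fin n, ∃ L : List (Fin n), L.Nodup ∧ (∀ x, x ∈ L ↔ lab x = l) ∧
      m₀ (2 + 3 * n + l) = ptr L[0]? ∧ ∀ i (hi : i < L.length),
        m₀ (2 + n + L[i]) = ptr L[i + 1]? ∧
        m₀ (2 + 2 * n + L[i]) = ptr (if i = 0 then none else L[i - 1]?) := by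
    intro l
    by_cases hl : ∃ w, lab w = l
    · obtain ⟨w, rfl⟩ := hl
      obtain ⟨L, hL, hm, hh, hn⟩ := h.clustering.list w
      refine ⟨L, hL, fun x => ?_, hh, hn⟩
      rw [← List.mem_toFinset, hm, ← part_eq_iff, hleq]
    -- An identifier carried by no vertex has the null head, so it represents the empty list.
    · refine ⟨[], by simp, fun x => ?_, ?_, by simp⟩
      · simpa using fun hx => hl ⟨x, hx⟩
      · refine h.clustering.unused l (by omega) fun w hw => hl ⟨w, Fin.ext hw⟩
  choose M hM1 hM2 hM3 hM4 using hlist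
  refine ⟨lab, M, D, ⟨h.numVertices, by rw [h.numPairs, hlen], fun _ => rfl, hM3,
    fun l i hi => (hM4 l i hi).1, fun l i hi => (hM4 l i hi).2, fun l => ?_, fun i hi => ?_,
    fun i hi => ?_⟩,
    ⟨hleq, hM1, hM2, ?_, fun a b => ?_⟩⟩
  · exact h.clustering.unused (n + l) (by omega) fun w hw => by
      have := h.clustering.label_lt w
      omega
  · simp only [hD, List.getElem_ofFn]; exact hu _ _
  · simp only [hD, List.getElem_ofFn]; exact hv _ _
  · rw [hD, List.nodup_ofFn]
    intro i j hij
    simp only [Prod.mk.injEq] at hij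
    refine Fin.ext (h3 i i.2 j j.2 ?_ ?_)
    · rw [hu i i.2, hu j j.2, hij.1]
    · rw [hv i i.2, hv j j.2, hij.2]
  · rw [hD, List.mem_ofFn]
    constructor
    · rintro ⟨i, hi⟩
      rw [Prod.mk.injEq] at hi
      rw [← hi.1, ← hi.2]; exact hadj i i.2
    · intro hab
      obtain ⟨i, hi, e1, e2⟩ := h2 a b hab
      refine ⟨⟨i, hi⟩, ?_⟩
      rw [Prod.mk.injEq]
      exact ⟨Fin.ext ((hu i hi).symm.trans e1), Fin.ext ((hv i hi).symm.trans e2)⟩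

theorem Input.congr {lab : Fin n → Fin n} {M : Fin n → List (Fin n)} {D : List (Fin n × Fin n)}
    {m m' : ℕ → ℕ} (h : Input lab M D m) (hm : ∀ a < CorrClust.memBase m, m' a = m a) :
    Input lab M D m' := by
  have hb : CorrClust.memBase m = 2 + (5 * n + D.length) := by
    rw [CorrClust.memBase, h.zero, h.one]
  rw [hb] at hm
  refine ⟨(hm _ (by omega)).trans h.zero, by rw [hm _ (by omega), h.one],
    fun v => (hm _ (by omega)).trans (h.lab v), fun l => (hm _ (by omega)).trans (h.head l),
    fun l i hi => (hm _ (by omega)).trans (h.next l i hi),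
    fun l i hi => (hm _ (by omega)).trans (h.prev l i hi),
    fun l => (hm _ (by omega)).trans (h.unused l),
    fun i hi => (hm _ (by omega)).trans (h.fst i hi),
    fun i hi => (hm _ (by have := h.one; omega)).trans (h.snd i hi)⟩

theorem Input.frame {lab : Fin n → Fin n} {M : Fin n → List (Fin n)} {D : List (Fin n × Fin n)}
    {rs : List ℕ} {m m' : ℕ → ℕ} (h : Input lab M D m) (hf : Frame rs m m') : Input lab M D m' :=
  h.congr hf.low

theorem Input.fst_eq {lab : Fin n → Fin n} {M : Fin n → List (Fin n)} {D : List (Fin n × Fin n)}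
    {m : ℕ → ℕ} (h : Input lab M D m) {pre post : List (Fin n × Fin n)} {a : Fin n × Fin n}
    (hD : D = pre ++ a :: post) : incFst n m pre.length = a.1 := by
  rw [h.fst _ (by simp [hD])]; simp [hD]

theorem Input.snd_eq {lab : Fin n → Fin n} {M : Fin n → List (Fin n)} {D : List (Fin n × Fin n)}
    {m : ℕ → ℕ} (h : Input lab M D m) {pre post : List (Fin n × Fin n)} {a : Fin n × Fin n}
    (hD : D = pre ++ a :: post) : incSnd n m pre.length = a.2 := by
  rw [h.snd _ (by simp [hD])]; simp [hD]

end Input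

/-! ### Expressions for the input -/

/-- The label of a vertex. -/
def Expr.lab (v : Expr) : Expr := .load (.bin .add (.lit 2) v)
def Expr.next (v : Expr) : Expr := .load (.bin .add (.bin .add (.lit 2) .numV) v)
def Expr.head (c : Expr) : Expr :=
  .load (.bin .add (.bin .add (.lit 2) (.bin .mul (.lit 3) .numV)) c)
def Expr.incFst (i : Expr) : Expr :=
  .load (.bin .add (.bin .add (.lit 2) (.bin .mul (.lit 5) .numV)) i)
def Expr.incSnd (i : Expr) : Expr :=
  .load (.bin .add (.bin .add (.lit 2) (.bin .mul (.lit 5) .numV))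
    (.bin .sub (.bin .add i (.lit 1)) (.bin .mul (.lit 2) (.bin .mod i (.lit 2)))))

theorem Expr.val_lab (s : State) (v : Expr) : (Expr.lab v).val s = s.mem (2 + v.val s) := rfl
theorem Expr.val_next (s : State) (v : Expr) :
    (Expr.next v).val s = s.mem (2 + s.mem 0 + v.val s) := rfl
theorem Expr.val_head (s : State) (v : Expr) :
    (Expr.head v).val s = s.mem (2 + 3 * s.mem 0 + v.val s) := rfl
theorem Expr.val_incFst (s : State) (i : Expr) :
    (Expr.incFst i).val s = CorrClust.incFst (s.mem 0) s.mem (i.val s) := rfl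
theorem Expr.val_incSnd (s : State) (i : Expr) :
    (Expr.incSnd i).val s = CorrClust.incSnd (s.mem 0) s.mem (i.val s) := rfl

end

/-! ### Passes over the violated pairs: counting, walking, selecting, storing, linking -/

section

variable {n : ℕ}

section Passes
open Classical

variable {lab : Fin n → Fin n} {M : Fin n → List (Fin n)} {D : List (Fin n × Fin n)}
  {m₀ : ℕ → ℕ} {ω : Rnd}

/-! ### Counting the violations -/

/-- Array 0 counts violations at vertices, array 1 by label of the first vertex; array 2 is the
matrix of violated pairs, whose zeros are already there. -/
def countBody : Prog :=
  .seq (.assign 1 (.incFst (.reg 0))) <|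
  .seq (.assign 2 (.incSnd (.reg 0))) <|
  .seq (.assign 3 (.lab (.reg 1))) <|
  .seq (.setFld 2 (.idx (.reg 1) (.reg 2)) (.lit 1)) <|
  .seq (.setFld 0 (.reg 1) (.bin .add (.fld 0 (.reg 1)) (.lit 1))) <|
  .setFld 1 (.reg 3) (.bin .add (.fld 1 (.reg 3)) (.lit 1))

def countLoop : Prog := forLoop 0 (.bin .mul (.lit 2) .numP) countBody

/-- The number of pairs whose first vertex has the label `l`. -/
def cnt (lab : Fin n → Fin n) (D : List (Fin n × Fin n)) (l : Fin n) : ℕ :=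
  D.countP fun p => lab p.1 = l

theorem cnt_append (D D' : List (Fin n × Fin n)) (l : Fin n) :
    cnt lab (D ++ D') l = cnt lab D l + cnt lab D' l := List.countP_append

theorem cnt_concat (D : List (Fin n × Fin n)) (a : Fin n × Fin n) (l : Fin n) :
    cnt lab (D ++ [a]) l = if l = lab a.1 then cnt lab D l + 1 else cnt lab D l := by
  rw [cnt_append]
  by_cases h : l = lab a.1
  · simp [cnt, h]
  · simp [cnt, h, Ne.symm h]

/-- After the pairs `pre`, the violations at vertices and in clusters are counted, and the pairs are
marked in a matrix. -/
structure CountInv (lab : Fin n → Fin n) (m₀ : ℕ → ℕ) (pre : List (Fin n × Fin n)) (m : ℕ → ℕ) :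
    Prop where
  frame : Frame [0, 1, 2] m₀ m
  viol : ∀ u : Fin n, fld m 0 u = pre.countP fun p => p.1 = u
  mass : ∀ l : Fin n, fld m 1 l = cnt lab pre l
  mark : ∀ u v : Fin n, fld m 2 (v * n + u) = if (u, v) ∈ pre then 1 else 0

theorem countLoop_meets (h : Input lab M D m₀) (hz : ∀ r i, fld m₀ r i = 0) (s : State)
    (hs : s.mem = m₀) : Meets ω countLoop s ((countBody.time + 30) * (D.length + 1))
      fun s' => CountInv lab m₀ D s'.mem := by
  refine (Meets.forListStraight D (CountInv lab m₀)
    (by simp [countBody, Prog.Straight, Prog.setFld]) (by simp [countBody, Prog.Keeps, Prog.setFld])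
    ?_ ?_ ?_).mono (Nat.mul_le_mul_right _ (by simp [Expr.cost])) fun _ h => h
  · exact ⟨by rw [hs]; exact Frame.refl _ _, by simp [hs, hz], by simp [hs, hz, cnt],
      by simp [hs, hz]⟩
  · intro pre s hI
    simp [Expr.val, Op.apply, (h.frame hI.frame).one]
  · rintro pre ⟨a, b⟩ post hD s hI hx
    have hi := h.frame hI.frame
    have e1 := hi.fst_eq hD
    have e2 := hi.snd_eq hD
    simp [countBody, Prog.eval, Prog.eval_setFld, Expr.val_incFst, Expr.val_incSnd,
      Expr.val_lab, Expr.val_fld, Expr.val_idx, Expr.val, Op.apply, hx, hi.zero, e1, e2, hi.lab]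
    refine ⟨((hI.frame.set (by norm_num) (by simp) _ _).set (by norm_num) (by simp) _ _).set
      (by norm_num) (by simp) _ _, fun u => ?_, fun l => ?_, fun u v => ?_⟩
    · simp [hI.viol, Fin.val_inj, List.countP_append]
      split <;> simp_all [eq_comm]
    · simp [hI.mass, Fin.val_inj, cnt_concat]
      split <;> simp_all
    · simp [hI.mark, idx_inj u.2 a.2, Fin.val_inj, and_comm (a := v = b)]
      by_cases e : u = a ∧ v = b <;> simp [e]

/-! ### Walking through the clusters -/

/-- Each occurrence of a cluster buys one step along its linked list. Array 4 is the cursor, array 5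
the vertices met in each cluster with their number in array 3, and array 6 all vertices met. A null
cursor means that the walk has not begun if the number is 0, and that the list is exhausted
otherwise. -/
def walkBody : Prog :=
  .seq (.assign 1 (.incFst (.reg 10))) <|
  .seq (.assign 2 (.lab (.reg 1))) <|
  .seq (.ite (.fld 3 (.reg 2)) (.assign 3 (.fld 4 (.reg 2))) (.assign 3 (.head (.reg 2)))) <|
  .ite (.reg 3)
    (.seq (.assign 4 (.bin .sub (.reg 3) (.lit 1))) <|
    .seq (.assign 5 (.next (.reg 4))) <|
    .seq (.push 5 3 2 4) <|
    .seq (.pushVec 6 23 4) <|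
    .setFld 4 (.reg 2) (.reg 5))
    .skip

def walkRound : Prog := forLoop 10 (.bin .mul (.lit 2) .numP) walkBody
-- The number 10000 is the constant in `Loose.card_le` and `CoreAdm.card_le`: after that many rounds
-- every relevant cluster has been walked completely.
def walkLoop : Prog := forLoop 0 (.lit 10000) walkRound

/-- After the pairs `pre`, the first vertices of every cluster have been found, as many as there are
pairs whose first vertex is in this cluster. -/
structure WalkInv (lab : Fin n → Fin n) (M : Fin n → List (Fin n)) (m₀ : ℕ → ℕ)
    (pre : List (Fin n × Fin n)) (m : ℕ → ℕ) : Prop where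
  frame : Frame [3, 4, 5, 6, 23] m₀ m
  rows : Rows m 5 3 fun l => (M l).take (cnt lab pre l)
  cur : ∀ l : Fin n, fld m 4 l = if cnt lab pre l = 0 then 0 else ptr (M l)[cnt lab pre l]?
  all : ∃ A : List (Fin n), Vec m 6 23 A ∧ A.Nodup ∧ A.length ≤ pre.length ∧
    ∀ x, x ∈ A ↔ x ∈ (M (lab x)).take (cnt lab pre (lab x))

/-- Here `pre` collects the pairs of all rounds, while `D₁` is the position within the current
round. A visit lengthens the prefix by one vertex until the list ends; afterwards visits change
nothing, as does taking a longer prefix. -/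
theorem WalkInv.step (h : Input lab M D m₀) (hM : ∀ l, (M l).Nodup)
    (hmem : ∀ l x, x ∈ M l ↔ lab x = l) {pre D₁ D₂ : List (Fin n × Fin n)} {a : Fin n × Fin n}
    (hD : D = D₁ ++ a :: D₂) {s : State} (hI : WalkInv lab M m₀ pre s.mem)
    (hx : s.reg 10 = D₁.length) : WalkInv lab M m₀ (pre ++ [a]) (walkBody.eval s).mem := by
  have hi := h.frame hI.frame
  have e1 := hi.fst_eq hD
  set l := lab a.1 with hl
  have hpos : 0 < (M l).length := List.length_pos_of_mem ((hmem l a.1).2 hl.symm)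
  have hsz := (hI.rows l).1
  simp only [List.length_take] at hsz
  have hr : (if fld s.mem 3 l = 0 then s.mem (2 + 3 * n + l) else fld s.mem 4 l) =
      ptr (M l)[cnt lab pre l]? := by
    rw [hsz, hi.head, hI.cur]
    by_cases h0 : cnt lab pre l = 0
    · simp [h0]
    · rw [if_neg (by omega), if_neg h0]
  have hev : (walkBody.eval s).mem = if ptr (M l)[cnt lab pre l]? = 0 then s.mem else
      setFld (pushVec (pushRow s.mem 5 3 l (ptr (M l)[cnt lab pre l]? - 1)) 6 23
        (ptr (M l)[cnt lab pre l]? - 1)) 4 l (s.mem (2 + n + (ptr (M l)[cnt lab pre l]? - 1))) := by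
    simp only [← hr]
    simp [walkBody, Prog.eval, Prog.eval_setFld, Prog.eval_push, Prog.eval_pushVec,
      Expr.val_incFst, Expr.val_head, Expr.val_next,
      Expr.val_lab, Expr.val_fld, Expr.val, Op.apply, hx, hi.zero, e1, hi.lab, ← hl]
    split <;> simp [hi.zero] <;> split <;> simp_all
  rw [hev]
  have hcnt : ∀ l', cnt lab (pre ++ [a]) l' =
      if l' = l then cnt lab pre l' + 1 else cnt lab pre l' := cnt_concat pre a
  by_cases hc : cnt lab pre l < (M l).length
  · rw [List.getElem?_eq_getElem hc]
    set y := (M l)[cnt lab pre l] with hy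
    have hly : lab y = l := (hmem l y).1 (List.getElem_mem _)
    have hnx := hi.next l _ hc
    simp only [ptr, Nat.add_eq_zero_iff, one_ne_zero, and_false, if_false, Nat.add_sub_cancel]
    rw [← hy] at hnx
    rw [hnx]
    refine ⟨((hI.frame.push (by norm_num) (by norm_num) (by simp) (by simp) _ _).pushVec
      (by norm_num) (by norm_num) (by simp) (by simp) _).set (by norm_num) (by simp) _ _,
      ?_, fun l' => ?_, ?_⟩
    · have := hI.rows.push (by norm_num) (by norm_num) (by norm_num) hi.zero l y
      refine Rows.congr (m := pushRow s.mem 5 3 l y) ?_ (by simp) (by simp)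
      convert this using 1
      funext l'
      rw [hcnt]
      by_cases e : l' = l
      · subst e
        rw [if_pos rfl, Function.update_self, List.take_succ_eq_append_getElem hc]
      · simp [e]
    · simp only [fld_setFld_same (show 4 < 32 by norm_num), Fin.val_inj, hcnt]
      split
      · rename_i e; subst e; simp
      · simp [hI.cur]
    · obtain ⟨A, hA, hn, hlen, hA'⟩ := hI.all
      refine ⟨A ++ [y], ?_, ?_, by simpa using hlen, fun x => ?_⟩
      · have := (hA.congr (m' := pushRow s.mem 5 3 l y) (by simp) (by simp)).push
          (by norm_num) (by norm_num) (by norm_num) y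
        exact this.congr (by simp) (by simp)
      · rw [List.nodup_append]
        refine ⟨hn, by simp, ?_⟩
        rintro b hb c hc' rfl
        simp only [List.mem_singleton] at hc'
        subst hc'
        rw [hA', hly, List.mem_take_iff_getElem] at hb
        obtain ⟨j, hj, e⟩ := hb
        have := (hM l).getElem_inj_iff.1 (e.trans hy)
        omega
      · rw [List.mem_append, hA', hcnt, List.mem_singleton]
        by_cases e : lab x = l
        · rw [e, if_pos rfl, List.take_succ_eq_append_getElem hc, List.mem_append,
            List.mem_singleton]
        · rw [if_neg e]
          refine or_iff_left ?_
          rintro rfl; exact e hly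
  · rw [List.getElem?_eq_none (by omega)]
    simp only [ptr, if_true]
    have htake : ∀ l', (M l').take (cnt lab (pre ++ [a]) l') = (M l').take (cnt lab pre l') := by
      intro l'
      rw [hcnt]
      split
      · rename_i e; subst e
        rw [List.take_of_length_le (by omega), List.take_of_length_le (by omega)]
      · rfl
    refine ⟨hI.frame, by simp only [htake]; exact hI.rows, fun l' => ?_, by
      simp only [htake]
      obtain ⟨A, h1, h2, h3, h4⟩ := hI.all
      exact ⟨A, h1, h2, by simp; omega, h4⟩⟩
    rw [hI.cur, hcnt]
    by_cases e : l' = l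
    · subst e
      rw [if_neg (by omega), if_pos rfl, if_neg (by omega), List.getElem?_eq_none (by omega),
        List.getElem?_eq_none (by omega)]
    · rw [if_neg e]

theorem walkLoop_meets (h : Input lab M D m₀) (hM : ∀ l, (M l).Nodup)
    (hmem : ∀ l x, x ∈ M l ↔ lab x = l) (hz : ∀ r ∈ [3, 4, 5, 6, 23], ∀ i, fld m₀ r i = 0)
    (s : State) (hs : s.mem = m₀) :
    Meets ω walkLoop s (10001 * (walkBody.time + 51) * (D.length + 1))
      fun s' => WalkInv lab M m₀ (List.replicate 10000 D).flatten s'.mem := by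
  have h23 := hz 23 (by simp)
  refine (Meets.forLoop (m := 10000)
    (fun k s => WalkInv lab M m₀ (List.replicate k D).flatten s.mem)
    (fun _ => (walkBody.time + 30) * (D.length + 1)) ?_ ?_ ?_).mono ?_ (fun s h => h.2)
  · refine ⟨by rw [hs]; exact Frame.refl _ _, ?_, ?_, [], ?_, by simp, by simp, by simp [cnt]⟩
    · intro l; simp [hs, hz, cnt]
    · intro l; simp [hs, hz, cnt]
    · exact ⟨by simp [hs, h23], by simp⟩
  · intro k _ s _ _; rfl
  · intro k hk s hI hx
    refine (Meets.forList D (fun _ => walkBody.time)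
      (fun pre s => s.reg 0 = k ∧
        WalkInv lab M m₀ ((List.replicate k D).flatten ++ pre) s.mem) ?_ ?_ ?_ ?_).mono ?_ ?_
    · intro pre s r h; simpa using h
    · simpa using ⟨hx, hI⟩
    · intro pre s hI
      simp [Expr.val, Op.apply, (h.frame hI.2.frame).one]
    · intro pre a post hD s hI hr
      refine Prog.Straight.meets (by simp [walkBody, Prog.Straight, Prog.setFld, Prog.push,
        Prog.pushVec]) ⟨?_, ?_, ?_⟩
      · exact Prog.Keeps.eval_reg (by simp [walkBody, Prog.Keeps, Prog.setFld, Prog.push,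
          Prog.pushVec]) s
      · exact (Prog.Keeps.eval_reg (by simp [walkBody, Prog.Keeps, Prog.setFld, Prog.push,
          Prog.pushVec]) s).trans hI.1
      · rw [← List.append_assoc]
        exact WalkInv.step h hM hmem hD hI.2 hr
    · simp only [List.map_const', List.sum_replicate, smul_eq_mul, Expr.cost]
      nlinarith [Nat.zero_le walkBody.time]
    · intro s' hs'
      refine ⟨hs'.1, ?_⟩
      rw [List.replicate_succ', List.flatten_append]
      simpa using hs'.2
  · simp only [Finset.sum_const, Finset.card_range, smul_eq_mul, Expr.cost]
    nlinarith [Nat.zero_le walkBody.time, Nat.zero_le (walkBody.time * D.length)]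

end Passes

end

section

variable {n : ℕ}

section Passes
open Classical

variable {lab : Fin n → Fin n} {M : Fin n → List (Fin n)} {D : List (Fin n × Fin n)}
  {m₀ : ℕ → ℕ} {ω : Rnd} {T : Fin n → Prop}

/-! ### Selecting the loose vertices -/

/-- A cluster with a non-null cursor is larger than 10000 times its mass and contains no loose
vertex. Otherwise array 3 holds its exact size, and the definition of loose can be evaluated; the
sum of the two comparisons is their disjunction. -/
def selectBody : Prog :=
  .seq (.assign 1 (.fld 6 (.reg 0))) <|
  .seq (.assign 2 (.lab (.reg 1))) <|
  .ite (.fld 4 (.reg 2)) .skip <|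
  .ite (.bin .add
      (.bin .lt (.fld 3 (.reg 2)) (.bin .mul (.lit 100) (.fld 0 (.reg 1))))
      (.bin .lt (.bin .mul (.fld 3 (.reg 2)) (.fld 3 (.reg 2)))
        (.bin .mul (.lit 10000) (.fld 1 (.reg 2)))))
    (.seq (.setFld 7 (.reg 1) (.lit 1)) (.pushVec 8 24 1)) .skip

def selectLoop : Prog := forLoop 0 (.fld 23 (.lit 0)) selectBody

structure SelectInv (T : Fin n → Prop) (m₀ : ℕ → ℕ) (pre : List (Fin n)) (m : ℕ → ℕ) :
    Prop where
  frame : Frame [7, 8, 24] m₀ m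
  flag : ∀ u : Fin n, fld m 7 u = if u ∈ pre ∧ T u then 1 else 0
  list : Vec m 8 24 (pre.filter T)

theorem selectLoop_meets (h : Input lab M D m₀) {A : List (Fin n)} (hA : Vec m₀ 6 23 A)
    (hz : ∀ r ∈ [7, 8, 24], ∀ i, fld m₀ r i = 0)
    (hT : ∀ x ∈ A, T x ↔ fld m₀ 4 (lab x) = 0 ∧ (fld m₀ 3 (lab x) < 100 * fld m₀ 0 x ∨
      fld m₀ 3 (lab x) * fld m₀ 3 (lab x) < 10000 * fld m₀ 1 (lab x)))
    (s : State) (hs : s.mem = m₀) : Meets ω selectLoop s ((selectBody.time + 60) * (A.length + 1))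
      fun s' => SelectInv T m₀ A s'.mem := by
  have hz7 := hz 7 (by simp)
  have hz24 := hz 24 (by simp)
  refine (Meets.forListStraight A (SelectInv T m₀)
    (by simp [selectBody, Prog.Straight, Prog.setFld, Prog.pushVec])
    (by simp [selectBody, Prog.Keeps, Prog.setFld, Prog.pushVec])
    ?_ ?_ ?_).mono (Nat.mul_le_mul_right _ (by simp [Expr.cost, Expr.fld, Expr.fldAddr]))
      fun _ h => h
  · exact ⟨by rw [hs]; exact Frame.refl _ _, by simp [hs, hz7], by simp [Vec, hs, hz24]⟩
  · intro pre s hI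
    rw [Expr.val_fld, ← hA.1]; exact hI.frame.fld _ (by norm_num) (by simp) _
  · rintro pre a post hD s hI hx
    have hi := h.frame hI.frame
    have hA' := hI.frame.vec hA (by norm_num) (by norm_num) (by simp) (by simp)
    have e1 : fld s.mem 6 pre.length = a := by
      rw [hA'.2 _ (by simp [hD])]; simp [hD]
    have e3 := hI.frame.fld 3 (by norm_num) (by simp)
    have e4 := hI.frame.fld 4 (by norm_num) (by simp)
    have e0 := hI.frame.fld 0 (by norm_num) (by simp)
    have e5 := hI.frame.fld 1 (by norm_num) (by simp)
    have hev : (selectBody.eval s).mem = if T a then pushVec (setFld s.mem 7 a 1) 8 24 a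
        else s.mem := by
      rw [hT a (by simp [hD])]
      simp [selectBody, Prog.eval, Prog.eval_setFld, Prog.eval_pushVec,
        Expr.val_lab, Expr.val_fld, Expr.val, Op.apply, hx, e1, hi.lab, e3, e4, e0, e5]
      grind
    rw [hev]
    by_cases ha : T a
    · rw [if_pos ha]
      refine ⟨(hI.frame.set (by norm_num) (by simp) _ _).pushVec (by norm_num) (by norm_num)
        (by simp) (by simp) _, fun u => ?_, ?_⟩
      · simp [Fin.val_inj, hI.flag]
        by_cases e : u = a
        · subst e; simp [ha]
        · simp [e]
      · rw [List.filter_append]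
        simp only [List.filter_cons, ha, decide_true, if_true, List.filter_nil]
        exact (hI.list.congr (m' := setFld s.mem 7 a 1) (by simp) (by simp)).push (by norm_num)
          (by norm_num) (by norm_num) a
    · rw [if_neg ha]
      refine ⟨hI.frame, fun u => ?_, ?_⟩
      · rw [hI.flag]
        by_cases e : u = a
        · subst e; simp [ha]
        · simp [e]
      · simpa [List.filter_append, ha] using hI.list

/-! ### Listing the neighbours of the loose vertices -/

/-- The arrays `9` and `10` hold the list `L` of pairs. -/
def PairVec (m : ℕ → ℕ) (L : List (Fin n × Fin n)) : Prop :=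
  fld m 25 0 = L.length ∧ ∀ j (hj : j < L.length), fld m 9 j = L[j].1 ∧ fld m 10 j = L[j].2

def pushPair (m : ℕ → ℕ) (x y : ℕ) : ℕ → ℕ :=
  setFld (setFld (setFld m 9 (fld m 25 0) x) 10 (fld m 25 0) y) 25 0 (fld m 25 0 + 1)

def Prog.pushPair (x y : ℕ) : Prog :=
  .seq (.setFld 9 (.fld 25 (.lit 0)) (.reg x)) <|
  .seq (.setFld 10 (.fld 25 (.lit 0)) (.reg y))
    (.setFld 25 (.lit 0) (.bin .add (.fld 25 (.lit 0)) (.lit 1)))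

theorem Prog.eval_pushPair {s : State} {x y : ℕ} :
    (Prog.pushPair x y).eval s = ⟨s.reg, CorrClust.pushPair s.mem (s.reg x) (s.reg y)⟩ := by
  simp [Prog.pushPair, Prog.eval, Prog.eval_setFld, Expr.val_fld, Expr.val, Op.apply,
    CorrClust.pushPair]

theorem Frame.pushPair {rs : List ℕ} {m m' : ℕ → ℕ} (h : Frame rs m m') (h1 : 9 ∈ rs)
    (h2 : 10 ∈ rs) (h3 : 25 ∈ rs) (x y : ℕ) : Frame rs m (pushPair m' x y) :=
  ((h.set (by norm_num) h1 _ _).set (by norm_num) h2 _ _).set (by norm_num) h3 _ _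

theorem PairVec.push {m : ℕ → ℕ} {L : List (Fin n × Fin n)} (h : PairVec m L) (x y : Fin n) :
    PairVec (pushPair m x y) (L ++ [(x, y)]) := by
  rw [pushPair, h.1]
  refine ⟨by simp, fun j hj => ?_⟩
  simp only [List.length_append, List.length_singleton] at hj
  simp
  by_cases e : j = L.length
  · subst e; simp
  · rw [List.getElem_append_left (by omega)]; simpa [e] using h.2 j (by omega)

theorem PairVec.congr {m m' : ℕ → ℕ} {L : List (Fin n × Fin n)} (h : PairVec m L)
    (h1 : ∀ i, fld m' 9 i = fld m 9 i) (h2 : ∀ i, fld m' 10 i = fld m 10 i)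
    (h3 : ∀ i, fld m' 25 i = fld m 25 i) : PairVec m' L := by
  exact ⟨(h3 0).trans h.1, fun j hj => ⟨(h1 j).trans (h.2 j hj).1, (h2 j).trans (h.2 j hj).2⟩⟩

/-- Within its own cluster, the closed neighbours of a vertex are exactly the members that are not
marked as violations with it. -/
def insideBody : Prog :=
  .seq (.assign 3 (.fld 5 (.idx (.reg 2) (.reg 10)))) <|
  .ite (.fld 2 (.idx (.reg 1) (.reg 3))) .skip (.pushPair 1 3)

def insideRow : Prog :=
  .seq (.seq (.assign 1 (.fld 8 (.reg 0))) (.assign 2 (.lab (.reg 1)))) <|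
  forLoop 10 (.fld 3 (.reg 2)) insideBody

def insideLoop : Prog := forLoop 0 (.fld 24 (.lit 0)) insideRow

/-- The neighbours of `u` in its cluster. -/
def inside (lab : Fin n → Fin n) (M : Fin n → List (Fin n)) (D : List (Fin n × Fin n))
    (u : Fin n) : List (Fin n × Fin n) :=
  ((M (lab u)).filter fun x => (u, x) ∉ D).map fun x => (u, x)

theorem insideLoop_meets (h : Input lab M D m₀) {S : List (Fin n)} (hS : Vec m₀ 8 24 S)
    (hz : ∀ r ∈ [9, 10, 25], ∀ i, fld m₀ r i = 0)
    (hrow : ∀ u ∈ S, fld m₀ 3 (lab u) = (M (lab u)).length ∧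
      ∀ j (hj : j < (M (lab u)).length), fld m₀ 5 (j * n + lab u) = (M (lab u))[j])
    (hmark : ∀ u v : Fin n, fld m₀ 2 (v * n + u) = if (u, v) ∈ D then 1 else 0)
    (s : State) (hs : s.mem = m₀) : Meets ω insideLoop s
      ((insideBody.time + 200) * (S.map fun u => (M (lab u)).length + 1).sum + 60)
      fun s' => Frame [9, 10, 25] m₀ s'.mem ∧ PairVec s'.mem (S.flatMap (inside lab M D)) := by
  have hz25 := hz 25 (by simp)
  refine (Meets.forList S (fun u => (insideBody.time + 60) * ((M (lab u)).length + 1) + 60)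
    (fun pre s => Frame [9, 10, 25] m₀ s.mem ∧
      PairVec s.mem (pre.flatMap (inside lab M D))) ?_ ?_ ?_ ?_).mono ?_ fun _ h => h
  · intro pre s r h; exact h
  · exact ⟨by rw [hs]; exact Frame.refl _ _, by simp [PairVec, hs, hz25]⟩
  · intro pre s hI
    rw [Expr.val_fld, ← hS.1]; exact hI.1.fld _ (by norm_num) (by simp) _
  · rintro pre u post hD s ⟨hf, hv⟩ hx
    have hi := h.frame hf
    have e1 : fld s.mem 8 pre.length = u := by
      rw [hf.fld 8 (by norm_num) (by simp), hS.2 _ (by simp [hD])]; simp [hD]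
    obtain ⟨hsz, harr⟩ := hrow u (by simp [hD])
    refine Meets.mono (B₁ := 58 + ((insideBody.time + 60) * ((M (lab u)).length + 1)))
      (Meets.seq (R := fun s' => s'.reg 0 = pre.length ∧ s'.reg 1 = u ∧ s'.reg 2 = lab u ∧
        s'.mem = s.mem) ?_ ?_) (by omega) (fun _ h => h)
    · refine (Prog.Straight.meets (by simp [Prog.Straight]) ?_).mono (B₁ := _) (B₂ := 58)
        (by simp [Prog.time, Expr.cost, Expr.fld, Expr.fldAddr, Expr.lab]) (fun _ h => h)
      simp [Prog.eval, Expr.val_lab, Expr.val_fld, Expr.val, hx, e1, hi.lab]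
    · rintro s₁ ⟨h0, h1, h2, hm⟩
      refine (Meets.forList (M (lab u)) (fun _ => insideBody.time)
        (fun q s => (s.reg 0 = pre.length ∧ s.reg 1 = u ∧ s.reg 2 = lab u) ∧
          Frame [9, 10, 25] m₀ s.mem ∧ PairVec s.mem (pre.flatMap (inside lab M D) ++
            (q.filter fun x => (u, x) ∉ D).map fun x => (u, x))) ?_ ?_ ?_ ?_).mono ?_ ?_
      · intro q s r h; simpa using h
      · simpa [h0, h1, h2, hm] using ⟨hf, hv⟩
      · rintro q s ⟨⟨-, -, h2⟩, hf, -⟩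
        rw [Expr.val_fld, ← hsz, Expr.val, h2]; exact hf.fld _ (by norm_num) (by simp) _
      · rintro q x post' hM s ⟨⟨h0, h1, h2⟩, hf, hv⟩ hr
        have hi := h.frame hf
        have e2 : fld s.mem 5 (q.length * n + lab u) = x := by
          rw [hf.fld 5 (by norm_num) (by simp), harr _ (by simp [hM])]; simp [hM]
        have e3 := hf.fld 2 (by norm_num) (by simp)
        refine Prog.Straight.meets (by simp [insideBody, Prog.Straight, Prog.setFld,
          Prog.pushPair]) ?_
        have hK : ∀ y, y ≠ 3 → (insideBody.eval s).reg y = s.reg y := fun y hy =>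
          Prog.Keeps.eval_reg (by simp [insideBody, Prog.Keeps, Prog.setFld, Prog.pushPair, hy]) s
        have hev : (insideBody.eval s).mem = if (u, x) ∈ D then s.mem else
            pushPair s.mem u x := by
          simp [insideBody, Prog.eval, Prog.eval_pushPair, Expr.val_idx,
            Expr.val_fld, Expr.val, hr, hi.zero, e2, e3, h1, h2, hmark]
          grind
        refine ⟨hK _ (by norm_num), ⟨by rw [hK _ (by norm_num), h0],
          by rw [hK _ (by norm_num), h1], by rw [hK _ (by norm_num), h2]⟩, ?_⟩
        rw [hev]
        by_cases hx : (u, x) ∈ D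
        · have := And.intro hf hv
          simpa [hx, List.filter_append] using this
        · rw [if_neg hx]
          refine ⟨hf.pushPair (by simp) (by simp) (by simp) _ _, ?_⟩
          have := hv.push u x
          simpa [hx, List.filter_append] using this
      · simp only [List.map_const', List.sum_replicate, smul_eq_mul, Expr.cost, Expr.fld,
          Expr.fldAddr]
        nlinarith [Nat.zero_le insideBody.time]
      · rintro s' ⟨⟨h0, -, -⟩, hf, hv⟩
        refine ⟨h0.trans hx.symm, hf, ?_⟩
        simpa [inside] using hv
  · have : ∀ S : List (Fin n), (S.map fun u => (insideBody.time + 60) * ((M (lab u)).length + 1) +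
        60 + (Expr.fld 24 (.lit 0)).cost + 20).sum ≤
        (insideBody.time + 200) * (S.map fun u => (M (lab u)).length + 1).sum := by
      intro S
      simp only [Expr.cost, Expr.fld, Expr.fldAddr]
      induction S with
      | nil => simp
      | cons a S ih =>
        rw [List.map_cons, List.sum_cons, List.map_cons, List.sum_cons, mul_add]
        nlinarith
    have := this S
    simp only [Expr.cost, Expr.fld, Expr.fldAddr] at this ⊢
    omega

/-- An edge between different clusters is a violation, so all such neighbours of a loose vertex
appear in the list of violated pairs. -/
def outsideBody : Prog :=
  .seq (.assign 1 (.incFst (.reg 0))) <|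
  .seq (.assign 2 (.incSnd (.reg 0))) <|
  .ite (.fld 7 (.reg 1)) (.ite (.bin .eq (.lab (.reg 1)) (.lab (.reg 2))) .skip (.pushPair 1 2))
    .skip

def outsideLoop : Prog := forLoop 0 (.bin .mul (.lit 2) .numP) outsideBody

theorem outsideLoop_meets (h : Input lab M D m₀) {L : List (Fin n × Fin n)} (hL : PairVec m₀ L)
    (hT : ∀ u : Fin n, fld m₀ 7 u = if T u then 1 else 0) (s : State) (hs : s.mem = m₀) :
    Meets ω outsideLoop s ((outsideBody.time + 60) * (D.length + 1))
      fun s' => Frame [9, 10, 25] m₀ s'.mem ∧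
        PairVec s'.mem (L ++ D.filter fun p => T p.1 ∧ lab p.1 ≠ lab p.2) := by
  refine (Meets.forListStraight D (fun pre m => Frame [9, 10, 25] m₀ m ∧
    PairVec m (L ++ pre.filter fun p => T p.1 ∧ lab p.1 ≠ lab p.2))
    (by simp [outsideBody, Prog.Straight, Prog.setFld, Prog.pushPair])
    (by simp [outsideBody, Prog.Keeps, Prog.setFld, Prog.pushPair])
    ?_ ?_ ?_).mono (Nat.mul_le_mul_right _ (by simp [Expr.cost])) fun _ h => h
  · simpa [hs] using ⟨Frame.refl _ _, hL⟩
  · intro pre s hI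
    simp [Expr.val, Op.apply, (h.frame hI.1).one]
  · rintro pre ⟨a, b⟩ post hD s ⟨hf, hv⟩ hx
    have hi := h.frame hf
    have e1 := hi.fst_eq hD
    have e2 := hi.snd_eq hD
    have e3 := hf.fld 7 (by norm_num) (by simp)
    have hev : (outsideBody.eval s).mem = if T a ∧ lab a ≠ lab b then pushPair s.mem a b
        else s.mem := by
      simp [outsideBody, Prog.eval, Prog.eval_pushPair, Expr.val_incFst,
        Expr.val_incSnd, Expr.val_lab, Expr.val_fld, Expr.val, Op.apply, hx, hi.zero, e1, e2,
        hi.lab, e3, hT, Fin.val_inj]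
      grind
    rw [hev]
    by_cases ha : T a ∧ lab a ≠ lab b
    · rw [if_pos ha]
      refine ⟨hf.pushPair (by simp) (by simp) (by simp) _ _, ?_⟩
      have := hv.push a b
      simpa [ha, List.filter_append] using this
    · rw [if_neg ha]
      refine ⟨hf, ?_⟩
      simpa [List.filter_append, List.filter_cons, ha] using hv

end Passes

end

section

variable {n : ℕ}

section Passes
open Classical

variable {lab : Fin n → Fin n} {M : Fin n → List (Fin n)} {D : List (Fin n × Fin n)}
  {m₀ : ℕ → ℕ} {ω : Rnd} {T : Fin n → Prop}

/-! ### Storing the neighbourhoods -/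

/-- Arrays 11 and 13 store the neighbourhoods of loose vertices as rows and as a matrix, array 14
the reverse rows, from a vertex to the loose vertices around it. Array 16 counts, for a loose vertex
and a label, the neighbours that stay in the atom. -/
def storeBody : Prog :=
  .seq (.assign 1 (.fld 9 (.reg 0))) <|
  .seq (.assign 2 (.fld 10 (.reg 0))) <|
  .seq (.assign 3 (.lab (.reg 2))) <|
  .seq (.push 11 12 1 2) <|
  .seq (.setFld 13 (.idx (.reg 1) (.reg 2)) (.lit 1)) <|
  .seq (.push 14 15 2 1) <|
  .ite (.fld 7 (.reg 2)) .skip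
    (.setFld 16 (.idx (.reg 1) (.reg 3)) (.bin .add (.fld 16 (.idx (.reg 1) (.reg 3))) (.lit 1)))

def storeLoop : Prog := forLoop 0 (.fld 25 (.lit 0)) storeBody

def rowFst (L : List (Fin n × Fin n)) (u : Fin n) : List (Fin n) :=
  (L.filter fun p => p.1 = u).map Prod.snd

def rowSnd (L : List (Fin n × Fin n)) (x : Fin n) : List (Fin n) :=
  (L.filter fun p => p.2 = x).map Prod.fst

theorem rowFst_concat (L : List (Fin n × Fin n)) (u x : Fin n) :
    rowFst (L ++ [(u, x)]) = Function.update (rowFst L) u (rowFst L u ++ [x]) := by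
  funext w
  by_cases e : w = u
  · subst e; simp [rowFst, List.filter_append]
  · simp [rowFst, List.filter_append, e, Ne.symm e]

theorem rowSnd_concat (L : List (Fin n × Fin n)) (u x : Fin n) :
    rowSnd (L ++ [(u, x)]) = Function.update (rowSnd L) x (rowSnd L x ++ [u]) := by
  funext w
  by_cases e : w = x
  · subst e; simp [rowSnd, List.filter_append]
  · simp [rowSnd, List.filter_append, e, Ne.symm e]

theorem mem_rowFst {L : List (Fin n × Fin n)} {u x : Fin n} : x ∈ rowFst L u ↔ (u, x) ∈ L := by
  simp [rowFst]

theorem mem_rowSnd {L : List (Fin n × Fin n)} {u x : Fin n} : u ∈ rowSnd L x ↔ (u, x) ∈ L := by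
  simp [rowSnd]

theorem nodup_rowFst {L : List (Fin n × Fin n)} (h : L.Nodup) (u : Fin n) : (rowFst L u).Nodup := by
  refine (List.nodup_map_iff_inj_on (h.filter _)).2 ?_
  rintro ⟨a, b⟩ hx ⟨c, d⟩ hy e
  simp only [List.mem_filter, decide_eq_true_eq] at hx hy
  rw [Prod.mk.injEq]
  exact ⟨hx.2.trans hy.2.symm, e⟩

theorem nodup_rowSnd {L : List (Fin n × Fin n)} (h : L.Nodup) (u : Fin n) : (rowSnd L u).Nodup := by
  refine (List.nodup_map_iff_inj_on (h.filter _)).2 ?_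
  rintro ⟨a, b⟩ hx ⟨c, d⟩ hy e
  simp only [List.mem_filter, decide_eq_true_eq] at hx hy
  rw [Prod.mk.injEq]
  exact ⟨e, hx.2.trans hy.2.symm⟩

/-- The number of pairs in `L` that consist of `u` and a vertex outside `T` with label `l`. -/
def cntInto (lab : Fin n → Fin n) (T : Fin n → Prop) (L : List (Fin n × Fin n)) (u l : Fin n) : ℕ :=
  L.countP fun p => p.1 = u ∧ lab p.2 = l ∧ ¬ T p.2

structure StoreInv (lab : Fin n → Fin n) (T : Fin n → Prop) (m₀ : ℕ → ℕ)
    (pre : List (Fin n × Fin n)) (m : ℕ → ℕ) : Prop where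
  frame : Frame [11, 12, 13, 14, 15, 16] m₀ m
  nbrs : Rows m 11 12 (rowFst pre)
  adj : ∀ u x : Fin n, fld m 13 (x * n + u) = if (u, x) ∈ pre then 1 else 0
  into : Rows m 14 15 (rowSnd pre)
  count : ∀ u l : Fin n, fld m 16 (l * n + u) = cntInto lab T pre u l

theorem storeLoop_meets (h : Input lab M D m₀) {L : List (Fin n × Fin n)} (hL : PairVec m₀ L)
    (hz : ∀ r ∈ [11, 12, 13, 14, 15, 16], ∀ i, fld m₀ r i = 0)
    (hT : ∀ u : Fin n, fld m₀ 7 u = if T u then 1 else 0) (s : State) (hs : s.mem = m₀) :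
    Meets ω storeLoop s ((storeBody.time + 60) * (L.length + 1))
      fun s' => StoreInv lab T m₀ L s'.mem := by
  have z12 := hz 12 (by simp)
  have z13 := hz 13 (by simp)
  have z15 := hz 15 (by simp)
  have z16 := hz 16 (by simp)
  refine (Meets.forListStraight L (StoreInv lab T m₀)
    (by simp [storeBody, Prog.Straight, Prog.setFld, Prog.push])
    (by simp [storeBody, Prog.Keeps, Prog.setFld, Prog.push])
    ?_ ?_ ?_).mono (Nat.mul_le_mul_right _ (by simp [Expr.cost, Expr.fld, Expr.fldAddr]))
      fun _ h => h
  · rw [hs]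
    exact ⟨Frame.refl _ _, fun v => by simp [z12, rowFst], by simp [z13],
      fun v => by simp [z15, rowSnd], by simp [z16, cntInto]⟩
  · intro pre s hI
    rw [Expr.val_fld, ← hL.1]; exact hI.frame.fld _ (by norm_num) (by simp) _
  · rintro pre ⟨a, b⟩ post hD s hI hx
    have hi := h.frame hI.frame
    have e1 : fld s.mem 9 pre.length = a := by
      rw [hI.frame.fld 9 (by norm_num) (by simp), (hL.2 _ (by simp [hD])).1]; simp [hD]
    have e2 : fld s.mem 10 pre.length = b := by
      rw [hI.frame.fld 10 (by norm_num) (by simp), (hL.2 _ (by simp [hD])).2]; simp [hD]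
    have e3 := hI.frame.fld 7 (by norm_num) (by simp)
    set m₁ := pushRow (setFld (pushRow s.mem 11 12 a b) 13 (b * n + a) 1) 14 15 b a with hm₁
    have hev : (storeBody.eval s).mem = if T b then m₁ else
        setFld m₁ 16 (lab b * n + a) (fld s.mem 16 (lab b * n + a) + 1) := by
      simp [storeBody, Prog.eval, Prog.eval_setFld, Prog.eval_push, Expr.val_idx,
        Expr.val_lab, Expr.val_fld, Expr.val, Op.apply, hx, hi.zero, e1, e2, hi.lab, e3, hT, hm₁]
      grind
    have hf₁ : Frame [11, 12, 13, 14, 15, 16] m₀ m₁ :=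
      (((hI.frame.push (by norm_num) (by norm_num) (by simp) (by simp) _ _).set (by norm_num)
        (by simp) _ _).push (by norm_num) (by norm_num) (by simp) (by simp) _ _)
    have hr1 : Rows m₁ 11 12 (rowFst (pre ++ [(a, b)])) := by
      rw [rowFst_concat]
      exact (hI.nbrs.push (by norm_num) (by norm_num) (by norm_num) hi.zero a b).congr
        (by simp [hm₁]) (by simp [hm₁])
    have hr2 : Rows m₁ 14 15 (rowSnd (pre ++ [(a, b)])) := by
      rw [rowSnd_concat]
      exact (hI.into.congr (by simp) (by simp)).push (by norm_num) (by norm_num)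
        (by norm_num) (by simp [hi.zero]) b a
    have hadj : ∀ u x : Fin n, fld m₁ 13 (x * n + u) =
        if (u, x) ∈ pre ++ [(a, b)] then 1 else 0 := by
      intro u x
      simp [hm₁, idx_inj u.2 a.2, Fin.val_inj, hI.adj, and_comm (a := x = b)]
      by_cases e : u = a ∧ x = b <;> simp [e]
    have h16 : ∀ i, fld m₁ 16 i = fld s.mem 16 i := by simp [hm₁]
    have hcnt : ∀ u l, cntInto lab T (pre ++ [(a, b)]) u l =
        cntInto lab T pre u l + if u = a ∧ l = lab b ∧ ¬ T b then 1 else 0 := by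
      intro u l
      simp [cntInto, List.countP_append, List.countP_singleton, eq_comm (a := a),
        eq_comm (a := lab b)]
    rw [hev]
    by_cases hb : T b
    · rw [if_pos hb]
      exact ⟨hf₁, hr1, hadj, hr2, fun u l => by rw [h16, hI.count, hcnt]; simp [hb]⟩
    · rw [if_neg hb]
      refine ⟨hf₁.set (by norm_num) (by simp) _ _, hr1.congr (by simp) (by simp),
        fun u x => by rw [← hadj]; simp, hr2.congr (by simp) (by simp), fun u l => ?_⟩
      rw [hcnt]
      simp only [fld_setFld_same (show 16 < 32 by norm_num), idx_inj u.2 a.2, Fin.val_inj, h16,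
        hI.count, hb, not_false_eq_true, and_comm (a := l = lab b)]
      by_cases e : u = a ∧ l = lab b
      · simp [e]
      · simp [e]

/-! ### Admissible pairs of loose vertices and atoms -/

/-- Besides a null cursor, a positive number of walked vertices is required, since a cluster never
visited has a null cursor too. Array 12 holds the size of the closed neighbourhood, hence the
subtraction of 1. Array 17 prevents repetitions, as the same atom is met through each of its
neighbours. -/
def linkBody (N : ℕ) : Prog :=
  .seq (.assign 1 (.fld 9 (.reg 0))) <|
  .seq (.assign 2 (.fld 10 (.reg 0))) <|
  .seq (.assign 3 (.lab (.reg 2))) <|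
  .ite (.fld 7 (.reg 2)) .skip <|
  .ite (.fld 4 (.reg 3)) .skip <|
  .ite (.bin .lt (.lit 0) (.fld 3 (.reg 3)))
    (.ite (.bin .lt (.bin .mul (.lit 5) (.fld 16 (.idx (.reg 1) (.reg 3))))
      (.bin .mul (.lit 2) (.fld 3 (.reg 3)))) .skip <|
    .ite (.bin .lt (.bin .mul (.lit (3 * N)) (.fld 3 (.reg 3)))
      (.bin .mul (.lit 5) (.bin .sub (.fld 12 (.reg 1)) (.lit 1)))) .skip <|
    .ite (.fld 17 (.idx (.reg 1) (.reg 3))) .skip <|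
    .seq (.setFld 17 (.idx (.reg 1) (.reg 3)) (.lit 1)) <|
    .seq (.push 18 19 3 1) (.push 20 21 1 3))
    .skip

def linkLoop (N : ℕ) : Prog := forLoop 0 (.fld 25 (.lit 0)) (linkBody N)

/-- Some pair in `L` consists of `u` and a vertex with label `l` and satisfies `Q`. -/
def Linked (lab : Fin n → Fin n) (Q : Fin n → Fin n → Prop) (L : List (Fin n × Fin n))
    (u l : Fin n) : Prop := ∃ x, (u, x) ∈ L ∧ lab x = l ∧ Q u x

structure LinkInv (lab : Fin n → Fin n) (Q : Fin n → Fin n → Prop) (m₀ : ℕ → ℕ)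
    (pre : List (Fin n × Fin n)) (m : ℕ → ℕ) : Prop where
  frame : Frame [17, 18, 19, 20, 21] m₀ m
  flag : ∀ u l : Fin n, fld m 17 (l * n + u) = if Linked lab Q pre u l then 1 else 0
  atoms : ∃ A : Fin n → List (Fin n), Rows m 18 19 A ∧ ∀ l, (A l).Nodup ∧
    ∀ u, u ∈ A l ↔ Linked lab Q pre u l
  verts : ∃ A : Fin n → List (Fin n), Rows m 20 21 A ∧ ∀ u, (A u).Nodup ∧
    ∀ l, l ∈ A u ↔ Linked lab Q pre u l

theorem nodup_mem_update {A : Fin n → List (Fin n)} {R : Fin n → Fin n → Prop}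
    (hA : ∀ l, (A l).Nodup ∧ ∀ u, u ∈ A l ↔ R u l) {a b : Fin n} (h : ¬ R a b) (l : Fin n) :
    (Function.update A b (A b ++ [a]) l).Nodup ∧
      ∀ u, u ∈ Function.update A b (A b ++ [a]) l ↔ R u l ∨ u = a ∧ l = b := by
  by_cases e : l = b
  · subst e
    rw [Function.update_self]
    refine ⟨List.nodup_append.2 ⟨(hA l).1, by simp, ?_⟩, fun u => by simp [(hA l).2]⟩
    rintro x hx y hy rfl
    rw [List.mem_singleton] at hy
    subst hy
    exact h (((hA l).2 x).1 hx)
  · rw [Function.update_of_ne e]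
    simpa [e] using hA l

theorem linkLoop_meets {N : ℕ} (h : Input lab M D m₀) {L : List (Fin n × Fin n)}
    (hL : PairVec m₀ L) (hz : ∀ r ∈ [17, 18, 19, 20, 21], ∀ i, fld m₀ r i = 0)
    {Q : Fin n → Fin n → Prop}
    (hQ : ∀ u x, (u, x) ∈ L → (Q u x ↔ fld m₀ 7 x = 0 ∧ fld m₀ 4 (lab x) = 0 ∧
      0 < fld m₀ 3 (lab x) ∧ 2 * fld m₀ 3 (lab x) ≤ 5 * fld m₀ 16 (lab x * n + u) ∧
      5 * (fld m₀ 12 u - 1) ≤ 3 * N * fld m₀ 3 (lab x)))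
    (s : State) (hs : s.mem = m₀) :
    Meets ω (linkLoop N) s (((linkBody N).time + 60) * (L.length + 1))
      fun s' => LinkInv lab Q m₀ L s'.mem := by
  have z17 := hz 17 (by simp)
  have z19 := hz 19 (by simp)
  have z21 := hz 21 (by simp)
  refine (Meets.forListStraight L (LinkInv lab Q m₀)
    (by simp [linkBody, Prog.Straight, Prog.setFld, Prog.push])
    (by simp [linkBody, Prog.Keeps, Prog.setFld, Prog.push])
    ?_ ?_ ?_).mono (Nat.mul_le_mul_right _ (by simp [Expr.cost, Expr.fld, Expr.fldAddr]))
      fun _ h => h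
  · rw [hs]
    exact ⟨Frame.refl _ _, by simp [z17, Linked], ⟨fun _ => [], fun v => by simp [z19],
      by simp [Linked]⟩, ⟨fun _ => [], fun v => by simp [z21], by simp [Linked]⟩⟩
  · intro pre s hI
    rw [Expr.val_fld, ← hL.1]; exact hI.frame.fld _ (by norm_num) (by simp) _
  · rintro pre ⟨a, b⟩ post hD s hI hx
    have hi := h.frame hI.frame
    have e1 : fld s.mem 9 pre.length = a := by
      rw [hI.frame.fld 9 (by norm_num) (by simp), (hL.2 _ (by simp [hD])).1]; simp [hD]
    have e2 : fld s.mem 10 pre.length = b := by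
      rw [hI.frame.fld 10 (by norm_num) (by simp), (hL.2 _ (by simp [hD])).2]; simp [hD]
    have e3 := hI.frame.fld 3 (by norm_num) (by simp)
    have e4 := hI.frame.fld 4 (by norm_num) (by simp)
    have e7 := hI.frame.fld 7 (by norm_num) (by simp)
    have e12 := hI.frame.fld 12 (by norm_num) (by simp)
    have e16 := hI.frame.fld 16 (by norm_num) (by simp)
    set l := lab b with hl
    have hev : ((linkBody N).eval s).mem = if Q a b ∧ ¬ Linked lab Q pre a l then
        pushRow (pushRow (setFld s.mem 17 (l * n + a) 1) 18 19 l a) 20 21 a l else s.mem := by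
      rw [hQ a b (by simp [hD])]
      simp [linkBody, Prog.eval, Prog.eval_setFld, Prog.eval_push, Expr.val_idx,
        Expr.val_lab, Expr.val_fld, Expr.val, Op.apply, hx, hi.zero, e1, e2, hi.lab, e3, e4, e7,
        e12, e16, hI.flag, ← hl]
      grind
    have hlink : ∀ u l', Linked lab Q (pre ++ [(a, b)]) u l' ↔
        Linked lab Q pre u l' ∨ Q a b ∧ u = a ∧ l' = l := by
      intro u l'
      simp only [Linked, List.mem_append, List.mem_singleton, Prod.mk.injEq]
      constructor
      · rintro ⟨x, h1 | ⟨rfl, rfl⟩, h2, h3⟩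
        · exact Or.inl ⟨x, h1, h2, h3⟩
        · exact Or.inr ⟨h3, rfl, h2.symm⟩
      · rintro (⟨x, h1, h2, h3⟩ | ⟨h1, rfl, rfl⟩)
        · exact ⟨x, Or.inl h1, h2, h3⟩
        · exact ⟨b, Or.inr ⟨rfl, rfl⟩, rfl, h1⟩
    rw [hev]
    by_cases hc : Q a b ∧ ¬ Linked lab Q pre a l
    · rw [if_pos hc]
      refine ⟨((hI.frame.set (by norm_num) (by simp) _ _).push (by norm_num)
        (by norm_num) (by simp) (by simp) _ _).push (by norm_num) (by norm_num) (by simp)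
        (by simp) _ _, fun u l' => ?_, ?_, ?_⟩
      · simp [idx_inj u.2 a.2, Fin.val_inj, hI.flag, hlink, hc.1]
        by_cases e : u = a ∧ l' = l <;> simp [e, and_comm]
      · obtain ⟨A, hA, hA'⟩ := hI.atoms
        refine ⟨_, ((hA.congr (m' := setFld s.mem 17 (l * n + a) 1) (by simp)
          (by simp)).push (by norm_num) (by norm_num) (by norm_num) (by simp [hi.zero])
          l a).congr (by simp) (by simp), fun l' => ?_⟩
        simp only [hlink, hc.1, true_and]
        exact nodup_mem_update hA' hc.2 l'
      · obtain ⟨A, hA, hA'⟩ := hI.verts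
        refine ⟨_, ((hA.congr (by simp) (by simp)).push (by norm_num) (by norm_num)
          (by norm_num) (by simp [hi.zero]) a l), fun u => ?_⟩
        simp only [hlink, hc.1, true_and]
        have := nodup_mem_update (R := fun l u => Linked lab Q pre u l) hA' hc.2 u
        simpa only [and_comm] using this
    · rw [if_neg hc]
      have : ∀ u l', Linked lab Q (pre ++ [(a, b)]) u l' ↔ Linked lab Q pre u l' := by
        intro u l'
        rw [hlink]
        refine or_iff_left_of_imp ?_
        rintro ⟨h1, rfl, rfl⟩
        by_contra h2
        exact hc ⟨h1, h2⟩
      refine ⟨hI.frame, ?_, ?_, ?_⟩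
      · simp only [this]; exact hI.flag
      · simp only [this]; exact hI.atoms
      · simp only [this]; exact hI.verts

end Passes

end

/-! ### Moving loose vertices to lists of their own -/

section

variable {n : ℕ}

/-! ### Linked lists -/

section Chains

/-- The vertices with label `c` form the doubly linked list `M c`. -/
structure Chains (lab : Fin n → ℕ) (M : ℕ → List (Fin n)) (m : ℕ → ℕ) : Prop where
  zero : m 0 = n
  label : ∀ v : Fin n, m (2 + v) = lab v
  lab_lt : ∀ v : Fin n, lab v < 2 * n
  nodup : ∀ c, (M c).Nodup
  mem : ∀ c x, x ∈ M c ↔ lab x = c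
  head : ∀ c < 2 * n, m (2 + 3 * n + c) = ptr (M c).head?
  link : ∀ c A (v : Fin n) B, M c = A ++ v :: B →
    m (2 + n + v) = ptr B.head? ∧ m (2 + 2 * n + v) = ptr A.getLast?

theorem Input.chains {lab : Fin n → Fin n} {M : Fin n → List (Fin n)} {D : List (Fin n × Fin n)}
    {m : ℕ → ℕ} (h : Input lab M D m) (hM : ∀ l, (M l).Nodup) (hmem : ∀ l x, x ∈ M l ↔ lab x = l) :
    Chains (fun v => (lab v : ℕ)) (fun c => if hc : c < n then M ⟨c, hc⟩ else []) m := by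
  refine ⟨h.zero, h.lab, fun v => by omega, fun c => ?_, fun c x => ?_, fun c hc => ?_,
    fun c A v B hc => ?_⟩
  · split
    · exact hM _
    · simp
  · split
    · rw [hmem, Fin.ext_iff]
    · simp only [List.not_mem_nil, false_iff]; omega
  · split
    · rename_i hc'
      rw [List.head?_eq_getElem?]
      exact h.head ⟨c, hc'⟩
    · have := h.unused ⟨c - n, by omega⟩
      rw [show n + (⟨c - n, by omega⟩ : Fin n) = c by simp; omega] at this
      rw [this]; rfl
  · split at hc
    · rename_i hc'
      have h1 := h.next ⟨c, hc'⟩ A.length (by simp [hc])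
      have h2 := h.prev ⟨c, hc'⟩ A.length (by simp [hc])
      simp only [hc, List.getElem_append_right le_rfl, Nat.sub_self, List.getElem_cons_zero] at h1 h2
      rw [h1, h2]
      constructor
      · congr 1
        rw [List.getElem?_append_right (by omega), List.head?_eq_getElem?]; simp
      · congr 1
        split
        · rename_i h0; rw [List.length_eq_zero_iff.1 h0]; rfl
        · rw [List.getElem?_append_left (by omega), List.getLast?_eq_getElem?]
    · simp at hc

theorem ptr_getLast? {A : List (Fin n)} {v : Fin n} (h : ptr A.getLast? = v + 1) :
    A.getLast? = some v := by
  cases hA : A.getLast? with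
  | none => simp [hA, ptr] at h
  | some w => simp only [hA, ptr, Nat.add_right_cancel_iff] at h; rw [Fin.ext h]

theorem ptr_head? {A : List (Fin n)} {v : Fin n} (h : ptr A.head? = v + 1) :
    A.head? = some v := by
  cases hA : A.head? with
  | none => simp [hA, ptr] at h
  | some w => simp only [hA, ptr, Nat.add_right_cancel_iff] at h; rw [Fin.ext h]

/-- Moving the vertex `u` from its list to the new list `d`. -/
theorem Chains.unlink {lab : Fin n → ℕ} {M : ℕ → List (Fin n)} {m m' : ℕ → ℕ}
    (h : Chains lab M m) {u : Fin n} {d : ℕ} (hd : d < 2 * n) (hnew : M d = []) {p q : ℕ}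
    (hq : m (2 + n + u) = q) (hp : m (2 + 2 * n + u) = p) (h0 : m' 0 = m 0)
    (hlab : ∀ v : Fin n, m' (2 + v) = if v = u then d else m (2 + v))
    (hnext : ∀ v : Fin n, m' (2 + n + v) =
      if v = u then 0 else if p = v + 1 then q else m (2 + n + v))
    (hprev : ∀ v : Fin n, m' (2 + 2 * n + v) =
      if v = u then 0 else if q = v + 1 then p else m (2 + 2 * n + v))
    (hhead : ∀ c < 2 * n, m' (2 + 3 * n + c) =
      if c = d then (u : ℕ) + 1 else if p = 0 ∧ c = lab u then q else m (2 + 3 * n + c)) :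
    Chains (Function.update lab u d)
      (fun c => if c = d then [u] else (M c).filter fun w => w ≠ u) m' := by
  have hul : u ∈ M (lab u) := (h.mem _ u).2 rfl
  obtain ⟨A, B, hAB⟩ := List.append_of_mem hul
  obtain ⟨hq', hp'⟩ := h.link _ A u B hAB
  rw [hq] at hq'
  rw [hp] at hp'
  have hdu : lab u ≠ d := fun e => by rw [e, hnew] at hul; simp at hul
  have hnd := h.nodup (lab u)
  rw [hAB] at hnd
  have huA : u ∉ A := fun hx => by
    rw [List.nodup_append] at hnd; exact hnd.2.2 u hx u (by simp) rfl
  have huB : u ∉ B := fun hx => by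
    rw [List.nodup_append, List.nodup_cons] at hnd; exact hnd.2.1.1 hx
  have hAB' : ∀ x ∈ A, x ∉ B := fun x hx hx' => by
    rw [List.nodup_append] at hnd; exact hnd.2.2 x hx x (by simp [hx']) rfl
  have hfil : (M (lab u)).filter (fun w => w ≠ u) = A ++ B := by
    rw [hAB, List.filter_append, List.filter_cons]
    simp only [ne_eq, not_true_eq_false, decide_false, Bool.false_eq_true, if_false]
    rw [List.filter_eq_self.2, List.filter_eq_self.2]
    · intro a ha; simp; rintro rfl; exact huB ha
    · intro a ha; simp; rintro rfl; exact huA ha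
  have hother : ∀ c, c ≠ lab u → (M c).filter (fun w => w ≠ u) = M c := fun c hc => by
    refine List.filter_eq_self.2 fun a ha => ?_
    simp only [ne_eq, decide_not, Bool.not_eq_eq_eq_not, Bool.not_true, decide_eq_false_iff_not]
    rintro rfl; exact hc ((h.mem c a).1 ha).symm
  have hpA : ∀ v : Fin n, p = v + 1 → v ∈ A := fun v hv =>
    List.mem_of_getLast? (ptr_getLast? (hp'.symm.trans hv))
  have hqB : ∀ v : Fin n, q = v + 1 → v ∈ B := fun v hv =>
    List.mem_of_head? (ptr_head? (hq'.symm.trans hv))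
  refine ⟨h0.trans h.zero, fun v => ?_, fun v => ?_, fun c => ?_, fun c x => ?_, fun c hc => ?_,
    fun c A' v B' hc => ?_⟩
  · rw [hlab, Function.update_apply, h.label]
  · rw [Function.update_apply]; split
    · exact hd
    · exact h.lab_lt v
  · split
    · simp
    · exact (h.nodup c).filter _
  · rw [Function.update_apply]
    split
    · rename_i e; subst e
      rw [List.mem_singleton]
      by_cases e : x = u
      · simp [e]
      · simp only [e, if_false, false_iff]
        intro hx; have := (h.mem c x).2 hx; rw [hnew] at this; simp at this
    · rename_i e
      simp only [List.mem_filter, h.mem, ne_eq, decide_not, Bool.not_eq_eq_eq_not, Bool.not_true,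
        decide_eq_false_iff_not]
      by_cases e' : x = u
      · simp [e', Ne.symm e]
      · simp [e']
  · rw [hhead c hc]
    split
    · rfl
    · by_cases e : c = lab u
      · subst e
        rw [hfil]
        by_cases hA : A = []
        · subst hA
          rw [if_pos ⟨by rw [hp']; rfl, rfl⟩, hq']; rfl
        · obtain ⟨A₁, a, rfl⟩ := List.eq_nil_or_concat A |>.resolve_left hA
          rw [if_neg (by rw [hp']; simp [ptr]), h.head _ hc, hAB]
          cases A₁ <;> rfl
      · rw [if_neg (by tauto), hother c e, h.head c hc]
  · rw [hnext, hprev]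
    split at hc
    · have hv : A' = [] ∧ v = u ∧ B' = [] := by
        cases A' with
        | nil => simp at hc; exact ⟨rfl, hc.1.symm, hc.2⟩
        | cons a A' => simp at hc
      obtain ⟨rfl, rfl, rfl⟩ := hv
      simp [ptr]
    · rename_i hcd
      by_cases e : c = lab u
      · subst e
        rw [hfil] at hc
        -- The vertex `u` sat between `A` and `B`. Only the last vertex of `A` and the first vertex
        -- of `B` get a new link, so it matters on which side of the gap `v` lies and whether it is
        -- adjacent to it.
        rcases List.append_eq_append_iff.1 hc with ⟨C, h1, h2⟩ | ⟨C, h1, h2⟩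
        · -- `v` lies in `B`
          have hvB : v ∈ B := by rw [h2]; simp
          have hvu : v ≠ u := fun e => huB (e ▸ hvB)
          have hvp : p ≠ v + 1 := fun e => hAB' v (hpA v e) hvB
          rw [if_neg hvu, if_neg hvp, if_neg hvu]
          have hl := h.link (lab u) (A ++ u :: C) v B' (by rw [hAB, h2]; simp)
          refine ⟨hl.1, ?_⟩
          cases C with
          | nil =>
            simp only [List.nil_append, List.append_nil] at h1 h2
            rw [hq', h2, if_pos (show ptr (v :: B').head? = v + 1 from rfl), hp', h1]
          | cons b C =>
            rw [if_neg, hl.2, h1]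
            · congr 1
              rw [List.getLast?_append, List.getLast?_append]; simp [List.getLast?_cons]
            · intro e
              rw [hq', h2] at e
              have : b = v := by
                have := ptr_head? e
                simpa using this
              subst this
              rw [List.nodup_append, List.nodup_cons, h2] at hnd
              have := hnd.2.1.2
              simp at this
        · cases C with
          | nil =>
            simp only [List.nil_append, List.append_nil] at h1 h2
            have hvB : v ∈ B := by rw [← h2]; simp
            have hvu : v ≠ u := fun e => huB (e ▸ hvB)
            have hvp : p ≠ v + 1 := fun e => hAB' v (hpA v e) hvB
            rw [if_neg hvu, if_neg hvp, if_neg hvu]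
            have hl := h.link (lab u) (A ++ [u]) v B' (by rw [hAB, ← h2]; simp)
            refine ⟨hl.1, ?_⟩
            rw [hq', ← h2, if_pos (show ptr (v :: B').head? = v + 1 from rfl), hp', h1]
          | cons b C =>
            simp only [List.cons_append, List.cons.injEq] at h2
            obtain ⟨rfl, rfl⟩ := h2
            have hvA : v ∈ A := by rw [h1]; simp
            have hvu : v ≠ u := fun e => huA (e ▸ hvA)
            have hvq : q ≠ v + 1 := fun e => hAB' v hvA (hqB v e)
            rw [if_neg hvu, if_neg hvu, if_neg hvq]
            have hl := h.link (lab u) A' v (C ++ u :: B) (by rw [hAB, h1]; simp)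
            refine ⟨?_, hl.2⟩
            cases hC : C.getLast? with
            | none =>
              rw [List.getLast?_eq_none_iff] at hC
              subst hC
              rw [hp', h1, if_pos (by simp [ptr]), hq']; rfl
            | some w =>
              rw [if_neg, hl.1]
              · congr 1
                cases C with
                | nil => simp at hC
                | cons c C => simp
              · intro e
                rw [hp', h1] at e
                have e1 := ptr_getLast? e
                rw [List.getLast?_append, List.getLast?_cons] at e1
                simp [hC] at e1
                subst e1
                rw [h1] at hnd
                have hw := List.mem_of_getLast? hC
                simp only [List.nodup_append, List.nodup_cons] at hnd
                exact hnd.1.2.1.1 hw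
      · rw [hother c e] at hc
        have hvc : lab v = c := (h.mem c v).1 (by rw [hc]; simp)
        have hv : v ∉ M (lab u) := fun hv => e (hvc.symm.trans ((h.mem _ v).1 hv))
        rw [hAB] at hv
        simp only [List.mem_append, List.mem_cons, not_or] at hv
        rw [if_neg hv.2.1, if_neg hv.2.1, if_neg (fun e => hv.1 (hpA v e)),
          if_neg (fun e => hv.2.2 (hqB v e))]
        exact h.link c A' v B' hc

theorem Chains.storesClustering {lab : Fin n → ℕ} {M : ℕ → List (Fin n)} {m : ℕ → ℕ}
    (h : Chains lab M m) {K : Clustering n} (hK : ∀ u v, lab u = lab v ↔ K.part u = K.part v) :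
    StoresClustering (2 * n) K m := by
  refine ⟨fun v => (h.label v).trans_lt (h.lab_lt v), fun u v => ?_, fun v => ?_, fun c hc hv => ?_⟩
  · rw [labelAddr, labelAddr, h.label, h.label, hK]
  · refine ⟨M (lab v), h.nodup _, ?_, ?_, fun i hi => ?_⟩
    · ext x
      rw [List.mem_toFinset, h.mem, hK, part_eq_iff]
    · rw [labelAddr, h.label, headAddr, h.head _ (h.lab_lt v), List.head?_eq_getElem?]
    · have hl := h.link (lab v) ((M (lab v)).take i) (M (lab v))[i] ((M (lab v)).drop (i + 1))
        (by simp)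
      rw [nextAddr, prevAddr, hl.1, hl.2]
      constructor
      · rw [List.head?_drop]
      · congr 1
        split
        · rename_i h0; subst h0; simp
        · rw [List.getLast?_take, if_neg (by assumption)]
          rw [List.getElem?_eq_getElem (show i - 1 < _ by omega)]; rfl
  · rw [headAddr, h.head c hc]
    have : M c = [] := by
      refine List.eq_nil_iff_forall_not_mem.2 fun x hx => hv x ?_
      rw [labelAddr, h.label, (h.mem c x).1 hx]
    rw [this]; rfl

theorem Chains.congr {lab : Fin n → ℕ} {M : ℕ → List (Fin n)} {m m' : ℕ → ℕ}
    (h : Chains lab M m) (hm : ∀ a < 2 + 5 * n, m' a = m a) : Chains lab M m' :=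
  ⟨(hm _ (by omega)).trans h.zero, fun v => (hm _ (by omega)).trans (h.label v), h.lab_lt, h.nodup,
    h.mem, fun c hc => (hm _ (by omega)).trans (h.head c hc), fun c A v B hc => by
      rw [hm _ (by omega), hm _ (by omega)]; exact h.link c A v B hc⟩

theorem Chains.links_le {lab : Fin n → ℕ} {M : ℕ → List (Fin n)} {m : ℕ → ℕ}
    (h : Chains lab M m) (u : Fin n) : m (2 + n + u) ≤ n ∧ m (2 + 2 * n + u) ≤ n := by
  have le : ∀ o : Option (Fin n), ptr o ≤ n := by
    rintro (_ | v)
    · exact Nat.zero_le _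
    · exact v.2
  obtain ⟨A, B, hAB⟩ := List.append_of_mem ((h.mem _ u).2 rfl)
  obtain ⟨h1, h2⟩ := h.link _ A u B hAB
  exact ⟨h1 ▸ le _, h2 ▸ le _⟩

/-! ### Splitting off the loose vertices -/

/-- The memory after the vertex `u` has been moved from the list `l` to the list `d`, where `p` and
`q` are its links. -/
def moveMem (n : ℕ) (m : ℕ → ℕ) (u l d p q : ℕ) : ℕ → ℕ :=
  let m₁ := if p = 0 then Function.update m (2 + 3 * n + l) q
    else Function.update m (2 + n + (p - 1)) q
  let m₂ := if q = 0 then m₁ else Function.update m₁ (2 + 2 * n + (q - 1)) p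
  Function.update (Function.update (Function.update (Function.update m₂ (2 + u) d)
    (2 + n + u) 0) (2 + 2 * n + u) 0) (2 + 3 * n + d) (u + 1)

theorem moveMem_apply (m : ℕ → ℕ) (u l d p q a : ℕ) : moveMem n m u l d p q a =
    if a = 2 + 3 * n + d then u + 1 else if a = 2 + 2 * n + u then 0 else
    if a = 2 + n + u then 0 else if a = 2 + u then d else
    if q ≠ 0 ∧ a = 2 + 2 * n + (q - 1) then p else
    if p ≠ 0 ∧ a = 2 + n + (p - 1) then q else
    if p = 0 ∧ a = 2 + 3 * n + l then q else m a := by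
  unfold moveMem
  by_cases h1 : p = 0 <;> by_cases h2 : q = 0 <;> simp [h1, h2, Function.update_apply]

theorem moveMem_of_ne {m : ℕ → ℕ} {u l d p q a : ℕ} (hu : u < n) (hl : l < 2 * n)
    (hd : d < 2 * n) (hp : p ≤ n) (hq : q ≤ n) (ha : a < 2 ∨ 2 + 5 * n ≤ a) :
    moveMem n m u l d p q a = m a := by
  rw [moveMem_apply, if_neg (by omega), if_neg (by omega), if_neg (by omega), if_neg (by omega),
    if_neg (by omega), if_neg (by omega), if_neg (by omega)]

theorem Chains.moveMem {lab : Fin n → ℕ} {M : ℕ → List (Fin n)} {m : ℕ → ℕ}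
    (h : Chains lab M m) (u : Fin n) {d : ℕ} (hd : d < 2 * n) (hnew : M d = []) :
    Chains (Function.update lab u d)
      (fun c => if c = d then [u] else (M c).filter fun w => w ≠ u)
      (moveMem n m u (lab u) d (m (2 + 2 * n + u)) (m (2 + n + u))) := by
  obtain ⟨hq, hp⟩ := h.links_le u
  have hl := h.lab_lt u
  have hne : lab u ≠ d := fun e => by
    have := (h.mem _ u).2 e; rw [hnew] at this; simp at this
  generalize hpe : m (2 + 2 * n + u) = p at *
  generalize hqe : m (2 + n + u) = q at *
  refine h.unlink hd hnew hqe hpe (moveMem_of_ne u.2 hl hd hp hq (by omega)) ?_ ?_ ?_ ?_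
  · intro v
    rw [moveMem_apply, if_neg (by omega), if_neg (by omega), if_neg (by omega)]
    by_cases e : v = u
    · rw [if_pos (by omega), if_pos e]
    · have : (v : ℕ) ≠ u := fun h => e (Fin.ext h)
      rw [if_neg (by omega), if_neg e, if_neg (by omega), if_neg (by omega), if_neg (by omega)]
  · intro v
    rw [moveMem_apply, if_neg (by omega), if_neg (by omega)]
    by_cases e : v = u
    · rw [if_pos (by omega), if_pos e]
    · have : (v : ℕ) ≠ u := fun h => e (Fin.ext h)
      rw [if_neg (by omega), if_neg (by omega), if_neg e, if_neg (by omega)]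
      by_cases e' : p = v + 1
      · rw [if_pos (by omega), if_pos e']
      · rw [if_neg (by omega), if_neg e', if_neg (by omega)]
  · intro v
    rw [moveMem_apply, if_neg (by omega)]
    by_cases e : v = u
    · rw [if_pos (by omega), if_pos e]
    · have : (v : ℕ) ≠ u := fun h => e (Fin.ext h)
      rw [if_neg (by omega), if_neg (by omega), if_neg (by omega), if_neg e]
      by_cases e' : q = v + 1
      · rw [if_pos (by omega), if_pos e']
      · rw [if_neg (by omega), if_neg e', if_neg (by omega), if_neg (by omega)]
  · intro c hc
    rw [moveMem_apply]
    by_cases e : c = d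
    · rw [if_pos (by omega), if_pos e]
    · rw [if_neg (by omega), if_neg (by omega), if_neg (by omega), if_neg (by omega),
        if_neg (by omega), if_neg (by omega), if_neg e]
      by_cases e' : p = 0 ∧ c = lab u
      · rw [if_pos (by omega), if_pos e']
      · rw [if_neg (by omega), if_neg e']

/-- Removal from a doubly linked list in constant time. The vertex then forms a new list under a
fresh identifier; the next one is kept in array 26 and starts at n, above all input labels. -/
def splitBody : Prog :=
  .seq (.assign 1 (.fld 8 (.reg 0))) <|
  .seq (.assign 2 (.lab (.reg 1))) <|
  .seq (.assign 3 (.next (.reg 1))) <|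
  .seq (.assign 4 (.load (.bin .add (.bin .add (.lit 2) (.bin .mul (.lit 2) .numV)) (.reg 1)))) <|
  .seq (.assign 5 (.fld 26 (.lit 0))) <|
  .seq (.assign 6 .numV) <|
  .seq (.setFld 26 (.lit 0) (.bin .add (.reg 5) (.lit 1))) <|
  .seq (.ite (.reg 4)
    (.store (.bin .add (.bin .add (.lit 2) (.reg 6)) (.bin .sub (.reg 4) (.lit 1))) (.reg 3))
    (.store (.bin .add (.bin .add (.lit 2) (.bin .mul (.lit 3) (.reg 6))) (.reg 2)) (.reg 3))) <|
  .seq (.ite (.reg 3)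
    (.store (.bin .add (.bin .add (.lit 2) (.bin .mul (.lit 2) (.reg 6)))
      (.bin .sub (.reg 3) (.lit 1))) (.reg 4)) .skip) <|
  .seq (.store (.bin .add (.lit 2) (.reg 1)) (.reg 5)) <|
  .seq (.store (.bin .add (.bin .add (.lit 2) (.reg 6)) (.reg 1)) (.lit 0)) <|
  .seq (.store (.bin .add (.bin .add (.lit 2) (.bin .mul (.lit 2) (.reg 6))) (.reg 1)) (.lit 0)) <|
  .store (.bin .add (.bin .add (.lit 2) (.bin .mul (.lit 3) (.reg 6))) (.reg 5))
    (.bin .add (.reg 1) (.lit 1))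

def splitLoop : Prog :=
  .seq (.setFld 26 (.lit 0) .numV) (forLoop 0 (.fld 24 (.lit 0)) splitBody)

/-- A `Frame` cannot describe this pass, because labels, links and heads of the input region are
overwritten. The invariant states instead which arrays survive and what the lists are now. -/
structure SplitInv (lab : Fin n → Fin n) (m₀ : ℕ → ℕ) (pre : List (Fin n)) (m : ℕ → ℕ) :
    Prop where
  zero : m 0 = m₀ 0
  one : m 1 = m₀ 1
  fld : ∀ r < 32, r ≠ 26 → ∀ i, fld m r i = fld m₀ r i
  next : CorrClust.fld m 26 0 = n + pre.length
  chains : ∃ lab' M', Chains lab' M' m ∧ (∀ v, v ∉ pre → lab' v = lab v) ∧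
    ∀ i (hi : i < pre.length), lab' pre[i] = n + i

theorem splitLoop_meets {lab : Fin n → Fin n} {M : Fin n → List (Fin n)}
    {D : List (Fin n × Fin n)} {m₀ : ℕ → ℕ} {ω : Rnd} (h : Input lab M D m₀)
    (hM : ∀ l, (M l).Nodup) (hmem : ∀ l x, x ∈ M l ↔ lab x = l)
    {S : List (Fin n)} (hS : Vec m₀ 8 24 S) (hnd : S.Nodup) (s : State) (hs : s.mem = m₀) :
    Meets ω splitLoop s ((splitBody.time + 200) * (S.length + 1))
      fun s' => SplitInv lab m₀ S s'.mem := by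
  have hSn : S.length ≤ n := by simpa using hnd.length_le_card
  refine Meets.mono (B₁ := 60 + (splitBody.time + 60) * (S.length + 1))
    (Meets.seq (R := fun s' => SplitInv lab m₀ [] s'.mem) ?_ ?_) (by nlinarith) (fun _ h => h)
  · refine (Prog.Straight.meets (by simp [Prog.Straight, Prog.setFld]) ?_).mono (B₁ := _)
      (by simp [Prog.time, Expr.cost, Prog.setFld, Expr.fldAddr]) (fun _ h => h)
    have hb : memBase m₀ = 2 + (5 * n + D.length) := by
      rw [CorrClust.memBase, h.zero, h.one]
    simp only [Prog.eval_setFld, Expr.val, hs]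
    refine ⟨by simp, by simp, fun r hr hn i => by simp [hr, hn], by simp [h.zero], _, _,
      (h.chains hM hmem).congr fun a ha => setFld_of_lt (by omega) _ _ _, by simp, by simp⟩
  · intro s hs
    refine (Meets.forListStraight S (SplitInv lab m₀)
      (by simp [splitBody, Prog.Straight, Prog.setFld]) (by simp [splitBody, Prog.Keeps,
        Prog.setFld]) hs ?_ ?_).mono
      (Nat.mul_le_mul_right _ (by simp [Expr.cost, Expr.fld, Expr.fldAddr])) fun _ h => h
    · intro pre s hI
      rw [Expr.val_fld, ← hS.1]; exact hI.fld _ (by norm_num) (by norm_num) _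
    · rintro pre u post hD s hI hx
      obtain ⟨lab', M', hc, hl1, hl2⟩ := hI.chains
      have e1 : CorrClust.fld s.mem 8 pre.length = u := by
        rw [hI.fld 8 (by norm_num) (by norm_num), hS.2 _ (by simp [hD])]; simp [hD]
      have hpre : pre.length < n := by
        have : pre.length < S.length := by simp [hD]
        omega
      set d := n + pre.length with hd
      have hb : memBase s.mem = 2 + (5 * n + D.length) := by
        rw [CorrClust.memBase, hc.zero, hI.one, h.one]
      set m₁ := setFld s.mem 26 0 (d + 1) with hm₁
      have hlow : ∀ a < 2 + 5 * n, m₁ a = s.mem a := fun a ha => setFld_of_lt (by omega) _ _ _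
      have hc₁ : Chains lab' M' m₁ := hc.congr hlow
      have hu : u ∉ pre := by
        intro hu
        rw [hD, List.nodup_append] at hnd
        exact hnd.2.2 u hu u (by simp) rfl
      have hev : (splitBody.eval s).mem =
          moveMem n m₁ u (lab' u) d (m₁ (2 + 2 * n + u)) (m₁ (2 + n + u)) := by
        rw [hlow _ (by omega), hlow _ (by omega)]
        simp [splitBody, Prog.eval, Prog.eval_setFld, Expr.val_next, Expr.val_lab, Expr.val_fld,
          Expr.val, Op.apply, hx, e1, hc.zero, hc.label, hI.next, ← hd, ← hm₁, moveMem]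
        split <;> split <;> simp_all
      obtain ⟨hq, hp⟩ := hc₁.links_le u
      -- Labels from the input are below n, and the labels given so far are below n + |pre|.
      have hnew : M' d = [] := by
        refine List.eq_nil_iff_forall_not_mem.2 fun x hx => ?_
        have hx' := (hc.mem _ x).1 hx
        by_cases hxp : x ∈ pre
        · obtain ⟨i, hi, rfl⟩ := List.getElem_of_mem hxp
          rw [hl2 i hi] at hx'
          omega
        · rw [hl1 x hxp] at hx'
          omega
      have hout : ∀ a, a < 2 ∨ 2 + 5 * n ≤ a → (splitBody.eval s).mem a = m₁ a := fun a ha => by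
        rw [hev]
        exact moveMem_of_ne u.2 (hc.lab_lt u) (by omega) hp hq ha
      have hbase : memBase (splitBody.eval s).mem = memBase m₁ := by
        rw [CorrClust.memBase, CorrClust.memBase, hout 0 (by omega), hout 1 (by omega)]
      have hfld : ∀ r i, CorrClust.fld (splitBody.eval s).mem r i = CorrClust.fld m₁ r i := by
        intro r i
        rw [CorrClust.fld, CorrClust.fld, fldAddr, fldAddr, hbase]
        refine hout _ (Or.inr ?_)
        rw [hm₁, memBase_setFld, hb]
        omega
      refine ⟨?_, ?_, fun r hr hn i => ?_, ?_, _, _, hev ▸ hc₁.moveMem u (by omega) hnew,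
        fun v hv => ?_, fun i hi => ?_⟩
      · rw [hout 0 (by omega), hm₁, setFld_zero, hI.zero]
      · rw [hout 1 (by omega), hm₁, setFld_one, hI.one]
      · rw [hfld, hm₁, fld_setFld_ne (by norm_num) hr hn, hI.fld r hr hn]
      · rw [hfld, hm₁]; simp [hd]; omega
      · simp only [List.mem_append, List.mem_singleton, not_or] at hv
        rw [Function.update_of_ne hv.2, hl1 v hv.1]
      · simp only [List.length_append, List.length_singleton] at hi
        by_cases e : i = pre.length
        · subst e; simp [hd]
        · rw [List.getElem_append_left (by omega), Function.update_of_ne, hl2]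
          exact fun e => hu (e ▸ List.getElem_mem _)

end Chains

end

/-! ### What the passes compute, in terms of the graph -/

section

variable {n : ℕ}

section Spec
open Classical

variable {G : SimpleGraph (Fin n)} {P : Clustering n} {lab : Fin n → Fin n}
  {M : Fin n → List (Fin n)} {D : List (Fin n × Fin n)} {N : ℕ}

theorem InputSpec.mem_iff (h : InputSpec G P lab M D) {v w : Fin n} :
    w ∈ M (lab v) ↔ w ∈ P.part v := by
  rw [h.mem, h.lab_eq, part_eq_iff]

theorem InputSpec.length_eq (h : InputSpec G P lab M D) (v : Fin n) :
    (M (lab v)).length = (P.part v).card := by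
  rw [← List.toFinset_card_of_nodup (h.nodup _)]
  congr 1; ext w; rw [List.mem_toFinset, h.mem_iff]

theorem InputSpec.countP_fst (h : InputSpec G P lab M D) (u : Fin n) :
    D.countP (fun p => p.1 = u) = deg (violation G P) u := by
  have : (D.filter fun p => p.1 = u).length = (rowFst D u).length := by simp [rowFst]
  rw [List.countP_eq_length_filter, this, ← List.toFinset_card_of_nodup (nodup_rowFst h.nodup_viol u),
    deg_eq_card_filter]
  congr 1; ext w
  simp [mem_rowFst, h.mem_viol]

theorem InputSpec.cnt_eq (h : InputSpec G P lab M D) (v : Fin n) :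
    cnt lab D (lab v) = mass G P v := by
  have key : ∀ D : List (Fin n × Fin n), cnt lab D (lab v) =
      ∑ w ∈ P.part v, D.countP fun p => p.1 = w := by
    intro D
    induction D with
    | nil => simp [cnt]
    | cons a D ih =>
      simp only [cnt] at ih
      simp only [cnt, List.countP_cons, Finset.sum_add_distrib, ih, decide_eq_true_eq,
        Finset.sum_ite_eq]
      congr 1
      simp only [h.lab_eq, part_eq_iff]
  rw [key, mass]
  exact Finset.sum_congr rfl fun w _ => h.countP_fst w

theorem deg_le_mass {v : Fin n} : deg (violation G P) v ≤ mass G P v :=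
  Finset.single_le_sum (f := fun w => deg (violation G P) w) (fun _ _ => Nat.zero_le _)
    (mem_part_self P v)

/-- Either condition suffices: the violations at `v` are part of the mass, and a natural number is
at most its square. -/
theorem Loose.card_le {v : Fin n} (h : Loose G P v) : (P.part v).card ≤ 10000 * mass G P v := by
  rcases h with h | h
  · have := deg_le_mass (G := G) (P := P) (v := v)
    omega
  · nlinarith [Nat.zero_le (P.part v).card]

/-- The relation of loose vertices to the vertices of admissible atoms. -/
abbrev CoreAdm (G : SimpleGraph (Fin n)) (P : Clustering n) (N : ℕ) (u v : Fin n) : Prop :=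
  AtomAdm G (coreClustering G P) (Loose G P) (fun v => (P.part v).card) N u v

/-- If `u` comes from the same input cluster, then it is a loose vertex of it. Otherwise its edges
to the atom, at least 2/5 of the cluster size in number, are all violated and contribute to the
mass. Either way, the cluster has been walked completely. -/
theorem CoreAdm.card_le {u v : Fin n} (h : CoreAdm G P N u v) :
    (P.part v).card ≤ 10000 * mass G P v := by
  obtain ⟨hu, hv, h1, -⟩ := h
  by_cases huv : u ∈ P.part v
  · have e := part_eq_of_mem huv
    have := hu.card_le
    rwa [e, mass_congr e] at this
  · have h2 : (((coreClustering G P).part v).filter fun w => G.Adj u w).card ≤ mass G P v := by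
      rw [Finset.card_eq_sum_ones, mass]
      refine le_trans (Finset.sum_le_sum (g := fun w => deg (violation G P) w) fun w hw => ?_)
        (Finset.sum_le_sum_of_subset fun w hw => ?_)
      · rw [part_coreClustering hv, Finset.mem_filter, Finset.mem_filter] at hw
        rw [deg_eq_card_filter]
        refine Finset.card_pos.2 ⟨u, ?_⟩
        simp only [Finset.mem_filter, Finset.mem_univ, true_and, violation_adj]
        refine ⟨hw.2.ne', iff_of_true hw.2.symm fun e => huv ?_⟩
        rw [← part_eq_iff, ← e]
        exact part_eq_of_mem hw.1.1
      · rw [part_coreClustering hv, Finset.mem_filter, Finset.mem_filter] at hw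
        exact hw.1.1
    dsimp only at h1
    omega

theorem mem_nbhd_iff_violation {u x : Fin n} : x ∈ nbhd G u ↔
    (P.part u = P.part x ↔ ¬ (violation G P).Adj u x) := by
  rw [mem_nbhd, violation_adj]
  by_cases e : x = u
  · subst e; simp
  · by_cases h1 : G.Adj u x <;> by_cases h2 : P.part u = P.part x <;> simp [e, h1, h2, Ne.symm e]

/-- The pairs of a loose vertex and a member of its closed neighbourhood. -/
def nbrPairs (T : Fin n → Prop) (lab : Fin n → Fin n) (M : Fin n → List (Fin n))
    (D : List (Fin n × Fin n)) (S : List (Fin n)) : List (Fin n × Fin n) :=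
  S.flatMap (inside lab M D) ++ D.filter fun p => T p.1 ∧ lab p.1 ≠ lab p.2

theorem mem_inside {u v x : Fin n} :
    (u, x) ∈ inside lab M D v ↔ u = v ∧ x ∈ M (lab u) ∧ (u, x) ∉ D := by
  simp only [inside, List.mem_map, List.mem_filter, decide_eq_true_eq, Prod.mk.injEq]
  constructor
  · rintro ⟨a, h1, rfl, rfl⟩; exact ⟨rfl, h1⟩
  · rintro ⟨rfl, h⟩; exact ⟨x, h, rfl, rfl⟩

theorem InputSpec.mem_nbrPairs (h : InputSpec G P lab M D) {S : List (Fin n)}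
    (hS : ∀ v, v ∈ S ↔ Loose G P v) {u x : Fin n} :
    (u, x) ∈ nbrPairs (Loose G P) lab M D S ↔ Loose G P u ∧ x ∈ nbhd G u := by
  simp only [nbrPairs, List.mem_append, List.mem_flatMap, mem_inside, List.mem_filter,
    decide_eq_true_eq, mem_nbhd_iff_violation (P := P), h.mem_viol, h.mem, ne_eq, h.lab_eq,
    eq_comm (a := P.part x)]
  constructor
  · rintro (⟨v, hv, rfl, h1, h2⟩ | ⟨h1, h2, h3⟩)
    · exact ⟨(hS u).1 hv, iff_of_true h1 h2⟩
    · exact ⟨h2, iff_of_false h3 (by simpa using h1)⟩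
  · rintro ⟨h1, h2⟩
    by_cases h3 : P.part u = P.part x
    · exact Or.inl ⟨u, (hS u).2 h1, rfl, h3, h2.1 h3⟩
    · exact Or.inr ⟨by_contra fun h4 => h3 (h2.2 h4), h1, h3⟩

theorem InputSpec.nodup_nbrPairs (h : InputSpec G P lab M D) {S : List (Fin n)} (hS : S.Nodup)
    (T : Fin n → Prop) : (nbrPairs T lab M D S).Nodup := by
  rw [nbrPairs, List.nodup_append]
  refine ⟨?_, h.nodup_viol.filter _, ?_⟩
  · rw [List.nodup_flatMap]
    refine ⟨fun u _ => ?_, hS.imp ?_⟩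
    · exact ((h.nodup _).filter _).map fun a b e => by simpa using e
    · rintro a b hab ⟨u, x⟩ h1 h2
      exact hab ((mem_inside.1 h1).1.symm.trans (mem_inside.1 h2).1)
  · rintro ⟨u, x⟩ h1 ⟨u', x'⟩ h2 e
    rw [← e] at h2
    simp only [List.mem_flatMap, mem_inside] at h1
    simp only [List.mem_filter, decide_eq_true_eq] at h2
    obtain ⟨v, -, -, -, h3⟩ := h1
    exact h3 h2.1

/-- The closed neighbourhoods of the loose vertices. -/
def nbrList (T : Fin n → Prop) (lab : Fin n → Fin n) (M : Fin n → List (Fin n))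
    (D : List (Fin n × Fin n)) (u : Fin n) : List (Fin n) :=
  if T u then (M (lab u)).filter (fun x => (u, x) ∉ D) ++
    ((D.filter fun p => T p.1 ∧ lab p.1 ≠ lab p.2).filter fun p => p.1 = u).map Prod.snd else []

/-- Within a row, the order does not depend on the order in which loose vertices were found. So the
lists from which samples are drawn are determined by the input alone. -/
theorem rowFst_nbrPairs {T : Fin n → Prop} {S : List (Fin n)} (hS : S.Nodup)
    (hmem : ∀ v, v ∈ S ↔ T v) :
    rowFst (nbrPairs T lab M D S) = nbrList T lab M D := by
  funext u
  rw [rowFst, nbrPairs, List.filter_append, List.map_append, nbrList]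
  have h1 : ∀ S : List (Fin n), S.Nodup → (((S.flatMap (inside lab M D)).filter
      fun p => p.1 = u).map Prod.snd) =
      if u ∈ S then (M (lab u)).filter (fun x => (u, x) ∉ D) else [] := by
    intro S
    induction S with
    | nil => simp
    | cons a S ih =>
      intro hnd
      rw [List.nodup_cons] at hnd
      rw [List.flatMap_cons, List.filter_append, List.map_append, ih hnd.2]
      by_cases e : u = a
      · subst e
        rw [if_neg hnd.1, if_pos (by simp), List.append_nil, inside, List.filter_map, List.map_map]
        simp [Function.comp_def]
      · have : ((inside lab M D a).filter fun p => p.1 = u) = [] := by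
          refine List.filter_eq_nil_iff.2 ?_
          rintro ⟨b, x⟩ hb
          have := (mem_inside.1 hb).1
          subst this
          simpa using Ne.symm e
        rw [this]
        simp [e]
  rw [h1 S hS]
  by_cases hu : T u
  · rw [if_pos ((hmem u).2 hu), if_pos hu]
  · rw [if_neg (fun h => hu ((hmem u).1 h)), if_neg hu, List.nil_append, List.map_eq_nil_iff,
      List.filter_eq_nil_iff]
    rintro ⟨a, b⟩ hp
    simp only [List.mem_filter, decide_eq_true_eq] at hp
    simp only [decide_eq_true_eq]
    rintro rfl
    exact hu hp.2.1

theorem InputSpec.listsNbhd (h : InputSpec G P lab M D) :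
    ListsNbhd G (Loose G P) (nbrList (Loose G P) lab M D) := by
  intro v hv
  have hS : ∀ w, w ∈ (Finset.univ.filter (Loose G P)).toList ↔ Loose G P w := by simp
  rw [← rowFst_nbrPairs (Finset.nodup_toList _) hS]
  exact ⟨nodup_rowFst (h.nodup_nbrPairs (Finset.nodup_toList _) _) v, fun w => by
    rw [mem_rowFst, h.mem_nbrPairs hS]; simp [hv]⟩

/-- The counter goes by input labels but omits loose vertices, and the input cluster without its
loose vertices is the part of `x` in the core. -/
theorem InputSpec.cntInto_eq (h : InputSpec G P lab M D) {S : List (Fin n)} (hnd : S.Nodup)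
    (hS : ∀ v, v ∈ S ↔ Loose G P v) {u x : Fin n} (hu : Loose G P u) (hx : ¬ Loose G P x) :
    cntInto lab (Loose G P) (nbrPairs (Loose G P) lab M D S) u (lab x) =
      (((coreClustering G P).part x).filter fun w => G.Adj u w).card := by
  set L := nbrPairs (Loose G P) lab M D S with hL
  have hLn : L.Nodup := h.nodup_nbrPairs hnd _
  have e : cntInto lab (Loose G P) L u (lab x) =
      ((rowFst L u).filter fun w => lab w = lab x ∧ ¬ Loose G P w).length := by
    rw [cntInto, List.countP_eq_length_filter, rowFst, List.filter_map, List.length_map,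
      List.filter_filter]
    congr 2; funext p
    simp [Bool.and_comm (decide (p.1 = u))]
  rw [e, ← List.toFinset_card_of_nodup ((nodup_rowFst hLn u).filter _)]
  congr 1; ext w
  simp only [List.mem_toFinset, List.mem_filter, mem_rowFst, hL, h.mem_nbrPairs hS,
    decide_eq_true_eq, part_coreClustering hx, Finset.mem_filter, h.lab_eq, part_eq_iff, mem_nbhd]
  constructor
  · rintro ⟨⟨-, rfl | h1⟩, h2, h3⟩
    · exact absurd hu h3
    · exact ⟨⟨h2, h3⟩, h1⟩
  · rintro ⟨⟨h2, h3⟩, h1⟩; exact ⟨⟨hu, Or.inr h1⟩, h2, h3⟩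

/-- A vertex admissible to an atom has a neighbour in it, and the pair of the two is in the list, so
every admissible atom is met by the linking pass. -/
theorem InputSpec.linked_iff (h : InputSpec G P lab M D) {S : List (Fin n)}
    (hS : ∀ v, v ∈ S ↔ Loose G P v) {u l : Fin n} :
    Linked lab (CoreAdm G P N) (nbrPairs (Loose G P) lab M D S) u l ↔
      ∃ x, lab x = l ∧ CoreAdm G P N u x := by
  constructor
  · rintro ⟨x, -, h1, h2⟩; exact ⟨x, h1, h2⟩
  · rintro ⟨x, rfl, hx⟩
    have h1 := hx.2.2.1
    have hpos : 0 < (P.part x).card := Finset.card_pos.2 ⟨x, mem_part_self P x⟩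
    dsimp only at h1
    obtain ⟨w, hw⟩ := Finset.card_pos.1 (show 0 < (((coreClustering G P).part x).filter
      fun w => G.Adj u w).card by omega)
    rw [Finset.mem_filter] at hw
    refine ⟨w, (h.mem_nbrPairs hS).2 ⟨hx.1, mem_nbhd.2 (Or.inr hw.2)⟩, ?_,
      ((sizedCore G P).atomAdm_congr hx.2.1 hw.1).2 hx⟩
    have := hw.1
    rw [part_coreClustering hx.2.1, Finset.mem_filter] at this
    rw [h.lab_eq]; exact part_eq_of_mem this.1

end Spec

end

/-! ### The construction in time linear in the number of violations -/

section

variable {n : ℕ}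

section Build
open Classical

/-! ### The data structure -/

/-- The vertex `u` is admissible to the atom with label `l`. -/
def LabelAdm (G : SimpleGraph (Fin n)) (P : Clustering n) (lab : Fin n → Fin n) (N : ℕ)
    (u l : Fin n) : Prop := ∃ x, lab x = l ∧ CoreAdm G P N u x

/-- The contents of the memory after the construction. -/
structure Holds (G : SimpleGraph (Fin n)) (P : Clustering n) (N : ℕ) (lab : Fin n → Fin n)
    (M : Fin n → List (Fin n)) (L : Fin n → List (Fin n)) (m : ℕ → ℕ) : Prop where
  zero : m 0 = n
  one : m 1 = cost G P
  stores : StoresClustering (2 * n) (coreClustering G P) m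
  label : ∀ v, ¬ Loose G P v → m (2 + v) = lab v
  flag : ∀ u : Fin n, fld m 7 u = if Loose G P u then 1 else 0
  nbrs : Rows m 11 12 L
  adj : ∀ u x : Fin n, fld m 13 (x * n + u) = if Loose G P u ∧ x ∈ nbhd G u then 1 else 0
  into : ∃ R, Rows m 14 15 R ∧ ∀ w, (R w).Nodup ∧ ∀ u, u ∈ R w ↔ Loose G P u ∧ w ∈ nbhd G u
  link : ∀ u l : Fin n, fld m 17 (l * n + u) = if LabelAdm G P lab N u l then 1 else 0
  atoms : ∃ R, Rows m 18 19 R ∧ ∀ l, (R l).Nodup ∧ ∀ u, u ∈ R l ↔ LabelAdm G P lab N u l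
  verts : ∃ R, Rows m 20 21 R ∧ ∀ u, (R u).Nodup ∧ ∀ l, l ∈ R u ↔ LabelAdm G P lab N u l
  members : ∀ u l : Fin n, LabelAdm G P lab N u l → fld m 3 l = (M l).length ∧
    ∀ j (hj : j < (M l).length), fld m 5 (j * n + l) = (M l)[j]

/-- Splitting comes last, since the earlier passes still read the input labels of loose vertices. -/
def build (N : ℕ) : Prog :=
  .seq countLoop <| .seq walkLoop <| .seq selectLoop <| .seq insideLoop <| .seq outsideLoop <|
  .seq storeLoop <| .seq (linkLoop N) splitLoop

/-- The numbers bound list lengths per violation: 2 ordered pairs, 20000 walked vertices, 20200 for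
the clusters of loose vertices (doubled to 40400 to count the loose vertices too), and 20200 + 2
neighbour pairs. -/
def buildTime (N : ℕ) : ℕ :=
  [(countBody.time + 30) * 2, 10001 * (walkBody.time + 51) * 2, (selectBody.time + 60) * 20000,
    (insideBody.time + 200) * 40400 + 60, (outsideBody.time + 60) * 2,
    (storeBody.time + 60) * 20202, ((linkBody N).time + 60) * 20202,
    (splitBody.time + 200) * 20200].sum

variable {G : SimpleGraph (Fin n)} {P : Clustering n} {lab : Fin n → Fin n}
  {M : Fin n → List (Fin n)} {D : List (Fin n × Fin n)} {N : ℕ} {m₀ : ℕ → ℕ} {ω : Rnd}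

theorem cnt_replicate (k : ℕ) (l : Fin n) :
    cnt lab (List.replicate k D).flatten l = k * cnt lab D l := by
  induction k with
  | zero => simp [cnt]
  | succ k ih => rw [List.replicate_succ, List.flatten_cons, cnt_append, ih]; ring

theorem InputSpec.sum_length_le (h : InputSpec G P lab M D) {S : List (Fin n)} (hnd : S.Nodup)
    (hS : ∀ v, v ∈ S ↔ Loose G P v) :
    (S.map fun u => (M (lab u)).length).sum ≤ 20200 * cost G P := by
  have e : S.toFinset = Finset.univ.filter (Loose G P) := by ext; simp [hS]
  rw [← List.sum_toFinset _ hnd, e]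
  simp only [h.length_eq]
  exact sum_card_loose_le G P

theorem length_flatMap_inside_le (S : List (Fin n)) :
    (S.flatMap (inside lab M D)).length ≤ (S.map fun u => (M (lab u)).length).sum := by
  rw [List.length_flatMap]
  refine List.sum_le_sum fun u _ => ?_
  simp only [inside, List.length_map]
  exact List.length_filter_le _ _

theorem InputSpec.length_le (h : InputSpec G P lab M D) (S : List (Fin n)) :
    S.length ≤ (S.map fun u => (M (lab u)).length).sum := by
  induction S with
  | nil => simp
  | cons a S ih =>
    have : 0 < (M (lab a)).length := List.length_pos_of_mem ((h.mem _ a).2 rfl)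
    simp only [List.length_cons, List.map_cons, List.sum_cons]
    omega

theorem build_meets (hi : Input lab M D m₀) (hsp : InputSpec G P lab M D)
    (hone : m₀ 1 = cost G P) (hz : ∀ r i, fld m₀ r i = 0) (s : State) (hs : s.mem = m₀) :
    Meets ω (build N) s (buildTime N * (cost G P + 1))
      fun s' => Holds G P N lab M (nbrList (Loose G P) lab M D) s'.mem ∧
        ∀ u : Fin n, fld s'.mem 22 u = 0 := by
  have hDlen : D.length = 2 * cost G P := by rw [← hi.one, hone]
  obtain ⟨c, hc⟩ : ∃ c, cost G P = c := ⟨_, rfl⟩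
  rw [hc] at hone hDlen ⊢
  obtain ⟨b1, e1⟩ : ∃ b, b = (countBody.time + 30) * 2 := ⟨_, rfl⟩
  obtain ⟨b2, e2⟩ : ∃ b, b = 10001 * (walkBody.time + 51) * 2 := ⟨_, rfl⟩
  obtain ⟨b3, e3⟩ : ∃ b, b = (selectBody.time + 60) * 20000 := ⟨_, rfl⟩
  obtain ⟨b4, e4⟩ : ∃ b, b = (insideBody.time + 200) * 40400 + 60 := ⟨_, rfl⟩
  obtain ⟨b5, e5⟩ : ∃ b, b = (outsideBody.time + 60) * 2 := ⟨_, rfl⟩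
  obtain ⟨b6, e6⟩ : ∃ b, b = (storeBody.time + 60) * 20202 := ⟨_, rfl⟩
  obtain ⟨b7, e7⟩ : ∃ b, b = ((linkBody N).time + 60) * 20202 := ⟨_, rfl⟩
  obtain ⟨b8, e8⟩ : ∃ b, b = (splitBody.time + 200) * 20200 := ⟨_, rfl⟩
  refine Meets.mono (B₁ := b1 * (c + 1) + (b2 * (c + 1) + (b3 * (c + 1) + (b4 * (c + 1) +
    (b5 * (c + 1) + (b6 * (c + 1) + (b7 * (c + 1) + b8 * (c + 1)))))))) ?_ (le_of_eq (by
      simp only [buildTime, ← e1, ← e2, ← e3, ← e4, ← e5, ← e6, ← e7, ← e8, List.sum_cons,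
        List.sum_nil]
      ring)) (fun _ h => h)
  rw [build]
  refine ((countLoop_meets hi hz s hs).mono (by rw [hDlen, e1, mul_assoc]; gcongr; omega)
    (fun _ h => h)).seq fun s₁ h₁ => ?_
  have hi₁ := hi.frame h₁.frame
  refine ((walkLoop_meets hi₁ hsp.nodup hsp.mem (fun r hr i => ?_) s₁ rfl).mono
    (by rw [hDlen, e2, mul_assoc _ 2]; gcongr; omega) (fun _ h => h)).seq fun s₂ h₂ => ?_
  · rw [h₁.frame.fld r (by simp at hr; omega) (by simp at hr ⊢; omega), hz]
  have hi₂ := hi₁.frame h₂.frame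
  have hcnt : ∀ v, cnt lab (List.replicate 10000 D).flatten (lab v) = 10000 * mass G P v :=
    fun v => by rw [cnt_replicate, hsp.cnt_eq]
  have hElen : (List.replicate 10000 D).flatten.length = 10000 * (2 * c) := by
    rw [List.length_flatten, List.map_replicate, List.sum_replicate, hDlen, smul_eq_mul]
  generalize (List.replicate 10000 D).flatten = E at h₂ hcnt hElen
  obtain ⟨A, hA, hAnd, hAlen, hAmem⟩ := h₂.all
  rw [hElen] at hAlen
  have z₂ : ∀ r < 32, r ∉ [0, 1, 2, 3, 4, 5, 6, 23] → ∀ i, fld s₂.mem r i = 0 := fun r hr hn i => by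
    rw [h₂.frame.fld r hr (by simp at hn ⊢; omega), h₁.frame.fld r hr (by simp at hn ⊢; omega), hz]
  have hpos : ∀ v, 0 < (P.part v).card := fun v => Finset.card_pos.2 ⟨v, mem_part_self P v⟩
  have hviol : ∀ v : Fin n, fld s₂.mem 0 v = deg (violation G P) v := fun v => by
    rw [h₂.frame.fld 0 (by norm_num) (by simp), h₁.viol, hsp.countP_fst]
  have hmass : ∀ v : Fin n, fld s₂.mem 1 (lab v) = mass G P v := fun v => by
    rw [h₂.frame.fld 1 (by norm_num) (by simp), h₁.mass, hsp.cnt_eq]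
  -- Every cluster has received 10000 visits per violation, so a cluster of at most this size is
  -- known completely, with its exact size.
  have hknown : ∀ v, (P.part v).card ≤ 10000 * mass G P v → fld s₂.mem 4 (lab v) = 0 ∧
      fld s₂.mem 3 (lab v) = (M (lab v)).length ∧ ∀ j (hj : j < (M (lab v)).length),
        fld s₂.mem 5 (j * n + lab v) = (M (lab v))[j] := fun v hv => by
    have hl := hsp.length_eq v
    have hp := hpos v
    have e : (M (lab v)).take (cnt lab E (lab v)) = M (lab v) :=
      List.take_of_length_le (by rw [hcnt]; omega)
    have hr := h₂.rows (lab v)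
    simp only [e] at hr
    refine ⟨?_, hr⟩
    rw [h₂.cur, hcnt, if_neg (by omega), List.getElem?_eq_none (by omega)]; rfl
  -- Conversely, the program recognizes a completely known cluster by a null cursor and a nonempty
  -- row.
  have hknown' : ∀ v, fld s₂.mem 4 (lab v) = 0 → 0 < fld s₂.mem 3 (lab v) →
      (P.part v).card ≤ 10000 * mass G P v := fun v h4 h3 => by
    rw [(h₂.rows (lab v)).1, List.length_take, hcnt] at h3
    rw [h₂.cur, hcnt, if_neg (by omega)] at h4
    by_contra hlt
    rw [List.getElem?_eq_getElem (by rw [hsp.length_eq]; omega)] at h4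
    simp [ptr] at h4
  have hALoose : ∀ v, Loose G P v → v ∈ A := fun v hv => by
    rw [hAmem, List.take_of_length_le (by rw [hcnt, hsp.length_eq]; exact hv.card_le), hsp.mem]
  have hT : ∀ x ∈ A, Loose G P x ↔ fld s₂.mem 4 (lab x) = 0 ∧
      (fld s₂.mem 3 (lab x) < 100 * fld s₂.mem 0 x ∨
      fld s₂.mem 3 (lab x) * fld s₂.mem 3 (lab x) < 10000 * fld s₂.mem 1 (lab x)) := fun x hx => by
    constructor
    · intro hl
      obtain ⟨h4, h3, -⟩ := hknown x hl.card_le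
      rw [h4, h3, hviol, hmass, hsp.length_eq, ← sq]
      exact ⟨rfl, hl⟩
    · rintro ⟨h4, h5⟩
      have h3 : 0 < fld s₂.mem 3 (lab x) := by
        rw [(h₂.rows (lab x)).1]; exact List.length_pos_of_mem ((hAmem x).1 hx)
      rw [(hknown x (hknown' x h4 h3)).2.1, hviol, hmass, hsp.length_eq, ← sq] at h5
      exact h5
  refine ((selectLoop_meets hi₂ hA (fun r hr i => z₂ r (by simp at hr; omega)
    (by simp at hr ⊢; omega) i) hT s₂ rfl).mono (B₂ := b3 * (c + 1))
    (by rw [e3, mul_assoc]; gcongr; omega) (fun _ h => h)).seq fun s₃ h₃ => ?_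
  have hi₃ := hi₂.frame h₃.frame
  set S := A.filter (Loose G P) with hSdef
  have hS : ∀ v, v ∈ S ↔ Loose G P v := fun v => by simp [hSdef]; exact hALoose v
  have hSnd : S.Nodup := hAnd.filter _
  have hflag₃ : ∀ u : Fin n, fld s₃.mem 7 u = if Loose G P u then 1 else 0 := fun u => by
    rw [h₃.flag]; congr 1
    exact propext ⟨fun h => h.2, fun h => ⟨hALoose u h, h⟩⟩
  have f₃ : ∀ r < 32, r ∉ [7, 8, 24] → ∀ i, fld s₃.mem r i = fld s₂.mem r i := h₃.frame.fld
  have hsum := hsp.sum_length_le hSnd hS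
  rw [hc] at hsum
  have hSlen := (hsp.length_le S).trans hsum
  refine ((insideLoop_meets hi₃ h₃.list (fun r hr i => ?_) (fun u hu => ?_) (fun u v => ?_) s₃
    rfl).mono (B₂ := b4 * (c + 1)) ?_ (fun _ h => h)).seq
    fun s₄ h₄ => ?_
  · rw [f₃ r (by simp at hr; omega) (by simp at hr ⊢; omega),
      z₂ r (by simp at hr; omega) (by simp at hr ⊢; omega)]
  · have := (hknown u ((hS u).1 hu).card_le).2
    simpa only [f₃ 3 (by norm_num) (by simp), f₃ 5 (by norm_num) (by simp)] using this
  · rw [f₃ 2 (by norm_num) (by simp), h₂.frame.fld 2 (by norm_num) (by simp), h₁.mark]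
  · have e : (S.map fun u => (M (lab u)).length + 1).sum =
        (S.map fun u => (M (lab u)).length).sum + S.length := by
      rw [List.sum_map_add]; simp
    rw [e, e4, add_mul _ 60 (c + 1), mul_assoc]
    refine Nat.add_le_add (Nat.mul_le_mul_left _ (by omega)) (by omega)
  obtain ⟨hf₄, hv₄⟩ := h₄
  have hi₄ := hi₃.frame hf₄
  refine ((outsideLoop_meets (T := Loose G P) hi₄ hv₄ (fun u => ?_) s₄ rfl).mono
    (by rw [hDlen, e5, mul_assoc]; gcongr; omega) (fun _ h => h)).seq fun s₅ h₅ => ?_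
  · rw [hf₄.fld 7 (by norm_num) (by simp), hflag₃]
  obtain ⟨hf₅, hv₅⟩ := h₅
  have hi₅ := hi₄.frame hf₅
  have hf₃₅ : Frame [9, 10, 25] s₃.mem s₅.mem := hf₄.trans hf₅ (by simp)
  set L := nbrPairs (Loose G P) lab M D S with hLdef
  have hv₅ : PairVec s₅.mem L := hv₅
  have hLlen : L.length ≤ 20202 * c := by
    rw [hLdef, nbrPairs, List.length_append]
    have h1 := length_flatMap_inside_le (lab := lab) (M := M) (D := D) S
    have h2 : (D.filter fun p => Loose G P p.1 ∧ lab p.1 ≠ lab p.2).length ≤ D.length :=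
      List.length_filter_le _ _
    omega
  have hLnd : L.Nodup := hsp.nodup_nbrPairs hSnd _
  have hLmem : ∀ {u x : Fin n}, (u, x) ∈ L ↔ Loose G P u ∧ x ∈ nbhd G u := hsp.mem_nbrPairs hS
  have f₅ : ∀ r < 32, r ∉ [7, 8, 9, 10, 24, 25] → ∀ i, fld s₅.mem r i = fld s₂.mem r i :=
    fun r hr hn i => by
      rw [hf₃₅.fld r hr (by simp at hn ⊢; omega), f₃ r hr (by simp at hn ⊢; omega)]
  have hflag₅ : ∀ u : Fin n, fld s₅.mem 7 u = if Loose G P u then 1 else 0 := fun u => by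
    rw [hf₃₅.fld 7 (by norm_num) (by simp), hflag₃]
  refine ((storeLoop_meets (T := Loose G P) hi₅ hv₅ (fun r hr i => ?_) hflag₅ s₅ rfl).mono
    (B₂ := b6 * (c + 1)) (by rw [e6, mul_assoc]; gcongr; omega)
    (fun _ h => h)).seq fun s₆ h₆ => ?_
  · rw [f₅ r (by simp at hr; omega) (by simp at hr ⊢; omega),
      z₂ r (by simp at hr; omega) (by simp at hr ⊢; omega)]
  have hi₆ := hi₅.frame h₆.frame
  have hv₆ : PairVec s₆.mem L := hv₅.congr (h₆.frame.fld 9 (by norm_num) (by simp))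
    (h₆.frame.fld 10 (by norm_num) (by simp)) (h₆.frame.fld 25 (by norm_num) (by simp))
  have f₆ : ∀ r < 32, r ∉ [7, 8, 9, 10, 11, 12, 13, 14, 15, 16, 24, 25] → ∀ i,
      fld s₆.mem r i = fld s₂.mem r i := fun r hr hn i => by
    rw [h₆.frame.fld r hr (by simp at hn ⊢; omega), f₅ r hr (by simp at hn ⊢; omega)]
  have hnbr : rowFst L = nbrList (Loose G P) lab M D := rowFst_nbrPairs hSnd hS
  have hQ : ∀ u x, (u, x) ∈ L → (CoreAdm G P N u x ↔ fld s₆.mem 7 x = 0 ∧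
      fld s₆.mem 4 (lab x) = 0 ∧ 0 < fld s₆.mem 3 (lab x) ∧
      2 * fld s₆.mem 3 (lab x) ≤ 5 * fld s₆.mem 16 (lab x * n + u) ∧
      5 * (fld s₆.mem 12 u - 1) ≤ 3 * N * fld s₆.mem 3 (lab x)) := by
    intro u x hux
    have hu := (hLmem.1 hux).1
    have e12 : fld s₆.mem 12 u = deg G u + 1 := by
      rw [(h₆.nbrs u).1, hnbr]; exact hsp.listsNbhd.length_eq hu
    have e7 : fld s₆.mem 7 x = 0 ↔ ¬ Loose G P x := by
      rw [h₆.frame.fld 7 (by norm_num) (by simp), hflag₅]; simp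
    rw [e7, e12, f₆ 4 (by norm_num) (by simp), f₆ 3 (by norm_num) (by simp), h₆.count,
      Nat.add_sub_cancel]
    by_cases hx : Loose G P x
    · exact iff_of_false (fun h => h.2.1 hx) fun h => h.1 hx
    rw [hsp.cntInto_eq hSnd hS hu hx]
    constructor
    · intro h
      obtain ⟨k4, k3, -⟩ := hknown x h.card_le
      rw [k4, k3, hsp.length_eq]
      exact ⟨hx, rfl, hpos x, h.2.2.1, h.2.2.2⟩
    · rintro ⟨-, k4, k3, k5, k6⟩
      rw [(hknown x (hknown' x k4 k3)).2.1, hsp.length_eq] at k5 k6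
      exact ⟨hu, hx, k5, k6⟩
  refine ((linkLoop_meets (N := N) hi₆ hv₆ (fun r hr i => ?_) hQ s₆ rfl).mono
    (B₂ := b7 * (c + 1)) (by rw [e7, mul_assoc]; gcongr; omega)
    (fun _ h => h)).seq fun s₇ h₇ => ?_
  · rw [f₆ r (by simp at hr; omega) (by simp at hr ⊢; omega),
      z₂ r (by simp at hr; omega) (by simp at hr ⊢; omega)]
  have hi₇ := hi₆.frame h₇.frame
  have f₇ : ∀ r < 32, r ∉ [7, 8, 9, 10, 11, 12, 13, 14, 15, 16, 17, 18, 19, 20, 21, 24, 25] → ∀ i,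
      fld s₇.mem r i = fld s₂.mem r i := fun r hr hn i => by
    rw [h₇.frame.fld r hr (by simp at hn ⊢; omega), f₆ r hr (by simp at hn ⊢; omega)]
  have hS₇ : Vec s₇.mem 8 24 S := h₇.frame.vec (h₆.frame.vec (hf₃₅.vec h₃.list (by norm_num)
    (by norm_num) (by simp) (by simp)) (by norm_num) (by norm_num) (by simp) (by simp))
    (by norm_num) (by norm_num) (by simp) (by simp)
  refine (splitLoop_meets hi₇ hsp.nodup hsp.mem hS₇ hSnd s₇ rfl).mono
    (by rw [e8, mul_assoc]; gcongr; omega) fun s₈ h₈ => ?_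
  obtain ⟨lab', M', hch, hl1, hl2⟩ := h₈.chains
  have g₇ : ∀ r < 32, r ∉ [17, 18, 19, 20, 21, 26] → ∀ i, fld s₈.mem r i = fld s₆.mem r i :=
    fun r hr hn i => by
      rw [h₈.fld r hr (by simp at hn; omega), h₇.frame.fld r hr (by simp at hn ⊢; omega)]
  -- Loose vertices carry distinct labels from n on, the others their input labels below n, so equal
  -- labels mean equal vertices or two non-loose vertices of one input cluster.
  have hlab' : ∀ u v, lab' u = lab' v ↔
      (coreClustering G P).part u = (coreClustering G P).part v := by
    intro u v
    rw [part_eq_iff, mem_coreClustering]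
    have hin : ∀ v, Loose G P v → ∃ i, ∃ hi : i < S.length, S[i] = v ∧ lab' v = n + i := fun v hv => by
      obtain ⟨i, hi, e⟩ := List.getElem_of_mem ((hS v).2 hv)
      exact ⟨i, hi, e, e ▸ hl2 i hi⟩
    have hout : ∀ v, ¬ Loose G P v → lab' v = lab v := fun v hv => hl1 v fun h => hv ((hS v).1 h)
    by_cases hu : Loose G P u <;> by_cases hv : Loose G P v
    · obtain ⟨i, hi, e1, e2⟩ := hin u hu
      obtain ⟨j, hj, e3, e4⟩ := hin v hv
      simp only [hu, not_true_eq_false, false_and, or_false, e2, e4]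
      constructor
      · intro h
        have : i = j := by omega
        subst this
        exact e1.symm.trans e3
      · rintro rfl
        have := hSnd.getElem_inj_iff.1 (e1.trans e3.symm)
        omega
    · obtain ⟨i, hi, e1, e2⟩ := hin u hu
      simp only [hu, not_true_eq_false, false_and, or_false, e2, hout v hv]
      refine iff_of_false (by omega) ?_
      rintro rfl; exact hv hu
    · obtain ⟨j, hj, e3, e4⟩ := hin v hv
      simp only [hv, not_true_eq_false, false_and, and_false, or_false, e4, hout u hu]
      refine iff_of_false (by omega) ?_
      rintro rfl; exact hu hv
    · rw [hout u hu, hout v hv, Fin.val_inj, hsp.lab_eq]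
      constructor
      · intro h; exact Or.inr ⟨hu, hv, h⟩
      · rintro (rfl | h)
        · rfl
        · exact h.2.2
  have hlk : ∀ u l, Linked lab (CoreAdm G P N) L u l ↔ LabelAdm G P lab N u l :=
    fun u l => hsp.linked_iff hS
  refine ⟨⟨hch.zero, by rw [h₈.one, h₇.frame.one, h₆.frame.one, hf₃₅.one, h₃.frame.one,
      h₂.frame.one, h₁.frame.one, hone, hc], hch.storesClustering hlab', fun v hv => ?_, fun u => ?_,
    ?_, fun u x => ?_, ?_, fun u l => ?_, ?_, ?_, fun u l hul => ?_⟩, fun u => ?_⟩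
  · rw [hch.label, hl1 v fun h => hv ((hS v).1 h)]
  · rw [g₇ 7 (by norm_num) (by simp), h₆.frame.fld 7 (by norm_num) (by simp), hflag₅]
  · rw [← hnbr]
    exact h₆.nbrs.congr (g₇ 11 (by norm_num) (by simp)) (g₇ 12 (by norm_num) (by simp))
  · rw [g₇ 13 (by norm_num) (by simp), h₆.adj]; simp only [hLmem]
  · refine ⟨rowSnd L, h₆.into.congr (g₇ 14 (by norm_num) (by simp)) (g₇ 15 (by norm_num) (by simp)),
      fun w => ⟨nodup_rowSnd hLnd w, fun u => by rw [mem_rowSnd, hLmem]⟩⟩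
  · rw [h₈.fld 17 (by norm_num) (by norm_num), h₇.flag]; simp only [hlk]
  · obtain ⟨R, hR, hR'⟩ := h₇.atoms
    exact ⟨R, hR.congr (h₈.fld 18 (by norm_num) (by norm_num))
      (h₈.fld 19 (by norm_num) (by norm_num)), by simpa only [hlk] using hR'⟩
  · obtain ⟨R, hR, hR'⟩ := h₇.verts
    exact ⟨R, hR.congr (h₈.fld 20 (by norm_num) (by norm_num))
      (h₈.fld 21 (by norm_num) (by norm_num)), by simpa only [hlk] using hR'⟩
  · obtain ⟨x, rfl, hx⟩ := hul
    have := (hknown x hx.card_le).2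
    simpa only [g₇ 3 (by norm_num) (by simp), g₇ 5 (by norm_num) (by simp),
      f₆ 3 (by norm_num) (by simp), f₆ 5 (by norm_num) (by simp)] using this
  · rw [g₇ 22 (by norm_num) (by simp), f₆ 22 (by norm_num) (by simp),
      z₂ 22 (by norm_num) (by simp)]

end Build

end

/-! ### Queries: testing a pair of loose vertices -/

section

variable {n : ℕ}

section Check
open Classical

variable {G : SimpleGraph (Fin n)} {P : Clustering n} {lab : Fin n → Fin n}
  {M L : Fin n → List (Fin n)} {N t : ℕ} {m m' : ℕ → ℕ} {ω : Rnd} {s : State}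

/-! ### Reading the data structure -/

theorem Rows.congr_of_lt {r c : ℕ} {L : Fin n → List (Fin n)} (h : Rows m r c L)
    (hL : ∀ v, (L v).length ≤ n) (h1 : ∀ i < n * n, fld m' r i = fld m r i)
    (h2 : ∀ i < n * n, fld m' c i = fld m c i) : Rows m' r c L := by
  intro v
  have hv : (v : ℕ) < n * n := lt_of_lt_of_le v.2 (Nat.le_mul_self n)
  refine ⟨by rw [h2 _ hv, (h v).1], fun j hj => ?_⟩
  rw [h1 _ (by nlinarith [v.2, hL v]), (h v).2 j hj]

theorem length_le_of_nodup {A : List (Fin n)} (h : A.Nodup) : A.length ≤ n := by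
  simpa using h.length_le_card

/-- Queries only write marks into array 22 and output behind index n² of the arrays. Rows of
duplicate-free lists have length at most n, so all stored entries have an index below n². -/
theorem Holds.congr (h : Holds G P N lab M L m) (hM : ∀ l, (M l).Nodup) (hL : ∀ v, (L v).Nodup)
    (hlow : ∀ a < memBase m, m' a = m a)
    (hfld : ∀ r < 32, r ≠ 22 → ∀ i < n * n, fld m' r i = fld m r i) :
    Holds G P N lab M L m' := by
  have hb : memBase m = 2 + (5 * n + 2 * cost G P) := by rw [memBase, h.zero, h.one]
  rw [hb] at hlow
  have hv : ∀ v : Fin n, (v : ℕ) < n * n := fun v => lt_of_lt_of_le v.2 (Nat.le_mul_self n)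
  have hvw : ∀ v w : Fin n, (v : ℕ) * n + w < n * n := fun v w => by nlinarith [v.2, w.2]
  have rows : ∀ {r c : ℕ} {R : Fin n → List (Fin n)}, Rows m r c R → (∀ v, (R v).Nodup) →
      r < 32 → c < 32 → r ≠ 22 → c ≠ 22 → Rows m' r c R := fun hR hn hr hc hr' hc' =>
    hR.congr_of_lt (fun v => length_le_of_nodup (hn v)) (hfld _ hr hr') (hfld _ hc hc')
  refine ⟨(hlow _ (by omega)).trans h.zero, (hlow _ (by omega)).trans h.one, ?_, fun v hvl => ?_,
    fun u => ?_, rows h.nbrs hL (by norm_num) (by norm_num) (by norm_num) (by norm_num),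
    fun u x => ?_, ?_, fun u l => ?_, ?_, ?_, fun u l hul => ?_⟩
  · have hs := h.stores
    have e1 : ∀ v : Fin n, m' (labelAddr v) = m (labelAddr v) := fun v =>
      hlow _ (by simp only [labelAddr]; omega)
    refine ⟨fun v => by rw [e1]; exact hs.label_lt v, fun u v => by rw [e1, e1]; exact hs.label_eq u v,
      fun v => ?_, fun c hc hc' => ?_⟩
    · obtain ⟨A, h1, h2, h3, h4⟩ := hs.list v
      refine ⟨A, h1, h2, ?_, fun i hi => ?_⟩
      · have := hs.label_lt v
        rw [e1, hlow _ (by simp only [headAddr]; omega), h3]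
      · rw [hlow _ (by simp only [nextAddr]; omega), hlow _ (by simp only [prevAddr]; omega)]
        exact h4 i hi
    · rw [hlow _ (by simp only [headAddr]; omega)]
      exact hs.unused c hc fun v => by rw [← e1]; exact hc' v
  · rw [hlow _ (by omega), h.label v hvl]
  · rw [hfld 7 (by norm_num) (by norm_num) _ (hv u), h.flag]
  · rw [hfld 13 (by norm_num) (by norm_num) _ (hvw x u), h.adj]
  · obtain ⟨R, hR, hR'⟩ := h.into
    exact ⟨R, rows hR (fun w => (hR' w).1) (by norm_num) (by norm_num) (by norm_num) (by norm_num),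
      hR'⟩
  · rw [hfld 17 (by norm_num) (by norm_num) _ (hvw l u), h.link]
  · obtain ⟨R, hR, hR'⟩ := h.atoms
    exact ⟨R, rows hR (fun w => (hR' w).1) (by norm_num) (by norm_num) (by norm_num) (by norm_num),
      hR'⟩
  · obtain ⟨R, hR, hR'⟩ := h.verts
    exact ⟨R, rows hR (fun w => (hR' w).1) (by norm_num) (by norm_num) (by norm_num) (by norm_num),
      hR'⟩
  · obtain ⟨h1, h2⟩ := h.members u l hul
    refine ⟨by rw [hfld 3 (by norm_num) (by norm_num) _ (hv l), h1], fun j hj => ?_⟩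
    have := length_le_of_nodup (hM l)
    rw [hfld 5 (by norm_num) (by norm_num) _ (by nlinarith [l.2]), h2 j hj]

theorem Holds.deg_eq (h : Holds G P N lab M L m) (hL : ListsNbhd G (Loose G P) L) {u : Fin n}
    (hu : Loose G P u) : fld m 12 u = deg G u + 1 := by
  rw [(h.nbrs u).1, hL.length_eq hu]

theorem length_eq_tcard {T : Fin n → Prop} {A : List (Fin n)} {w : Fin n} (hA : A.Nodup)
    (hmem : ∀ u, u ∈ A ↔ T u ∧ w ∈ nbhd G u) : A.length = tcard G T w := by
  rw [← List.toFinset_card_of_nodup hA, tcard]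
  congr 1; ext u
  rw [List.mem_toFinset, hmem, Finset.mem_filter, mem_nbhd_comm, and_comm]

theorem Holds.into_eq (h : Holds G P N lab M L m) (w : Fin n) :
    fld m 15 w = tcard G (Loose G P) w := by
  obtain ⟨R, hR, hR'⟩ := h.into
  rw [(hR w).1, length_eq_tcard (hR' w).1 (hR' w).2]

/-! ### Testing a pair of loose vertices -/

/-- Registers 6 and 7 hold the smaller and the larger vertex, registers 8 and 9 their degrees plus
one. The sampled vertex is a closed neighbour of the smaller one by construction; array 13 decides
about the larger one, and array 15 counts its loose neighbours. -/
def sampleBody (N : ℕ) : Prog :=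
  .seq (.assign 14 (.fld 11 (.idx (.reg 6) (.reg 13)))) <|
  .ite (.fld 13 (.idx (.reg 7) (.reg 14)))
    (.ite (.bin .lt (.bin .mul (.lit N) (.bin .sub (.reg 8) (.lit 1))) (.fld 15 (.reg 14))) .skip <|
    .ite (.bin .lt (.bin .mul (.lit N) (.bin .sub (.reg 9) (.lit 1))) (.fld 15 (.reg 14))) .skip <|
    .assign 11 (.bin .add (.reg 11) (.lit 1)))
    .skip

def sampleLoop (N : ℕ) : Prog :=
  forLoop 12 (.bin .mul (.lit (sampleRate N)) (.reg 22))
    (.seq (.rand 13 (.reg 12) (.reg 8)) (sampleBody N))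

def sampleInit : Prog :=
  .seq (.ite (.bin .lt (.reg 20) (.reg 21)) (.seq (.assign 6 (.reg 20)) (.assign 7 (.reg 21)))
    (.seq (.assign 6 (.reg 21)) (.assign 7 (.reg 20)))) <|
  .seq (.assign 8 (.fld 12 (.reg 6))) <|
  .seq (.assign 9 (.fld 12 (.reg 7))) <|
  .seq (.assign 5 (.lit 0)) (.assign 11 (.lit 0))

def sampleEnd (N : ℕ) : Prog :=
  .ite (.bin .lt (.bin .mul (.lit (3 * N)) (.bin .mul (.reg 11) (.reg 8)))
    (.bin .mul (.bin .mul (.lit 2)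
      (.bin .add (.bin .sub (.reg 8) (.lit 1)) (.bin .sub (.reg 9) (.lit 1))))
      (.bin .mul (.lit (sampleRate N)) (.reg 22)))) .skip (.assign 5 (.lit 1))

/-- Tests the vertices in registers `20` and `21` with the parameter in register `22`; the answer
is in register `5`. -/
def pairTest (N : ℕ) : Prog :=
  .seq sampleInit <|
  .ite (.bin .eq (.reg 20) (.reg 21)) .skip <|
  .ite (.bin .lt (.bin .sub (.reg 8) (.lit 1)) (.bin .mul (.lit N) (.bin .sub (.reg 9) (.lit 1))))
    (.ite (.bin .lt (.bin .sub (.reg 9) (.lit 1))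
      (.bin .mul (.lit N) (.bin .sub (.reg 8) (.lit 1))))
      (.seq (sampleLoop N) (sampleEnd N)) .skip)
    .skip

def pairTestTime (N : ℕ) : ℕ :=
  ((sampleBody N).time + 30) * (sampleRate N + 1) + sampleInit.time + (sampleEnd N).time + 50

/-- The registers that are not used by the test are unchanged. -/
def SameRegs (s s' : State) : Prop := ∀ y, y < 5 ∨ 14 < y → s'.reg y = s.reg y

theorem sampleBody_keeps (y : ℕ) (hy : y ≠ 14) (hy' : y ≠ 11) : (sampleBody N).Keeps y := by
  simp [sampleBody, Prog.Keeps, hy, hy']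

structure SampleInv (G : SimpleGraph (Fin n)) (P : Clustering n) (N : ℕ)
    (L : Fin n → List (Fin n)) (ω : Rnd) (t : ℕ) (s₀ : State) (a b : Fin n) (k : ℕ) (s : State) :
    Prop where
  mem : s.mem = s₀.mem
  regs : SameRegs s₀ s
  reg5 : s.reg 5 = 0
  reg6 : s.reg 6 = a
  reg7 : s.reg 7 = b
  reg8 : s.reg 8 = deg G a + 1
  reg9 : s.reg 9 = deg G b + 1
  reg11 : s.reg 11 = commonHits G (Loose G P) N L k a b ω

theorem sampleLoop_meets (h : Holds G P N lab M L s.mem) (hL : ListsNbhd G (Loose G P) L)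
    {a b : Fin n} (ha : Loose G P a) (hb : Loose G P b) (ht : s.reg 22 = t) {s₁ : State}
    (hI : SampleInv G P N L ω t s a b 0 s₁) :
    Meets ω (sampleLoop N) s₁ (((sampleBody N).time + 30) * (sampleRate N * t + 1))
      (SampleInv G P N L ω t s a b (sampleRate N * t)) := by
  refine (Meets.forLoop (m := sampleRate N * t) (SampleInv G P N L ω t s a b)
    (fun _ => 3 + (sampleBody N).time) ?_ ?_ ?_).mono ?_ (fun s h => h.2)
  · obtain ⟨h1, h2, h3, h4, h5, h6, h7, h8⟩ := hI
    refine ⟨h1, fun y hy => ?_, by simpa, by simpa, by simpa, by simpa, by simpa, by simpa⟩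
    simp only [Function.update_of_ne (show y ≠ 12 by omega)]; exact h2 y hy
  · intro k _ s' hI _
    simp [Expr.val, Op.apply, hI.regs 22 (by norm_num), ht]
  · intro k hk s' hI hx
    have hlen := hL.length_eq ha
    obtain ⟨j, hj⟩ : ∃ j : ℕ, (ω (k, deg G a) : ℕ) = j := ⟨_, rfl⟩
    have hjlt : j < (L a).length := by rw [hlen, ← hj]; exact (ω (k, deg G a)).2
    set w := (L a)[j] with hw
    have hwa : w ∈ nbhd G a := ((hL a ha).2 w).1 (List.getElem_mem _)
    have hS : SampleIn G L a (goodCommon G (Loose G P) N a b) (ω (k, deg G a)) ↔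
        w ∈ goodCommon G (Loose G P) N a b := by
      simp [SampleIn, hj, List.getElem?_eq_getElem hjlt, hw]
    have hcount : commonHits G (Loose G P) N L (k + 1) a b ω =
        commonHits G (Loose G P) N L k a b ω +
          if w ∈ goodCommon G (Loose G P) N a b then 1 else 0 := by
      simp only [commonHits, hits, Finset.range_add_one, Finset.filter_insert, hS]
      split
      · rw [Finset.card_insert_of_notMem (by simp)]
      · rfl
    refine Meets.seq (B₁ := 3) (R := fun s'' => s'' = ⟨Function.update s'.reg 13 j, s'.mem⟩)
      (Meets.rand ?_ ?_) ?_
    · simp [Expr.val, hI.reg8]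
    -- The range deg a + 1 is the length of the list, and this sample is the coordinate `(k, deg G
    -- a)` of the random source.
    · have e8 : s'.reg 8 - 1 = deg G a := by rw [hI.reg8]; omega
      have : (ω (s'.reg 12, s'.reg 8 - 1) : ℕ) = j := by rw [hx, e8]; exact hj
      simp only [Expr.val, this]
    · rintro s'' rfl
      refine Prog.Straight.meets (by simp [sampleBody, Prog.Straight]) ?_
      set s₂ : State := ⟨Function.update s'.reg 13 j, s'.mem⟩ with hs₂
      have hK : ∀ y, y ≠ 14 → y ≠ 11 → ((sampleBody N).eval s₂).reg y = s₂.reg y := fun y h1 h2 =>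
        (sampleBody_keeps y h1 h2).eval_reg s₂
      have hmem : ((sampleBody N).eval s₂).mem = s'.mem := by
        simp [sampleBody, Prog.eval, hs₂, Expr.val, Op.apply]
        split_ifs <;> rfl
      have e11 : fld s.mem 11 (j * n + a) = w := (h.nbrs a).2 j hjlt
      have h11 : ((sampleBody N).eval s₂).reg 11 = s'.reg 11 +
          if w ∈ goodCommon G (Loose G P) N a b then 1 else 0 := by
        simp [sampleBody, Prog.eval, hs₂, Expr.val, Op.apply, Expr.val_fld, Expr.val_idx, hI.mem,
          hI.reg6, hI.reg7, hI.reg8, hI.reg9, h.zero, e11, h.adj, h.into_eq, goodCommon, hwa, hb]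
        by_cases h1 : w ∈ nbhd G b <;> by_cases h2 : tcard G (Loose G P) w ≤ N * deg G a <;>
          by_cases h3 : tcard G (Loose G P) w ≤ N * deg G b <;>
          simp [h1, h2, h3]
      refine ⟨by rw [hK _ (by norm_num) (by norm_num), hs₂]; simpa using hx, ?_⟩
      refine ⟨hmem.trans hI.mem, fun y hy => ?_, ?_, ?_, ?_, ?_, ?_, ?_⟩
      · simp only [Function.update_of_ne (show y ≠ 12 by omega)]
        rw [hK y (by omega) (by omega), hs₂]
        simp only [Function.update_of_ne (show y ≠ 13 by omega)]
        exact hI.regs y hy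
      · simpa [hs₂, hI.reg5] using hK 5 (by norm_num) (by norm_num)
      · simpa [hs₂, hI.reg6] using hK 6 (by norm_num) (by norm_num)
      · simpa [hs₂, hI.reg7] using hK 7 (by norm_num) (by norm_num)
      · simpa [hs₂, hI.reg8] using hK 8 (by norm_num) (by norm_num)
      · simpa [hs₂, hI.reg9] using hK 9 (by norm_num) (by norm_num)
      · simp [h11, hcount, hI.reg11]
  · simp only [Finset.sum_const, Finset.card_range, smul_eq_mul, Expr.cost]
    nlinarith [Nat.zero_le (sampleBody N).time]

theorem pairTest_meets (h : Holds G P N lab M L s.mem) (hL : ListsNbhd G (Loose G P) L)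
    {u v : Fin n} (hu : Loose G P u) (hv : Loose G P v) (h20 : s.reg 20 = u) (h21 : s.reg 21 = v)
    (ht : s.reg 22 = t) : Meets ω (pairTest N) s (pairTestTime N * (t + 1)) fun s' =>
      s'.mem = s.mem ∧ SameRegs s s' ∧ s'.reg 5 =
        if PairTest G (Loose G P) N L (sampleRate N * t) u v ω then 1 else 0 := by
  set a := min u v with ha
  set b := max u v with hb
  have hab : a = u ∧ b = v ∨ a = v ∧ b = u := by
    rcases le_total u v with h | h
    · exact Or.inl ⟨min_eq_left h, max_eq_right h⟩
    · exact Or.inr ⟨min_eq_right h, max_eq_left h⟩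
  have hla : Loose G P a := by rcases hab with h | h <;> rw [h.1] <;> assumption
  have hlb : Loose G P b := by rcases hab with h | h <;> rw [h.2] <;> assumption
  have hsim : PairSim G (Loose G P) N u v ↔
      u ≠ v ∧ deg G a < N * deg G b ∧ deg G b < N * deg G a := by
    simp only [PairSim, hu, hv, true_and]
    rcases hab with h | h <;> rw [h.1, h.2]
    tauto
  have hinit : SampleInv G P N L ω t s a b 0 (sampleInit.eval s) := by
    have hreg6 : (if s.reg 20 < s.reg 21 then s.reg 20 else s.reg 21) = a := by
      rw [h20, h21, ha]
      split
      · rename_i hlt; rw [min_eq_left (by exact_mod_cast hlt.le)]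
      · rename_i hlt; rw [min_eq_right (by exact_mod_cast not_lt.1 hlt)]
    have hreg7 : (if s.reg 20 < s.reg 21 then s.reg 21 else s.reg 20) = b := by
      rw [h20, h21, hb]
      split
      · rename_i hlt; rw [max_eq_right (by exact_mod_cast hlt.le)]
      · rename_i hlt; rw [max_eq_left (by exact_mod_cast not_lt.1 hlt)]
    have hda := h.deg_eq hL hla
    have hdb := h.deg_eq hL hlb
    have hK : SameRegs s (sampleInit.eval s) := fun y hy => by
      refine Prog.Keeps.eval_reg ?_ s
      simp only [sampleInit, Prog.Keeps]
      omega
    by_cases hlt : s.reg 20 < s.reg 21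
    · simp only [hlt, if_true] at hreg6 hreg7
      rw [hreg6, hreg7] at hlt
      replace hlt : ¬ b ≤ a := not_le.2 (by exact_mod_cast hlt)
      refine ⟨?_, hK, ?_, ?_, ?_, ?_, ?_, ?_⟩ <;>
        simp [sampleInit, Prog.eval, Expr.val, Op.apply, Expr.val_fld, hlt, hreg6, hreg7, hda, hdb,
          commonHits, hits]
    · simp only [hlt, if_false] at hreg6 hreg7
      rw [hreg6, hreg7] at hlt
      replace hlt : a ≤ b := by exact_mod_cast not_lt.1 hlt
      refine ⟨?_, hK, ?_, ?_, ?_, ?_, ?_, ?_⟩ <;>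
        simp [sampleInit, Prog.eval, Expr.val, Op.apply, Expr.val_fld, hlt, hreg6, hreg7, hda, hdb,
          commonHits, hits]
  have hno : ∀ s₁ : State, SampleInv G P N L ω t s a b 0 s₁ → ¬ PairSim G (Loose G P) N u v →
      s₁.mem = s.mem ∧ SameRegs s s₁ ∧ s₁.reg 5 =
        if PairTest G (Loose G P) N L (sampleRate N * t) u v ω then 1 else 0 := fun s₁ hI hn => by
    refine ⟨hI.mem, hI.regs, ?_⟩
    rw [hI.reg5, if_neg fun h => hn h.1]
  refine Meets.mono (B₁ := sampleInit.time + (10 + 1 + (10 + 1 + (10 + 1 +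
    (((sampleBody N).time + 30) * (sampleRate N * t + 1) + (sampleEnd N).time + 1)))))
    (Meets.seq (R := SampleInv G P N L ω t s a b 0) ?_ fun s₁ hI => ?_) ?_ (fun _ h => h)
  · exact Prog.Straight.meets (by simp [sampleInit, Prog.Straight]) hinit
  · have e8 : s₁.reg 8 - 1 = deg G a := by rw [hI.reg8]; omega
    have e9 : s₁.reg 9 - 1 = deg G b := by rw [hI.reg9]; omega
    have e20 : s₁.reg 20 = u := (hI.regs 20 (by norm_num)).trans h20
    have e21 : s₁.reg 21 = v := (hI.regs 21 (by norm_num)).trans h21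
    have skip : ∀ {B}, ¬ PairSim G (Loose G P) N u v → Meets ω .skip s₁ (B + 1) fun s' =>
      s'.mem = s.mem ∧ SameRegs s s' ∧ s'.reg 5 =
        if PairTest G (Loose G P) N L (sampleRate N * t) u v ω then 1 else 0 := fun hn =>
      (Prog.Straight.meets (p := .skip) trivial (hno s₁ hI hn)).mono (by simp [Prog.time])
        fun _ h => h
    refine (Meets.ite (B := 10 + 1 + (10 + 1 +
      (((sampleBody N).time + 30) * (sampleRate N * t + 1) + (sampleEnd N).time + 1)))
      (fun he => ?_) fun he => ?_).mono (by simp [Expr.cost]) (fun _ h => h)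
    · refine skip fun hs => (hsim.1 hs).1 ?_
      simp [Expr.val, Op.apply, e20, e21] at he
      exact Fin.ext he
    have huv : u ≠ v := by
      rintro rfl; simp [Expr.val, Op.apply, e20, e21] at he
    refine (Meets.ite (B := 10 + 1 +
      (((sampleBody N).time + 30) * (sampleRate N * t + 1) + (sampleEnd N).time + 1))
      (fun he1 => ?_) fun he1 => ?_).mono (by simp [Expr.cost]) (fun _ h => h)
    swap
    · refine skip fun hs => ?_
      have := (hsim.1 hs).2.1
      simp [Expr.val, Op.apply, e8, e9] at he1
      omega
    refine (Meets.ite (B :=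
      (((sampleBody N).time + 30) * (sampleRate N * t + 1) + (sampleEnd N).time + 1))
      (fun he2 => ?_) fun he2 => ?_).mono (by simp [Expr.cost]) (fun _ h => h)
    swap
    · refine skip fun hs => ?_
      have := (hsim.1 hs).2.2
      simp [Expr.val, Op.apply, e8, e9] at he2
      omega
    have hs : PairSim G (Loose G P) N u v := by
      refine hsim.2 ⟨huv, ?_, ?_⟩
      · simp [Expr.val, Op.apply, e8, e9] at he1; omega
      · simp [Expr.val, Op.apply, e8, e9] at he2; omega
    refine Meets.mono (Meets.seq (sampleLoop_meets h hL hla hlb ht hI) fun s₂ h₂ =>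
      Prog.Straight.meets (p := sampleEnd N) (by simp [sampleEnd, Prog.Straight]) ?_)
      (Nat.le_succ _) (fun _ h => h)
    have e8 : s₂.reg 8 - 1 = deg G a := by rw [h₂.reg8]; omega
    have e9 : s₂.reg 9 - 1 = deg G b := by rw [h₂.reg9]; omega
    have e22 : s₂.reg 22 = t := (h₂.regs 22 (by norm_num)).trans ht
    have hK : SameRegs s₂ ((sampleEnd N).eval s₂) := fun y hy => by
      refine Prog.Keeps.eval_reg ?_ s₂
      simp [sampleEnd, Prog.Keeps]
      omega
    refine ⟨?_, fun y hy => (hK y hy).trans (h₂.regs y hy), ?_⟩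
    · rw [← h₂.mem]
      simp only [sampleEnd, Prog.eval]
      split <;> rfl
    · have : PairTest G (Loose G P) N L (sampleRate N * t) u v ω ↔
          2 * (deg G a + deg G b) * (sampleRate N * t) ≤
            3 * N * (commonHits G (Loose G P) N L (sampleRate N * t) a b ω * (deg G a + 1)) :=
        and_iff_right hs
      rw [if_congr this rfl rfl]
      simp [sampleEnd, Prog.eval, Expr.val, Op.apply, e9, e22, h₂.reg8, h₂.reg11]
      split_ifs <;> first | omega | simp [h₂.reg5]
  · rw [pairTestTime]
    have : ((sampleBody N).time + 30) * (sampleRate N * t + 1) ≤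
        ((sampleBody N).time + 30) * (sampleRate N + 1) * (t + 1) := by
      rw [mul_assoc]; gcongr; nlinarith
    nlinarith [Nat.zero_le (sampleInit.time * t), Nat.zero_le ((sampleEnd N).time * t)]

end Check

end

/-! ### Queries: answering for an arbitrary pair, and output without repetition -/

section

variable {n : ℕ}

section Output
open Classical

variable {G : SimpleGraph (Fin n)} {P : Clustering n} {lab : Fin n → Fin n}
  {M L : Fin n → List (Fin n)} {D : List (Fin n × Fin n)} {N t : ℕ} {m m' : ℕ → ℕ} {ω : Rnd}
  {s : State}

/-! ### Checking a pair -/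

/-- Links refer to input labels; two non-loose vertices with the same label lie in the same atom, to
which admissibility is uniform. -/
theorem InputSpec.labelAdm_iff (h : InputSpec G P lab M D) {u v : Fin n} (hv : ¬ Loose G P v) :
    LabelAdm G P lab N u (lab v) ↔ CoreAdm G P N u v := by
  refine ⟨?_, fun hu => ⟨v, rfl, hu⟩⟩
  rintro ⟨x, hx, hu⟩
  exact ((sizedCore G P).atomAdm_congr hv (mem_coreClustering.2
    (Or.inr ⟨hu.2.1, hv, (h.lab_eq _ _).1 hx⟩))).1 hu

abbrev CoreAnswer (G : SimpleGraph (Fin n)) (P : Clustering n) (N : ℕ)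
    (L : Fin n → List (Fin n)) (t : ℕ) (u v : Fin n) (ω : Rnd) : Prop :=
  Answer G (coreClustering G P) (Loose G P) (fun v => (P.part v).card) N L (sampleRate N * t) u v ω

/-- Checks the pair in the registers `0` and `1` with the parameter in register `2`. -/
def check (N : ℕ) : Prog :=
  .seq (.seq (.assign 20 (.reg 0)) (.seq (.assign 21 (.reg 1)) (.assign 22 (.reg 2)))) <|
  .ite (.fld 7 (.reg 20))
    (.ite (.fld 7 (.reg 21)) (.seq (pairTest N) (.assign 0 (.reg 5)))
      (.assign 0 (.fld 17 (.idx (.reg 20) (.lab (.reg 21))))))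
    (.ite (.fld 7 (.reg 21)) (.assign 0 (.fld 17 (.idx (.reg 21) (.lab (.reg 20)))))
      (.assign 0 (.lit 0)))

def checkTime (N : ℕ) : ℕ := pairTestTime N + 200

/-- Two loose vertices are tested by sampling, a loose and a non-loose one are looked up in the link
matrix, and two non-loose ones are never admissible. Only labels of non-loose vertices are read, and
these are still the input labels. -/
theorem check_meets (hsp : InputSpec G P lab M D) (h : Holds G P N lab M L s.mem)
    (hL : ListsNbhd G (Loose G P) L) {u v : Fin n} (h0 : s.reg 0 = u) (h1 : s.reg 1 = v)
    (h2 : s.reg 2 = t) : Meets ω (check N) s (checkTime N * (t + 1)) fun s' =>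
      s'.mem = s.mem ∧ ReturnsBool (CoreAnswer G P N L t u v ω) s' := by
  refine Meets.mono (B₁ := 6 + (30 + (30 + (pairTestTime N * (t + 1) + 100)))) (Meets.seq
    (R := fun s₁ => s₁.mem = s.mem ∧ s₁.reg 20 = u ∧ s₁.reg 21 = v ∧ s₁.reg 22 = t)
    (Prog.Straight.meets (by simp [Prog.Straight]) (by simp [Prog.eval, Expr.val, h0, h1, h2]))
    ?_) ?_ (fun _ h => h)
  swap
  · rw [checkTime]; nlinarith
  rintro s₁ ⟨hm, h20, h21, h22⟩
  rw [← hm] at h ⊢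
  have hfu : (Expr.fld 7 (.reg 20)).val s₁ = if Loose G P u then 1 else 0 := by
    rw [Expr.val_fld, ← h.flag]; simp [Expr.val, h20]
  have hfv : (Expr.fld 7 (.reg 21)).val s₁ = if Loose G P v then 1 else 0 := by
    rw [Expr.val_fld, ← h.flag]; simp [Expr.val, h21]
  have ret : ∀ {e : Expr} {B : ℕ}, e.cost ≤ 99 → e.val s₁ = (if CoreAnswer G P N L t u v ω
      then 1 else 0) → Meets ω (.assign 0 e) s₁ (B + 100) fun s' =>
      s'.mem = s₁.mem ∧ ReturnsBool (CoreAnswer G P N L t u v ω) s' := by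
    intro e B he hv
    refine (Prog.Straight.meets (p := .assign 0 e) trivial ⟨rfl, ?_⟩).mono
      (by simp only [Prog.time]; omega) (fun _ h => h)
    simp only [Prog.eval, ReturnsBool, Function.update_self, hv]
    split <;> simp_all
  refine (Meets.ite (B := 30 + (pairTestTime N * (t + 1) + 100)) (fun hu => ?_) fun hu => ?_).mono
    (by simp [Expr.fld, Expr.fldAddr, Expr.cost]) (fun _ h => h) <;>
  refine (Meets.ite (B := pairTestTime N * (t + 1) + 100) (fun hv => ?_) fun hv => ?_).mono
    (by simp [Expr.fld, Expr.fldAddr, Expr.cost]) (fun _ h => h) <;>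
  simp only [hfu, hfv, ne_eq, ite_eq_right_iff, one_ne_zero, imp_false, not_not] at hu hv
  · refine (Meets.seq (pairTest_meets h hL hu hv h20 h21 h22) fun s₂ h₂ => Prog.Straight.meets
      (p := .assign 0 (.reg 5)) trivial ⟨h₂.1, ?_⟩).mono
      (by simp [Prog.time, Expr.cost]) (fun _ h => h)
    have : CoreAnswer G P N L t u v ω ↔ PairTest G (Loose G P) N L (sampleRate N * t) u v ω := by
      simp [CoreAnswer, Answer, AtomAdm, hu, hv]
    simp only [Prog.eval, ReturnsBool, Function.update_self, Expr.val, h₂.2.2, this]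
    split <;> simp_all
  · refine ret (by simp [Expr.fld, Expr.fldAddr, Expr.cost, Expr.idx, Expr.lab]) ?_
    have e : s₁.mem (2 + v) = lab v := h.label v hv
    have : CoreAnswer G P N L t u v ω ↔ CoreAdm G P N u v := by
      simp [CoreAnswer, Answer, PairTest, PairSim, hv, AtomAdm, hu]
    rw [if_congr (this.trans (hsp.labelAdm_iff hv).symm) rfl rfl, ← h.link]
    simp [Expr.val_fld, Expr.val_idx, Expr.lab, Expr.val, Op.apply, h20, h21, h.zero, e]
  · refine ret (by simp [Expr.fld, Expr.fldAddr, Expr.cost, Expr.idx, Expr.lab]) ?_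
    have e : s₁.mem (2 + u) = lab u := h.label u hu
    have : CoreAnswer G P N L t u v ω ↔ CoreAdm G P N v u := by
      simp [CoreAnswer, Answer, PairTest, PairSim, hv, AtomAdm, hu]
    rw [if_congr (this.trans (hsp.labelAdm_iff hu).symm) rfl rfl, ← h.link]
    simp [Expr.val_fld, Expr.val_idx, Expr.lab, Expr.val, Op.apply, h20, h21, h.zero, e]
  · refine ret (by simp [Expr.cost]) ?_
    simp [CoreAnswer, Answer, PairTest, PairSim, AtomAdm, hu, hv, Expr.val]

/-! ### Writing the output -/

/-- The first address behind the arrays. -/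
def outBase (m : ℕ → ℕ) : ℕ := fldAddr m 0 (m 0 * m 0 + 1)

def Expr.outBase : Expr := .fldAddr 0 (.bin .add (.bin .mul .numV .numV) (.lit 1))

theorem Expr.val_outBase (s : State) : Expr.outBase.val s = CorrClust.outBase s.mem := rfl

theorem le_outBase (m : ℕ → ℕ) : memBase m + 32 ≤ outBase m := by
  simp only [outBase, fldAddr]; omega

/-- Up to marks and outputs, the memory `m'` agrees with `m`. -/
structure Scratch (n : ℕ) (m m' : ℕ → ℕ) : Prop where
  low : ∀ a < memBase m, m' a = m a
  fld : ∀ r < 32, r ≠ 22 → ∀ i < n * n, fld m' r i = fld m r i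
  le : ∀ a, m' a ≤ max (m a) n

theorem Scratch.refl (m : ℕ → ℕ) : Scratch n m m :=
  ⟨fun _ _ => rfl, fun _ _ _ _ _ => rfl, fun _ => le_max_left _ _⟩

theorem Scratch.zero (h : Scratch n m m') : m' 0 = m 0 := h.low 0 (by simp [memBase])

theorem Scratch.one (h : Scratch n m m') : m' 1 = m 1 := h.low 1 (by simp [memBase]; omega)

theorem Scratch.memBase (h : Scratch n m m') : memBase m' = memBase m := by
  simp [CorrClust.memBase, h.zero, h.one]

theorem Scratch.outBase (h : Scratch n m m') : outBase m' = outBase m := by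
  simp [CorrClust.outBase, fldAddr, h.zero, h.memBase]

theorem Scratch.mark (h : Scratch n m m') (i : ℕ) {x : ℕ} (hx : x ≤ n) :
    Scratch n m (setFld m' 22 i x) := by
  refine ⟨fun a ha => ?_, fun r hr hr' j hj => ?_, fun a => ?_⟩
  · rw [setFld_of_lt (by rwa [h.memBase]), h.low a ha]
  · rw [fld_setFld_ne (by norm_num) hr hr', h.fld r hr hr' j hj]
  · rw [setFld, Function.update_apply]
    split
    · exact hx.trans (le_max_right _ _)
    · exact h.le a

theorem fldAddr_lt_outBase {r i : ℕ} (hr : r < 32) (hi : i ≤ m 0 * m 0) :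
    fldAddr m r i < outBase m := by
  simp only [outBase, fldAddr]; omega

theorem update_out_of_lt {k x a : ℕ} (ha : a < outBase m) :
    Function.update m (outBase m + k) x a = m a :=
  Function.update_of_ne (by omega) _ _

theorem memBase_update_out (k x : ℕ) :
    memBase (Function.update m (outBase m + k) x) = memBase m := by
  have := le_outBase m
  simp only [memBase] at *
  rw [update_out_of_lt (by omega), update_out_of_lt (by omega)]

theorem fld_update_out {k x r i : ℕ} (hr : r < 32) (hi : i ≤ m 0 * m 0) :
    fld (Function.update m (outBase m + k) x) r i = fld m r i := by
  have e : fldAddr (Function.update m (outBase m + k) x) r i = fldAddr m r i := by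
    simp [fldAddr, memBase_update_out]
  rw [fld, e, update_out_of_lt (fldAddr_lt_outBase hr hi), fld]

theorem Scratch.out (h : Scratch n m m') (hn : m 0 = n) (k : ℕ) {x : ℕ} (hx : x ≤ n) :
    Scratch n m (Function.update m' (CorrClust.outBase m' + k) x) := by
  have h0 : m' 0 = n := h.zero.trans hn
  refine ⟨fun a ha => ?_, fun r hr hr' j hj => ?_, fun a => ?_⟩
  · have := le_outBase m'
    rw [update_out_of_lt (by rw [h.memBase] at this; omega), h.low a ha]
  · rw [fld_update_out hr (by rw [h0]; exact hj.le), h.fld r hr hr' j hj]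
  · rw [Function.update_apply]
    split
    · exact hx.trans (le_max_right _ _)
    · exact h.le a

theorem setFld_out {r i x k : ℕ} (hr : r < 32) (hi : i ≤ m 0 * m 0) :
    setFld m r i x (outBase m + k) = m (outBase m + k) :=
  Function.update_of_ne (by have := fldAddr_lt_outBase hr hi; omega) _ _

theorem Holds.scratch (h : Holds G P N lab M L m) (hM : ∀ l, (M l).Nodup)
    (hL : ∀ v, (L v).Nodup) (hs : Scratch n m m') : Holds G P N lab M L m' :=
  h.congr hM hL hs.low hs.fld

/-- The list `F` has been written: its elements are marked, and its length is in register `23`. -/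
structure Wrote (F : List (Fin n)) (s : State) : Prop where
  nodup : F.Nodup
  len : s.reg 23 = F.length
  out : ∀ j (hj : j < F.length), s.mem (outBase s.mem + j) = F[j]

/-- The elements of `S` have been written and marked; otherwise, the memory is as in `m`. -/
def Emits (m : ℕ → ℕ) (S : Set (Fin n)) (s : State) : Prop :=
  Scratch n m s.mem ∧ (∀ u : Fin n, fld s.mem 22 u = if u ∈ S then 1 else 0) ∧
    ∃ F, Wrote F s ∧ ∀ u, u ∈ F ↔ u ∈ S

theorem Emits.congr {S : Set (Fin n)} {s s' : State} (h : Emits m S s) (hm : s'.mem = s.mem)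
    (hr : s'.reg 23 = s.reg 23) : Emits m S s' := by
  obtain ⟨h1, h2, F, ⟨h3, h4, h5⟩, h6⟩ := h
  exact ⟨hm ▸ h1, hm ▸ h2, F, ⟨h3, hr.trans h4, hm ▸ h5⟩, h6⟩

/-- Writes the vertex in register `20` unless it is marked. -/
def emit : Prog :=
  .ite (.fld 22 (.reg 20)) .skip <|
  .seq (.store (.bin .add .outBase (.reg 23)) (.reg 20)) <|
  .seq (.setFld 22 (.reg 20) (.lit 1)) (.assign 23 (.bin .add (.reg 23) (.lit 1)))

theorem emit_straight : emit.Straight := by simp [emit, Prog.Straight, Prog.setFld]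

theorem emit_eval_reg (s : State) {y : ℕ} (hy : y ≠ 23) : (emit.eval s).reg y = s.reg y :=
  Prog.Keeps.eval_reg (by simp [emit, Prog.Keeps, Prog.setFld, hy]) s

/-- The mark prevents a repetition. The output lies behind all marks and data, so writing it
disturbs neither. -/
theorem Emits.emit (hn : m 0 = n) {S : Set (Fin n)} (h : Emits m S s) {u : Fin n}
    (hu : s.reg 20 = u) : Emits m (S ∪ {u}) (emit.eval s) := by
  obtain ⟨hs, hmark, F, hF, hFS⟩ := h
  have h0 : s.mem 0 = n := hs.zero.trans hn
  have hun : (u : ℕ) ≤ n * n := u.2.le.trans (Nat.le_mul_self n)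
  have hval : (Expr.fld 22 (.reg 20)).val s = if u ∈ S then 1 else 0 := by
    rw [Expr.val_fld, ← hmark]; simp [Expr.val, hu]
  by_cases huS : u ∈ S
  · have e : CorrClust.emit.eval s = s := by
      simp [CorrClust.emit, Prog.eval, hval, huS]
    rw [e]
    have : S ∪ {u} = S := Set.union_eq_self_of_subset_right (by simpa)
    rw [this]
    exact ⟨hs, hmark, F, hF, hFS⟩
  · set m₁ := Function.update s.mem (CorrClust.outBase s.mem + s.reg 23) (u : ℕ) with hm₁
    have hs₁ : Scratch n m m₁ := hs.out hn _ u.2.le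
    have h01 : m₁ 0 = n := hs₁.zero.trans hn
    have e : CorrClust.emit.eval s =
        ⟨Function.update s.reg 23 (s.reg 23 + 1), setFld m₁ 22 u 1⟩ := by
      simp [CorrClust.emit, Prog.eval, hval, huS, Expr.val, Op.apply, hu, Prog.eval_setFld,
        Expr.val_outBase, hm₁]
    rw [e]
    have ho : outBase m₁ = outBase s.mem := hs₁.outBase.trans hs.outBase.symm
    have hs₂ := hs₁.mark u (x := 1) (by have := u.2; omega)
    refine ⟨hs₂, fun w => ?_, F ++ [u], ⟨?_, ?_, fun j hj => ?_⟩, fun w => ?_⟩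
    · simp only [fld_setFld_same (show 22 < 32 by norm_num)]
      rw [hm₁, fld_update_out (by norm_num) (by rw [h0]; exact w.2.le.trans (Nat.le_mul_self n)),
        hmark w]
      by_cases hw : w = u
      · simp [hw]
      · have : (w : ℕ) ≠ u := fun h => hw (Fin.ext h)
        simp [hw, this]
    · exact hF.nodup.append (by simp) (by simpa [hFS] using huS)
    · simp [hF.len]
    · have e2 : outBase (setFld m₁ 22 u 1) = outBase m₁ := hs₂.outBase.trans hs₁.outBase.symm
      simp only [e2]
      rw [setFld_out (by norm_num) (by rw [h01]; exact hun), ho, hm₁, Function.update_apply]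
      simp only [List.length_append, List.length_singleton] at hj
      by_cases hj' : j = F.length
      · subst hj'; simp [hF.len]
      · rw [if_neg (by rw [hF.len]; omega), List.getElem_append_left (by omega)]
        exact hF.out j (by omega)
    · simp [hFS, or_comm]

/-- A loop in which every element `a` of a list emits the set `T a`. -/
theorem Meets.forEmit {α : Type*} {x : ℕ} {e : Expr} {p : Prog} (A : List α) (c : α → ℕ)
    (T : α → Set (Fin n)) (rs : List ℕ) (hx : x ∉ rs) (hx' : x ≠ 23) {S : Set (Fin n)}
    (h : Emits m S s)
    (hm : ∀ (S : Set (Fin n)) s', Emits m S s' → (∀ y ∈ rs, s'.reg y = s.reg y) → e.val s' = A.length)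
    (hstep : ∀ i (hi : i < A.length), ∀ (S : Set (Fin n)) s', Emits m S s' → (∀ y ∈ rs, s'.reg y = s.reg y) →
      s'.reg x = i → Meets ω p s' (c A[i]) fun s'' =>
        Emits m (S ∪ T A[i]) s'' ∧ ∀ y ∈ x :: rs, s''.reg y = s'.reg y) :
    Meets ω (CorrClust.forLoop x e p) s ((A.map fun a => c a + e.cost + 20).sum + (e.cost + 20))
      fun s' => Emits m (S ∪ {u | ∃ a ∈ A, u ∈ T a}) s' ∧ ∀ y ∈ rs, s'.reg y = s.reg y := by
  refine Meets.forList A c (fun pre s' => Emits m (S ∪ {u | ∃ a ∈ pre, u ∈ T a}) s' ∧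
    ∀ y ∈ rs, s'.reg y = s.reg y) ?_ ⟨by simpa using h, fun _ _ => rfl⟩ (fun pre s' h' =>
      hm _ s' h'.1 h'.2) ?_
  · rintro pre s' r ⟨h1, h2⟩
    refine ⟨h1.congr rfl (by simp [hx'.symm]), fun y hy => ?_⟩
    have : y ≠ x := by rintro rfl; exact hx hy
    simpa [this] using h2 y hy
  · rintro pre a post rfl s' ⟨h1, h2⟩ hr
    refine ((hstep pre.length (by simp) _ s' h1 h2 hr).mono (by simp) fun s'' h'' => ?_)
    refine ⟨h''.2 x (by simp), ?_, fun y hy => (h''.2 y (by simp [hy])).trans (h2 y hy)⟩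
    have : S ∪ {u | ∃ b ∈ pre ++ [a], u ∈ T b} = S ∪ {u | ∃ b ∈ pre, u ∈ T b} ∪ T a := by
      ext u
      simp only [List.mem_append, List.mem_singleton, Set.mem_union, Set.mem_ofPred_eq, or_assoc,
        or_and_right, exists_or, exists_eq_left]
    rw [this]
    simpa using h''.1

/-- The set `S` has been written and nothing is marked; otherwise, the memory is as in `m`. -/
def Output (m : ℕ → ℕ) (S : Set (Fin n)) (s : State) : Prop :=
  Scratch n m s.mem ∧ (∀ u : Fin n, fld s.mem 22 u = 0) ∧
    ∃ F : List (Fin n), F.Nodup ∧ (∀ u, u ∈ F ↔ u ∈ S) ∧ s.reg 0 = F.length ∧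
      ∀ j (hj : j < F.length), s.mem (outBase s.mem + j) = F[j]

/-- Clears the marks and returns the number of elements. -/
def clear : Prog :=
  .seq (forLoop 16 (.reg 23) (.seq (.assign 20 (.load (.bin .add .outBase (.reg 16))))
    (.setFld 22 (.reg 20) (.lit 0)))) (.assign 0 (.reg 23))

/-- Only the written vertices carry marks, so the marks are removed in time linear in the output,
and the next query starts from unmarked memory. -/
theorem clear_meets (hn : m 0 = n) {S : Set (Fin n)} (h : Emits m S s) :
    Meets ω clear s (200 * (S.ncard + 1)) (Output m S) := by
  obtain ⟨hs, hmark, F, hF, hFS⟩ := h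
  have hc : S.ncard = F.length := by
    rw [← List.toFinset_card_of_nodup hF.nodup, ← Set.ncard_coe_finset]
    congr 1; ext u; simp [hFS]
  refine Meets.mono (B₁ := ((F.map fun _ => 100 + (Expr.reg 23).cost + 20).sum +
    ((Expr.reg 23).cost + 20)) + 2) (Meets.seq (Meets.forList F (fun _ => 100) (fun pre s' =>
      (Scratch n m s'.mem ∧ Wrote F s') ∧
        ∀ u : Fin n, fld s'.mem 22 u = if u ∈ S ∧ u ∉ pre then 1 else 0) ?_ ?_ ?_ ?_)
        fun s' h' => Prog.Straight.meets (p := .assign 0 (.reg 23)) trivial ?_) ?_ fun _ h => h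
  · rintro pre s' r ⟨⟨h1, h2⟩, h3⟩
    exact ⟨⟨h1, h2.nodup, by simpa using h2.len, h2.out⟩, h3⟩
  · exact ⟨⟨hs, hF⟩, by simpa using hmark⟩
  · rintro pre s' ⟨⟨h1, h2⟩, h3⟩
    exact h2.len
  · rintro pre a post hpre s' ⟨⟨h1, h2⟩, h3⟩ hr
    have h0 : s'.mem 0 = n := h1.zero.trans hn
    have ha : s'.mem (outBase s'.mem + pre.length) = a := by
      rw [h2.out _ (by simp [hpre])]; simp [hpre]
    refine (Prog.Straight.meets (by simp [Prog.Straight, Prog.setFld]) ?_).mono (B₁ := _)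
      (by simp [Prog.time, Expr.cost, Prog.setFld, Expr.outBase, Expr.fldAddr]) fun _ h => h
    simp only [Prog.eval, Prog.eval_setFld, Expr.val, Op.apply, Expr.val_outBase, hr, ha]
    have hs₁ := h1.mark a (x := 0) (Nat.zero_le n)
    refine ⟨by simp [hr], ⟨⟨by simpa using hs₁, h2.nodup, by simpa using h2.len, fun j hj => ?_⟩,
      fun u => ?_⟩⟩
    · simp only [Function.update_self]
      rw [hs₁.outBase, ← h1.outBase, setFld_out (by norm_num)
        (by rw [h0]; exact a.2.le.trans (Nat.le_mul_self n))]
      exact h2.out j hj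
    · simp only [Function.update_self, fld_setFld_same (show 22 < 32 by norm_num), h3]
      by_cases hu : u = a
      · simp [hu]
      · have : (u : ℕ) ≠ a := fun h => hu (Fin.ext h)
        simp [hu, this]
  · obtain ⟨⟨h1, h2⟩, h3⟩ := h'
    refine ⟨h1, fun u => ?_, F, hF.nodup, hFS, ?_, h2.out⟩
    · simp only [Prog.eval, h3, ← hFS]
      simp
    · simp [Prog.eval, Expr.val, h2.len]
  · simp [Expr.cost, hc]; omega

end Output

end

/-! ### Queries: the admissible vertices of an atom, and the atoms of a vertex -/

section

variable {n : ℕ}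

section Lists
open Classical

variable {G : SimpleGraph (Fin n)} {P : Clustering n} {lab : Fin n → Fin n}
  {M L : Fin n → List (Fin n)} {D : List (Fin n × Fin n)} {N t : ℕ} {m m' : ℕ → ℕ} {ω : Rnd}
  {s : State}

theorem Scratch.rows (h : Scratch n m m') {r c : ℕ} {R : Fin n → List (Fin n)} (hR : Rows m r c R)
    (hn : ∀ v, (R v).Nodup) (hr : r < 32) (hc : c < 32) (hr' : r ≠ 22) (hc' : c ≠ 22) :
    Rows m' r c R :=
  hR.congr_of_lt (fun v => length_le_of_nodup (hn v)) (h.fld _ hr hr') (h.fld _ hc hc')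

/-! ### Listing the admissible neighbours of an atom -/

def atomLoop : Prog :=
  forLoop 16 (.fld 19 (.reg 21)) (.seq (.assign 20 (.fld 18 (.idx (.reg 21) (.reg 16)))) emit)

/-- Lists the vertices admissible to the atom whose label is in register `0`. -/
def listAtomBody : Prog :=
  .seq (.seq (.assign 21 (.reg 0)) (.assign 23 (.lit 0))) (.seq atomLoop clear)

theorem emits_empty (hm : m = s.mem) (hmark : ∀ u : Fin n, fld m 22 u = 0) (hr : s.reg 23 = 0) :
    Emits (n := n) m ∅ s := by
  subst hm
  exact ⟨Scratch.refl _, by simpa using hmark, [], ⟨by simp, by simpa using hr, by simp⟩, by simp⟩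

theorem listAtomBody_meets (h : Holds G P N lab M L s.mem)
    (hmark : ∀ u : Fin n, fld s.mem 22 u = 0) {l : Fin n} (h0 : s.reg 0 = l) :
    Meets ω listAtomBody s (1000 * ({u | LabelAdm G P lab N u l}.ncard + 1))
      (Output s.mem {u | LabelAdm G P lab N u l}) := by
  obtain ⟨R, hR, hR'⟩ := h.atoms
  have hc : {u | LabelAdm G P lab N u l}.ncard = (R l).length := by
    rw [← List.toFinset_card_of_nodup (hR' l).1, ← Set.ncard_coe_finset]
    congr 1; ext u; simp [(hR' l).2]
  have hset : (∅ : Set (Fin n)) ∪ {u | ∃ a ∈ R l, u ∈ ({a} : Set (Fin n))} =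
      {u | LabelAdm G P lab N u l} := by
    ext u; simp [(hR' l).2]
  have key : ∀ s' S, Emits (n := n) s.mem S s' → s'.reg 21 = l → fld s'.mem 19 (s'.reg 21) =
      (R l).length ∧ ∀ i (hi : i < (R l).length), fld s'.mem 18 (i * s'.mem 0 + s'.reg 21) =
        (R l)[i] := fun s' S hE h21 => by
    have := hE.1.rows hR (fun v => (hR' v).1) (by norm_num) (by norm_num) (by norm_num)
      (by norm_num) l
    rw [h21, hE.1.zero, h.zero]
    exact this
  refine Meets.mono (Meets.seq (R := fun s₁ => Emits s.mem ∅ s₁ ∧ s₁.reg 21 = l)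
    (Prog.Straight.meets (by simp [Prog.Straight]) ?_) fun s₁ h₁ => Meets.seq
      (R := Emits s.mem {u | LabelAdm G P lab N u l}) (B₁ := 500 * ((R l).length + 1))
      ((Meets.forEmit (R l) (fun _ => 300) (fun a => {a}) [21] (by simp) (by norm_num) h₁.1
        ?_ ?_).mono ?_ fun s₂ h₂ => hset ▸ h₂.1) fun s₂ h₂ => clear_meets h.zero h₂)
      ?_ fun _ h => h
  · refine ⟨emits_empty rfl hmark (by simp [Prog.eval, Expr.val]), by
      simp [Prog.eval, Expr.val, h0]⟩
  · intro S s' hE hrs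
    exact (key s' S hE ((hrs 21 (by simp)).trans h₁.2)).1
  · intro i hi S s' hE hrs hx
    have h21 := (hrs 21 (by simp)).trans h₁.2
    have hk := (key s' S hE h21).2 i hi
    refine (Prog.Straight.meets (by simp [Prog.Straight, emit_straight]) ?_).mono (B₁ := _)
      (by simp [Prog.time, emit, Expr.cost, Prog.setFld, Expr.outBase, Expr.fldAddr, Expr.fld,
        Expr.idx]) fun _ h => h
    simp only [Prog.eval, Expr.val_fld, Expr.val_idx, Expr.val, hx, hk]
    have hE' : Emits s.mem S ⟨Function.update s'.reg 20 ((R l)[i] : ℕ), s'.mem⟩ :=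
      hE.congr rfl (by simp)
    refine ⟨hE'.emit h.zero (by simp), fun y hy => ?_⟩
    have : y ≠ 23 ∧ y ≠ 20 := by
      simp only [List.mem_cons, List.not_mem_nil, or_false] at hy; omega
    rw [emit_eval_reg _ this.1]
    exact Function.update_of_ne this.2 _ _
  · simp [Expr.fld, Expr.fldAddr, Expr.cost]; omega
  · rw [hc]; simp [Prog.time, Expr.cost]; omega

/-! ### Listing the admissible neighbours of a vertex -/

/-- The rows of array 5 list the input clusters, so loose members have to be left out. -/
def memberLoop : Prog :=
  forLoop 17 (.fld 3 (.reg 26)) (.seq (.assign 20 (.fld 5 (.idx (.reg 26) (.reg 17))))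
    (.ite (.fld 7 (.reg 20)) .skip emit))

def vertexAtoms : Prog :=
  forLoop 16 (.fld 21 (.reg 21))
    (.seq (.assign 26 (.fld 20 (.idx (.reg 21) (.reg 16)))) memberLoop)

theorem memberLoop_meets (h : Holds G P N lab M L m) (hM : ∀ l, (M l).Nodup) {u l : Fin n}
    (hul : LabelAdm G P lab N u l) {S : Set (Fin n)} (hE : Emits m S s) (h26 : s.reg 26 = l) :
    Meets ω memberLoop s (500 * ((M l).length + 1)) fun s' =>
      Emits m (S ∪ {x | x ∈ M l ∧ ¬ Loose G P x}) s' ∧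
        ∀ y ∈ [16, 21, 22, 26], s'.reg y = s.reg y := by
  obtain ⟨hlen, hmem⟩ := h.members u l hul
  have hln : (l : ℕ) < n * n := lt_of_lt_of_le l.2 (Nat.le_mul_self n)
  refine (Meets.forEmit (M l) (fun _ => 400) (fun a => {x | x = a ∧ ¬ Loose G P x}) [16, 21, 22, 26]
    (by simp) (by norm_num) hE ?_ ?_).mono ?_ ?_
  · intro S s' hE hrs
    rw [Expr.val_fld, ← hlen, Expr.val, hrs 26 (by simp), h26]
    exact hE.1.fld 3 (by norm_num) (by norm_num) _ hln
  · intro i hi S s' hE hrs hx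
    have h26' := (hrs 26 (by simp)).trans h26
    have hil : i * n + l < n * n := by
      have := length_le_of_nodup (hM l)
      nlinarith [l.2]
    have hk : fld s'.mem 5 (i * s'.mem 0 + s'.reg 26) = (M l)[i] := by
      rw [h26', hE.1.zero, h.zero, hE.1.fld 5 (by norm_num) (by norm_num) _ hil, hmem i hi]
    set a := (M l)[i]
    have hflag : fld s'.mem 7 a = if Loose G P a then 1 else 0 := by
      rw [hE.1.fld 7 (by norm_num) (by norm_num) _ (lt_of_lt_of_le a.2 (Nat.le_mul_self n)), h.flag]
    refine (Prog.Straight.meets (by simp [Prog.Straight, emit_straight]) ?_).mono (B₁ := _)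
      (by simp [Prog.time, emit, Expr.cost, Prog.setFld, Expr.outBase, Expr.fldAddr, Expr.fld,
        Expr.idx]) fun _ h => h
    simp only [Prog.eval, Expr.val_fld, Expr.val_idx, Expr.val, hx, hk, Function.update_self, hflag]
    have hE' : Emits m S ⟨Function.update s'.reg 20 (a : ℕ), s'.mem⟩ := hE.congr rfl (by simp)
    have hreg : ∀ y ∈ [17, 16, 21, 22, 26], y ≠ 23 ∧ y ≠ 20 := by
      simp only [List.mem_cons, List.not_mem_nil, or_false]; omega
    by_cases ha : Loose G P a
    · have e : {x | x = a ∧ ¬ Loose G P x} = (∅ : Set (Fin n)) := by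
        ext x; simp only [Set.mem_ofPred_eq, Set.mem_empty_iff_false, iff_false]
        rintro ⟨rfl, h⟩; exact h ha
      simp only [ha, if_true, one_ne_zero, if_false, e, Set.union_empty]
      exact ⟨hE', fun y hy => Function.update_of_ne (hreg y hy).2 _ _⟩
    · have e : {x | x = a ∧ ¬ Loose G P x} = ({a} : Set (Fin n)) := by
        ext x; simp only [Set.mem_ofPred_eq, Set.mem_singleton_iff, and_iff_left_iff_imp]
        rintro rfl; exact ha
      simp only [ha, if_true, if_false, e]
      refine ⟨hE'.emit h.zero (by simp), fun y hy => ?_⟩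
      rw [emit_eval_reg _ (hreg y hy).1]
      exact Function.update_of_ne (hreg y hy).2 _ _
  · simp [Expr.fld, Expr.fldAddr, Expr.cost]; omega
  · rintro s' ⟨h1, h2⟩
    refine ⟨?_, h2⟩
    convert h1 using 2
    ext x; simp

/-- The vertex `u` is adjacent to at least 2/5 of each input cluster listed for it, and these
clusters are disjoint. So even scanning them with their loose members takes time linear in the
degree. -/
theorem sum_length_atoms_le (hsp : InputSpec G P lab M D) {u : Fin n} {R : List (Fin n)}
    (hnd : R.Nodup) (hR : ∀ l ∈ R, LabelAdm G P lab N u l) :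
    2 * (R.map fun l => (M l).length).sum ≤ 5 * deg G u := by
  rw [← List.sum_toFinset _ hnd, Finset.mul_sum, deg_eq_card_filter]
  refine le_trans (Finset.sum_le_sum (g := fun l => 5 * ((Finset.univ.filter fun w =>
    G.Adj u w).filter fun w => lab w = l).card) fun l hl => ?_) ?_
  · obtain ⟨x, rfl, hx⟩ := hR l (by simpa using hl)
    rw [hsp.length_eq]
    refine hx.2.2.1.trans (Nat.mul_le_mul_left 5 (Finset.card_le_card fun w hw => ?_))
    rw [Finset.mem_filter, part_coreClustering hx.2.1, Finset.mem_filter] at hw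
    simp only [Finset.mem_filter, Finset.mem_univ, true_and]
    exact ⟨hw.2, (hsp.lab_eq _ _).2 (part_eq_of_mem hw.1.1)⟩
  · rw [← Finset.mul_sum]
    refine Nat.mul_le_mul_left 5 ?_
    rw [Finset.card_eq_sum_card_fiberwise (f := lab) (t := Finset.univ) (by simp)]
    exact Finset.sum_le_sum_of_subset (Finset.subset_univ _)

theorem vertexAtoms_meets (hsp : InputSpec G P lab M D) (h : Holds G P N lab M L m) {v : Fin n}
    {S : Set (Fin n)} (hE : Emits m S s) (h21 : s.reg 21 = v) :
    Meets ω vertexAtoms s (4000 * (deg G v + 1)) fun s' =>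
      Emits m (S ∪ {x | CoreAdm G P N v x}) s' ∧ ∀ y ∈ [21, 22], s'.reg y = s.reg y := by
  obtain ⟨R, hR, hR'⟩ := h.verts
  have key : ∀ s' S, Emits (n := n) m S s' → s'.reg 21 = v → fld s'.mem 21 (s'.reg 21) =
      (R v).length ∧ ∀ i (hi : i < (R v).length), fld s'.mem 20 (i * s'.mem 0 + s'.reg 21) =
        (R v)[i] := fun s' S hE h21 => by
    have := hE.1.rows hR (fun v => (hR' v).1) (by norm_num) (by norm_num) (by norm_num)
      (by norm_num) v
    rw [h21, hE.1.zero, h.zero]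
    exact this
  refine (Meets.forEmit (R v) (fun l => 500 * ((M l).length + 1) + 100)
    (fun l => {x | x ∈ M l ∧ ¬ Loose G P x}) [21, 22] (by simp) (by norm_num) hE ?_ ?_).mono ?_ ?_
  · intro S s' hE hrs
    exact (key s' S hE ((hrs 21 (by simp)).trans h21)).1
  · intro i hi S s' hE hrs hx
    have hk := (key s' S hE ((hrs 21 (by simp)).trans h21)).2 i hi
    set l := (R v)[i] with hl
    have hvl : LabelAdm G P lab N v l := ((hR' v).2 l).1 (List.getElem_mem _)
    rw [add_comm]
    refine Meets.mono (B₁ := 100 + _) (Meets.seq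
      (R := fun s₁ => s₁ = ⟨Function.update s'.reg 26 l, s'.mem⟩)
      ((Prog.Straight.meets (p := .assign 26 _) trivial ?_).mono ?_ fun _ h => h) ?_) le_rfl
      fun _ h => h
    · simp only [Prog.eval, Expr.val_fld, Expr.val_idx, Expr.val, hx, hk]
    · simp [Prog.time, Expr.cost, Expr.fldAddr, Expr.fld, Expr.idx]
    · rintro s₁ rfl
      have hE' : Emits m S ⟨Function.update s'.reg 26 (l : ℕ), s'.mem⟩ := hE.congr rfl (by simp)
      refine (memberLoop_meets h hsp.nodup hvl hE' (by simp)).mono le_rfl ?_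
      rintro s₂ ⟨h1, h2⟩
      refine ⟨h1, fun y hy => ?_⟩
      have hy' : y ≠ 26 ∧ y ∈ [16, 21, 22, 26] := by
        simp only [List.mem_cons, List.not_mem_nil, or_false] at hy ⊢; omega
      rw [h2 y hy'.2]
      exact Function.update_of_ne hy'.1 _ _
  · have h1 := sum_length_atoms_le hsp (hR' v).1 (fun l hl => ((hR' v).2 l).1 hl)
    have h2 : ∀ l ∈ R v, 1 ≤ (M l).length := fun l hl => by
      obtain ⟨x, rfl, hx⟩ := ((hR' v).2 l).1 hl
      exact List.length_pos_of_mem ((hsp.mem _ x).2 rfl)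
    have h3 : ((R v).map fun l => 500 * ((M l).length + 1) + 100 +
        (Expr.fld 21 (.reg 21)).cost + 20).sum ≤ ((R v).map fun l => 1300 * (M l).length).sum := by
      refine List.sum_le_sum fun l hl => ?_
      have := h2 l hl
      simp [Expr.fld, Expr.fldAddr, Expr.cost]; omega
    rw [List.sum_map_mul_left] at h3
    have h4 : (Expr.fld 21 (.reg 21)).cost ≤ 100 := by simp [Expr.fld, Expr.fldAddr, Expr.cost]
    omega
  · rintro s' ⟨h1, h2⟩
    refine ⟨?_, h2⟩
    convert h1 using 2
    ext x
    simp only [Set.mem_ofPred_eq, (hR' v).2, hsp.mem]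
    constructor
    · exact fun hx => ⟨lab x, ⟨x, rfl, hx⟩, rfl, hx.2.1⟩
    · rintro ⟨l, h1, rfl, h3⟩
      exact (hsp.labelAdm_iff h3).1 h1

end Lists

end

/-! ### Queries: listing the admissible neighbours of a singleton -/

section

variable {n : ℕ}

section Vertex
open Classical

variable {G : SimpleGraph (Fin n)} {P : Clustering n} {lab : Fin n → Fin n}
  {M L : Fin n → List (Fin n)} {D : List (Fin n × Fin n)} {N t : ℕ} {m m' : ℕ → ℕ} {ω : Rnd}
  {s : State}

/-- The reverse row of a sampled vertex w contains the loose vertices around w; each of them is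
tested against `v`, and only those that pass are emitted. -/
def partnerLoop (N : ℕ) : Prog :=
  forLoop 17 (.fld 15 (.reg 25)) (.seq (.assign 20 (.fld 14 (.idx (.reg 25) (.reg 17))))
    (.seq (pairTest N) (.ite (.reg 5) emit .skip)))

/-- A sampled vertex with more than N deg v loose neighbours is passed over. Hence each of the O(t)
samples causes O(deg v) tests of O(t) steps. -/
def vertexSamples (N : ℕ) : Prog :=
  forLoop 16 (.bin .mul (.lit (sampleRate N)) (.reg 22))
    (.seq (.rand 24 (.reg 16) (.fld 12 (.reg 21))) <|
    .seq (.assign 25 (.fld 11 (.idx (.reg 21) (.reg 24)))) <|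
    .ite (.bin .lt (.bin .mul (.lit N) (.bin .sub (.fld 12 (.reg 21)) (.lit 1))) (.fld 15 (.reg 25)))
      .skip (partnerLoop N))

/-- Lists the vertices found for the vertex in register `0` with the parameter in register `1`. -/
def listVertexBody (N : ℕ) : Prog :=
  .seq (.seq (.assign 21 (.reg 0)) (.seq (.assign 22 (.reg 1)) (.assign 23 (.lit 0)))) <|
  .seq (.ite (.bin .mul (.fld 7 (.reg 21)) (.bin .sub (.fld 12 (.reg 21)) (.lit 1)))
    (.seq vertexAtoms (vertexSamples N)) .skip) clear

theorem partnerLoop_meets (h : Holds G P N lab M L m) (hM : ∀ l, (M l).Nodup)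
    (hLn : ∀ v, (L v).Nodup) (hL : ListsNbhd G (Loose G P) L) {v w : Fin n} (hv : Loose G P v)
    {S : Set (Fin n)} (hE : Emits m S s) (h21 : s.reg 21 = v) (h22 : s.reg 22 = t)
    (h25 : s.reg 25 = w) :
    Meets ω (partnerLoop N) s ((pairTestTime N * (t + 1) + 500) * (tcard G (Loose G P) w + 1))
      fun s' => Emits m (S ∪ {u | PairTest G (Loose G P) N L (sampleRate N * t) u v ω ∧
        u ∈ nbhd G w}) s' ∧ ∀ y ∈ [16, 21, 22, 25], s'.reg y = s.reg y := by
  obtain ⟨R, hR, hR'⟩ := h.into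
  have hlen := length_eq_tcard (hR' w).1 (hR' w).2
  have key : ∀ s' S, Emits (n := n) m S s' → s'.reg 25 = w → fld s'.mem 15 (s'.reg 25) =
      (R w).length ∧ ∀ i (hi : i < (R w).length), fld s'.mem 14 (i * s'.mem 0 + s'.reg 25) =
        (R w)[i] := fun s' S hE h25 => by
    have := hE.1.rows hR (fun v => (hR' v).1) (by norm_num) (by norm_num) (by norm_num)
      (by norm_num) w
    rw [h25, hE.1.zero, h.zero]
    exact this
  refine (Meets.forEmit (R w) (fun _ => 100 + (pairTestTime N * (t + 1) + (2 + 200)))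
    (fun a => {u | u = a ∧ PairTest G (Loose G P) N L (sampleRate N * t) u v ω}) [16, 21, 22, 25]
    (by simp) (by norm_num) hE ?_ ?_).mono ?_ ?_
  · intro S s' hE hrs
    exact (key s' S hE ((hrs 25 (by simp)).trans h25)).1
  · intro i hi S s' hE hrs hx
    have hk := (key s' S hE ((hrs 25 (by simp)).trans h25)).2 i hi
    set u := (R w)[i] with hu
    have huL : Loose G P u := (((hR' w).2 u).1 (List.getElem_mem _)).1
    refine Meets.seq (R := fun s₁ => s₁ = ⟨Function.update s'.reg 20 u, s'.mem⟩)
      ((Prog.Straight.meets (p := .assign 20 _) trivial ?_).mono ?_ fun _ h => h) ?_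
    · simp only [Prog.eval, Expr.val_fld, Expr.val_idx, Expr.val, hx, hk]
    · simp [Prog.time, Expr.cost, Expr.fldAddr, Expr.fld, Expr.idx]
    rintro s₁ rfl
    have hE' : Emits m S ⟨Function.update s'.reg 20 (u : ℕ), s'.mem⟩ := hE.congr rfl (by simp)
    refine Meets.seq (pairTest_meets (h.scratch hM hLn hE'.1) hL huL hv (t := t)
      (by simp) ?_ ?_) fun s₂ h₂ => ?_
    · simpa using (hrs 21 (by simp)).trans h21
    · simpa using (hrs 22 (by simp)).trans h22
    have hE₂ : Emits m S s₂ := hE'.congr h₂.1 (h₂.2.1 23 (by norm_num))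
    have hreg : ∀ y ∈ [17, 16, 21, 22, 25], y ≠ 23 ∧ s₂.reg y = s'.reg y := fun y hy => by
      have : y ≠ 23 ∧ y ≠ 20 ∧ 14 < y := by
        simp only [List.mem_cons, List.not_mem_nil, or_false] at hy; omega
      refine ⟨this.1, (h₂.2.1 y (Or.inr this.2.2)).trans ?_⟩
      exact Function.update_of_ne this.2.1 _ _
    have h20 : s₂.reg 20 = u := by simpa using h₂.2.1 20 (by norm_num)
    refine (Meets.ite (B := 200) (fun he => ?_) fun he => ?_).mono (by simp [Expr.cost])
      fun _ h => h
    · have hT : PairTest G (Loose G P) N L (sampleRate N * t) u v ω := by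
        by_contra hT; simp [Expr.val, h₂.2.2, hT] at he
      have e : {u' | u' = u ∧ PairTest G (Loose G P) N L (sampleRate N * t) u' v ω} =
          ({u} : Set (Fin n)) := by
        ext x; simp only [Set.mem_ofPred_eq, Set.mem_singleton_iff, and_iff_left_iff_imp]
        rintro rfl; exact hT
      rw [e]
      refine (Prog.Straight.meets emit_straight ⟨hE₂.emit h.zero h20, fun y hy => ?_⟩).mono
        (by simp [Prog.time, emit, Expr.cost, Prog.setFld, Expr.outBase, Expr.fldAddr, Expr.fld])
        fun _ h => h
      rw [emit_eval_reg _ (hreg y hy).1, (hreg y hy).2]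
    · have hT : ¬ PairTest G (Loose G P) N L (sampleRate N * t) u v ω := by
        intro hT; simp [Expr.val, h₂.2.2, hT] at he
      have e : {u' | u' = u ∧ PairTest G (Loose G P) N L (sampleRate N * t) u' v ω} =
          (∅ : Set (Fin n)) := by
        ext x; simp only [Set.mem_ofPred_eq, Set.mem_empty_iff_false, iff_false]
        rintro ⟨rfl, h⟩; exact hT h
      rw [e, Set.union_empty]
      exact (Prog.Straight.meets (p := .skip) trivial ⟨hE₂, fun y hy => (hreg y hy).2⟩).mono
        (by simp [Prog.time]) fun _ h => h
  · have : (Expr.fld 15 (.reg 25)).cost ≤ 100 := by simp [Expr.fld, Expr.fldAddr, Expr.cost]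
    simp only [List.map_const', List.sum_replicate, smul_eq_mul, hlen]
    nlinarith [Nat.zero_le (pairTestTime N * (t + 1))]
  · rintro s' ⟨h1, h2⟩
    refine ⟨?_, h2⟩
    convert h1 using 2
    ext u
    simp only [Set.mem_ofPred_eq, (hR' w).2]
    constructor
    · rintro ⟨h1, h2⟩; exact ⟨u, ⟨h1.1.2.1, mem_nbhd_comm.1 h2⟩, rfl, h1⟩
    · rintro ⟨a, ⟨h1, h2⟩, rfl, h3⟩; exact ⟨h3, mem_nbhd_comm.1 h2⟩

/-- The vertices found for `v` with the `i`-th sample. -/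
def sampleFound (G : SimpleGraph (Fin n)) (P : Clustering n) (N : ℕ) (L : Fin n → List (Fin n))
    (t : ℕ) (v : Fin n) (ω : Rnd) (i : ℕ) : Set (Fin n) :=
  {u | PairTest G (Loose G P) N L (sampleRate N * t) u v ω ∧ ∃ w,
    (L v)[(ω (i, deg G v) : ℕ)]? = some w ∧ tcard G (Loose G P) w ≤ N * deg G v ∧ u ∈ nbhd G w}

theorem vertexSamples_meets (h : Holds G P N lab M L m) (hM : ∀ l, (M l).Nodup)
    (hLn : ∀ v, (L v).Nodup) (hL : ListsNbhd G (Loose G P) L) {v : Fin n} (hv : Loose G P v)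
    {S : Set (Fin n)} (hE : Emits m S s) (h21 : s.reg 21 = v) (h22 : s.reg 22 = t) :
    Meets ω (vertexSamples N) s
      (((pairTestTime N * (t + 1) + 500) * (N * deg G v + 1) + 500) * (sampleRate N * t + 1))
      (Emits m (S ∪ {u | ∃ i < sampleRate N * t, u ∈ sampleFound G P N L t v ω i})) := by
  have hlen := hL.length_eq hv
  have hvn : (v : ℕ) < n * n := lt_of_lt_of_le v.2 (Nat.le_mul_self n)
  refine (Meets.forEmit (List.range (sampleRate N * t))
    (fun _ => 50 + (100 + (100 + (pairTestTime N * (t + 1) + 500) * (N * deg G v + 1))))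
    (sampleFound G P N L t v ω) [21, 22] (by simp) (by norm_num) hE ?_ ?_).mono ?_ ?_
  · intro S s' hE hrs
    simp [Expr.val, Op.apply, hrs 22 (by simp), h22]
  · intro i hi S s' hE hrs hx
    have h21' := (hrs 21 (by simp)).trans h21
    have h22' := (hrs 22 (by simp)).trans h22
    have hH := h.scratch hM hLn hE.1
    have h12 := hH.deg_eq hL hv
    obtain ⟨j, hj⟩ : ∃ j : ℕ, (ω (i, deg G v) : ℕ) = j := ⟨_, rfl⟩
    have hjlt : j < (L v).length := by rw [hlen, ← hj]; exact (ω (i, deg G v)).2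
    obtain ⟨w, hw⟩ : ∃ w, (L v)[j] = w := ⟨_, rfl⟩
    have hset : sampleFound G P N L t v ω i =
        {u | PairTest G (Loose G P) N L (sampleRate N * t) u v ω ∧
          tcard G (Loose G P) w ≤ N * deg G v ∧ u ∈ nbhd G w} := by
      ext u
      simp [sampleFound, hj, List.getElem?_eq_getElem hjlt, hw]
    rw [List.getElem_range, hset]
    refine Meets.seq (R := fun s₁ => s₁ = ⟨Function.update s'.reg 24 j, s'.mem⟩)
      ((Meets.rand ?_ ?_).mono ?_ fun _ h => h) ?_
    · simp [Expr.val_fld, Expr.val, h21', h12]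
    · have e1 : (Expr.fld 12 (.reg 21)).val s' - 1 = deg G v := by
        rw [Expr.val_fld, Expr.val, h21', h12]; omega
      have : (ω ((Expr.reg 16).val s', (Expr.fld 12 (.reg 21)).val s' - 1) : ℕ) = j := by
        rw [e1, Expr.val, hx]; exact hj
      rw [this]
    · simp [Expr.cost, Expr.fldAddr, Expr.fld]
    rintro s₁ rfl
    refine Meets.seq (R := fun s₂ => s₂ = ⟨Function.update (Function.update s'.reg 24 j) 25 w,
      s'.mem⟩) ((Prog.Straight.meets (p := .assign 25 _) trivial ?_).mono ?_ fun _ h => h) ?_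
    · have : fld s'.mem 11 (j * n + v) = w := by rw [(hH.nbrs v).2 j hjlt, hw]
      simp [Prog.eval, Expr.val_fld, Expr.val_idx, Expr.val, h21', hH.zero, this]
    · simp [Prog.time, Expr.cost, Expr.fldAddr, Expr.fld, Expr.idx]
    rintro s₂ rfl
    set s₂ : State := ⟨Function.update (Function.update s'.reg 24 j) 25 w, s'.mem⟩ with hs₂
    have hE₂ : Emits m S s₂ := hE.congr rfl (by simp [hs₂])
    have hreg : ∀ y ∈ [16, 21, 22], s₂.reg y = s'.reg y := fun y hy => by
      have : y ≠ 24 ∧ y ≠ 25 := by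
        simp only [List.mem_cons, List.not_mem_nil, or_false] at hy; omega
      simp [hs₂, this.1, this.2]
    have hval : (Expr.bin .lt (.bin .mul (.lit N) (.bin .sub (.fld 12 (.reg 21)) (.lit 1)))
        (.fld 15 (.reg 25))).val s₂ =
        if N * deg G v < tcard G (Loose G P) w then 1 else 0 := by
      simp [Expr.val, Expr.val_fld, Op.apply, hs₂, h21', h12, hH.into_eq]
    refine (Meets.ite (B := (pairTestTime N * (t + 1) + 500) * (N * deg G v + 1))
      (fun he => ?_) fun he => ?_).mono (by simp [Expr.cost, Expr.fldAddr, Expr.fld]) fun _ h => h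
    · have hlt : N * deg G v < tcard G (Loose G P) w := by
        by_contra hlt; simp [hval, hlt] at he
      have e : {u | PairTest G (Loose G P) N L (sampleRate N * t) u v ω ∧
          tcard G (Loose G P) w ≤ N * deg G v ∧ u ∈ nbhd G w} = (∅ : Set (Fin n)) := by
        ext x; simp [hlt]
      rw [e, Set.union_empty]
      exact (Prog.Straight.meets (p := .skip) trivial ⟨hE₂, hreg⟩).mono
        (by simp only [Prog.time]; nlinarith [Nat.zero_le (pairTestTime N * (t + 1)),
          Nat.zero_le (N * deg G v)]) fun _ h => h
    · have hle : tcard G (Loose G P) w ≤ N * deg G v := by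
        by_contra hlt; simp [hval, not_le.1 hlt] at he
      simp only [hle, true_and]
      refine (partnerLoop_meets (w := w) h hM hLn hL hv hE₂ ?_ ?_ ?_).mono
        (Nat.mul_le_mul_left _ (by omega)) ?_
      · rw [hreg 21 (by simp), h21']
      · rw [hreg 22 (by simp), h22']
      · simp [hs₂]
      · rintro s₃ ⟨h1, h2⟩
        refine ⟨h1, fun y hy => (h2 y ?_).trans (hreg y hy)⟩
        simp only [List.mem_cons, List.not_mem_nil, or_false] at hy ⊢; omega
  · simp only [List.map_const', List.sum_replicate, smul_eq_mul, List.length_range, Expr.cost]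
    nlinarith [Nat.zero_le ((pairTestTime N * (t + 1) + 500) * (N * deg G v + 1))]
  · rintro s' ⟨h1, h2⟩
    simpa using h1

/-- Each sample contributes at most the permitted number of loose neighbours of the sampled vertex.
The size of the output matters because it determines the time for clearing marks. -/
theorem ncard_sampleFound_le (L : Fin n → List (Fin n)) (v : Fin n) (k : ℕ) :
    {u | ∃ i < k, u ∈ sampleFound G P N L t v ω i}.ncard ≤ k * (N * deg G v) := by
  set F : ℕ → Finset (Fin n) := fun i => Finset.univ.filter fun u =>
    u ∈ sampleFound G P N L t v ω i with hF
  have e : {u | ∃ i < k, u ∈ sampleFound G P N L t v ω i} = ((Finset.range k).biUnion F :) := by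
    ext u; simp [hF]
  rw [e, Set.ncard_coe_finset]
  have := Finset.card_biUnion_le_card_mul (Finset.range k) F (N * deg G v) fun i _ => ?_
  · simpa using this
  by_cases hw : ∃ w, (L v)[(ω (i, deg G v) : ℕ)]? = some w ∧
      tcard G (Loose G P) w ≤ N * deg G v
  · obtain ⟨w, hw, hle⟩ := hw
    refine (Finset.card_le_card fun u hu => ?_).trans hle
    rw [hF, Finset.mem_filter] at hu
    obtain ⟨h1, w', h2, -, h3⟩ := hu.2
    rw [hw, Option.some.injEq] at h2
    subst h2
    exact Finset.mem_filter.2 ⟨h3, h1.1.2.1⟩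
  · have : F i = ∅ := by
      ext u
      simp only [hF, Finset.mem_filter, Finset.mem_univ, true_and, Finset.notMem_empty, iff_false]
      rintro ⟨-, w, h1, h2, -⟩
      exact hw ⟨w, h1, h2⟩
    simp [this]

abbrev CoreFound (G : SimpleGraph (Fin n)) (P : Clustering n) (N : ℕ)
    (L : Fin n → List (Fin n)) (t : ℕ) (v : Fin n) (ω : Rnd) (u : Fin n) : Prop :=
  Found G (coreClustering G P) (Loose G P) (fun v => (P.part v).card) N L (sampleRate N * t) v ω u

def listVertexTime (N : ℕ) : ℕ :=
  10000 + (2 * pairTestTime N + 2000) * (N + 1) * (sampleRate N + 1) * 4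

theorem listVertexBody_meets (hsp : InputSpec G P lab M D) (h : Holds G P N lab M L s.mem)
    (hLn : ∀ v, (L v).Nodup) (hL : ListsNbhd G (Loose G P) L)
    (hmark : ∀ u : Fin n, fld s.mem 22 u = 0) (ht : 1 ≤ t) {v : Fin n} (h0 : s.reg 0 = v)
    (h1 : s.reg 1 = t) :
    Meets ω (listVertexBody N) s (listVertexTime N * (t ^ 2 * deg G v + 1))
      (Output s.mem {u | CoreFound G P N L t v ω u}) := by
  have hfound : {u | CoreFound G P N L t v ω u} = ∅ ∪ {x | CoreAdm G P N v x} ∪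
      {u | ∃ i < sampleRate N * t, u ∈ sampleFound G P N L t v ω i} := by
    ext u
    simp only [CoreFound, Found, sampleFound, Set.empty_union, Set.mem_union, Set.mem_ofPred_eq]
    exact or_congr_right ⟨fun ⟨h1, i, h2, h3⟩ => ⟨i, h2, h1, h3⟩, fun ⟨i, h2, h1, h3⟩ => ⟨h1, i, h2, h3⟩⟩
  have hA : {x | CoreAdm G P N v x}.ncard ≤ 3 * deg G v := by
    have : 2 * (Finset.univ.filter fun x => CoreAdm G P N v x).card ≤ 5 * deg G v :=
      (sizedCore G P).card_atomAdm_le (N := N) v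
    have e : {x | CoreAdm G P N v x} = (Finset.univ.filter fun x => CoreAdm G P N v x :) := by
      ext; simp
    rw [e, Set.ncard_coe_finset]; omega
  have hcard : {u | CoreFound G P N L t v ω u}.ncard ≤
      3 * deg G v + sampleRate N * t * (N * deg G v) := by
    rw [hfound, Set.empty_union]
    exact (Set.ncard_union_le _ _).trans (add_le_add hA (ncard_sampleFound_le L v _))
  set d := deg G v with hd
  set X := (2 * pairTestTime N + 2000) * (N + 1) * (sampleRate N + 1) with hX
  have hXpos : 0 < X := Nat.mul_pos (Nat.mul_pos (by omega) (by omega)) (by omega)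
  have hS : 200 * (sampleRate N * t * (N * d)) ≤ X * (t ^ 2 * d) := by
    calc 200 * (sampleRate N * t * (N * d)) = (200 * N * sampleRate N) * (t * d) := by ring
      _ ≤ X * (t ^ 2 * d) := by
        refine Nat.mul_le_mul ?_ (Nat.mul_le_mul_right _ (by nlinarith))
        rw [hX]
        exact Nat.mul_le_mul (Nat.mul_le_mul (by omega) (by omega)) (by omega)
  have hdt : d ≤ t ^ 2 * d := Nat.le_mul_of_pos_left _ (by positivity)
  -- A positive degree absorbs the additive constants. Degree 0 is excluded by the first test of the
  -- program, since the time must then be constant, independent of t.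
  have hbig : d ≠ 0 → ((pairTestTime N * (t + 1) + 500) * (N * d + 1) + 500) *
      (sampleRate N * t + 1) ≤ X * (t ^ 2 * d) := fun h0 => by
    have e1 : (pairTestTime N * (t + 1) + 500) * (N * d + 1) + 500 ≤
        (2 * pairTestTime N + 2000) * (N + 1) * (t * d) := by
      have e2 : pairTestTime N * (t + 1) + 500 ≤ (2 * pairTestTime N + 500) * t := by nlinarith
      have e3 : N * d + 1 ≤ (N + 1) * d := by
        have : 1 ≤ d := Nat.pos_of_ne_zero h0
        nlinarith
      have e4 : 1 ≤ (N + 1) * (t * d) := Nat.succ_le_of_lt (by positivity)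
      calc _ ≤ (2 * pairTestTime N + 500) * t * ((N + 1) * d) + 500 * ((N + 1) * (t * d)) :=
            add_le_add (Nat.mul_le_mul e2 e3) (by omega)
        _ = (2 * pairTestTime N + 1000) * ((N + 1) * (t * d)) := by ring
        _ ≤ (2 * pairTestTime N + 2000) * ((N + 1) * (t * d)) := Nat.mul_le_mul_right _ (by omega)
        _ = _ := by ring
    calc _ ≤ (2 * pairTestTime N + 2000) * (N + 1) * (t * d) * ((sampleRate N + 1) * t) :=
          Nat.mul_le_mul e1 (by nlinarith)
      _ = X * (t ^ 2 * d) := by rw [hX]; ring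
  refine Meets.mono (B₁ := 10 + ((100 + (4000 * (d + 1) + X * (t ^ 2 * d))) +
    200 * ({u | CoreFound G P N L t v ω u}.ncard + 1))) (Meets.seq
    (R := fun s₁ => s₁.mem = s.mem ∧ s₁.reg 21 = v ∧ s₁.reg 22 = t ∧ s₁.reg 23 = 0)
    ((Prog.Straight.meets (by simp [Prog.Straight])
      (by simp [Prog.eval, Expr.val, h0, h1])).mono (by simp [Prog.time, Expr.cost]) fun _ h => h)
    fun s₁ h₁ => Meets.seq (R := Emits s.mem {u | CoreFound G P N L t v ω u})
      ((Meets.ite (B := 4000 * (d + 1) + X * (t ^ 2 * d)) (fun he => ?_) fun he => ?_).mono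
        (by simp [Expr.cost, Expr.fldAddr, Expr.fld]) fun _ h => h)
      fun s₂ h₂ => clear_meets h.zero h₂) ?_ fun _ h => h
  · have hE : Emits (n := n) s.mem ∅ s₁ := emits_empty h₁.1.symm hmark h₁.2.2.2
    have hv : Loose G P v := by
      by_contra hv
      simp [Expr.val, Op.apply, Expr.val_fld, h₁.1, h₁.2.1, h.flag, hv] at he
    have hd0 : d ≠ 0 := by
      intro h0
      simp [Expr.val, Op.apply, Expr.val_fld, h₁.1, h₁.2.1, h.deg_eq hL hv, ← hd, h0] at he
    refine (Meets.seq (vertexAtoms_meets hsp h hE h₁.2.1) fun s₂ h₂ => vertexSamples_meets h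
      hsp.nodup hLn hL hv h₂.1 ((h₂.2 21 (by simp)).trans h₁.2.1)
        ((h₂.2 22 (by simp)).trans h₁.2.2.1)).mono (Nat.add_le_add_left (hbig hd0) _) ?_
    intro s₂ h₂
    rw [hfound]; exact h₂
  -- The set is empty in the skipped cases: found vertices require `v` to be loose, and both kinds
  -- of admissibility force a positive degree of `v`.
  · have hno : ∀ u, ¬ CoreFound G P N L t v ω u := by
      intro u hu
      have hv : Loose G P v := hu.elim (fun h => h.1) fun h => h.1.1.2.2.1
      have hd0 : d = 0 := by
        simpa [Expr.val, Op.apply, Expr.val_fld, h₁.1, h₁.2.1, h.flag, hv, h.deg_eq hL hv] using he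
      rcases hu with hu | hu
      · have := ((sizedCore G P).deg_bounds hu).2.2
        have : 0 < (P.part u).card := (sizedCore G P).size_pos hu.2.1
        omega
      · have := hu.1.1.deg_pos
        omega
    have e : {u | CoreFound G P N L t v ω u} = (∅ : Set (Fin n)) := by ext u; simp [hno]
    rw [e]
    exact (Prog.Straight.meets (p := .skip) trivial (emits_empty h₁.1.symm hmark h₁.2.2.2)).mono
      (by simp only [Prog.time]; omega) fun _ h => h
  · rw [listVertexTime, ← hX]
    nlinarith

end Vertex

end

/-! ### Word sizes -/

section

variable {n : ℕ}

section Words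
open Classical

variable {G : SimpleGraph (Fin n)} {P : Clustering n} {lab : Fin n → Fin n}
  {M L : Fin n → List (Fin n)} {D : List (Fin n × Fin n)} {N t : ℕ} {m m' : ℕ → ℕ} {ω : Rnd}
  {s : State}

/-! ### The size of words -/

theorem ptr_le (o : Option (Fin n)) : ptr o ≤ n := by
  cases o with
  | none => exact Nat.zero_le n
  | some v => exact v.2

theorem InputSpec.length_viol_le (h : InputSpec G P lab M D) : D.length ≤ n * n := by
  simpa using h.nodup_viol.length_le_card

theorem Input.le (hi : Input lab M D m) (hsp : InputSpec G P lab M D)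
    (hz : ∀ a, 2 + 5 * n + D.length ≤ a → m a = 0) (a : ℕ) : m a ≤ n * n + n := by
  have hD := hsp.length_viol_le
  have hone := hi.one
  -- Every vertex occurs in some list, so the conditions on lists determine all words of the link
  -- arrays.
  have hM : ∀ v : Fin n, ∃ l i, ∃ hi : i < (M l).length, (M l)[i] = v := fun v => by
    obtain ⟨i, hi, he⟩ := List.getElem_of_mem ((hsp.mem (lab v) v).2 rfl)
    exact ⟨_, i, hi, he⟩
  rcases Nat.lt_or_ge a 2 with h | h
  · interval_cases a
    · rw [hi.zero]; omega
    · omega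
  obtain ⟨b, rfl⟩ := Nat.exists_eq_add_of_le h
  suffices m (2 + b) ≤ n by omega
  rcases Nat.lt_or_ge b n with h1 | h1
  · rw [hi.lab ⟨b, h1⟩]; exact (lab _).2.le
  rcases Nat.lt_or_ge b (2 * n) with h2 | h2
  · obtain ⟨l, i, hil, he⟩ := hM ⟨b - n, by omega⟩
    have := hi.next l i hil
    rw [he, show 2 + n + (b - n) = 2 + b by omega] at this
    rw [this]; exact ptr_le _
  rcases Nat.lt_or_ge b (3 * n) with h3 | h3
  · obtain ⟨l, i, hil, he⟩ := hM ⟨b - 2 * n, by omega⟩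
    have := hi.prev l i hil
    rw [he, show 2 + 2 * n + (b - 2 * n) = 2 + b by omega] at this
    rw [this]; exact ptr_le _
  rcases Nat.lt_or_ge b (4 * n) with h4 | h4
  · have := hi.head ⟨b - 3 * n, by omega⟩
    rw [show 2 + 3 * n + (b - 3 * n) = 2 + b by omega] at this
    rw [this]; exact ptr_le _
  rcases Nat.lt_or_ge b (5 * n) with h5 | h5
  · have := hi.unused ⟨b - 4 * n, by omega⟩
    rw [show 2 + 3 * n + (n + (b - 4 * n)) = 2 + b by omega] at this
    omega
  rcases Nat.lt_or_ge b (5 * n + D.length) with h6 | h6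
  · have := hi.fst (b - 5 * n) (by omega)
    rw [incFst, show 2 + 5 * n + (b - 5 * n) = 2 + b by omega] at this
    rw [this]; exact (D[b - 5 * n].1).2.le
  · rw [hz _ (by omega)]; omega

/-- As κ is used both as a factor and as an exponent, one condition on `W` absorbs the constant a^c
as well as the degree d c. -/
theorem pow_lt_word {a c d κ X Y W : ℕ} (hX : X ≤ a * Y ^ d) (hY : 1 ≤ Y)
    (hκ : a ^ c + d * c + 1 ≤ κ) (hW : κ * Y ^ κ ≤ W) : X ^ c < W := by
  calc X ^ c ≤ (a * Y ^ d) ^ c := Nat.pow_le_pow_left hX c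
    _ = a ^ c * Y ^ (d * c) := by rw [mul_pow, pow_mul]
    _ ≤ a ^ c * Y ^ κ := Nat.mul_le_mul_left _ (Nat.pow_le_pow_right hY (by omega))
    _ < κ * Y ^ κ := Nat.mul_lt_mul_of_pos_right (by omega) (Nat.pow_pos hY)
    _ ≤ W := hW

/-- A program that leaves an output is completed by the address of the output. -/
theorem Meets.runs_output {p : Prog} {B V c W : ℕ} {S : Set (Fin n)}
    (h : Meets ω p s B (Output m S)) (ht : p.Tame c) (hc : 100 ≤ c) (hV : c ≤ V) (hs : s.Bdd V)
    (hW : (V + B) ^ c < W) : Runs W ω (.seq p (.assign 1 .outBase)) s (B + 50) fun s' =>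
      Scratch n m s'.mem ∧ (∀ u : Fin n, fld s'.mem 22 u = 0) ∧ ReturnsSet S s' := by
  obtain ⟨k, s', hex, hk, ⟨h1, h2, F, h3, h4, h5, h6⟩, hb⟩ := h.runs ht (by omega) hV hs hW
  refine ⟨_, _, .seq _ _ _ _ _ _ _ hex (.assign s' 1 .outBase ?_), ?_, h1, h2, F, h3, h4, ?_, ?_⟩
  · refine Expr.fits_of_bdd (by omega) (c := c) (by omega) hb _ ?_ (lt_of_le_of_lt
      (Nat.pow_le_pow_right (by omega) ?_) hW)
    · simp [Expr.outBase, Expr.fldAddr, Expr.LitLe]; omega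
    · simp [Expr.outBase, Expr.fldAddr, Expr.size]; omega
  · simp [Expr.outBase, Expr.fldAddr, Expr.cost]; omega
  · simpa using h5
  · intro i hi
    simpa [Expr.val_outBase] using h6 i hi

/-- A bound for the size and the constants of all programs. -/
def tameBound (N : ℕ) : ℕ := 20000 + 3 * N + sampleRate N

theorem forLoop_tame {c x : ℕ} {e : Expr} {p : Prog} (hc : 1 ≤ c) (hs : e.size + 1 ≤ c)
    (hl : e.LitLe c) (hp : p.Tame c) : (forLoop x e p).Tame c := by
  simp only [forLoop, Prog.Tame, Expr.size, Expr.LitLe, Expr.Slow]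
  exact ⟨⟨hc, Nat.zero_le c, trivial⟩, ⟨by omega, trivial, hl⟩, hp,
    by have := e.size_pos; omega, ⟨trivial, hc⟩, trivial⟩

theorem count_tame {c : ℕ} (hc : 20000 ≤ c) : countLoop.Tame c := by
  refine forLoop_tame (by omega) ?_ ?_ ?_ <;>
  simp only [countBody, Prog.Tame, Prog.setFld, Expr.incFst, Expr.incSnd, Expr.lab, Expr.fld,
    Expr.fldAddr, Expr.idx, Expr.size, Expr.LitLe, Expr.Slow] <;>
  and_intros <;> first | trivial | omega

theorem walk_tame {c : ℕ} (hc : 20000 ≤ c) : walkLoop.Tame c := by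
  refine forLoop_tame (by omega) ?_ ?_ (forLoop_tame (by omega) ?_ ?_ ?_) <;>
  simp only [walkBody, Prog.Tame, Prog.setFld, Prog.push, Prog.pushVec, Expr.incFst, Expr.lab,
    Expr.next, Expr.head, Expr.fld, Expr.fldAddr, Expr.idx, Expr.size, Expr.LitLe, Expr.Slow] <;>
  and_intros <;> first | trivial | omega

theorem select_tame {c : ℕ} (hc : 20000 ≤ c) : selectLoop.Tame c := by
  refine forLoop_tame (by omega) ?_ ?_ ?_ <;>
  simp only [selectBody, Prog.Tame, Prog.setFld, Prog.pushVec, Expr.lab, Expr.fld, Expr.fldAddr,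
    Expr.size, Expr.LitLe, Expr.Slow] <;>
  and_intros <;> first | trivial | omega

theorem inside_tame {c : ℕ} (hc : 20000 ≤ c) : insideLoop.Tame c := by
  refine forLoop_tame (by omega) ?_ ?_ ⟨?_, forLoop_tame (by omega) ?_ ?_ ?_⟩ <;>
  simp only [insideBody, Prog.Tame, Prog.setFld, Prog.pushPair, Expr.lab, Expr.fld, Expr.fldAddr,
    Expr.idx, Expr.size, Expr.LitLe, Expr.Slow] <;>
  and_intros <;> first | trivial | omega

theorem outside_tame {c : ℕ} (hc : 20000 ≤ c) : outsideLoop.Tame c := by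
  refine forLoop_tame (by omega) ?_ ?_ ?_ <;>
  simp only [outsideBody, Prog.Tame, Prog.setFld, Prog.pushPair, Expr.incFst, Expr.incSnd,
    Expr.lab, Expr.fld, Expr.fldAddr, Expr.size, Expr.LitLe, Expr.Slow] <;>
  and_intros <;> first | trivial | omega

theorem store_tame {c : ℕ} (hc : 20000 ≤ c) : storeLoop.Tame c := by
  refine forLoop_tame (by omega) ?_ ?_ ?_ <;>
  simp only [storeBody, Prog.Tame, Prog.setFld, Prog.push, Expr.lab, Expr.fld, Expr.fldAddr,
    Expr.idx, Expr.size, Expr.LitLe, Expr.Slow] <;>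
  and_intros <;> first | trivial | omega

theorem link_tame {c : ℕ} (hc : 20000 ≤ c) (hN : 3 * N ≤ c) : (linkLoop N).Tame c := by
  refine forLoop_tame (by omega) ?_ ?_ ?_ <;>
  simp only [linkBody, Prog.Tame, Prog.setFld, Prog.push, Expr.lab, Expr.fld, Expr.fldAddr,
    Expr.idx, Expr.size, Expr.LitLe, Expr.Slow] <;>
  and_intros <;> first | trivial | omega

theorem split_tame {c : ℕ} (hc : 20000 ≤ c) : splitLoop.Tame c := by
  refine ⟨?_, forLoop_tame (by omega) ?_ ?_ ?_⟩ <;>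
  simp only [splitBody, Prog.Tame, Prog.setFld, Expr.lab, Expr.next, Expr.fld, Expr.fldAddr,
    Expr.size, Expr.LitLe, Expr.Slow] <;>
  and_intros <;> first | trivial | omega

theorem build_tame : (build N).Tame (tameBound N) := by
  have hc : 20000 ≤ tameBound N := by rw [tameBound]; omega
  exact ⟨count_tame hc, walk_tame hc, select_tame hc, inside_tame hc, outside_tame hc,
    store_tame hc, link_tame hc (by rw [tameBound]; omega), split_tame hc⟩

theorem pairTest_tame {c : ℕ} (hc : 20000 ≤ c) (hN : 3 * N ≤ c) (hr : sampleRate N ≤ c) :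
    (pairTest N).Tame c := by
  refine ⟨?_, ⟨?_, ?_⟩, ?_, ⟨?_, ?_⟩, ⟨⟨?_, ?_⟩, ⟨forLoop_tame (by omega) ?_ ?_ ?_, ?_⟩, ?_⟩, ?_⟩ <;>
  simp only [sampleInit, sampleBody, sampleEnd, Prog.Tame, Expr.fld, Expr.fldAddr, Expr.idx,
    Expr.size, Expr.LitLe, Expr.Slow] <;>
  and_intros <;> first | trivial | omega

theorem check_tame : (check N).Tame (tameBound N) := by
  have hc : 20000 ≤ tameBound N := by rw [tameBound]; omega
  have hp : (pairTest N).Tame (tameBound N) :=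
    pairTest_tame hc (by rw [tameBound]; omega) (by rw [tameBound]; omega)
  generalize tameBound N = c at *
  refine ⟨?_, ?_, ⟨?_, ⟨hp, ?_⟩, ?_⟩, ?_⟩ <;>
  simp only [Prog.Tame, Expr.lab, Expr.fld, Expr.fldAddr, Expr.idx, Expr.size, Expr.LitLe,
    Expr.Slow] <;>
  and_intros <;> first | trivial | omega

theorem emit_tame {c : ℕ} (hc : 20000 ≤ c) : emit.Tame c := by
  simp only [emit, Prog.Tame, Prog.setFld, Expr.outBase, Expr.fld, Expr.fldAddr, Expr.size,
    Expr.LitLe, Expr.Slow]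
  and_intros <;> first | trivial | omega

theorem clear_tame {c : ℕ} (hc : 20000 ≤ c) : clear.Tame c := by
  refine ⟨forLoop_tame (by omega) ?_ ?_ ?_, ?_⟩ <;>
  simp only [Prog.Tame, Prog.setFld, Expr.outBase, Expr.fldAddr, Expr.size, Expr.LitLe,
    Expr.Slow] <;>
  and_intros <;> first | trivial | omega

theorem listAtomBody_tame {c : ℕ} (hc : 20000 ≤ c) : listAtomBody.Tame c := by
  refine ⟨?_, forLoop_tame (by omega) ?_ ?_ ⟨?_, emit_tame hc⟩, clear_tame hc⟩ <;>
  simp only [Prog.Tame, Expr.fld, Expr.fldAddr, Expr.idx, Expr.size, Expr.LitLe, Expr.Slow] <;>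
  and_intros <;> first | trivial | omega

theorem vertexAtoms_tame {c : ℕ} (hc : 20000 ≤ c) : vertexAtoms.Tame c := by
  refine forLoop_tame (by omega) ?_ ?_ ⟨?_, forLoop_tame (by omega) ?_ ?_
    ⟨?_, ?_, ?_, emit_tame hc⟩⟩ <;>
  simp only [Prog.Tame, Expr.fld, Expr.fldAddr, Expr.idx, Expr.size, Expr.LitLe, Expr.Slow] <;>
  and_intros <;> first | trivial | omega

theorem vertexSamples_tame {c : ℕ} (hc : 20000 ≤ c) (hN : 3 * N ≤ c) (hr : sampleRate N ≤ c) :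
    (vertexSamples N).Tame c := by
  refine forLoop_tame (by omega) ?_ ?_ ⟨?_, ?_, ?_, ?_, forLoop_tame (by omega) ?_ ?_
    ⟨?_, pairTest_tame hc hN hr, ?_, emit_tame hc, ?_⟩⟩ <;>
  simp only [Prog.Tame, Expr.fld, Expr.fldAddr, Expr.idx, Expr.size, Expr.LitLe, Expr.Slow] <;>
  and_intros <;> first | trivial | omega

theorem listVertexBody_tame : (listVertexBody N).Tame (tameBound N) := by
  have hc : 20000 ≤ tameBound N := by rw [tameBound]; omega
  refine ⟨?_, ⟨?_, ⟨vertexAtoms_tame hc, vertexSamples_tame hc (by rw [tameBound]; omega)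
    (by rw [tameBound]; omega)⟩, trivial⟩, clear_tame hc⟩ <;>
  generalize tameBound N = c at * <;>
  simp only [Prog.Tame, Expr.fld, Expr.fldAddr, Expr.size, Expr.LitLe, Expr.Slow] <;>
  and_intros <;> first | trivial | omega

end Words

end

/-! ### The programs on bounded words -/

section

variable {n : ℕ}

section Valid
open Classical

variable {G : SimpleGraph (Fin n)} {P : Clustering n} {lab : Fin n → Fin n}
  {M L : Fin n → List (Fin n)} {D : List (Fin n × Fin n)} {N t W : ℕ} {m m' m₀ : ℕ → ℕ} {ω : Rnd}
  {s : State}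

/-! ### The programs on words -/

/-- A bound for the words of the data structure. -/
def wordBound (N n : ℕ) : ℕ := tameBound N + (buildTime N + 1) * (n + 2) ^ 2

/-- The factor 2 comes from t + 1 ≤ 2t, and 1100 covers the listing for an atom and the final
address computations. -/
def timeBound (N : ℕ) : ℕ := buildTime N + 2 * checkTime N + listVertexTime N + 1100

def wordExponent (N : ℕ) : ℕ :=
  (tameBound N + buildTime N + 2 + timeBound N) ^ tameBound N + 3 * tameBound N + 1

/-- Degree 3 in n + t + 2 suffices: the words are quadratic in n plus t, and the longest query takes
O(t² n) steps. -/
theorem pow_tameBound_lt {V B Y : ℕ} (hY : n + t + 2 = Y) (hV : V ≤ wordBound N n + t)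
    (hB : B ≤ timeBound N * Y ^ 3) (hW : wordExponent N * Y ^ wordExponent N ≤ W) :
    (V + B) ^ tameBound N < W := by
  have hY1 : 1 ≤ Y := by omega
  have h3 : 1 ≤ Y ^ 3 := Nat.pow_pos hY1
  have h1 : Y ≤ Y ^ 3 := Nat.le_self_pow (by norm_num) Y
  have h2 : (n + 2) ^ 2 ≤ Y ^ 3 :=
    (Nat.pow_le_pow_left (by omega) 2).trans (Nat.pow_le_pow_right hY1 (by norm_num))
  refine pow_lt_word (a := tameBound N + buildTime N + 2 + timeBound N) (d := 3) ?_ hY1 le_rfl hW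
  have h4 : (buildTime N + 1) * (n + 2) ^ 2 ≤ (buildTime N + 1) * Y ^ 3 := Nat.mul_le_mul_left _ h2
  have h5 : tameBound N ≤ tameBound N * Y ^ 3 := Nat.le_mul_of_pos_right _ h3
  rw [wordBound] at hV
  calc V + B ≤ tameBound N * Y ^ 3 + (buildTime N + 1) * Y ^ 3 + Y ^ 3 + timeBound N * Y ^ 3 := by
        omega
    _ = _ := by ring

theorem le_wordBound (N n : ℕ) : n ≤ wordBound N n := by
  have : (n + 2) ^ 2 ≤ (buildTime N + 1) * (n + 2) ^ 2 := Nat.le_mul_of_pos_left _ (by omega)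
  rw [wordBound]; nlinarith

theorem deg_le (G : SimpleGraph (Fin n)) (v : Fin n) : deg G v ≤ n := by
  rw [deg_eq_card_filter]
  exact (Finset.card_le_univ _).trans (by simp)

theorem tameBound_ge (N : ℕ) : 20000 ≤ tameBound N := by rw [tameBound]; omega

theorem start_bdd {args : List ℕ} {V : ℕ} (ha : ∀ a ∈ args, a ≤ V) (hm : ∀ a, m a ≤ V) :
    (start args m).Bdd V := by
  refine ⟨fun x => ?_, hm⟩
  simp only [start, List.getD_eq_getElem?_getD]
  rcases Nat.lt_or_ge x args.length with h | h
  · rw [List.getElem?_eq_getElem h]; exact ha _ (List.getElem_mem _)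
  · rw [List.getElem?_eq_none h]; exact Nat.zero_le _

/-- The valid contents of the memory. -/
def validMem (G : SimpleGraph (Fin n)) (P : Clustering n) (N : ℕ) (lab : Fin n → Fin n)
    (M L : Fin n → List (Fin n)) : Set (ℕ → ℕ) :=
  {m | Holds G P N lab M L m ∧ (∀ u : Fin n, fld m 22 u = 0) ∧ ∀ a, m a ≤ wordBound N n}

/-- A query leaves behind only marks and vertices, which never exceed n, so the word bound does not
deteriorate over arbitrarily many queries. -/
theorem validMem_scratch (hm : m ∈ validMem G P N lab M L) (hM : ∀ l, (M l).Nodup)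
    (hL : ∀ v, (L v).Nodup) (hs : Scratch n m m') (hmark : ∀ u : Fin n, fld m' 22 u = 0) :
    m' ∈ validMem G P N lab M L :=
  ⟨hm.1.scratch hM hL hs, hmark, fun a => (hs.le a).trans (max_le (hm.2.2 a) (le_wordBound N n))⟩

theorem build_runs (hin : StoresInput G P m₀) (hi : Input lab M D m₀)
    (hsp : InputSpec G P lab M D) (hW : wordExponent N * (n + 2) ^ wordExponent N ≤ W) :
    Runs W ω (build N) (start [] m₀) (timeBound N * (cost G P + 1)) fun s =>
      s.mem ∈ validMem G P N lab M (nbrList (Loose G P) lab M D) := by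
  have hD : 2 * cost G P = D.length := by rw [← hin.numPairs, hi.one]
  have hDn := hsp.length_viol_le
  have hz : ∀ a, m₀ a ≤ n * n + n := hi.le hsp fun a ha => hin.zero a (by simp only [pairAddr]; omega)
  have hc := tameBound_ge N
  -- The 2 cost violated ordered pairs are distinct, so there are at most n² of them.
  have hcost : cost G P + 1 ≤ (n + 2) ^ 2 := by nlinarith
  have hb : (start [] m₀).Bdd (tameBound N + (n + 2) ^ 2) :=
    start_bdd (by simp) fun a => (hz a).trans (by nlinarith)
  have hB : buildTime N * (cost G P + 1) ≤ buildTime N * (n + 2) ^ 2 := Nat.mul_le_mul_left _ hcost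
  have hV : tameBound N + (n + 2) ^ 2 ≤ wordBound N n + 0 := by
    rw [wordBound, Nat.add_mul]; omega
  have hB' : buildTime N * (n + 2) ^ 2 ≤ timeBound N * (n + 2) ^ 3 :=
    Nat.mul_le_mul (by rw [timeBound]; omega) (Nat.pow_le_pow_right (by omega) (by norm_num))
  obtain ⟨k, s', hex, hk, ⟨h1, h2⟩, h3⟩ := (build_meets (ω := ω) (N := N) hi hsp hin.numPairs
    hin.fld_eq_zero (start [] m₀) rfl).runs (W := W) build_tame (V := tameBound N + (n + 2) ^ 2)
    (by omega) (by omega) hb (pow_tameBound_lt (t := 0) (Y := n + 2) rfl hV (hB.trans hB') hW)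
  refine ⟨k, s', hex, hk.trans (Nat.mul_le_mul_right _ (by rw [timeBound]; omega)), h1, h2,
    fun a => (h3.2 a).trans ?_⟩
  rw [wordBound]; linarith

theorem check_runs (hsp : InputSpec G P lab M D) (hL : ListsNbhd G (Loose G P) L)
    (hm : m ∈ validMem G P N lab M L) (ht : 1 ≤ t)
    (hW : wordExponent N * (n + t + 2) ^ wordExponent N ≤ W) (u v : Fin n) :
    Runs W ω (check N) (start [u, v, t] m) (timeBound N * t) fun s =>
      s.mem = m ∧ ReturnsBool (CoreAnswer G P N L t u v ω) s := by
  have hc := tameBound_ge N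
  have hn := le_wordBound N n
  have hw : tameBound N ≤ wordBound N n := by rw [wordBound]; omega
  have hB : checkTime N * (t + 1) ≤ timeBound N * t := by
    have : 2 * checkTime N * t ≤ timeBound N * t :=
      Nat.mul_le_mul_right _ (by rw [timeBound]; omega)
    nlinarith
  have hb : (start [(u : ℕ), v, t] m).Bdd (wordBound N n + t) := by
    refine start_bdd ?_ fun a => (hm.2.2 a).trans (by omega)
    simp only [List.mem_cons, List.not_mem_nil, or_false]
    have := u.2; have := v.2
    rintro a (rfl | rfl | rfl) <;> omega
  have ht' : t ≤ (n + t + 2) ^ 3 :=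
    (by omega : t ≤ n + t + 2).trans (Nat.le_self_pow (by norm_num) _)
  obtain ⟨k, s', hex, hk, h1, -⟩ := (check_meets (ω := ω) (s := start [(u : ℕ), v, t] m) hsp hm.1 hL
    rfl rfl rfl).runs (W := W) check_tame (by omega) (by omega) hb
      (pow_tameBound_lt rfl le_rfl (hB.trans (Nat.mul_le_mul_left _ ht')) hW)
  exact ⟨k, s', hex, hk.trans hB, h1⟩

def listAtom : Prog := .seq listAtomBody (.assign 1 .outBase)

def listVertex (N : ℕ) : Prog := .seq (listVertexBody N) (.assign 1 .outBase)

theorem InputSpec.nodup_nbrList (h : InputSpec G P lab M D) (v : Fin n) :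
    (nbrList (Loose G P) lab M D v).Nodup := by
  by_cases hv : Loose G P v
  · exact (h.listsNbhd v hv).1
  · simp [nbrList, hv]

theorem listAtom_runs (hsp : InputSpec G P lab M D) (hLn : ∀ v, (L v).Nodup)
    (hm : m ∈ validMem G P N lab M L) (hW : wordExponent N * (n + 2) ^ wordExponent N ≤ W)
    {v : Fin n} (hv : ¬ Loose G P v) :
    Runs W ω listAtom (start [m (labelAddr v)] m)
      (timeBound N * ({u | CoreAdm G P N u v}.ncard + 1)) fun s =>
      s.mem ∈ validMem G P N lab M L ∧ ReturnsSet {u | CoreAdm G P N u v} s := by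
  have hset : {u | CoreAdm G P N u v} = {u | LabelAdm G P lab N u (lab v)} := by
    ext u; exact (hsp.labelAdm_iff hv).symm
  rw [hset]
  set S := {u | LabelAdm G P lab N u (lab v)}
  have hS : S.ncard ≤ n := by
    simpa using Set.ncard_le_card S
  have hc := tameBound_ge N
  have hw : tameBound N ≤ wordBound N n := by rw [wordBound]; omega
  have hb : (start [m (labelAddr v)] m).Bdd (wordBound N n) :=
    start_bdd (by simpa using hm.2.2 _) hm.2.2
  have hB : 1000 * (S.ncard + 1) + 50 ≤ timeBound N * (S.ncard + 1) := by
    rw [timeBound]; nlinarith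
  have hS' : S.ncard + 1 ≤ (n + 2) ^ 3 :=
    (by omega : S.ncard + 1 ≤ n + 2).trans (Nat.le_self_pow (by norm_num) _)
  obtain ⟨k, s', hex, hk, h1, h2, h3⟩ := (listAtomBody_meets (ω := ω)
    (s := start [m (labelAddr v)] m) hm.1 hm.2.1 (l := lab v) (hm.1.label v hv)).runs_output (W := W)
    (listAtomBody_tame hc) (by omega) hw hb (pow_tameBound_lt (t := 0) (Y := n + 2) rfl (by omega)
      (((Nat.le_add_right _ 50).trans hB).trans (Nat.mul_le_mul_left _ hS')) hW)
  exact ⟨k, s', hex, hk.trans hB, validMem_scratch hm hsp.nodup hLn h1 h2, h3⟩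

theorem listVertex_runs (hsp : InputSpec G P lab M D) (hL : ListsNbhd G (Loose G P) L)
    (hLn : ∀ v, (L v).Nodup) (hm : m ∈ validMem G P N lab M L) (ht : 1 ≤ t)
    (hW : wordExponent N * (n + t + 2) ^ wordExponent N ≤ W) (v : Fin n) :
    Runs W ω (listVertex N) (start [v, t] m) (timeBound N * (t ^ 2 * deg G v + 1)) fun s =>
      s.mem ∈ validMem G P N lab M L ∧ ReturnsSet {u | CoreFound G P N L t v ω u} s := by
  have hc := tameBound_ge N
  have hn := le_wordBound N n
  have hw : tameBound N ≤ wordBound N n := by rw [wordBound]; omega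
  have hb : (start [(v : ℕ), t] m).Bdd (wordBound N n + t) := by
    refine start_bdd ?_ fun a => (hm.2.2 a).trans (by omega)
    simp only [List.mem_cons, List.not_mem_nil, or_false]
    have := v.2
    rintro a (rfl | rfl) <;> omega
  have hB : listVertexTime N * (t ^ 2 * deg G v + 1) + 50 ≤
      timeBound N * (t ^ 2 * deg G v + 1) := by
    have : (listVertexTime N + 50) * (t ^ 2 * deg G v + 1) ≤ timeBound N * (t ^ 2 * deg G v + 1) :=
      Nat.mul_le_mul_right _ (by rw [timeBound]; omega)
    nlinarith
  have hd : t ^ 2 * deg G v + 1 ≤ (n + t + 2) ^ 3 := by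
    have h4 : t ^ 2 * deg G v ≤ (n + t + 2) ^ 2 * n :=
      Nat.mul_le_mul (Nat.pow_le_pow_left (by omega) 2) (deg_le G v)
    have h5 : 1 ≤ (n + t + 2) ^ 2 := Nat.pow_pos (by omega)
    calc t ^ 2 * deg G v + 1 ≤ (n + t + 2) ^ 2 * (n + 1) := by nlinarith
      _ ≤ (n + t + 2) ^ 2 * (n + t + 2) := Nat.mul_le_mul_left _ (by omega)
      _ = (n + t + 2) ^ 3 := by ring
  obtain ⟨k, s', hex, hk, h1, h2, h3⟩ := (listVertexBody_meets (ω := ω)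
    (s := start [(v : ℕ), t] m) hsp hm.1 hLn hL hm.2.1 ht rfl rfl).runs_output (W := W)
    listVertexBody_tame (by omega) (by omega) hb (pow_tameBound_lt rfl le_rfl
      (((Nat.le_add_right _ 50).trans hB).trans (Nat.mul_le_mul_left _ hd)) hW)
  exact ⟨k, s', hex, hk.trans hB, validMem_scratch hm hsp.nodup hLn h1 h2, h3⟩

end Valid

end

end CorrClust

end

/-! ### The theorem: preclustering, construction and queries combined -/

theorem mainTheorem10 :
    -- absolute constants
    ∃ C c : ℝ, 0 < C ∧ 0 < c ∧ ∀ ε : ℝ, 0 < ε → ε < 1 / 10 →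
    -- programs, time constant and word-size constant, depending only on `ε`
    ∃ (build check listAtom listVertex : Prog) (T κ : ℕ),
    ∀ (n : ℕ) (G : SimpleGraph (Fin n)) (P : Clustering n) (mem₀ : ℕ → ℕ) (W : ℕ),
      StoresInput G P mem₀ → κ * (n + 2) ^ κ ≤ W →
    -- the clustering, the lower and upper bounds for the set of admissible pairs, and the set of
    -- valid memory contents of the data structure
    ∃ (K : Clustering n) (Alo Ahi : SimpleGraph (Fin n)) (Valid : Set (ℕ → ℕ)),
      Alo ≤ Ahi ∧
      (∀ A, Alo ≤ A → A ≤ Ahi → GoodPreclustering C ε G K A) ∧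
      (cost G K : ℝ) ≤ C * cost G P ∧
      -- the construction
      (∀ ω, Runs W ω build (start [] mem₀) (T * (cost G P + 1)) fun s => s.mem ∈ Valid) ∧
      (∀ mem ∈ Valid, StoresClustering (2 * n) K mem) ∧
      -- listing the admissible neighbours of an atom, given by its identifier
      (∀ A, Alo ≤ A → A ≤ Ahi → ∀ mem ∈ Valid, ∀ S, IsAtomOf K S → ∀ v ∈ S, ∀ ω,
        Runs W ω listAtom (start [mem (labelAddr v)] mem) (T * ((admNbrs A S).ncard + 1))
          fun s => s.mem ∈ Valid ∧ ReturnsSet (admNbrs A S) s) ∧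
      -- the randomized access with parameter `t`
      ∀ t : ℕ, 1 ≤ t → κ * (n + t + 2) ^ κ ≤ W →
      ∃ A : Rnd → SimpleGraph (Fin n), (∀ ω, Alo ≤ A ω ∧ A ω ≤ Ahi) ∧
        -- checking a pair
        (∀ mem ∈ Valid, ∀ u v : Fin n,
          (∀ ω, Runs W ω check (start [u, v, t] mem) (T * t) fun s => s.mem ∈ Valid) ∧
          rndMeasure {ω | ¬ Runs W ω check (start [u, v, t] mem) (T * t)
              (ReturnsBool ((A ω).Adj u v))} ≤ ENNReal.ofReal (Real.exp (-(c * t)))) ∧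
        -- listing the admissible neighbours of a singleton
        (∀ mem ∈ Valid, ∀ v : Fin n, IsSingleton K v →
          (∀ ω, Runs W ω listVertex (start [v, t] mem) (T * (t ^ 2 * deg G v + 1))
            fun s => s.mem ∈ Valid) ∧
          (C * Real.log (deg G v) ≤ t →
            rndMeasure {ω | ¬ Runs W ω listVertex (start [v, t] mem)
              (T * (t ^ 2 * deg G v + 1)) (ReturnsSet ((A ω).neighborSet v))} ≤
                ENNReal.ofReal (Real.exp (-(c * t))))) := by
  -- The constant 30000 covers 20201 for the cost, 10 for the O(1/ε²) bounds, and 1 for the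
  -- logarithmic condition on t.
  refine ⟨30000, 1, by norm_num, by norm_num, fun ε hε hε' => ?_⟩
  -- Rounding 1/ε down gives εN ≤ 1 < ε(N + 1), which lets the programs compare integers only; ε <
  -- 1/10 yields N ≥ 10.
  obtain ⟨N, hNdef⟩ : ∃ N, N = ⌊1 / ε⌋₊ := ⟨_, rfl⟩
  have hN : (N : ℝ) ≤ 1 / ε := hNdef ▸ Nat.floor_le (by positivity)
  have hN' : 1 / ε - 1 < N := by
    have := Nat.lt_floor_add_one (1 / ε)
    rw [← hNdef] at this; linarith
  have hN10 : 10 ≤ N := by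
    rw [hNdef]
    refine Nat.le_floor ?_
    rw [le_div_iff₀ hε]; push_cast; linarith
  refine ⟨build N, check N, listAtom, listVertex N, timeBound N, wordExponent N, ?_⟩
  intro n G P mem₀ W hin hW
  obtain ⟨lab, M, D, hi, hsp⟩ := hin.exists_input
  have hcore := sizedCore G P
  have hL := hsp.listsNbhd
  have hLn := hsp.nodup_nbrList
  obtain ⟨L, hLdef⟩ : ∃ L, L = nbrList (Loose G P) lab M D := ⟨_, rfl⟩
  rw [← hLdef] at hL hLn
  refine ⟨coreClustering G P,
    admGraph G (coreClustering G P) (Loose G P) (fun v => (P.part v).card) N (N + 1),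
    admGraph G (coreClustering G P) (Loose G P) (fun v => (P.part v).card) N (2 * N),
    validMem G P N lab M L, admGraph_mono (by omega), fun A hA hA' =>
      hcore.good (by norm_num) hε hε' hN hN' hN10 hA hA', ?_, fun ω => ?_,
    fun mem hmem => hmem.1.stores, ?_, ?_⟩
  · have : (cost G (coreClustering G P) : ℝ) ≤ 20201 * cost G P := by
      exact_mod_cast cost_coreClustering_le G P
    have : (0 : ℝ) ≤ cost G P := by positivity
    linarith
  · rw [hLdef]
    exact build_runs hin hi hsp hW
  · intro A hA hA' mem hmem S hS v hv ω
    have e : (coreClustering G P).part v = S := (coreClustering G P).part_eq_of_mem hS.1 hv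
    have hT : ¬ Loose G P v := fun hT => hS.2 (by rw [← e, hcore.single v hT]; simp)
    have hset : admNbrs A S = {u | CoreAdm G P N u v} := by
      rw [← e, hcore.admNbrs_eq hA hA' hT]; ext u; simp [atomNbrs]
    rw [hset]
    exact listAtom_runs hsp hLn hmem hW hT
  -- The random graph is defined by the first `sampleRate N * t` samples, the very ones that the
  -- queries read; this is why answers of different queries refer to the same graph.
  · intro t ht hWt
    refine ⟨rndAdm G (coreClustering G P) (Loose G P) (fun v => (P.part v).card) N L
      (sampleRate N * t), fun ω => ⟨le_rndAdm ω, rndAdm_le (by omega) ω⟩, fun mem hmem u v => ?_,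
      fun mem hmem v hv => ?_⟩
    · have hrun : ∀ ω, _ := fun ω => check_runs (ω := ω) hsp hL hmem ht hWt u v
      refine ⟨fun ω => ?_, ?_⟩
      · obtain ⟨k, s, h1, h2, h3, -⟩ := hrun ω
        exact ⟨k, s, h1, h2, show s.mem ∈ _ from h3 ▸ hmem⟩
      · refine le_trans (measure_mono fun ω hω => ?_) ((measure_answer_ne_le
          (K := coreClustering G P) (x := fun v => (P.part v).card) hL hN10 u v).trans
          (ENNReal.ofReal_le_ofReal (answer_error_le hN10 t)))
        refine fun hiff => hω ?_
        obtain ⟨k, s, h1, h2, -, h3⟩ := hrun ω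
        refine ⟨k, s, h1, h2, ?_⟩
        simpa only [ReturnsBool, hiff] using h3
    · have hrun : ∀ ω, _ := fun ω => listVertex_runs (ω := ω) hsp hL hLn hmem ht hWt v
      refine ⟨fun ω => ?_, fun hlog => ?_⟩
      · obtain ⟨k, s, h1, h2, h3, -⟩ := hrun ω
        exact ⟨k, s, h1, h2, h3⟩
      · have hsub : ∀ ω, (∀ u, CoreFound G P N L t v ω u ↔ (rndAdm G (coreClustering G P)
            (Loose G P) (fun v => (P.part v).card) N L (sampleRate N * t) ω).Adj v u) →
            Runs W ω (listVertex N) (start [v, t] mem) (timeBound N * (t ^ 2 * deg G v + 1))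
              (ReturnsSet ((rndAdm G (coreClustering G P) (Loose G P) (fun v => (P.part v).card) N L
                (sampleRate N * t) ω).neighborSet v)) := by
          intro ω hiff
          obtain ⟨k, s, h1, h2, -, h3⟩ := hrun ω
          refine ⟨k, s, h1, h2, ?_⟩
          have e : (rndAdm G (coreClustering G P) (Loose G P) (fun v => (P.part v).card) N L
              (sampleRate N * t) ω).neighborSet v = {u | CoreFound G P N L t v ω u} := by
            ext u; exact (hiff u).symm
          rw [e]; exact h3
        by_cases hT : Loose G P v
        · have hlog' : Real.log (deg G v) ≤ t := by
            have := Real.log_natCast_nonneg (deg G v)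
            linarith
          refine le_trans (measure_mono fun ω hω => ?_) ((measure_found_ne_le
            (K := coreClustering G P) (x := fun v => (P.part v).card) hL hN10 hT).trans
            (found_error_le hN10 ht hlog'))
          exact fun hiff => hω (hsub ω hiff)
        -- A singleton of `K` need not be loose. If it is not, nothing is found, and nothing is
        -- admissible either: 98 times the number of its admissible vertices would be at most 5.
        · refine le_trans (measure_mono (t := ∅) fun ω hω => hω (hsub ω fun u => ?_)) (by simp)
          refine iff_of_false ?_ fun hadj => ?_
          · rintro (h | h)
            · exact hT h.1
            · exact hT h.1.1.2.2.1
          · have h1 := admGraph_neighbor_of_not hT (rndAdm_le (by omega) ω hadj.symm)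
            have h2 := hcore.sum_atomNbrs_le (N := N) hT
            have h3 : 0 < (atomNbrs G (coreClustering G P) (Loose G P) (fun v => (P.part v).card)
              N v).card := Finset.card_pos.2 ⟨u, by simpa [atomNbrs] using h1⟩
            rw [show (coreClustering G P).part v = {v} from hv] at h2
            simp only [Finset.card_singleton] at h2
            omega
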